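/- Let $1\le p<q$ be integers with $p\mid q$, and let $\mathbf{BS}(p,q)=\langle a,t\mid ta^pt^{-1}=a^q\rangle$. Write $A=a^{-1}$, $T=t^{-1}$, and identify $a^\alpha$ with the integer $\alpha\in\mathbb Z$. We consider words $u=\alpha_0\theta_1\alpha_1\cdots\theta_k\alpha_k$ with $k\ge 0$, $\alpha_i\in\mathbb Z$, $\theta_i\in\{t,T\}$, and write $u\sim v$ if $u$ and $v$ represent the same element of $\mathbf{BS}(p,q)$. *Norm, sinks, height.* The geodesic length of a group element is the least length of a word over $\{t,T,a,A\}$ representing it; $\|\alpha\|$ is the geodesic length of $a^\alpha$, and $\|u\|=k+\sum_{i=0}^k\|\alpha_i\|$. A sink of $u$ is a position $i\in\{0,\dots,k\}$ with $\theta_i\ne t$ and $\theta_{i+1}\neq T$ (conditions on the undefined $\theta_0$, $\theta_{k+1}$ hold vacuously); $s(u)$ is the number of sinks. Let $h(0)=0$, and for $1\le i\le k$ let $h(i)=h(i-1)+1$ if $\theta_i=t$ and $h(i)=h(i-1)-1$ if $\theta_i=T$; the height of $u$ is $h(u)=\max_{0\le i\le k} h(i)$, and the peak of $u$ is the largest $i$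 with $h(i)=h(u)$. A word $v$ is a *valley* if $v\sim u$ for some $u=\alpha_0\theta_1\alpha_1\cdots\theta_k\alpha_k$ with $h(u)=0$ and $h(k)=0$. *Peak normal form.* The word $u$ is Britton-reduced if it contains no factor $t(\mu p)T$ and no factor $T(\mu q)t$ with $\mu\in\mathbb Z$. The normal form $\mathrm{llnf}(\alpha)$ is the first word over $\{t,T,a,A\}$ representing $a^\alpha$ in the length-lexicographical order with $t<T<a<A$. If $i$ is the peak of $u$, factor $u=u_1\alpha_iu_2$ with $u_1=\alpha_0\theta_1\cdots\alpha_{i-1}\theta_i$ and $u_2=\theta_{i+1}\alpha_{i+1}\cdots\theta_k\alpha_k$. Let $\le_\Delta$ be the length-lexicographical order on sequences over $\mathbb Z\cup\{t,T\}$ (every integer, also $0$, counting as one symbol) for $t<T<0<1<-1<2<-2<\cdots$, and let $\overline{u_2}$ be the reversal of $u_2$ with $t,T$ exchanged and integers negated. Among all Britton-reduced $u\sim v$ for which $\|u\|$ is the geodesic length of $v$, choose the one for which $u_1$ is first with respect to $\le_\Delta$ and, after that, $\overline{u_2}$ is first with respect to $\le_\Delta$. The *peak normal form* of $v$ is the word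 $\mathrm{pnf}(v)=\mathrm{llnf}(\alpha_0)\,\theta_1\,\mathrm{llnf}(\alpha_1)\cdots\theta_k\,\mathrm{llnf}(\alpha_k)$ over $\{t,T,a,A\}$, where $u=\alpha_0\theta_1\cdots\theta_k\alpha_k$ is this choice. *Claim.* There are a random access machine program, with integer cells and with addition, subtraction, multiplication, division with remainder and comparison as unit-cost operations, and a constant $C$, both depending only on $p$ and $q$, such that for every valley $v=\alpha_0\theta_1\alpha_1\cdots\theta_k\alpha_k$, given by $k$, the integers $\alpha_i$ (one per cell) and the letters $\theta_i$, the program computes $\mathrm{pnf}(v)$, letter by letter, in at most $$C\cdot s(v)\,(\|v\|+s(v))$$ steps, and all integers used in the computation have absolute value at most $2^{C(\|v\|+s(v))}$. -/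

import Mathlib

namespace BaumslagSolitar

/-! ### The group and words over the four letters -/

/-- The two generators. -/
inductive Gen where
  | a
  | t

/-- The group `⟨a, t ∣ t a^p t⁻¹ = a^q⟩`. -/
abbrev BSGroup (p q : ℕ) : Type :=
  PresentedGroup
    ({FreeGroup.of Gen.t * FreeGroup.of Gen.a ^ p * (FreeGroup.of Gen.t)⁻¹ *
      (FreeGroup.of Gen.a ^ q)⁻¹} : Set (FreeGroup Gen))

/-- The generator `a` as a group element. -/
def genA (p q : ℕ) : BSGroup p q := PresentedGroup.of Gen.a

/-- The generator `t` as a group element. -/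
def genT (p q : ℕ) : BSGroup p q := PresentedGroup.of Gen.t

/-- The letters; `T` stands for `t⁻¹` and `A` for `a⁻¹`. -/
inductive Letter where
  | t
  | T
  | a
  | A

/-- Position of a letter in the order `t < T < a < A`; also the code of the letter as machine
output. -/
def Letter.code : Letter → ℕ
  | .t => 0
  | .T => 1
  | .a => 2
  | .A => 3

/-- The order `t < T < a < A`. -/
def Letter.lt (x y : Letter) : Prop := x.code < y.code

/-- The group element of a letter. -/
def Letter.val (p q : ℕ) : Letter → BSGroup p q
  | .t => genT p q
  | .T => (genT p q)⁻¹
  | .a => genA p q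
  | .A => (genA p q)⁻¹

/-- The group element represented by a word over `t, T, a, A`. -/
def wordVal (p q : ℕ) (w : List Letter) : BSGroup p q := (w.map (Letter.val p q)).prod

/-- The geodesic length of a group element: the least length of a word representing it. -/
noncomputable def geodesicLength (p q : ℕ) (g : BSGroup p q) : ℕ :=
  sInf {n : ℕ | ∃ w : List Letter, wordVal p q w = g ∧ w.length = n}

/-- `‖α‖`, the geodesic length of `a^α`. -/
noncomputable def intNorm (p q : ℕ) (α : ℤ) : ℕ := geodesicLength p q (genA p q ^ α)

/-- `w` is the length-lexicographical normal form of `g`: the first word representing `g`. -/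
def IsLLNF (p q : ℕ) (g : BSGroup p q) (w : List Letter) : Prop :=
  wordVal p q w = g ∧
    ∀ v : List Letter, wordVal p q v = g → w = v ∨ List.Shortlex Letter.lt w v

/-! ### Words `α₀ θ₁ α₁ ⋯ θₖ αₖ` with integers `αᵢ` and `θᵢ ∈ {t, T}` -/

/-- The two stable letters. -/
inductive Stable where
  | t
  | T
  deriving DecidableEq

/-- The group element of a stable letter. -/
def Stable.val (p q : ℕ) : Stable → BSGroup p q
  | .t => genT p q
  | .T => (genT p q)⁻¹

/-- A stable letter as a letter of the four-letter alphabet. -/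
def Stable.letter : Stable → Letter
  | .t => .t
  | .T => .T

/-- `+1` for `t` (one step upwards), `-1` for `T` (one step downwards). -/
def Stable.sign : Stable → ℤ
  | .t => 1
  | .T => -1

/-- The word `α₀ θ₁ α₁ ⋯ θₖ αₖ`, stored as `head = α₀` and
`tail = [(θ₁, α₁), …, (θₖ, αₖ)]`. -/
structure Word where
  head : ℤ
  tail : List (Stable × ℤ)

namespace Word

/-- The number `k` of stable letters. -/
def len (u : Word) : ℕ := u.tail.length

/-- The integers `[α₀, …, αₖ]`. -/
def coeffs (u : Word) : List ℤ := u.head :: u.tail.map Prod.snd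

/-- `θᵢ` for `1 ≤ i ≤ k`, and `none` for all other `i`. -/
def theta (u : Word) : ℕ → Option Stable
  | 0 => none
  | i + 1 => (u.tail[i]?).map Prod.fst

/-- The group element represented by `u`. -/
def val (p q : ℕ) (u : Word) : BSGroup p q :=
  genA p q ^ u.head * (u.tail.map fun x => x.1.val p q * genA p q ^ x.2).prod

/-- `u` is Britton-reduced: it has no factor `t (μp) T` and no factor `T (μq) t`. -/
def Reduced (p q : ℕ) (u : Word) : Prop :=
  u.tail.IsChain fun x y =>
    ¬ (x.1 = .t ∧ (p : ℤ) ∣ x.2 ∧ y.1 = .T) ∧ ¬ (x.1 = .T ∧ (q : ℤ) ∣ x.2 ∧ y.1 = .t)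

/-- The norm `‖u‖ = k + ∑ ‖αᵢ‖`. -/
noncomputable def norm (p q : ℕ) (u : Word) : ℕ :=
  u.len + (u.coeffs.map (intNorm p q)).sum

/-- The number `s(u)` of sinks: positions `0 ≤ i ≤ k` with `θᵢ ≠ t` and `θᵢ₊₁ ≠ T`. -/
def sinks (u : Word) : ℕ :=
  ((Finset.range (u.len + 1)).filter fun i =>
    u.theta i ≠ some .t ∧ u.theta (i + 1) ≠ some .T).card

/-- The height `h(i)` of position `i`. -/
def heightAt (u : Word) (i : ℕ) : ℤ := ((u.tail.take i).map fun x => x.1.sign).sum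

/-- The height of `u`: the maximum of `h(i)` over `0 ≤ i ≤ k`. -/
def height (u : Word) : ℤ :=
  (Finset.range (u.len + 1)).sup' Finset.nonempty_range_add_one u.heightAt

/-- The peak: the rightmost position of maximal height. -/
def peak (u : Word) : ℕ := Nat.findGreatest (fun i => u.heightAt i = u.height) u.len

/-- `w` is a valley: it is equal in the group to a word of height `0` whose last position has
height `0`. -/
def IsValley (p q : ℕ) (w : Word) : Prop :=
  ∃ u : Word, u.val p q = w.val p q ∧ u.height = 0 ∧ u.heightAt u.len = 0

end Word

/-! ### Peak normal forms -/

/-- The infinite alphabet of all integers together with `t` and `T`. -/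
inductive Sym where
  | stable (θ : Stable)
  | int (α : ℤ)

/-- The order of the infinite alphabet: `t < T < 0 < 1 < -1 < 2 < -2 < ⋯`. -/
def Sym.lt : Sym → Sym → Prop
  | .stable θ, .stable θ' => θ = .t ∧ θ' = .T
  | .stable _, .int _ => True
  | .int _, .stable _ => False
  | .int α, .int β => |α| < |β| ∨ (|α| = |β| ∧ β < α)

/-- The involution `t ↔ T`, `α ↦ -α`. -/
def Sym.bar : Sym → Sym
  | .stable .t => .stable .T
  | .stable .T => .stable .t
  | .int α => .int (-α)

/-- The length-lexicographical order of words over the infinite alphabet. -/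
def deltaLE (x y : List Sym) : Prop := x = y ∨ List.Shortlex Sym.lt x y

namespace Word

/-- `u` as the sequence `α₀, θ₁, α₁, …, θₖ, αₖ`; the symbol `αᵢ` has index `2i`. -/
def symbols (u : Word) : List Sym :=
  .int u.head :: u.tail.flatMap fun x => [.stable x.1, .int x.2]

/-- The part `u₁ = α₀ θ₁ ⋯ αᵢ₋₁ θᵢ` of `u` in front of `αᵢ`, where `i` is the peak. -/
def left (u : Word) : List Sym := u.symbols.take (2 * u.peak)

/-- The part `u₂ = θᵢ₊₁ αᵢ₊₁ ⋯ θₖ αₖ` of `u` behind `αᵢ`, where `i` is the peak. -/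
def right (u : Word) : List Sym := u.symbols.drop (2 * u.peak + 1)

/-- The formal inverse of `u₂`. -/
def rightBar (u : Word) : List Sym := (u.right.map Sym.bar).reverse

/-- `u` is Britton-reduced, represents the same element as `w`, and its norm is the geodesic
length of that element. -/
def IsOptimal (p q : ℕ) (w u : Word) : Prop :=
  u.Reduced p q ∧ u.val p q = w.val p q ∧ u.norm p q = geodesicLength p q (w.val p q)

/-- `u` is the Britton peak normal form of `w`. -/
def IsBrittonPNF (p q : ℕ) (w u : Word) : Prop :=
  IsOptimal p q w u ∧
    (∀ u' : Word, IsOptimal p q w u' → deltaLE u.left u'.left) ∧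
    (∀ u' : Word, IsOptimal p q w u' → u'.left = u.left → deltaLE u.rightBar u'.rightBar)

/-- `x` is the peak normal form `pnf(w) = llnf(α₀) θ₁ llnf(α₁) ⋯ θₖ llnf(αₖ)`, where
`α₀ θ₁ α₁ ⋯ θₖ αₖ` is the Britton peak normal form of `w`. -/
def IsPNF (p q : ℕ) (w : Word) (x : List Letter) : Prop :=
  ∃ (u : Word) (llnf : ℤ → List Letter), IsBrittonPNF p q w u ∧
    (∀ α : ℤ, IsLLNF p q (genA p q ^ α) (llnf α)) ∧
    x = llnf u.head ++ u.tail.flatMap fun y => y.1.letter :: llnf y.2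

end Word

/-! ### A random access machine with integer cells

A program has integer variables and arrays of integer cells, finitely many of each occurring
in it. Every operation on cells costs one step, but it may be executed only if its operands and
its result have absolute value at most a given bound `B`, the word size of the machine. -/

/-- Arithmetic operations and comparisons. -/
inductive Op where
  | add
  | sub
  | mul
  | div
  | mod
  | lt
  | eq

/-- The result of an operation; `div` and `mod` are Euclidean, the comparisons give `0` or `1`. -/
def Op.eval : Op → ℤ → ℤ → ℤ
  | .add, m, n => m + n
  | .sub, m, n => m - n
  | .mul, m, n => m * n
  | .div, m, n => m / n
  | .mod, m, n => m % n
  | .lt, m, n => if m < n then 1 else 0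
  | .eq, m, n => if m = n then 1 else 0

/-- Memory contents: the variables, and the cells of the arrays. -/
structure State where
  var : ℕ → ℤ
  arr : ℕ → ℤ → ℤ

/-- Expressions: a constant, a variable, a cell of an array at a computed index, an operation. -/
inductive Expr where
  | lit (n : ℤ)
  | var (x : ℕ)
  | get (A : ℕ) (e : Expr)
  | op (o : Op) (e f : Expr)

namespace Expr

/-- The value of an expression. -/
def eval (s : State) : Expr → ℤ
  | lit n => n
  | var x => s.var x
  | get A e => s.arr A (e.eval s)
  | op o e f => o.eval (e.eval s) (f.eval s)

/-- The number of steps needed to evaluate an expression: one for each node. -/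
def cost : Expr → ℕ
  | lit _ => 1
  | var _ => 1
  | get _ e => e.cost + 1
  | op _ e f => e.cost + f.cost + 1

/-- All values that occur in the evaluation have absolute value at most `B`. -/
def Within (B : ℤ) (s : State) : Expr → Prop
  | lit n => |n| ≤ B
  | var x => |s.var x| ≤ B
  | get A e => e.Within B s ∧ |s.arr A (e.eval s)| ≤ B
  | op o e f => e.Within B s ∧ f.Within B s ∧ |o.eval (e.eval s) (f.eval s)| ≤ B

end Expr

/-- Programs: `assign x e` is `x := e`, and `put A i e` is `A[i] := e`. -/
inductive Prog where
  | skip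
  | assign (x : ℕ) (e : Expr)
  | put (A : ℕ) (i e : Expr)
  | seq (c d : Prog)
  | ite (e : Expr) (c d : Prog)
  | loop (e : Expr) (c : Prog)

/-- `Exec B c s n s'`: with word size `B`, the program `c` started in state `s` halts after
exactly `n` steps in state `s'`. Conditions are true when nonzero; `loop` is a while loop. -/
inductive Exec (B : ℤ) : Prog → State → ℕ → State → Prop
  | skip (s : State) : Exec B .skip s 1 s
  | assign (s : State) (x : ℕ) (e : Expr) (he : e.Within B s) :
      Exec B (.assign x e) s (e.cost + 1)
        { s with var := Function.update s.var x (e.eval s) }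
  | put (s : State) (A : ℕ) (i e : Expr) (hi : i.Within B s) (he : e.Within B s) :
      Exec B (.put A i e) s (i.cost + e.cost + 1)
        { s with
          arr := Function.update s.arr A (Function.update (s.arr A) (i.eval s) (e.eval s)) }
  | seq {c d : Prog} {s s' s'' : State} {m n : ℕ} (hc : Exec B c s m s')
      (hd : Exec B d s' n s'') : Exec B (.seq c d) s (m + n) s''
  | iteTrue {e : Expr} {c d : Prog} {s s' : State} {n : ℕ} (he : e.Within B s)
      (h : e.eval s ≠ 0) (hc : Exec B c s n s') : Exec B (.ite e c d) s (e.cost + n + 1) s'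
  | iteFalse {e : Expr} {c d : Prog} {s s' : State} {n : ℕ} (he : e.Within B s)
      (h : e.eval s = 0) (hd : Exec B d s n s') : Exec B (.ite e c d) s (e.cost + n + 1) s'
  | loopTrue {e : Expr} {c : Prog} {s s' s'' : State} {m n : ℕ} (he : e.Within B s)
      (h : e.eval s ≠ 0) (hc : Exec B c s m s') (hl : Exec B (.loop e c) s' n s'') :
      Exec B (.loop e c) s (e.cost + m + n + 1) s''
  | loopFalse {e : Expr} {c : Prog} {s : State} (he : e.Within B s) (h : e.eval s = 0) :
      Exec B (.loop e c) s (e.cost + 1) s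

/-- The initial state for the input `α₀ θ₁ α₁ ⋯ θₖ αₖ`: variable `0` holds `k`, array `0` holds
`αᵢ` in cell `i` for `0 ≤ i ≤ k`, array `1` holds `±1` in cell `i` for `1 ≤ i ≤ k` according to
`θᵢ = t` or `θᵢ = T`, and everything else is `0`. -/
def Word.inputState (v : Word) : State where
  var x := if x = 0 then (v.len : ℤ) else 0
  arr A i :=
    if 0 ≤ i then
      if A = 0 then v.coeffs.getD i.toNat 0
      else if A = 1 then ((v.theta i.toNat).map Stable.sign).getD 0
      else 0
    else 0

/-- The output of a final state is the word `w` over `t, T, a, A`: variable `0` holds the length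
of `w`, and array `2` holds the codes of its letters, one in each of the cells `0, 1, 2, …`. -/
def State.Outputs (s : State) (w : List Letter) : Prop :=
  s.var 0 = (w.length : ℤ) ∧
    ∀ (i : ℕ) (hi : i < w.length), s.arr 2 (i : ℤ) = ((w[i]).code : ℤ)

end BaumslagSolitar

namespace BaumslagSolitar

/-! ### The length-lexicographical order as an order of numbers -/

/-- The number with the base four digits of `w`. -/
def numVal (w : List Letter) : ℕ := w.foldl (fun n c => 4 * n + c.code) 0

/-- The position of `w` in the length-lexicographical order. -/
def rank (w : List Letter) : ℕ := 4 ^ w.length + numVal w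

theorem numVal_foldl (w : List Letter) (m : ℕ) :
    w.foldl (fun n c => 4 * n + c.code) m = m * 4 ^ w.length + numVal w := by
  unfold numVal
  induction w generalizing m with
  | nil => simp
  | cons c w ih =>
    simp only [List.foldl_cons, List.length_cons]
    rw [ih, ih (4 * 0 + c.code)]
    ring

theorem numVal_append (u v : List Letter) :
    numVal (u ++ v) = numVal u * 4 ^ v.length + numVal v := by
  conv_lhs => rw [numVal, List.foldl_append, numVal_foldl]
  rfl

@[simp] theorem numVal_nil : numVal [] = 0 := rfl

theorem numVal_cons (c : Letter) (w : List Letter) :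
    numVal (c :: w) = c.code * 4 ^ w.length + numVal w := by
  rw [← List.singleton_append, numVal_append]; simp [numVal]

theorem Letter.code_lt (c : Letter) : c.code < 4 := by cases c <;> simp [Letter.code]

theorem Letter.code_injective : Function.Injective Letter.code := by
  intro x y h; cases x <;> cases y <;> simp_all [Letter.code]

theorem numVal_lt (w : List Letter) : numVal w < 4 ^ w.length := by
  induction w with
  | nil => simp
  | cons c w ih =>
    rw [numVal_cons, List.length_cons, pow_succ]
    have := c.code_lt
    have : c.code * 4 ^ w.length ≤ 3 * 4 ^ w.length := Nat.mul_le_mul_right _ (by omega)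
    omega

theorem rank_lt_of_length_lt {u v : List Letter} (h : u.length < v.length) : rank u < rank v := by
  have h1 := numVal_lt u
  have h2 : 4 ^ (u.length + 1) ≤ 4 ^ v.length := Nat.pow_le_pow_right (by norm_num) h
  rw [pow_succ] at h2
  unfold rank; omega

theorem length_le_of_rank_le {u v : List Letter} (h : rank u ≤ rank v) : u.length ≤ v.length := by
  by_contra hh
  have := rank_lt_of_length_lt (not_le.mp hh)
  omega

theorem rank_le_iff {u v : List Letter} :
    rank u ≤ rank v ↔ u.length < v.length ∨ (u.length = v.length ∧ numVal u ≤ numVal v) := by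
  rcases lt_trichotomy u.length v.length with h | h | h
  · simp [h, (rank_lt_of_length_lt h).le]
  · simp [rank, h]
  · have := rank_lt_of_length_lt h
    constructor
    · omega
    · omega

theorem rank_append_le {u u' v v' : List Letter} (h : rank u ≤ rank u') (h' : rank v ≤ rank v') :
    rank (u ++ v) ≤ rank (u' ++ v') := by
  have l1 := length_le_of_rank_le h
  have l2 := length_le_of_rank_le h'
  rcases rank_le_iff.1 h with a | ⟨a, b⟩
  · exact (rank_lt_of_length_lt (by simp only [List.length_append]; omega)).le
  rcases rank_le_iff.1 h' with c | ⟨c, d⟩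
  · exact (rank_lt_of_length_lt (by simp only [List.length_append]; omega)).le
  apply rank_le_iff.2
  right
  refine ⟨by simp [a, c], ?_⟩
  rw [numVal_append, numVal_append, c]
  gcongr

theorem rank_cons_le (c : Letter) {v v' : List Letter} (h' : rank v ≤ rank v') :
    rank (c :: v) ≤ rank (c :: v') := rank_append_le (u := [c]) (u' := [c]) le_rfl h'

theorem rank_cons_lt_of_code {b c : Letter} {v v' : List Letter} (h : b.code < c.code)
    (h' : v.length ≤ v'.length) : rank (b :: v) < rank (c :: v') := by
  rcases h'.lt_or_eq with h' | h'
  · exact rank_lt_of_length_lt (by simpa)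
  · unfold rank
    rw [numVal_cons, numVal_cons]
    have := numVal_lt v
    simp only [List.length_cons, h'] at *
    have h2 : (b.code + 1) * 4 ^ v'.length ≤ c.code * 4 ^ v'.length := Nat.mul_le_mul_right _ h
    rw [add_mul] at h2
    omega

theorem lex_of_numVal_lt {u v : List Letter} (hl : u.length = v.length)
    (h : numVal u < numVal v) : List.Lex Letter.lt u v := by
  induction u generalizing v with
  | nil =>
    cases v with
    | nil => simp at h
    | cons c v => simp at hl
  | cons b u ih =>
    cases v with
    | nil => simp at hl
    | cons c v =>
      simp only [List.length_cons, add_left_inj] at hl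
      rw [numVal_cons, numVal_cons, hl] at h
      rcases lt_trichotomy b.code c.code with hc | hc | hc
      · exact List.Lex.rel hc
      · rw [Letter.code_injective hc]
        rw [hc] at h
        exact List.Lex.cons (ih hl (by omega))
      · exfalso
        have h2 : (c.code + 1) * 4 ^ v.length ≤ b.code * 4 ^ v.length := Nat.mul_le_mul_right _ hc
        have := numVal_lt v
        rw [add_mul] at h2
        omega

theorem eq_of_numVal_eq {u v : List Letter} (hl : u.length = v.length)
    (h : numVal u = numVal v) : u = v := by
  induction u generalizing v with
  | nil => exact (List.length_eq_zero_iff.1 hl.symm).symm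
  | cons b u ih =>
    cases v with
    | nil => simp at hl
    | cons c v =>
      simp only [List.length_cons, add_left_inj] at hl
      rw [numVal_cons, numVal_cons, hl] at h
      have h1 := numVal_lt u
      have h2 := numVal_lt v
      rw [hl] at h1
      have hb : b.code = c.code := by
        rcases lt_trichotomy b.code c.code with hc | hc | hc
        · have h3 : (b.code + 1) * 4 ^ v.length ≤ c.code * 4 ^ v.length :=
            Nat.mul_le_mul_right _ hc
          rw [add_mul] at h3
          omega
        · exact hc
        · have h3 : (c.code + 1) * 4 ^ v.length ≤ b.code * 4 ^ v.length :=
            Nat.mul_le_mul_right _ hc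
          rw [add_mul] at h3
          omega
      rw [hb] at h
      rw [Letter.code_injective hb, ih hl (by omega)]

theorem eq_or_shortlex_of_rank_le {u v : List Letter} (h : rank u ≤ rank v) :
    u = v ∨ List.Shortlex Letter.lt u v := by
  rcases rank_le_iff.1 h with h | ⟨h, h'⟩
  · exact Or.inr (List.Shortlex.of_length_lt h)
  · rcases h'.lt_or_eq with h' | h'
    · exact Or.inr (List.Shortlex.of_lex h (lex_of_numVal_lt h h'))
    · exact Or.inl (eq_of_numVal_eq h h')

/-! ### The defining relation -/

/-- `a^m` with `outer θ ∣ m` can be moved over `θ` from the left to the right. -/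
def Stable.outer (p q : ℕ) : Stable → ℤ
  | .t => q
  | .T => p

/-- `a^m` with `inner θ ∣ m` can be moved over `θ` from the right to the left. -/
def Stable.inner (p q : ℕ) : Stable → ℤ
  | .t => p
  | .T => q

/-- Exchange of `t` and `T`. -/
def Stable.inv : Stable → Stable
  | .t => .T
  | .T => .t

@[simp] theorem Stable.inv_inv (θ : Stable) : θ.inv.inv = θ := by cases θ <;> rfl

theorem Stable.eq_inv_of_ne {θ θ' : Stable} (h : θ' ≠ θ) : θ' = θ.inv := by
  cases θ <;> cases θ' <;> simp_all [Stable.inv]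

theorem Stable.inv_ne (θ : Stable) : θ.inv ≠ θ := by cases θ <;> simp [Stable.inv]

theorem Stable.outer_inv (p q : ℕ) (θ : Stable) : θ.inv.outer p q = θ.inner p q := by
  cases θ <;> rfl

theorem Stable.inner_inv (p q : ℕ) (θ : Stable) : θ.inv.inner p q = θ.outer p q := by
  cases θ <;> rfl

theorem Stable.val_inv (p q : ℕ) (θ : Stable) : θ.inv.val p q = (θ.val p q)⁻¹ := by
  cases θ <;> simp [Stable.inv, Stable.val]

theorem Stable.outer_pos {p q : ℕ} (hp : 1 ≤ p) (hq : 1 ≤ q) (θ : Stable) : 0 < θ.outer p q := by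
  cases θ <;> simp [Stable.outer] <;> omega

theorem Stable.inner_pos {p q : ℕ} (hp : 1 ≤ p) (hq : 1 ≤ q) (θ : Stable) : 0 < θ.inner p q := by
  cases θ <;> simp [Stable.inner] <;> omega

theorem genT_mul_genA_pow (p q : ℕ) : genT p q * genA p q ^ p = genA p q ^ q * genT p q := by
  have h : PresentedGroup.mk ({FreeGroup.of Gen.t * FreeGroup.of Gen.a ^ p *
      (FreeGroup.of Gen.t)⁻¹ * (FreeGroup.of Gen.a ^ q)⁻¹} : Set (FreeGroup Gen))
      (FreeGroup.of Gen.t * FreeGroup.of Gen.a ^ p *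
      (FreeGroup.of Gen.t)⁻¹ * (FreeGroup.of Gen.a ^ q)⁻¹) = 1 :=
    PresentedGroup.one_of_mem (by simp)
  simp only [map_mul, map_inv, map_pow] at h
  change genT p q * genA p q ^ p * (genT p q)⁻¹ * (genA p q ^ q)⁻¹ = 1 at h
  rw [mul_inv_eq_one, mul_inv_eq_iff_eq_mul] at h
  exact h

theorem genA_zpow_mul_genT (p q : ℕ) (m : ℤ) :
    genA p q ^ ((q : ℤ) * m) * genT p q = genT p q * genA p q ^ ((p : ℤ) * m) := by
  rw [zpow_mul, zpow_mul, zpow_natCast, zpow_natCast]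
  have h : SemiconjBy (genT p q) (genA p q ^ p) (genA p q ^ q) := genT_mul_genA_pow p q
  exact ((h.zpow_right m).eq).symm

theorem genA_zpow_mul_val (p q : ℕ) (θ : Stable) (m : ℤ) :
    genA p q ^ (θ.outer p q * m) * θ.val p q = θ.val p q * genA p q ^ (θ.inner p q * m) := by
  cases θ with
  | t => exact genA_zpow_mul_genT p q m
  | T =>
    simp only [Stable.outer, Stable.inner, Stable.val]
    have h := genA_zpow_mul_genT p q m
    calc genA p q ^ ((p : ℤ) * m) * (genT p q)⁻¹
        = (genT p q)⁻¹ * (genT p q * genA p q ^ ((p : ℤ) * m)) * (genT p q)⁻¹ := by group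
      _ = (genT p q)⁻¹ * genA p q ^ ((q : ℤ) * m) := by rw [← h]; group

/-! ### Normal forms and the action of the group on them -/

/-- A normal form: the factors `β θ` in reverse order, and the last integer. -/
abbrev NF : Type := List (ℤ × Stable) × ℤ

/-- The group element of a normal form. -/
def NF.eval (p q : ℕ) (S : NF) : BSGroup p q :=
  (S.1.reverse.map fun x => genA p q ^ x.1 * x.2.val p q).prod * genA p q ^ S.2

theorem NF.eval_nil (p q : ℕ) (c : ℤ) : NF.eval p q ([], c) = genA p q ^ c := by
  simp [NF.eval]

theorem NF.eval_cons (p q : ℕ) (b c : ℤ) (θ : Stable) (l : List (ℤ × Stable)) :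
    NF.eval p q ((b, θ) :: l, c) = NF.eval p q (l, b) * θ.val p q * genA p q ^ c := by
  simp [NF.eval, mul_assoc]

theorem NF.eval_add (p q : ℕ) (c d : ℤ) (l : List (ℤ × Stable)) :
    NF.eval p q (l, c + d) = NF.eval p q (l, c) * genA p q ^ d := by
  simp [NF.eval, mul_assoc, zpow_add]

/-- Right multiplication by `θ` without cancellation. -/
def NF.push (p q : ℕ) (θ : Stable) (S : NF) : NF :=
  ((S.2 % θ.outer p q, θ) :: S.1, θ.inner p q * (S.2 / θ.outer p q))

/-- Right multiplication by `θ`. -/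
def NF.step (p q : ℕ) (θ : Stable) : NF → NF
  | ([], c) => NF.push p q θ ([], c)
  | ((b, θ') :: l, c) =>
    if θ' ≠ θ ∧ θ.outer p q ∣ c then (l, b + θ.inner p q * (c / θ.outer p q))
    else NF.push p q θ ((b, θ') :: l, c)

theorem NF.eval_push (p q : ℕ) (θ : Stable) (S : NF) :
    (NF.push p q θ S).eval p q = S.eval p q * θ.val p q := by
  obtain ⟨l, c⟩ := S
  rw [NF.push, NF.eval_cons, mul_assoc, ← genA_zpow_mul_val, ← mul_assoc]
  congr 1
  simp only
  rw [← NF.eval_add, Int.emod_add_mul_ediv]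

theorem NF.eval_step (p q : ℕ) (θ : Stable) (S : NF) :
    (NF.step p q θ S).eval p q = S.eval p q * θ.val p q := by
  match S with
  | ([], c) => exact NF.eval_push ..
  | ((b, θ') :: l, c) =>
    rw [NF.step]
    split_ifs with h
    · obtain ⟨h1, m, rfl⟩ := h
      rcases eq_or_ne (θ.outer p q) 0 with h0 | h0
      · rw [h0]
        simp only [Int.ediv_zero, mul_zero, add_zero, zero_mul]
        rw [Stable.eq_inv_of_ne h1, NF.eval_cons, Stable.val_inv]
        simp
      · rw [Int.mul_ediv_cancel_left _ h0, NF.eval_cons, mul_assoc, genA_zpow_mul_val,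
          Stable.eq_inv_of_ne h1, Stable.val_inv, NF.eval_add]
        simp [mul_assoc]
    · exact NF.eval_push ..

/-- The stacks of normal forms. -/
def NF.Valid (p q : ℕ) : List (ℤ × Stable) → Prop
  | [] => True
  | (b, θ) :: l => 0 ≤ b ∧ b < θ.outer p q ∧ (∀ y ∈ l.head?, y.2 ≠ θ → b ≠ 0) ∧ NF.Valid p q l

variable {p q : ℕ}

theorem NF.valid_push (hp : 1 ≤ p) (hq : 1 ≤ q) {S : NF} (h : NF.Valid p q S.1) (θ : Stable)
    (h' : ∀ y ∈ S.1.head?, y.2 ≠ θ → ¬ θ.outer p q ∣ S.2) : NF.Valid p q (NF.push p q θ S).1 := by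
  have h0 := Stable.outer_pos hp hq θ
  refine ⟨Int.emod_nonneg _ h0.ne', Int.emod_lt_of_pos _ h0, ?_, h⟩
  intro y hy hne h2
  exact h' y hy hne (Int.dvd_of_emod_eq_zero h2)

theorem NF.valid_step (hp : 1 ≤ p) (hq : 1 ≤ q) {S : NF} (h : NF.Valid p q S.1) (θ : Stable) :
    NF.Valid p q (NF.step p q θ S).1 := by
  match S with
  | ([], c) => exact NF.valid_push hp hq h θ (by simp)
  | ((b, θ') :: l, c) =>
    rw [NF.step]
    split_ifs with h1
    · exact h.2.2.2
    · refine NF.valid_push hp hq h θ ?_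
      intro y hy hne hd
      simp only [List.head?_cons, Option.mem_def, Option.some.injEq] at hy
      subst hy
      exact h1 ⟨hne, hd⟩

theorem NF.step_push_inv (hp : 1 ≤ p) (hq : 1 ≤ q) (S : NF) (θ : Stable) :
    NF.step p q θ.inv (NF.push p q θ S) = S := by
  have h0 := Stable.inner_pos hp hq θ
  obtain ⟨l, c⟩ := S
  simp only [NF.push, NF.step]
  rw [if_pos ⟨θ.inv_ne.symm, by rw [Stable.outer_inv]; exact dvd_mul_right _ _⟩]
  rw [Stable.outer_inv, Stable.inner_inv, Int.mul_ediv_cancel_left _ h0.ne',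
    Int.emod_add_mul_ediv]

theorem NF.step_step_inv (hp : 1 ≤ p) (hq : 1 ≤ q) {S : NF} (h : NF.Valid p q S.1) (θ : Stable) :
    NF.step p q θ.inv (NF.step p q θ S) = S := by
  have h0 := Stable.outer_pos hp hq θ
  have h0' := Stable.inner_pos hp hq θ
  match S with
  | ([], c) => exact NF.step_push_inv hp hq _ θ
  | ((b, θ') :: l, c) =>
    rw [NF.step]
    split_ifs with h1
    · obtain ⟨h1, m, rfl⟩ := h1
      rw [Int.mul_ediv_cancel_left _ h0.ne']
      have hθ := Stable.eq_inv_of_ne h1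
      subst hθ
      obtain ⟨hb0, hb1, hb2, -⟩ := h
      rw [Stable.outer_inv] at hb1
      have e1 : (b + θ.inner p q * m) % θ.inner p q = b := by
        rw [Int.add_mul_emod_self_left, Int.emod_eq_of_lt hb0 hb1]
      have e2 : (b + θ.inner p q * m) / θ.inner p q = m := by
        rw [Int.add_mul_ediv_left _ _ h0'.ne', Int.ediv_eq_zero_of_lt hb0 hb1, zero_add]
      have key : NF.push p q θ.inv (l, b + θ.inner p q * m) = ((b, θ.inv) :: l, θ.outer p q * m) := by
        simp only [NF.push, Stable.outer_inv, Stable.inner_inv, e1, e2]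
      match l with
      | [] => exact key
      | (b', θ'') :: l =>
        rw [NF.step, if_neg, key]
        rintro ⟨h3, h4⟩
        rw [Stable.outer_inv] at h4
        apply hb2 (b', θ'') (by simp) h3
        rw [← e1]
        exact Int.emod_eq_zero_of_dvd h4
    · exact NF.step_push_inv hp hq _ θ

theorem NF.step_add (hp : 1 ≤ p) (hq : 1 ≤ q) (l : List (ℤ × Stable)) (c m : ℤ) (θ : Stable) :
    NF.step p q θ (l, c + θ.outer p q * m) =
      ((NF.step p q θ (l, c)).1, (NF.step p q θ (l, c)).2 + θ.inner p q * m) := by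
  have h0 := (Stable.outer_pos hp hq θ).ne'
  have key : ∀ l, NF.push p q θ (l, c + θ.outer p q * m) =
      ((NF.push p q θ (l, c)).1, (NF.push p q θ (l, c)).2 + θ.inner p q * m) := by
    intro l
    simp only [NF.push, Int.add_mul_emod_self_left, Int.add_mul_ediv_left _ _ h0, mul_add]
  match l with
  | [] => exact key []
  | (b, θ') :: l =>
    simp only [NF.step]
    have : θ.outer p q ∣ c + θ.outer p q * m ↔ θ.outer p q ∣ c := by
      rw [dvd_add_left (dvd_mul_right _ _)]
    by_cases h : θ' ≠ θ ∧ θ.outer p q ∣ c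
    · rw [if_pos h, if_pos ⟨h.1, this.2 h.2⟩]
      simp only [Int.add_mul_ediv_left _ _ h0, mul_add, add_assoc]
    · rw [if_neg h, if_neg fun h' => h ⟨h'.1, this.1 h'.2⟩]
      exact key _

/-- The set of normal forms. -/
abbrev VNF (p q : ℕ) : Type := {S : NF // NF.Valid p q S.1}

/-- Right multiplication by `t` as a permutation of normal forms. -/
def permT (hp : 1 ≤ p) (hq : 1 ≤ q) : Equiv.Perm (VNF p q) where
  toFun S := ⟨NF.step p q .t S.1, NF.valid_step hp hq S.2 _⟩
  invFun S := ⟨NF.step p q .T S.1, NF.valid_step hp hq S.2 _⟩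
  left_inv S := Subtype.ext (NF.step_step_inv hp hq S.2 .t)
  right_inv S := Subtype.ext (NF.step_step_inv hp hq S.2 .T)

/-- Right multiplication by `a` as a permutation of normal forms. -/
def permA (p q : ℕ) : Equiv.Perm (VNF p q) where
  toFun S := ⟨(S.1.1, S.1.2 + 1), S.2⟩
  invFun S := ⟨(S.1.1, S.1.2 - 1), S.2⟩
  left_inv S := Subtype.ext (by simp)
  right_inv S := Subtype.ext (by simp)

theorem permA_zpow (m : ℤ) (S : VNF p q) : ((permA p q) ^ m) S = ⟨(S.1.1, S.1.2 + m), S.2⟩ := by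
  induction m using Int.induction_on generalizing S with
  | zero => simp
  | succ i ih =>
    rw [zpow_add_one, Equiv.Perm.mul_apply, ih]
    simp [permA, add_comm, add_left_comm]
  | pred i ih =>
    rw [zpow_sub_one, Equiv.Perm.mul_apply, ih]
    apply Subtype.ext
    change ((S.1.1, S.1.2 - 1 + -(i : ℤ)) : NF) = _
    simp only [Prod.mk.injEq, true_and]
    ring

/-- The images of the generators in the opposite of the permutation group. -/
def genPerm (hp : 1 ≤ p) (hq : 1 ≤ q) : Gen → (Equiv.Perm (VNF p q))ᵐᵒᵖ
  | .a => MulOpposite.op (permA p q)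
  | .t => MulOpposite.op (permT hp hq)

/-- The right action of the group on normal forms. -/
def actionHom (hp : 1 ≤ p) (hq : 1 ≤ q) : BSGroup p q →* (Equiv.Perm (VNF p q))ᵐᵒᵖ :=
  PresentedGroup.toGroup (f := genPerm hp hq) (by
    intro r hr
    rw [Set.mem_singleton_iff] at hr
    subst hr
    simp only [map_mul, map_inv, map_pow, FreeGroup.lift_apply_of, genPerm]
    rw [mul_inv_eq_one, mul_inv_eq_iff_eq_mul]
    apply MulOpposite.unop_injective
    simp only [MulOpposite.unop_mul, MulOpposite.unop_op, MulOpposite.unop_pow]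
    ext1 S
    rw [Equiv.Perm.mul_apply, Equiv.Perm.mul_apply, ← zpow_natCast, ← zpow_natCast, permA_zpow,
      permA_zpow]
    apply Subtype.ext
    have := NF.step_add hp hq S.1.1 S.1.2 1 .t
    simp only [Stable.outer, Stable.inner, mul_one] at this
    exact this.symm)

/-- The normal form of a group element. -/
def nf (hp : 1 ≤ p) (hq : 1 ≤ q) (g : BSGroup p q) : NF :=
  ((actionHom hp hq g).unop ⟨([], 0), trivial⟩).1

theorem nf_valid (hp : 1 ≤ p) (hq : 1 ≤ q) (g : BSGroup p q) : NF.Valid p q (nf hp hq g).1 :=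
  ((actionHom hp hq g).unop ⟨([], 0), trivial⟩).2

theorem nf_mul_genA_zpow (hp : 1 ≤ p) (hq : 1 ≤ q) (g : BSGroup p q) (m : ℤ) :
    nf hp hq (g * genA p q ^ m) = ((nf hp hq g).1, (nf hp hq g).2 + m) := by
  have : actionHom hp hq (genA p q) = MulOpposite.op (permA p q) := by
    simp only [actionHom, genA, PresentedGroup.toGroup.of, genPerm]
  unfold nf
  rw [map_mul, map_zpow, this, MulOpposite.unop_mul, MulOpposite.unop_zpow, MulOpposite.unop_op,
    Equiv.Perm.mul_apply, permA_zpow]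

theorem nf_mul_val (hp : 1 ≤ p) (hq : 1 ≤ q) (g : BSGroup p q) (θ : Stable) :
    nf hp hq (g * θ.val p q) = NF.step p q θ (nf hp hq g) := by
  have : actionHom hp hq (genT p q) = MulOpposite.op (permT hp hq) := by
    simp only [actionHom, genT, PresentedGroup.toGroup.of, genPerm]
  unfold nf
  cases θ with
  | t =>
    rw [Stable.val, map_mul, this, MulOpposite.unop_mul, MulOpposite.unop_op,
      Equiv.Perm.mul_apply]
    rfl
  | T =>
    rw [Stable.val, map_mul, map_inv, this, MulOpposite.unop_mul, MulOpposite.unop_inv,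
      MulOpposite.unop_op, Equiv.Perm.mul_apply]
    rfl

theorem nf_one (hp : 1 ≤ p) (hq : 1 ≤ q) : nf hp hq 1 = ([], 0) := by simp [nf]

theorem nf_genA_zpow (hp : 1 ≤ p) (hq : 1 ≤ q) (m : ℤ) :
    nf hp hq (genA p q ^ m) = ([], m) := by
  rw [← one_mul (genA p q ^ m), nf_mul_genA_zpow, nf_one]; simp

/-- The computation of a normal form from left to right. -/
def Word.toNF (p q : ℕ) (u : Word) : NF :=
  u.tail.foldl (fun S x => ((NF.step p q x.1 S).1, (NF.step p q x.1 S).2 + x.2)) ([], u.head)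

theorem nf_mul_tail (hp : 1 ≤ p) (hq : 1 ≤ q) (l : List (Stable × ℤ)) (g : BSGroup p q) :
    nf hp hq (g * (l.map fun x => x.1.val p q * genA p q ^ x.2).prod) =
      l.foldl (fun S x => ((NF.step p q x.1 S).1, (NF.step p q x.1 S).2 + x.2)) (nf hp hq g) := by
  induction l generalizing g with
  | nil => simp
  | cons x l ih =>
    rw [List.map_cons, List.prod_cons, ← mul_assoc, ih, ← mul_assoc, nf_mul_genA_zpow, nf_mul_val]
    rfl

theorem nf_val (hp : 1 ≤ p) (hq : 1 ≤ q) (u : Word) : nf hp hq (u.val p q) = u.toNF p q := by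
  rw [Word.val, nf_mul_tail, nf_genA_zpow]; rfl

theorem toNF_eval (u : Word) : (u.toNF p q).eval p q = u.val p q := by
  have : ∀ (l : List (Stable × ℤ)) (S : NF),
      NF.eval p q (l.foldl (fun S x => ((NF.step p q x.1 S).1, (NF.step p q x.1 S).2 + x.2)) S) =
      S.eval p q * (l.map fun x => x.1.val p q * genA p q ^ x.2).prod := by
    intro l
    induction l with
    | nil => simp
    | cons x l ih =>
      intro S
      rw [List.foldl_cons, ih, NF.eval_add, NF.eval_step]
      simp [mul_assoc]
  rw [Word.toNF, this, NF.eval_nil]; rfl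

end BaumslagSolitar

namespace BaumslagSolitar

/-! ### Geodesics of powers of `a` -/

/-- The word `a^x` over `a` and `A`. -/
def apow (x : ℤ) : List Letter := List.replicate x.natAbs (if x < 0 then .A else .a)

@[simp] theorem length_apow (x : ℤ) : (apow x).length = x.natAbs := by simp [apow]

@[simp] theorem apow_zero : apow 0 = [] := rfl

theorem wordVal_append (p q : ℕ) (u v : List Letter) :
    wordVal p q (u ++ v) = wordVal p q u * wordVal p q v := by simp [wordVal]

@[simp] theorem wordVal_nil (p q : ℕ) : wordVal p q [] = 1 := rfl

@[simp] theorem wordVal_cons (p q : ℕ) (c : Letter) (v : List Letter) :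
    wordVal p q (c :: v) = c.val p q * wordVal p q v := by simp [wordVal]

@[simp] theorem wordVal_apow (p q : ℕ) (x : ℤ) : wordVal p q (apow x) = genA p q ^ x := by
  unfold apow wordVal
  rw [List.map_replicate, List.prod_replicate, ← zpow_natCast]
  split_ifs with h
  · rw [Letter.val, inv_zpow, ← zpow_neg]
    congr 1; omega
  · rw [Letter.val]
    congr 1; omega

theorem apow_add_of_nonneg {x y : ℤ} (h : 0 ≤ x) (h' : 0 ≤ y) : apow (x + y) = apow x ++ apow y := by
  unfold apow
  rw [if_neg (by omega), if_neg (by omega), if_neg (by omega), ← List.replicate_add]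
  congr 1; omega

theorem apow_add_of_nonpos {x y : ℤ} (h : x < 0) (h' : y < 0) : apow (x + y) = apow x ++ apow y := by
  unfold apow
  rw [if_pos (by omega), if_pos (by omega), if_pos (by omega), ← List.replicate_add]
  congr 1; omega

theorem rank_apow_add (x y : ℤ) : rank (apow (x + y)) ≤ rank (apow x ++ apow y) := by
  rcases eq_or_ne x 0 with rfl | hx
  · simp
  rcases eq_or_ne y 0 with rfl | hy
  · simp
  rcases le_or_gt 0 x with h | h <;> rcases le_or_gt 0 y with h' | h'
  · rw [apow_add_of_nonneg h h']
  · exact (rank_lt_of_length_lt (by simp; omega)).le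
  · exact (rank_lt_of_length_lt (by simp; omega)).le
  · rw [apow_add_of_nonpos h h']

/-- Words `t ⋯ t a^* T a^* ⋯ T a^*` that represent `a^α`. -/
inductive Hill (p q : ℕ) : ℤ → List Letter → Prop
  | flat (α : ℤ) : Hill p q α (apow α)
  | up (m x : ℤ) (w : List Letter) (h : Hill p q (p * m) w) :
      Hill p q (x + q * m) (.t :: w ++ .T :: apow x)

variable {p q : ℕ}

theorem Hill.wordVal_eq {α : ℤ} {w : List Letter} (h : Hill p q α w) :
    wordVal p q w = genA p q ^ α := by
  induction h with
  | flat α => simp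
  | up m x w h ih =>
    rw [wordVal_append, wordVal_cons, wordVal_cons, ih, wordVal_apow]
    simp only [Letter.val]
    rw [← genA_zpow_mul_genT, mul_assoc, mul_inv_cancel_left, ← zpow_add, add_comm]

theorem Hill.add {α β : ℤ} {u v : List Letter} (hu : Hill p q α u) (hv : Hill p q β v) :
    ∃ w, Hill p q (α + β) w ∧ w.length ≤ u.length + v.length := by
  induction hu generalizing β v with
  | flat α =>
    cases hv with
    | flat β => exact ⟨_, Hill.flat _, by simp; omega⟩
    | up m x w h =>
      refine ⟨_, by rw [← add_assoc]; exact Hill.up m (α + x) w h, by simp; omega⟩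
  | up m x w h ih =>
    cases hv with
    | flat β =>
      refine ⟨_, by rw [add_right_comm]; exact Hill.up m (x + β) w h, by simp; omega⟩
    | up m' x' w' h' =>
      obtain ⟨z, hz, hl⟩ := ih h'
      rw [← mul_add] at hz
      refine ⟨_, by
        rw [show x + q * m + (x' + q * m') = (x + x') + q * (m + m') by ring]
        exact Hill.up (m + m') (x + x') z hz, by simp; omega⟩

theorem exists_minimal_hill (p q : ℕ) (α : ℤ) :
    ∃ w, Hill p q α w ∧ ∀ v, Hill p q α v → rank w ≤ rank v := by
  classical
  have h : ∃ n, ∃ w, Hill p q α w ∧ rank w = n := ⟨_, _, Hill.flat α, rfl⟩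
  obtain ⟨w, hw, e⟩ := Nat.find_spec h
  exact ⟨w, hw, fun v hv => e ▸ Nat.find_min' h ⟨v, hv, rfl⟩⟩

/-- The normal form of `a^α`. -/
noncomputable def lnf (p q : ℕ) (α : ℤ) : List Letter := (exists_minimal_hill p q α).choose

theorem lnf_hill (p q : ℕ) (α : ℤ) : Hill p q α (lnf p q α) :=
  (exists_minimal_hill p q α).choose_spec.1

theorem rank_lnf_le {α : ℤ} {v : List Letter} (h : Hill p q α v) : rank (lnf p q α) ≤ rank v :=
  (exists_minimal_hill p q α).choose_spec.2 v h

theorem length_lnf_le {α : ℤ} {v : List Letter} (h : Hill p q α v) :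
    (lnf p q α).length ≤ v.length := length_le_of_rank_le (rank_lnf_le h)

theorem rank_lnf_add (p q : ℕ) (α β : ℤ) :
    rank (lnf p q (α + β)) ≤ rank (lnf p q α ++ lnf p q β) := by
  have hα := lnf_hill p q α
  have hβ := lnf_hill p q β
  generalize lnf p q α = u at *
  generalize lnf p q β = v at *
  cases hα with
  | flat α =>
    cases hβ with
    | flat β => exact (rank_lnf_le (Hill.flat _)).trans (rank_apow_add _ _)
    | up m x w h =>
      rcases eq_or_ne α 0 with rfl | h0
      · simpa using rank_lnf_le (Hill.up m x w h)
      · rw [← add_assoc]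
        refine (rank_lnf_le (Hill.up m (α + x) w h)).trans ?_
        obtain ⟨k, hk⟩ : ∃ k, α.natAbs = k + 1 := ⟨α.natAbs - 1, by omega⟩
        simp only [List.cons_append, apow, hk, List.replicate_succ]
        refine (rank_cons_lt_of_code ?_ ?_).le
        · split_ifs <;> simp [Letter.code]
        · simp; omega
  | up m x w h =>
    cases hβ with
    | flat β =>
      rw [add_right_comm]
      refine (rank_lnf_le (Hill.up m (x + β) w h)).trans ?_
      simpa using rank_append_le (le_refl (rank (.t :: w))) (rank_cons_le .T (rank_apow_add x β))
    | up m' x' w' h' =>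
      obtain ⟨z, hz, hl⟩ := h.add h'
      rw [← mul_add] at hz
      rw [show x + q * m + (x' + q * m') = (x + x') + q * (m + m') by ring]
      refine (rank_lnf_le (Hill.up _ _ _ hz)).trans (rank_lt_of_length_lt ?_).le
      simp; omega

theorem length_lnf_add (p q : ℕ) (α β : ℤ) :
    (lnf p q (α + β)).length ≤ (lnf p q α).length + (lnf p q β).length := by
  simpa using length_le_of_rank_le (rank_lnf_add p q α β)

theorem length_lnf_le_natAbs (p q : ℕ) (α : ℤ) : (lnf p q α).length ≤ α.natAbs := by
  simpa using length_lnf_le (Hill.flat (p := p) (q := q) α)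

theorem lnf_zero (p q : ℕ) : lnf p q 0 = [] := by
  simpa using length_lnf_le_natAbs p q 0

theorem rank_lnf_up (p q : ℕ) (m : ℤ) :
    rank (lnf p q (q * m)) ≤ rank (.t :: lnf p q (p * m) ++ [.T]) := by
  simpa using rank_lnf_le (Hill.up m 0 _ (lnf_hill p q (p * m)))

theorem length_lnf_down (hpq : p ≤ q) (m : ℤ) :
    (lnf p q (p * m)).length ≤ (lnf p q (q * m)).length := by
  have h := lnf_hill p q (q * m)
  rcases Nat.eq_zero_or_pos q with rfl | hq
  · simp at hpq; simp [hpq]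
  generalize lnf p q (q * m) = u at *
  generalize hα : (q : ℤ) * m = α at *
  cases h with
  | flat α =>
    refine (length_lnf_le_natAbs _ _ _).trans ?_
    rw [length_apow, ← hα, Int.natAbs_mul, Int.natAbs_mul]
    exact Nat.mul_le_mul_right _ (by simpa)
  | up n x w h =>
    have hx : x = q * (m - n) := by linarith
    rw [show (p : ℤ) * m = p * n + p * (m - n) by ring]
    refine (length_lnf_add _ _ _ _).trans ?_
    have h1 := length_lnf_le h
    have h2 : (lnf p q (p * (m - n))).length ≤ x.natAbs := by
      refine (length_lnf_le_natAbs _ _ _).trans ?_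
      rw [hx, Int.natAbs_mul, Int.natAbs_mul]
      exact Nat.mul_le_mul_right _ (by simpa)
    simp; omega

theorem rank_lnf_inner (hpq : p ≤ q) (θ : Stable) (m : ℤ) :
    rank (lnf p q (θ.inner p q * m)) ≤
      rank (θ.inv.letter :: (lnf p q (θ.outer p q * m) ++ [θ.letter])) := by
  cases θ with
  | T => exact rank_lnf_up p q m
  | t =>
    refine (rank_lt_of_length_lt ?_).le
    have := length_lnf_down hpq m
    simp only [Stable.inner, Stable.outer, List.length_cons, List.length_append, List.length_nil]
    omega

/-! ### Britton-reduced words -/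

namespace Word

/-- The word over the four letters obtained from `u` by normal forms of the integers. -/
noncomputable def expand (p q : ℕ) (u : Word) : List Letter :=
  lnf p q u.head ++ u.tail.flatMap fun y => y.1.letter :: lnf p q y.2

end Word

theorem Stable.letter_val (p q : ℕ) (θ : Stable) : θ.letter.val p q = θ.val p q := by
  cases θ <;> rfl

theorem wordVal_lnf (p q : ℕ) (α : ℤ) : wordVal p q (lnf p q α) = genA p q ^ α :=
  (lnf_hill p q α).wordVal_eq

theorem wordVal_expand (p q : ℕ) (u : Word) : wordVal p q (u.expand p q) = u.val p q := by
  obtain ⟨h, l⟩ := u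
  rw [Word.expand, Word.val, wordVal_append, wordVal_lnf]
  congr 1
  induction l with
  | nil => rfl
  | cons x l ih =>
    rw [List.flatMap_cons, wordVal_append, ih, wordVal_cons, wordVal_lnf, Stable.letter_val]
    rfl

theorem exists_reduced_mul_gen (h : ℤ) (l : List (Stable × ℤ)) (e : ℤ) :
    rank (lnf p q (e + h) ++ l.flatMap fun y => y.1.letter :: lnf p q y.2) ≤
      rank (apow e ++ (Word.mk h l).expand p q) := by
  rw [Word.expand, ← List.append_assoc]
  refine rank_append_le ?_ le_rfl
  refine (rank_lnf_add _ _ _ _).trans (rank_append_le ?_ le_rfl)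
  exact rank_lnf_le (Hill.flat _)

theorem exists_reduced_stable (hpq : p ≤ q) (u : Word) (hu : u.Reduced p q) (θ : Stable) :
    ∃ u' : Word, u'.Reduced p q ∧ u'.val p q = θ.val p q * u.val p q ∧
      rank (u'.expand p q) ≤ rank (θ.letter :: u.expand p q) := by
  obtain ⟨h, l⟩ := u
  by_cases hc : ∃ (m y : ℤ) (l' : List (Stable × ℤ)), h = θ.inner p q * m ∧ l = (θ.inv, y) :: l'
  · obtain ⟨m, y, l', rfl, rfl⟩ := hc
    refine ⟨⟨θ.outer p q * m + y, l'⟩, List.IsChain.tail hu, ?_, ?_⟩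
    · simp only [Word.val, List.map_cons, List.prod_cons]
      rw [← mul_assoc, ← mul_assoc, ← mul_assoc, ← genA_zpow_mul_val, Stable.val_inv,
        mul_inv_cancel_right, zpow_add]
    · simp only [Word.expand, List.flatMap_cons]
      have h1 := rank_lnf_inner hpq θ.inv m
      rw [Stable.inner_inv, Stable.outer_inv, Stable.inv_inv] at h1
      have h2 := rank_append_le ((rank_lnf_add p q (θ.outer p q * m) y).trans
        (rank_append_le h1 le_rfl))
        (le_refl (rank (l'.flatMap fun y => y.1.letter :: lnf p q y.2)))
      simpa using h2
  · refine ⟨⟨0, (θ, h) :: l⟩, ?_, ?_, ?_⟩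
    · change List.IsChain _ _
      cases l with
      | nil => exact List.isChain_singleton _
      | cons z l =>
        refine List.IsChain.cons_cons ?_ hu
        constructor
        · rintro ⟨h1, ⟨m, h2⟩, h3⟩
          obtain ⟨z1, z2⟩ := z
          simp only at h1 h2 h3
          subst h1 h2 h3
          exact hc ⟨m, z2, l, rfl, rfl⟩
        · rintro ⟨h1, ⟨m, h2⟩, h3⟩
          obtain ⟨z1, z2⟩ := z
          simp only at h1 h2 h3
          subst h1 h2 h3
          exact hc ⟨m, z2, l, rfl, rfl⟩
    · simp [Word.val, mul_assoc]
    · simp [Word.expand, lnf_zero]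

theorem exists_reduced (hpq : p ≤ q) (w : List Letter) :
    ∃ u : Word, u.Reduced p q ∧ u.val p q = wordVal p q w ∧ rank (u.expand p q) ≤ rank w := by
  induction w with
  | nil => exact ⟨⟨0, []⟩, List.isChain_nil, by simp [Word.val], by simp [Word.expand, lnf_zero]⟩
  | cons c w ih =>
    obtain ⟨u, h1, h2, h3⟩ := ih
    have key : ∀ θ : Stable, θ.letter = c → ∃ u : Word, u.Reduced p q ∧
        u.val p q = wordVal p q (c :: w) ∧ rank (u.expand p q) ≤ rank (c :: w) := by
      intro θ hθ
      obtain ⟨u', h4, h5, h6⟩ := exists_reduced_stable hpq u h1 θ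
      refine ⟨u', h4, ?_, h6.trans ?_⟩
      · rw [h5, h2, wordVal_cons, ← hθ, Stable.letter_val]
      · rw [hθ]; exact rank_cons_le _ h3
    have key' : ∀ e : ℤ, apow e = [c] → ∃ u : Word, u.Reduced p q ∧
        u.val p q = wordVal p q (c :: w) ∧ rank (u.expand p q) ≤ rank (c :: w) := by
      intro e hc
      refine ⟨⟨e + u.head, u.tail⟩, h1, ?_, (exists_reduced_mul_gen u.head u.tail e).trans ?_⟩
      · have := wordVal_apow p q e
        rw [hc] at this
        simp only [wordVal_cons, wordVal_nil, mul_one] at this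
        rw [wordVal_cons, ← h2, this, Word.val, Word.val, zpow_add]
        simp [mul_assoc]
      · rw [hc]; exact rank_cons_le _ h3
    cases c with
    | t => exact key .t rfl
    | T => exact key .T rfl
    | a => exact key' 1 rfl
    | A => exact key' (-1) rfl

/-! ### Britton's lemma -/

theorem NF.step_eq_push {θ : Stable} {S : NF}
    (h : ∀ y ∈ S.1.head?, y.2 ≠ θ → ¬ θ.outer p q ∣ S.2) : NF.step p q θ S = NF.push p q θ S := by
  match S with
  | ([], c) => rfl
  | ((b, θ') :: l, c) =>
    rw [NF.step, if_neg]
    rintro ⟨h1, h2⟩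
    exact h (b, θ') (by simp) h1 h2

theorem NF.length_step_of_not {θ : Stable} {S : NF}
    (h : ¬ ∀ y ∈ S.1.head?, y.2 ≠ θ → ¬ θ.outer p q ∣ S.2) :
    (NF.step p q θ S).1.length < S.1.length := by
  match S with
  | ([], c) => simp at h
  | ((b, θ') :: l, c) =>
    rw [NF.step, if_pos]
    · simp
    · simpa using h

theorem NF.length_step_le (θ : Stable) (S : NF) :
    (NF.step p q θ S).1.length ≤ S.1.length + 1 := by
  by_cases h : ∀ y ∈ S.1.head?, y.2 ≠ θ → ¬ θ.outer p q ∣ S.2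
  · rw [NF.step_eq_push h]; simp [NF.push]
  · have := NF.length_step_of_not h; omega

theorem toNF_concat (h : ℤ) (l : List (Stable × ℤ)) (θ : Stable) (x : ℤ) :
    (Word.mk h (l ++ [(θ, x)])).toNF p q =
      ((NF.step p q θ ((Word.mk h l).toNF p q)).1,
        (NF.step p q θ ((Word.mk h l).toNF p q)).2 + x) := by
  simp [Word.toNF]

theorem length_toNF_le (u : Word) : (u.toNF p q).1.length ≤ u.len := by
  obtain ⟨h, l⟩ := u
  induction l using List.reverseRecOn with
  | nil => simp [Word.toNF, Word.len]
  | append_singleton l x ih =>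
    obtain ⟨θ, x⟩ := x
    rw [toNF_concat]
    have := NF.length_step_le (p := p) (q := q) θ ((Word.mk h l).toNF p q)
    simp only [Word.len, List.length_append, List.length_singleton] at *
    omega

/-- The last stable letter of a word and the integer behind it, up to multiples of the modulus of
the inverse letter, are not changed by normalisation without cancellation. -/
theorem toNF_head_of_length_eq (h : ℤ) (l : List (Stable × ℤ)) (θ : Stable) (x : ℤ)
    (hl : ((Word.mk h (l ++ [(θ, x)])).toNF p q).1.length = l.length + 1) :
    ((Word.mk h l).toNF p q).1.length = l.length ∧
    (∀ y ∈ ((Word.mk h l).toNF p q).1.head?, y.2 ≠ θ →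
      ¬ θ.outer p q ∣ ((Word.mk h l).toNF p q).2) ∧
    (Word.mk h (l ++ [(θ, x)])).toNF p q =
      ((((Word.mk h l).toNF p q).2 % θ.outer p q, θ) :: ((Word.mk h l).toNF p q).1,
        θ.inner p q * (((Word.mk h l).toNF p q).2 / θ.outer p q) + x) := by
  rw [toNF_concat] at *
  have h1 : ((Word.mk h l).toNF p q).1.length ≤ l.length := length_toNF_le ⟨h, l⟩
  by_cases h2 : ∀ y ∈ ((Word.mk h l).toNF p q).1.head?, y.2 ≠ θ →
      ¬ θ.outer p q ∣ ((Word.mk h l).toNF p q).2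
  · refine ⟨?_, h2, by rw [NF.step_eq_push h2]; rfl⟩
    have := NF.length_step_le (p := p) (q := q) θ ((Word.mk h l).toNF p q)
    simp only at hl
    omega
  · have := NF.length_step_of_not h2
    simp only at hl
    omega

theorem pinch_iff (x y : Stable × ℤ) :
    (¬ (x.1 = .t ∧ (p : ℤ) ∣ x.2 ∧ y.1 = .T) ∧ ¬ (x.1 = .T ∧ (q : ℤ) ∣ x.2 ∧ y.1 = .t)) ↔
      (x.1 ≠ y.1 → ¬ y.1.outer p q ∣ x.2) := by
  obtain ⟨θ, x⟩ := x
  obtain ⟨θ', y⟩ := y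
  cases θ <;> cases θ' <;> simp [Stable.outer]

theorem reduced_concat (h : ℤ) (l : List (Stable × ℤ)) (θ : Stable) (x : ℤ) :
    (Word.mk h (l ++ [(θ, x)])).Reduced p q ↔ (Word.mk h l).Reduced p q ∧
      ∀ y ∈ l.getLast?, y.1 ≠ θ → ¬ θ.outer p q ∣ y.2 := by
  unfold Word.Reduced
  rw [List.isChain_append]
  simp only [pinch_iff, List.isChain_singleton, true_and, List.head?_cons, Option.mem_def,
    Option.some.injEq, forall_eq']

theorem reduced_iff_length_toNF (u : Word) :
    u.Reduced p q ↔ (u.toNF p q).1.length = u.len := by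
  obtain ⟨h, l⟩ := u
  induction l using List.reverseRecOn with
  | nil => simp [Word.toNF, Word.len, Word.Reduced]
  | append_singleton l x ih =>
    obtain ⟨θ, x⟩ := x
    rw [reduced_concat, ih]
    have key : ((Word.mk h l).toNF p q).1.length = l.length →
        ((∀ y ∈ l.getLast?, y.1 ≠ θ → ¬ θ.outer p q ∣ y.2) ↔
          ∀ y ∈ ((Word.mk h l).toNF p q).1.head?, y.2 ≠ θ →
            ¬ θ.outer p q ∣ ((Word.mk h l).toNF p q).2) := by
      intro hl
      induction l using List.reverseRecOn with
      | nil => simp [Word.toNF]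
      | append_singleton l z _ =>
        obtain ⟨θ', z⟩ := z
        obtain ⟨-, -, e⟩ := toNF_head_of_length_eq h l θ' z (by simpa using hl)
        rw [e]
        simp only [List.getLast?_append, List.getLast?_singleton, Option.some_or, Option.mem_def,
          Option.some.injEq, forall_eq', List.head?_cons]
        refine imp_congr_right fun hne => ?_
        have := Stable.eq_inv_of_ne hne
        subst this
        rw [← Stable.inner_inv, dvd_add_right (dvd_mul_right _ _)]
    simp only [Word.len, List.length_append, List.length_singleton] at *
    constructor
    · rintro ⟨h1, h2⟩
      rw [toNF_concat, NF.step_eq_push ((key h1).1 h2)]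
      simp [NF.push, h1]
    · intro h1
      obtain ⟨h2, h3, -⟩ := toNF_head_of_length_eq h l θ x h1
      exact ⟨h2, (key h2).2 h3⟩

theorem thetas_toNF (u : Word) (hu : u.Reduced p q) :
    (u.toNF p q).1.map Prod.snd = (u.tail.map Prod.fst).reverse := by
  obtain ⟨h, l⟩ := u
  induction l using List.reverseRecOn with
  | nil => simp [Word.toNF]
  | append_singleton l x ih =>
    obtain ⟨θ, x⟩ := x
    obtain ⟨-, -, e⟩ := toNF_head_of_length_eq h l θ x (by
      have := (reduced_iff_length_toNF _).1 hu
      simpa [Word.len] using this)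
    rw [e]
    simp [← ih ((reduced_concat h l θ x).1 hu).1]

theorem isLLNF_lnf (hp : 1 ≤ p) (hpq : p ≤ q) (α : ℤ) : IsLLNF p q (genA p q ^ α) (lnf p q α) := by
  refine ⟨wordVal_lnf p q α, fun v hv => eq_or_shortlex_of_rank_le ?_⟩
  obtain ⟨u, h1, h2, h3⟩ := exists_reduced hpq v
  have hq : 1 ≤ q := hp.trans hpq
  have h4 : u.toNF p q = ([], α) := by
    rw [← nf_val hp hq, h2, hv, nf_genA_zpow]
  have h5 := (reduced_iff_length_toNF u).1 h1
  rw [h4] at h5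
  obtain ⟨h, l⟩ := u
  have hl : l = [] := List.length_eq_zero_iff.1 h5.symm
  subst hl
  simp only [Word.toNF, List.foldl_nil, Prod.mk.injEq, true_and] at h4
  subst h4
  simpa [Word.expand] using h3

theorem geodesicLength_le (w : List Letter) : geodesicLength p q (wordVal p q w) ≤ w.length :=
  Nat.sInf_le ⟨w, rfl, rfl⟩

theorem intNorm_eq (hp : 1 ≤ p) (hpq : p ≤ q) (α : ℤ) : intNorm p q α = (lnf p q α).length := by
  apply le_antisymm
  · have := geodesicLength_le (p := p) (q := q) (lnf p q α)
    rwa [wordVal_lnf] at this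
  · refine le_csInf ⟨_, _, wordVal_lnf p q α, rfl⟩ ?_
    rintro n ⟨w, hw, rfl⟩
    rcases (isLLNF_lnf hp hpq α).2 w hw with rfl | h
    · rfl
    · rcases List.shortlex_def.1 h with h | h <;> omega

theorem length_expand (hp : 1 ≤ p) (hpq : p ≤ q) (u : Word) :
    (u.expand p q).length = u.norm p q := by
  obtain ⟨h, l⟩ := u
  simp only [Word.expand, Word.norm, Word.len, Word.coeffs, List.length_append, List.map_cons,
    List.sum_cons, intNorm_eq hp hpq h]
  have : (l.flatMap fun y => y.1.letter :: lnf p q y.2).length =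
      l.length + ((l.map Prod.snd).map (intNorm p q)).sum := by
    induction l with
    | nil => rfl
    | cons x l ih =>
      simp only [List.flatMap_cons, List.length_append, ih, List.map_cons, List.sum_cons,
        List.length_cons, intNorm_eq hp hpq x.2]
      omega
  omega

theorem geodesicLength_le_norm (hp : 1 ≤ p) (hpq : p ≤ q) (u : Word) :
    geodesicLength p q (u.val p q) ≤ u.norm p q := by
  rw [← length_expand hp hpq, ← wordVal_expand]
  exact geodesicLength_le _

theorem exists_reduced_norm_le (hp : 1 ≤ p) (hpq : p ≤ q) (v : Word) :
    ∃ u : Word, u.Reduced p q ∧ u.val p q = v.val p q ∧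
      u.norm p q ≤ geodesicLength p q (v.val p q) := by
  have hne : {n : ℕ | ∃ w : List Letter, wordVal p q w = v.val p q ∧ w.length = n}.Nonempty :=
    ⟨_, _, wordVal_expand p q v, rfl⟩
  obtain ⟨w, hw, hl⟩ := Nat.sInf_mem hne
  obtain ⟨u, h1, h2, h3⟩ := exists_reduced hpq w
  refine ⟨u, h1, h2.trans hw, ?_⟩
  rw [← length_expand hp hpq]
  exact (length_le_of_rank_le h3).trans hl.le

end BaumslagSolitar

namespace BaumslagSolitar

variable {p q : ℕ}

/-! ### Sizes of the normal forms of integers -/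

theorem Hill.abs_lt (hpq : p ≤ q) (hp : 1 ≤ p) {α : ℤ} {w : List Letter} (h : Hill p q α w) :
    |α| < (2 * q : ℤ) ^ w.length := by
  have hq : (1 : ℤ) ≤ q := by exact_mod_cast hp.trans hpq
  have hp' : (1 : ℤ) ≤ p := by exact_mod_cast hp
  have hx : ∀ x : ℤ, |x| + 1 ≤ (2 * q : ℤ) ^ x.natAbs := by
    intro x
    rw [Int.abs_eq_natAbs]
    have h1 : x.natAbs < 2 ^ x.natAbs := Nat.lt_two_pow_self
    have h2 : (2 : ℤ) ^ x.natAbs ≤ (2 * q : ℤ) ^ x.natAbs :=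
      pow_le_pow_left₀ (by norm_num) (by linarith) _
    have h3 : ((x.natAbs : ℤ)) + 1 ≤ 2 ^ x.natAbs := by exact_mod_cast h1
    linarith
  induction h with
  | flat α => rw [length_apow]; linarith [hx α]
  | up m x w h ih =>
    have h1 := hx x
    have e : (Letter.t :: w ++ Letter.T :: apow x).length = w.length + (2 + x.natAbs) := by
      simp; omega
    rw [e, pow_add, pow_add]
    set E := (2 * q : ℤ) ^ w.length
    set G := (2 * q : ℤ) ^ x.natAbs
    have h2 : |m| ≤ |(p * m : ℤ)| := by
      rw [abs_mul, abs_of_nonneg (by linarith : (0 : ℤ) ≤ p)]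
      nlinarith [abs_nonneg m]
    have h3 : |x + q * m| ≤ |x| + q * |m| := by
      refine (abs_add_le _ _).trans ?_
      rw [abs_mul, abs_of_nonneg (by linarith : (0 : ℤ) ≤ q)]
    have h4 : 1 ≤ E := by
      have := abs_nonneg (p * m : ℤ)
      omega
    have h5 : q * |m| ≤ q * E := by nlinarith [abs_nonneg m]
    have h6 : (1 : ℤ) ≤ G := by linarith [abs_nonneg x]
    have h7 : G ≤ E * q * G := by nlinarith [mul_nonneg (sub_nonneg.2 h4) (sub_nonneg.2 hq), mul_pos (by linarith : (0:ℤ) < E) (by linarith : (0:ℤ) < q)]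
    have h8 : q * E ≤ E * q * G := by nlinarith [mul_pos (by linarith : (0:ℤ) < E) (by linarith : (0:ℤ) < q)]
    have h9 : E * q * G * 4 ≤ E * ((2 * q : ℤ) ^ 2 * G) := by
      have : 0 ≤ E * q * G := by positivity
      nlinarith
    linarith

theorem abs_lt_pow_lnf (hpq : p ≤ q) (hp : 1 ≤ p) (α : ℤ) :
    |α| < (2 * q : ℤ) ^ (lnf p q α).length := (lnf_hill p q α).abs_lt hpq hp

theorem length_lnf_le_of_lt {r : ℕ} (hp : 1 ≤ p) (hr : 1 ≤ r) (hq : q = p * r) (h : ℕ) {β : ℤ}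
    (hβ : |β| < q * r ^ h) : (lnf p q β).length ≤ (q + 2) * (h + 1) := by
  have hq0 : 0 < q := by rw [hq]; positivity
  induction h generalizing β with
  | zero =>
    have := length_lnf_le_natAbs p q β
    rw [pow_zero, mul_one, Int.abs_eq_natAbs] at hβ
    omega
  | succ h ih =>
    have e := Int.tmod_add_mul_tdiv β q
    set m := β.tdiv q
    set x := β.tmod q
    have hx : |x| < q := by
      rw [Int.abs_eq_natAbs, Int.natAbs_tmod, Int.natAbs_natCast]
      exact_mod_cast Nat.mod_lt _ hq0
    have hm : |m| < (r : ℤ) ^ (h + 1) := by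
      rw [Int.abs_eq_natAbs] at hβ ⊢
      rw [Int.natAbs_tdiv, Int.natAbs_natCast]
      have h1 : β.natAbs < r ^ (h + 1) * q := by rw [mul_comm]; exact_mod_cast hβ
      exact_mod_cast Nat.div_lt_of_lt_mul (by rwa [mul_comm])
    have h1 := length_lnf_le (Hill.up m x _ (lnf_hill p q (p * m)))
    rw [e] at h1
    have h2 : (lnf p q (p * m)).length ≤ (q + 2) * (h + 1) := by
      apply ih
      rw [abs_mul, hq, Nat.abs_cast]
      push_cast
      have : (p : ℤ) * |m| < p * (r ^ (h + 1)) := by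
        have : (0 : ℤ) < p := by exact_mod_cast hp
        gcongr
      rw [pow_succ] at this
      linarith
    rw [Int.abs_eq_natAbs] at hx
    simp only [List.length_append, List.length_cons, length_apow] at h1
    rw [mul_add (q + 2) (h + 1) 1]
    omega

/-- An integer in front of `θ` can be used unchanged by an optimal word. -/
def Fits (p q : ℕ) (θ : Stable) (x : ℤ) : Prop :=
  |x| < θ.outer p q ∧ ((lnf p q x).length : ℤ) = |x|

theorem fits_or_exists {r : ℕ} (hp : 1 ≤ p) (hpq : p ≤ q) (hq : q = p * r) (θ : Stable) (x : ℤ) :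
    Fits p q θ x ∨ ∃ y m : ℤ, x = y + θ.outer p q * m ∧ |y| < |x| ∧
      (lnf p q y).length + (lnf p q (p * m)).length ≤ (lnf p q x).length := by
  have hpz : (1 : ℤ) ≤ p := by exact_mod_cast hp
  have ho : (p : ℤ) ≤ θ.outer p q := by
    cases θ <;> simp [Stable.outer]; exact_mod_cast hpq
  have h := lnf_hill p q x
  have hl := length_lnf_le_natAbs p q x
  generalize hu : lnf p q x = u at *
  cases h with
  | flat x =>
    by_cases hx : |x| < θ.outer p q
    · left
      refine ⟨hx, ?_⟩
      rw [hu, length_apow, Int.abs_eq_natAbs]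
    · right
      rw [not_lt] at hx
      have h0 := length_lnf_le_natAbs p q
      rcases le_or_gt 0 x with h | h
      · have h1 := h0 (x - θ.outer p q)
        have h2 := h0 (p * 1)
        refine ⟨x - θ.outer p q, 1, by ring, ?_, ?_⟩
        · rw [abs_of_nonneg h] at *
          rw [abs_of_nonneg] <;> linarith
        · rw [abs_of_nonneg h] at *
          rw [length_apow]
          omega
      · have h1 := h0 (x + θ.outer p q)
        have h2 := h0 (p * (-1))
        refine ⟨x + θ.outer p q, -1, by ring, ?_, ?_⟩
        · rw [abs_of_neg h] at *
          rw [abs_of_nonpos] <;> linarith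
        · rw [abs_of_neg h] at *
          rw [length_apow]
          omega
  | up m y w h =>
    right
    have h1 := length_lnf_le h
    have h2 := length_lnf_le_natAbs p q y
    simp only [List.length_append, List.length_cons, length_apow] at hl ⊢
    have h3 : |y| < |y + q * m| := by
      rw [Int.abs_eq_natAbs, Int.abs_eq_natAbs]; omega
    cases θ with
    | t => exact ⟨y, m, rfl, h3, by omega⟩
    | T =>
      refine ⟨y, r * m, ?_, h3, ?_⟩
      · simp [Stable.outer, hq]; ring
      · have h4 := length_le_of_rank_le (rank_lnf_up p q m)
        have e : (p : ℤ) * (r * m) = q * m := by rw [hq]; push_cast; ring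
        simp only [List.length_append, List.length_cons, List.length_nil] at h4
        rw [e]
        omega

/-- The normal form of `a^β` is one of three candidates. -/
theorem lnf_candidates (hp : 1 ≤ p) (hpq : p < q) {β M : ℤ} (h1 : q * M ≤ β)
    (h2 : β ≤ q * M + q) :
    lnf p q β = .t :: lnf p q (p * M) ++ .T :: apow (β - q * M) ∨
    lnf p q β = .t :: lnf p q (p * (M + 1)) ++ .T :: apow (β - q * M - q) ∨
    (|β| < 2 * q ∧ lnf p q β = apow β) := by
  have hpz : (1 : ℤ) ≤ p := by exact_mod_cast hp
  have h0 := length_lnf_le_natAbs p q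
  have hmin : ∀ v, Hill p q β v → rank (lnf p q β) ≤ rank v := fun v hv => rank_lnf_le hv
  have h := lnf_hill p q β
  generalize hu : lnf p q β = u at *
  cases h with
  | flat β =>
    right; right
    refine ⟨?_, rfl⟩
    by_contra hb
    rw [not_lt] at hb
    have key : ∀ y m : ℤ, β = y + q * m → (lnf p q (p * m)).length + 2 + y.natAbs ≤ β.natAbs →
        False := by
      intro y m hy hl
      have h3 := hmin (.t :: lnf p q (p * m) ++ .T :: apow y) (by
        rw [hy]; exact Hill.up m y _ (lnf_hill p q _))
      obtain ⟨k, hk⟩ : ∃ k, β.natAbs = k + 1 := ⟨β.natAbs - 1, by omega⟩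
      simp only [apow, hk, List.replicate_succ, List.cons_append] at h3
      refine absurd h3 (not_le.2 (rank_cons_lt_of_code ?_ ?_))
      · split_ifs <;> simp [Letter.code]
      · simp; omega
    rcases le_or_gt 0 β with h | h
    · have := h0 (p * 2)
      rw [abs_of_nonneg h] at hb
      exact key (β - 2 * q) 2 (by ring) (by omega)
    · have := h0 (p * (-2))
      rw [abs_of_neg h] at hb
      exact key (β + 2 * q) (-2) (by ring) (by omega)
  | up m x w h =>
    have hx : |x| < q := by
      by_contra hb
      rw [not_lt] at hb
      have key : ∀ y e : ℤ, e.natAbs = 1 → x = y + q * e → y.natAbs + q ≤ x.natAbs → False := by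
        intro y e he hy hl
        have h3 := length_le_of_rank_le (hmin (.t :: lnf p q (p * (m + e)) ++ .T :: apow y) (by
          rw [hy, show y + q * e + q * m = y + q * (m + e) by ring]
          exact Hill.up _ y _ (lnf_hill p q _)))
        have h4 := length_lnf_add p q (p * m) (p * e)
        have h5 := h0 (p * e)
        have h6 := length_lnf_le h
        rw [Int.natAbs_mul, he] at h5
        rw [← mul_add] at h4
        simp only [List.length_append, List.length_cons, length_apow] at h3
        omega
      rcases le_or_gt 0 x with h | h
      · rw [abs_of_nonneg h] at hb
        exact key (x - q) 1 rfl (by ring) (by omega)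
      · rw [abs_of_neg h] at hb
        exact key (x + q) (-1) rfl (by ring) (by omega)
    have hw : w = lnf p q (p * m) := by
      have h3 := hmin _ (Hill.up m x _ (lnf_hill p q (p * m)))
      have h4 := rank_lnf_le h
      have h5 : rank (.t :: w ++ .T :: apow x) =
          rank (.t :: lnf p q (p * m) ++ .T :: apow x) :=
        le_antisymm h3 (rank_append_le (rank_cons_le _ h4) le_rfl)
      have h6 : (Letter.t :: w ++ .T :: apow x).length =
          (Letter.t :: lnf p q (p * m) ++ .T :: apow x).length :=
        le_antisymm (length_le_of_rank_le h5.le) (length_le_of_rank_le h5.ge)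
      have h7 := eq_of_numVal_eq h6 (by unfold rank at h5; rw [h6] at h5; omega)
      simpa using h7
    rw [abs_lt] at hx
    have hq0 : (0 : ℤ) < q := by omega
    have h3 : M - 1 < m := by
      have : (q : ℤ) * (M - 1) < q * m := by linarith
      exact lt_of_mul_lt_mul_left this hq0.le
    have h4 : m < M + 2 := by
      have : (q : ℤ) * m < q * (M + 2) := by linarith
      exact lt_of_mul_lt_mul_left this hq0.le
    rcases (by omega : m = M ∨ m = M + 1) with rfl | rfl
    · left
      rw [hw]; simp
    · right; left
      rw [hw]
      congr 4
      ring

/-! ### Moving powers of `a` to the right -/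

/-- The product of the factors `θᵢ a^αᵢ`. -/
def tailVal (p q : ℕ) (l : List (Stable × ℤ)) : BSGroup p q :=
  (l.map fun x => x.1.val p q * genA p q ^ x.2).prod

/-- The norm of the factors `θᵢ a^αᵢ`. -/
noncomputable def tailCost (p q : ℕ) (l : List (Stable × ℤ)) : ℕ :=
  (l.map fun x => 1 + (lnf p q x.2).length).sum

/-- The height of the end of `l` over its beginning. -/
def rise (l : List (Stable × ℤ)) : ℤ := (l.map fun x => x.1.sign).sum

/-- Adds `p * m` to the integer at the first position that is `d` higher than the beginning. -/
def shiftRight (p : ℕ) (m : ℤ) : ℕ → List (Stable × ℤ) → List (Stable × ℤ)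
  | _, [] => []
  | d, (.T, x) :: l => (.T, x) :: shiftRight p m (d + 1) l
  | 0, (.t, x) :: l => (.t, x) :: l
  | 1, (.t, x) :: l => (.t, x + p * m) :: l
  | d + 2, (.t, x) :: l => (.t, x) :: shiftRight p m (d + 1) l

theorem norm_mk (hp : 1 ≤ p) (hpq : p ≤ q) (h : ℤ) (l : List (Stable × ℤ)) :
    (Word.mk h l).norm p q = (lnf p q h).length + tailCost p q l := by
  rw [← length_expand hp hpq, Word.expand, List.length_append, tailCost]
  congr 1
  induction l with
  | nil => rfl
  | cons x l ih => simp [ih]; omega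

theorem map_fst_shiftRight (m : ℤ) (d : ℕ) (l : List (Stable × ℤ)) :
    (shiftRight p m d l).map Prod.fst = l.map Prod.fst := by
  induction l generalizing d with
  | nil => simp [shiftRight]
  | cons x l ih =>
    obtain ⟨θ, x⟩ := x
    match d, θ with
    | d, .T => simp [shiftRight, ih]
    | 0, .t => simp [shiftRight]
    | 1, .t => simp [shiftRight]
    | d + 2, .t => simp [shiftRight, ih]

theorem tailCost_cons (x : Stable × ℤ) (l : List (Stable × ℤ)) :
    tailCost p q (x :: l) = 1 + (lnf p q x.2).length + tailCost p q l := by simp [tailCost]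

theorem tailVal_cons (x : Stable × ℤ) (l : List (Stable × ℤ)) :
    tailVal p q (x :: l) = x.1.val p q * genA p q ^ x.2 * tailVal p q l := by simp [tailVal]

theorem tailCost_shiftRight (m : ℤ) (d : ℕ) (l : List (Stable × ℤ)) :
    tailCost p q (shiftRight p m d l) ≤ (lnf p q (p * m)).length + tailCost p q l := by
  induction l generalizing d with
  | nil => simp [shiftRight]
  | cons x l ih =>
    obtain ⟨θ, x⟩ := x
    match d, θ with
    | d, .T => have := ih (d + 1); simp only [shiftRight, tailCost_cons]; omega
    | 0, .t => simp only [shiftRight, tailCost_cons]; omega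
    | 1, .t =>
      have := length_lnf_add p q x (p * m); simp only [shiftRight, tailCost_cons]; omega
    | d + 2, .t => have := ih (d + 1); simp only [shiftRight, tailCost_cons]; omega

theorem mul_move {G : Type*} [Group G] {A B C s x x' L L' : G} (h1 : A * s = s * B)
    (h2 : B * x = x' * C) (h3 : C * L = L') : A * (s * x * L) = s * x' * L' := by
  rw [← h3, ← mul_assoc, ← mul_assoc, h1, mul_assoc s B x, h2]
  simp only [mul_assoc]

theorem tailVal_shiftRight_T {r : ℕ} (hq : q = p * r) (m : ℤ) (d : ℕ) (x : ℤ)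
    (l : List (Stable × ℤ)) (h : genA p q ^ (p * (m * r ^ (d + 1))) * tailVal p q l =
      tailVal p q (shiftRight p m (d + 1) l)) :
    genA p q ^ (p * (m * r ^ d)) * tailVal p q ((.T, x) :: l) =
      tailVal p q (shiftRight p m d ((.T, x) :: l)) := by
  have h1 := genA_zpow_mul_val p q .T (m * r ^ d)
  simp only [Stable.outer, Stable.inner] at h1
  rw [shiftRight, tailVal_cons, tailVal_cons]
  refine mul_move h1 ?_ h
  rw [← zpow_add, ← zpow_add, hq]
  congr 1
  push_cast
  ring

theorem tailVal_shiftRight {r : ℕ} (hq : q = p * r) (m : ℤ) (d : ℕ) (l : List (Stable × ℤ))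
    (hl : (d + 1 : ℕ) ≤ rise l) :
    genA p q ^ (p * (m * r ^ (d + 1))) * tailVal p q l =
      tailVal p q (shiftRight p m (d + 1) l) := by
  induction l generalizing d with
  | nil => simp [rise] at hl; omega
  | cons x l ih =>
    obtain ⟨θ, x⟩ := x
    cases θ with
    | T =>
      refine tailVal_shiftRight_T hq m _ x l (ih (d + 1) ?_)
      simp [rise, Stable.sign] at *
      linarith
    | t =>
      have h1 := genA_zpow_mul_val p q .t (m * r ^ d)
      simp only [Stable.outer, Stable.inner] at h1
      have e : (p : ℤ) * (m * r ^ (d + 1)) = q * (m * r ^ d) := by rw [hq]; push_cast; ring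
      rw [e]
      cases d with
      | zero =>
        rw [shiftRight, tailVal_cons, tailVal_cons]
        refine mul_move (C := 1) h1 ?_ (one_mul _)
        rw [← zpow_add, mul_one]
        congr 1
        ring
      | succ d =>
        have := ih d (by simp [rise, Stable.sign] at *; linarith)
        rw [shiftRight, tailVal_cons, tailVal_cons]
        refine mul_move h1 ?_ this
        rw [← zpow_add, ← zpow_add]
        congr 1
        ring

/-! ### The order of the infinite alphabet -/

/-- The position of an integer in the order `0, 1, -1, 2, -2, …`. -/
def digit (x : ℤ) : ℕ := if 0 < x then 2 * x.natAbs - 1 else 2 * x.natAbs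

/-- The position of a symbol. -/
def Sym.index : Sym → ℕ
  | .stable .t => 0
  | .stable .T => 1
  | .int α => 2 + digit α

theorem digit_lt_iff (x y : ℤ) : digit x < digit y ↔ |x| < |y| ∨ (|x| = |y| ∧ y < x) := by
  unfold digit
  rw [Int.abs_eq_natAbs, Int.abs_eq_natAbs]
  split_ifs <;> omega

theorem digit_injective : Function.Injective digit := by
  intro x y h
  unfold digit at h
  split_ifs at h <;> omega

theorem Sym.lt_iff (x y : Sym) : x.lt y ↔ x.index < y.index := by
  match x, y with
  | .stable θ, .stable θ' => cases θ <;> cases θ' <;> simp [Sym.lt, Sym.index]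
  | .stable θ, .int _ => cases θ <;> simp [Sym.lt, Sym.index]; omega
  | .int _, .stable θ => cases θ <;> simp [Sym.lt, Sym.index]
  | .int α, .int β => simp [Sym.lt, Sym.index, digit_lt_iff]

theorem Sym.wf_lt : WellFounded Sym.lt := by
  refine Subrelation.wf (r := InvImage (· < ·) Sym.index) ?_ (InvImage.wf _ wellFounded_lt)
  intro x y h
  exact (Sym.lt_iff x y).1 h

theorem deltaLE_trans {x y z : List Sym} (h : deltaLE x y) (h' : deltaLE y z) : deltaLE x z := by
  rcases h with rfl | h
  · exact h'
  rcases h' with rfl | h'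
  · exact Or.inr h
  right
  rw [List.shortlex_def] at *
  rcases h with h | ⟨h, h1⟩ <;> rcases h' with h' | ⟨h', h1'⟩
  · left; omega
  · left; omega
  · left; omega
  · right
    refine ⟨h.trans h', List.lex_trans ?_ h1 h1'⟩
    intro a b c hab hbc
    rw [Sym.lt_iff] at *
    omega

/-! ### Words with small integers -/

/-- All symbols of `x θ₁ α₁ ⋯ θₖ αₖ` but the last. -/
def initSyms : ℤ → List (Stable × ℤ) → List Sym
  | _, [] => []
  | x, (θ, y) :: l => .int x :: .stable θ :: initSyms y l

/-- All integers but the last one fit. -/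
def AllFit (p q : ℕ) : ℤ → List (Stable × ℤ) → Prop
  | _, [] => True
  | x, (θ, y) :: l => Fits p q θ x ∧ AllFit p q y l

theorem length_initSyms (x : ℤ) (l : List (Stable × ℤ)) :
    (initSyms x l).length = 2 * l.length := by
  induction l generalizing x with
  | nil => rfl
  | cons y l ih => simp [initSyms, ih]; omega

theorem exists_improvement {r : ℕ} (hp : 1 ≤ p) (hpq : p ≤ q) (hq : q = p * r)
    (l : List (Stable × ℤ)) (x : ℤ) (hl : ∀ l', l' <:+ l → 0 ≤ rise l') (hf : ¬ AllFit p q x l) :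
    ∃ x' l', l'.map Prod.fst = l.map Prod.fst ∧
      genA p q ^ x' * tailVal p q l' = genA p q ^ x * tailVal p q l ∧
      (lnf p q x').length + tailCost p q l' ≤ (lnf p q x).length + tailCost p q l ∧
      List.Lex Sym.lt (initSyms x' l') (initSyms x l) := by
  induction l generalizing x with
  | nil => simp [AllFit] at hf
  | cons y l ih =>
    obtain ⟨θ, y⟩ := y
    rcases fits_or_exists hp hpq hq θ x with h | ⟨z, m, e, h1, h2⟩
    · have hf' : ¬ AllFit p q y l := fun h' => hf ⟨h, h'⟩
      obtain ⟨y', l', a1, a2, a3, a4⟩ := ih y (fun l' h' => hl l' (h'.trans (List.suffix_cons _ _))) hf'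
      refine ⟨x, (θ, y') :: l', by simp [a1], ?_, ?_, ?_⟩
      · rw [tailVal_cons, tailVal_cons]
        simp only [mul_assoc, a2]
      · simp only [tailCost, List.map_cons, List.sum_cons] at *
        omega
      · exact List.Lex.cons (List.Lex.cons a4)
    · have h0 := hl _ List.suffix_rfl
      have h0' := hl l (List.suffix_cons _ _)
      obtain ⟨d, hd⟩ : ∃ d : ℕ, genA p q ^ (θ.outer p q * m) * tailVal p q ((θ, y) :: l) =
          tailVal p q (shiftRight p m d ((θ, y) :: l)) := by
        cases θ with
        | t =>
          refine ⟨1, ?_⟩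
          rw [← tailVal_shiftRight hq m 0 _ (by simp [rise, Stable.sign] at *; linarith)]
          congr 2
          simp [Stable.outer, hq]; ring
        | T =>
          refine ⟨0, ?_⟩
          rw [← tailVal_shiftRight_T hq m 0 y l]
          · congr 2
            simp [Stable.outer]
          · apply tailVal_shiftRight hq
            simp [rise, Stable.sign] at *
            linarith
      refine ⟨z, shiftRight p m d ((θ, y) :: l), map_fst_shiftRight .., ?_, ?_, ?_⟩
      · rw [← hd, e, zpow_add]
        exact (mul_assoc (G := BSGroup p q) _ _ _).symm
      · have := tailCost_shiftRight (p := p) (q := q) m d ((θ, y) :: l)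
        omega
      · have h3 := map_fst_shiftRight (p := p) m d ((θ, y) :: l)
        generalize shiftRight p m d ((θ, y) :: l) = k at *
        cases k with
        | nil => simp at h3
        | cons w k =>
          obtain ⟨w1, w2⟩ := w
          exact List.Lex.rel (Or.inl h1)

theorem reduced_of_val_eq (hp : 1 ≤ p) (hpq : p ≤ q) {u u' : Word} (hu : u.Reduced p q)
    (hv : u'.val p q = u.val p q) (hl : u'.len = u.len) : u'.Reduced p q := by
  have hq : 1 ≤ q := hp.trans hpq
  rw [reduced_iff_length_toNF] at *
  rw [← nf_val hp hq, hv, nf_val, hu, hl]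

theorem exists_allFit {r : ℕ} (hp : 1 ≤ p) (hpq : p ≤ q) (hq : q = p * r) (u : Word)
    (hu : u.Reduced p q) (hl : ∀ l', l' <:+ u.tail → 0 ≤ rise l') :
    ∃ u' : Word, u'.Reduced p q ∧ u'.val p q = u.val p q ∧ u'.norm p q ≤ u.norm p q ∧
      AllFit p q u'.head u'.tail ∧
      deltaLE (initSyms u'.head u'.tail) (initSyms u.head u.tail) := by
  have wf : WellFounded fun u v : Word => List.Shortlex Sym.lt (initSyms u.head u.tail)
    (initSyms v.head v.tail) := InvImage.wf (fun u : Word => initSyms u.head u.tail) (List.Shortlex.wf Sym.wf_lt)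
  induction u using wf.induction with
  | h u ih =>
    obtain ⟨x, l⟩ := u
    by_cases hf : AllFit p q x l
    · exact ⟨⟨x, l⟩, hu, rfl, le_rfl, hf, Or.inl rfl⟩
    obtain ⟨x', l', a1, a2, a3, a4⟩ := exists_improvement hp hpq hq l x hl hf
    have hlen : l'.length = l.length := by simpa using congrArg List.length a1
    have hs : List.Shortlex Sym.lt (initSyms x' l') (initSyms x l) := by
      refine List.Shortlex.of_lex ?_ a4
      rw [length_initSyms, length_initSyms, hlen]
    have hrise : ∀ l'', l'' <:+ l' → 0 ≤ rise l'' := by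
      intro l'' h
      have h1 := h.map Prod.fst
      rw [a1] at h1
      obtain ⟨k, hk⟩ := h1
      have h2 := List.map_eq_append_iff.1 hk.symm
      obtain ⟨k1, k2, e1, e2, e3⟩ := h2
      have h3 := hl k2 ⟨k1, e1.symm⟩
      unfold rise at *
      have e4 : (l''.map fun x => x.1.sign) = (k2.map fun x => x.1.sign) := by
        have := congrArg (List.map Stable.sign) e3
        rw [List.map_map, List.map_map] at this
        exact this.symm
      rwa [e4]
    obtain ⟨u', b1, b2, b3, b4, b5⟩ := ih ⟨x', l'⟩ hs
      (reduced_of_val_eq hp hpq hu a2 (by simpa [Word.len] using hlen)) hrise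
    refine ⟨u', b1, b2.trans a2, b3.trans ?_, b4, deltaLE_trans b5 (Or.inr hs)⟩
    rw [norm_mk hp hpq, norm_mk hp hpq]
    exact a3

end BaumslagSolitar

namespace BaumslagSolitar

variable {p q : ℕ}

/-! ### Words as reversed lists -/

/-- The word with the factors `αᵢ θᵢ₊₁` in reverse order and the last integer `c`. -/
def NF.word : List (ℤ × Stable) → ℤ → Word
  | [], c => ⟨c, []⟩
  | (x, θ) :: l, c => ⟨(NF.word l x).head, (NF.word l x).tail ++ [(θ, c)]⟩

theorem NF.val_word (l : List (ℤ × Stable)) (c : ℤ) :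
    (NF.word l c).val p q = NF.eval p q (l, c) := by
  induction l generalizing c with
  | nil => simp [NF.word, Word.val, NF.eval_nil]
  | cons b l ih =>
    obtain ⟨x, θ⟩ := b
    rw [NF.eval_cons, ← ih x]
    simp [NF.word, Word.val, mul_assoc]

theorem NF.len_word (l : List (ℤ × Stable)) (c : ℤ) : (NF.word l c).len = l.length := by
  induction l generalizing c with
  | nil => rfl
  | cons b l ih =>
    have := ih b.1
    simp only [Word.len] at this
    simp [NF.word, Word.len, this]

theorem NF.norm_word (hp : 1 ≤ p) (hpq : p ≤ q) (l : List (ℤ × Stable)) (c : ℤ) :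
    (NF.word l c).norm p q =
      (l.map fun x => (lnf p q x.1).length + 1).sum + (lnf p q c).length := by
  induction l generalizing c with
  | nil => simp [NF.word, norm_mk hp hpq, tailCost]
  | cons b l ih =>
    have := ih b.1
    rw [norm_mk hp hpq] at this
    rw [NF.word, norm_mk hp hpq]
    simp only [tailCost, List.map_append, List.sum_append, List.map_cons, List.sum_cons,
      List.map_nil, List.sum_nil] at *
    omega

theorem NF.expand_word (l : List (ℤ × Stable)) (c : ℤ) :
    (NF.word l c).expand p q =
      (l.reverse.flatMap fun x => lnf p q x.1 ++ [x.2.letter]) ++ lnf p q c := by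
  induction l generalizing c with
  | nil => simp [NF.word, Word.expand]
  | cons b l ih =>
    have := ih b.1
    simp only [Word.expand] at this
    simp only [NF.word, Word.expand, List.flatMap_append, List.reverse_cons]
    rw [← List.append_assoc, this]
    simp

theorem initSyms_append (h : ℤ) (l : List (Stable × ℤ)) (θ' : Stable) (x : ℤ) (θ : Stable)
    (c : ℤ) : initSyms h (l ++ [(θ', x)] ++ [(θ, c)]) =
      initSyms h (l ++ [(θ', x)]) ++ [.int x, .stable θ] := by
  induction l generalizing h with
  | nil => rfl
  | cons y l ih =>
    have := ih y.2
    simp only [List.append_assoc, List.cons_append, List.nil_append, initSyms] at *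
    rw [this]

theorem NF.initSyms_word (x : ℤ) (θ : Stable) (l : List (ℤ × Stable)) (c : ℤ) :
    initSyms (NF.word ((x, θ) :: l) c).head (NF.word ((x, θ) :: l) c).tail =
      initSyms (NF.word l x).head (NF.word l x).tail ++ [.int x, .stable θ] := by
  cases l with
  | nil => rfl
  | cons b l =>
    simp only [NF.word]
    exact initSyms_append _ _ _ _ _ _

theorem allFit_append (h : ℤ) (l : List (Stable × ℤ)) (θ' : Stable) (x : ℤ) (θ : Stable)
    (c : ℤ) : AllFit p q h (l ++ [(θ', x)] ++ [(θ, c)]) ↔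
      AllFit p q h (l ++ [(θ', x)]) ∧ Fits p q θ x := by
  induction l generalizing h with
  | nil => simp [AllFit]
  | cons y l ih =>
    have := ih y.2
    simp only [List.append_assoc, List.cons_append, List.nil_append, AllFit] at *
    rw [this, and_assoc]

theorem NF.allFit_word (l : List (ℤ × Stable)) (c : ℤ) :
    AllFit p q (NF.word l c).head (NF.word l c).tail ↔ ∀ b ∈ l, Fits p q b.2 b.1 := by
  induction l generalizing c with
  | nil => simp [NF.word, AllFit]
  | cons b l ih =>
    have h := ih b.1
    rw [List.forall_mem_cons, ← h, and_comm]
    obtain ⟨x, θ⟩ := b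
    cases l with
    | nil => simp [NF.word, AllFit]
    | cons b l =>
      simp only [NF.word]
      exact allFit_append _ _ _ _ _ _

/-! ### Runs -/

/-- `ZRun p q bs xs σ`: the integers of the normal form `bs` can be replaced by `xs`, and then a
power of `a` is left over. It is described by one integer for each level of the current position,
which counts the part that was collected on that level. All lists are in reverse order. -/
inductive ZRun (p q : ℕ) : List (ℤ × Stable) → List ℤ → List ℤ → Prop
  | nil : ZRun p q [] [] [0]
  | down {bs : List (ℤ × Stable)} {xs ρ : List ℤ} {z : ℤ} (h : ZRun p q bs xs (z :: ρ))
      (b x z' : ℤ) (e : x - b + p * z = p * z') :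
      ZRun p q ((b, .T) :: bs) (x :: xs) (0 :: z' :: ρ)
  | up {bs : List (ℤ × Stable)} {xs ρ : List ℤ} {z y : ℤ} (h : ZRun p q bs xs (z :: y :: ρ))
      (b x c : ℤ) (e : x - b + p * z = q * c) :
      ZRun p q ((b, .t) :: bs) (x :: xs) ((y + c) :: ρ)

/-- The left over exponent, divided by `p`. -/
def total (r : ℕ) : List ℤ → ℤ
  | [] => 0
  | z :: ρ => z + r * total r ρ

/-- Replacement of the integers. -/
def setInts (xs : List ℤ) (bs : List (ℤ × Stable)) : List (ℤ × Stable) :=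
  List.zipWith (fun x b => (x, b.2)) xs bs

@[simp] theorem setInts_cons (x : ℤ) (xs : List ℤ) (b : ℤ × Stable) (bs : List (ℤ × Stable)) :
    setInts (x :: xs) (b :: bs) = (x, b.2) :: setInts xs bs := rfl

@[simp] theorem setInts_nil (bs : List (ℤ × Stable)) : setInts [] bs = [] := by simp [setInts]

theorem ZRun.length_eq {bs : List (ℤ × Stable)} {xs σ : List ℤ} (h : ZRun p q bs xs σ) :
    xs.length = bs.length := by
  induction h <;> simp_all

theorem ZRun.ne_nil {bs : List (ℤ × Stable)} {xs σ : List ℤ} (h : ZRun p q bs xs σ) : σ ≠ [] := by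
  cases h <;> simp

theorem map_snd_setInts {bs : List (ℤ × Stable)} {xs : List ℤ} (h : xs.length = bs.length) :
    (setInts xs bs).map Prod.snd = bs.map Prod.snd := by
  induction xs generalizing bs with
  | nil =>
    have := List.length_eq_zero_iff.1 h.symm
    simp [this]
  | cons x xs ih =>
    cases bs with
    | nil => simp at h
    | cons b bs => simp [ih (by simpa using h)]

theorem length_setInts {bs : List (ℤ × Stable)} {xs : List ℤ} (h : xs.length = bs.length) :
    (setInts xs bs).length = bs.length := by
  simpa using congrArg List.length (map_snd_setInts h)

theorem eval_mul_outer (bs : List (ℤ × Stable)) (θ : Stable) (b m c d : ℤ) (hd : d = b + θ.outer p q * m) :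
    NF.eval p q (bs, d) * θ.val p q * genA p q ^ c =
      NF.eval p q ((b, θ) :: bs, c + θ.inner p q * m) := by
  rw [NF.eval_cons, hd, NF.eval_add]
  have := genA_zpow_mul_val p q θ m
  calc _ = NF.eval p q (bs, b) * (genA p q ^ (θ.outer p q * m) * θ.val p q) * genA p q ^ c := by
        group
    _ = _ := by rw [this, add_comm c, zpow_add]; group

theorem ZRun.eval_eq {r : ℕ} (hq : q = p * r) {bs : List (ℤ × Stable)} {xs σ : List ℤ}
    (h : ZRun p q bs xs σ) (c : ℤ) :
    NF.eval p q (setInts xs bs, c) = NF.eval p q (bs, c + p * total r σ) := by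
  induction h generalizing c with
  | nil => simp [total]
  | @down bs xs ρ z h b x z' e ih =>
    rw [setInts_cons, NF.eval_cons, ih, eval_mul_outer bs .T b (z' + r * total r ρ)]
    · congr 2
      simp only [Stable.inner, total, hq]; push_cast; ring
    · simp only [Stable.outer, total]; linarith
  | @up bs xs ρ z y h b x d e ih =>
    rw [setInts_cons, NF.eval_cons, ih, eval_mul_outer bs .t b (d + y + r * total r ρ)]
    · congr 2
      simp only [Stable.inner, total]; ring
    · simp only [Stable.outer, total, hq] at *; push_cast at *; linarith

theorem ZRun.of_reduced {r : ℕ} (hq : q = p * r) (u : Word)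
    (hu : u.Reduced p q) (hl : ∀ l', l' <+: u.tail → rise l' ≤ 0) :
    ∃ xs σ c, ZRun p q (u.toNF p q).1 xs σ ∧ u = NF.word (setInts xs (u.toNF p q).1) c ∧
      (u.toNF p q).2 = c + p * total r σ ∧ (σ.length : ℤ) = 1 - rise u.tail := by
  obtain ⟨h, l⟩ := u
  induction l using List.reverseRecOn with
  | nil => exact ⟨[], [0], h, by simpa [Word.toNF] using ZRun.nil, rfl, by simp [Word.toNF, total],
      by simp [rise]⟩
  | append_singleton l x ih =>
    obtain ⟨θ, x⟩ := x
    obtain ⟨-, -, e⟩ := toNF_head_of_length_eq h l θ x (by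
      have := (reduced_iff_length_toNF _).1 hu
      simpa [Word.len] using this)
    obtain ⟨xs, σ, c, h1, h2, h3, h4⟩ := ih ((reduced_concat h l θ x).1 hu).1
      (fun l' h' => hl l' (h'.trans (List.prefix_append _ _)))
    rw [e]
    simp only at h4
    have h5 := hl _ List.prefix_rfl
    have hr : rise (l ++ [(θ, x)]) = rise l + θ.sign := by simp [rise]
    simp only [hr] at *
    set S := (Word.mk h l).toNF p q
    have h6 := Int.emod_add_mul_ediv S.2 (θ.outer p q)
    set b := S.2 % θ.outer p q
    set m := S.2 / θ.outer p q
    have hw : Word.mk h (l ++ [(θ, x)]) = NF.word ((c, θ) :: setInts xs S.1) x := by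
      rw [NF.word, ← h2]
    cases θ with
    | T =>
      match σ, h4 with
      | z :: ρ, h4 =>
        refine ⟨c :: xs, 0 :: (m - r * total r ρ) :: ρ, x, ?_, hw, ?_, ?_⟩
        · refine ZRun.down h1 b c _ ?_
          simp only [Stable.outer, total] at *
          linarith
        · simp only [Stable.inner, total, hq]; push_cast; ring
        · simp [Stable.sign] at *; linarith
      | [], h4 => exact absurd rfl h1.ne_nil
    | t =>
      match σ, h4 with
      | z :: y :: ρ, h4 =>
        refine ⟨c :: xs, (y + (m - y - r * total r ρ)) :: ρ, x, ?_, hw, ?_, ?_⟩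
        · refine ZRun.up h1 b c _ ?_
          simp only [Stable.outer, total, hq] at *
          push_cast at *
          linarith
        · simp only [Stable.inner, total]; ring
        · simp [Stable.sign] at *; linarith
      | [z], h4 =>
        simp [Stable.sign] at *; linarith
      | [], h4 =>
        simp [Stable.sign] at *; linarith

/-! ### Valleys -/

/-- The height of the end of the stack of a normal form. -/
def stackRise (l : List (ℤ × Stable)) : ℤ := (l.map fun x => x.2.sign).sum

theorem stackRise_step (θ : Stable) (S : NF) :
    stackRise (NF.step p q θ S).1 = stackRise S.1 + θ.sign := by
  match S with
  | ([], c) => simp [NF.step, NF.push, stackRise]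
  | ((b, θ') :: l, c) =>
    rw [NF.step]
    split_ifs with h
    · rw [Stable.eq_inv_of_ne h.1]
      cases θ <;> simp [stackRise, Stable.sign, Stable.inv]
    · simp [NF.push, stackRise, add_comm]

theorem stackRise_toNF (u : Word) : stackRise (u.toNF p q).1 = rise u.tail := by
  obtain ⟨h, l⟩ := u
  induction l using List.reverseRecOn with
  | nil => rfl
  | append_singleton l x ih =>
    obtain ⟨θ, x⟩ := x
    rw [toNF_concat]
    simp only at ih ⊢
    rw [stackRise_step, ih]
    simp [rise]

theorem stack_suffix_step (θ : Stable) (S : NF) {k : List (ℤ × Stable)}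
    (h : k <:+ (NF.step p q θ S).1) : k = (NF.step p q θ S).1 ∨ k <:+ S.1 := by
  match S with
  | ([], c) =>
    rcases List.suffix_cons_iff.1 h with h | h
    · exact Or.inl h
    · exact Or.inr h
  | ((b, θ') :: l, c) =>
    rw [NF.step] at *
    split_ifs at * with h1
    · exact Or.inr (h.trans (List.suffix_cons _ _))
    · rcases List.suffix_cons_iff.1 h with h | h
      · exact Or.inl h
      · exact Or.inr h

theorem stackRise_suffix_nonpos (u : Word) (hl : ∀ l', l' <+: u.tail → rise l' ≤ 0)
    {k : List (ℤ × Stable)} (hk : k <:+ (u.toNF p q).1) : stackRise k ≤ 0 := by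
  obtain ⟨h, l⟩ := u
  induction l using List.reverseRecOn with
  | nil =>
    have : k = [] := List.suffix_nil.1 hk
    simp [this, stackRise]
  | append_singleton l x ih =>
    obtain ⟨θ, x⟩ := x
    have e := toNF_concat (p := p) (q := q) h l θ x
    rw [e] at hk
    rcases stack_suffix_step θ _ hk with h1 | h1
    · have : stackRise k = stackRise ((Word.mk h (l ++ [(θ, x)])).toNF p q).1 := by rw [e, h1]
      rw [this, stackRise_toNF]
      exact hl _ List.prefix_rfl
    · exact ih (fun l' h' => hl l' (h'.trans (List.prefix_append _ _))) h1

/-- The stacks of the normal forms of valleys. -/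
def ValleyStack (l : List (ℤ × Stable)) : Prop :=
  stackRise l = 0 ∧ ∀ k, k <:+ l → stackRise k ≤ 0

theorem heightAt_le_height (u : Word) (i : ℕ) (hi : i ≤ u.len) : u.heightAt i ≤ u.height :=
  Finset.le_sup' u.heightAt (by simpa [Nat.lt_succ_iff] using hi)

theorem valleyStack_toNF (hp : 1 ≤ p) (hpq : p ≤ q) {v : Word} (hv : v.IsValley p q) :
    ValleyStack (v.toNF p q).1 := by
  obtain ⟨u, h1, h2, h3⟩ := hv
  have hq : 1 ≤ q := hp.trans hpq
  rw [← nf_val hp hq, ← h1, nf_val]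
  refine ⟨?_, fun k hk => stackRise_suffix_nonpos u ?_ hk⟩
  · rw [stackRise_toNF]
    simpa [Word.heightAt, Word.len, rise] using h3
  · intro l' hl'
    have := heightAt_le_height u l'.length hl'.length_le
    rw [h2, Word.heightAt, ← List.prefix_iff_eq_take.1 hl'] at this
    exact this

theorem rise_prefix_nonpos {u : Word} {k : List (ℤ × Stable)} (hk : ValleyStack k)
    (h : u.tail.map Prod.fst = (k.map Prod.snd).reverse) {l : List (Stable × ℤ)}
    (hl : l <+: u.tail) : rise l ≤ 0 := by
  have h1 := hl.map Prod.fst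
  rw [h] at h1
  have h2 : (l.map Prod.fst).reverse <:+ k.map Prod.snd := by
    rw [← List.reverse_reverse (k.map Prod.snd)]; exact List.reverse_suffix.2 h1
  obtain ⟨k1, hk1⟩ := h2
  obtain ⟨k2, k3, e1, e2, e3⟩ := List.map_eq_append_iff.1 hk1.symm
  have h3 := hk.2 k3 ⟨k2, e1.symm⟩
  have h4 : rise l = stackRise k3 := by
    have : stackRise k3 = ((k3.map Prod.snd).map Stable.sign).sum := by
      simp [stackRise, Function.comp_def]
    rw [this, e3, List.map_reverse, List.sum_reverse]
    simp [rise, Function.comp_def]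
  rw [h4]; exact h3

theorem rise_tail_eq_zero {u : Word} {k : List (ℤ × Stable)} (hk : ValleyStack k)
    (h : u.tail.map Prod.fst = (k.map Prod.snd).reverse) : rise u.tail = 0 := by
  have h1 : rise u.tail = ((u.tail.map Prod.fst).map Stable.sign).sum := by
    simp [rise, Function.comp_def]
  rw [h1, h, List.map_reverse, List.sum_reverse, ← hk.1]
  simp [stackRise, Function.comp_def]

theorem rise_suffix_nonneg {u : Word} {k : List (ℤ × Stable)} (hk : ValleyStack k)
    (h : u.tail.map Prod.fst = (k.map Prod.snd).reverse) {l : List (Stable × ℤ)}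
    (hl : l <:+ u.tail) : 0 ≤ rise l := by
  obtain ⟨l', e⟩ := hl
  have h1 := rise_prefix_nonpos hk h ⟨l, e⟩
  have h2 := rise_tail_eq_zero hk h
  rw [← e] at h2
  simp [rise] at *
  linarith

theorem peak_eq_len {u : Word} {k : List (ℤ × Stable)} (hk : ValleyStack k)
    (h : u.tail.map Prod.fst = (k.map Prod.snd).reverse) : u.peak = u.len := by
  have h0 : u.heightAt u.len = 0 := by
    have := rise_tail_eq_zero hk h
    simpa [Word.heightAt, Word.len, rise] using this
  have h1 : u.height = 0 := by
    apply le_antisymm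
    · refine Finset.sup'_le _ _ fun i _ => ?_
      exact rise_prefix_nonpos hk h (List.take_prefix _ _)
    · rw [← h0]; exact heightAt_le_height u _ le_rfl
  rw [Word.peak, Nat.findGreatest_eq_iff]
  refine ⟨le_rfl, fun _ => by rw [h0, h1], fun n h2 h3 => by omega⟩

theorem take_symbols (h : ℤ) (l : List (Stable × ℤ)) :
    (Word.mk h l).symbols.take (2 * l.length) = initSyms h l := by
  induction l generalizing h with
  | nil => rfl
  | cons y l ih =>
    have := ih y.2
    simp only [Word.symbols, initSyms] at *
    rw [← this, List.length_cons, mul_add]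
    rfl

theorem left_eq {u : Word} {k : List (ℤ × Stable)} (hk : ValleyStack k)
    (h : u.tail.map Prod.fst = (k.map Prod.snd).reverse) :
    u.left = initSyms u.head u.tail := by
  rw [Word.left, peak_eq_len hk h]
  exact take_symbols u.head u.tail

theorem rightBar_eq {u : Word} {k : List (ℤ × Stable)} (hk : ValleyStack k)
    (h : u.tail.map Prod.fst = (k.map Prod.snd).reverse) : u.rightBar = [] := by
  have h1 : u.right = [] := by
    rw [Word.right, peak_eq_len hk h, List.drop_eq_nil_iff]
    obtain ⟨h, l⟩ := u
    simp only [Word.symbols, Word.len, List.length_cons, List.length_flatMap]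
    simp
    omega
  rw [Word.rightBar, h1]; rfl

/-! ### Keys -/

/-- The sum of the absolute values. -/
def absSum (xs : List ℤ) : ℕ := (xs.map Int.natAbs).sum

/-- The number with base `D` digits `digit x`. -/
def digits (D : ℕ) : List ℤ → ℕ
  | [] => 0
  | x :: xs => digits D xs * D + digit x

theorem digit_lt {q : ℕ} {x : ℤ} (h : |x| < q) : digit x < 2 * q := by
  rw [Int.abs_eq_natAbs] at h
  unfold digit
  split_ifs <;> omega

theorem digits_lt {q : ℕ} {xs : List ℤ} (h : ∀ x ∈ xs, |x| < q) :
    digits (2 * q) xs < (2 * q) ^ xs.length := by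
  induction xs with
  | nil => simp [digits]
  | cons x xs ih =>
    have h1 := ih fun y hy => h y (List.mem_cons_of_mem _ hy)
    have h2 := digit_lt (h x List.mem_cons_self)
    rw [digits, List.length_cons, pow_succ]
    nlinarith

theorem lex_append {α : Type*} {R : α → α → Prop} {s₁ s₂ : List α} (h : List.Lex R s₁ s₂)
    (hl : s₁.length = s₂.length) (t₁ t₂ : List α) : List.Lex R (s₁ ++ t₁) (s₂ ++ t₂) := by
  induction h with
  | nil => simp at hl
  | cons _ ih => exact List.Lex.cons (ih (by simpa using hl))
  | rel h => exact List.Lex.rel h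

theorem digits_inj {q : ℕ} {xs ys : List ℤ} (hl : xs.length = ys.length)
    (hx : ∀ x ∈ xs, |x| < q) (hy : ∀ x ∈ ys, |x| < q)
    (h : digits (2 * q) xs = digits (2 * q) ys) : xs = ys := by
  induction xs generalizing ys with
  | nil => exact (List.length_eq_zero_iff.1 hl.symm).symm
  | cons x xs ih =>
    cases ys with
    | nil => simp at hl
    | cons y ys =>
      rw [List.forall_mem_cons] at hx hy
      have h1 := digit_lt hx.1
      have h2 := digit_lt hy.1
      simp only [digits] at h
      have e1 : digit x = digit y := by
        have := congrArg (· % (2 * q)) h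
        simpa [Nat.mul_add_mod, Nat.add_mod, Nat.mod_eq_of_lt h1, Nat.mod_eq_of_lt h2] using this
      have e2 : digits (2 * q) xs = digits (2 * q) ys := by
        rw [e1] at h
        exact Nat.eq_of_mul_eq_mul_right (by omega) (Nat.add_right_cancel h)
      rw [digit_injective e1, ih (by simpa using hl) hx.2 hy.2 e2]

theorem deltaLE_of_digits_le {q : ℕ} {xs ys : List ℤ} {bs : List (ℤ × Stable)}
    (hxl : xs.length = bs.length) (hyl : ys.length = bs.length)
    (hx : ∀ x ∈ xs, |x| < q) (hy : ∀ x ∈ ys, |x| < q)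
    (h : digits (2 * q) xs ≤ digits (2 * q) ys) (c d : ℤ) :
    deltaLE (initSyms (NF.word (setInts xs bs) c).head (NF.word (setInts xs bs) c).tail)
      (initSyms (NF.word (setInts ys bs) d).head (NF.word (setInts ys bs) d).tail) := by
  have hlen : ∀ (xs : List ℤ) (bs : List (ℤ × Stable)) (c : ℤ), xs.length = bs.length →
      (initSyms (NF.word (setInts xs bs) c).head (NF.word (setInts xs bs) c).tail).length =
        2 * bs.length := by
    intro xs bs c h
    rw [length_initSyms]
    have := NF.len_word (setInts xs bs) c
    rw [length_setInts h] at this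
    rw [← this]; rfl
  have key : digits (2 * q) xs < digits (2 * q) ys → List.Lex Sym.lt
      (initSyms (NF.word (setInts xs bs) c).head (NF.word (setInts xs bs) c).tail)
      (initSyms (NF.word (setInts ys bs) d).head (NF.word (setInts ys bs) d).tail) := by
    clear h
    intro h
    induction bs generalizing xs ys c d with
    | nil =>
      rw [List.length_eq_zero_iff.1 hxl, List.length_eq_zero_iff.1 hyl] at h
      simp at h
    | cons b bs ih =>
      match xs, ys, hxl, hyl with
      | x :: xs, y :: ys, hxl, hyl =>
        rw [List.forall_mem_cons] at hx hy
        simp only [List.length_cons, add_left_inj] at hxl hyl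
        rw [setInts_cons, setInts_cons, NF.initSyms_word, NF.initSyms_word]
        have h1 := digit_lt hx.1
        have h2 := digit_lt hy.1
        simp only [digits] at h
        rcases lt_trichotomy (digits (2 * q) xs) (digits (2 * q) ys) with h3 | h3 | h3
        · refine lex_append (ih hxl hyl hx.2 hy.2 x y h3) ?_ _ _
          rw [hlen _ _ _ hxl, hlen _ _ _ hyl]
        · have e := digits_inj (hxl.trans hyl.symm) hx.2 hy.2 h3
          subst e
          have h4 : digit x < digit y := by omega
          have h5 : initSyms (NF.word (setInts xs bs) x).head (NF.word (setInts xs bs) x).tail =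
              initSyms (NF.word (setInts xs bs) y).head (NF.word (setInts xs bs) y).tail := by
            cases setInts xs bs with
            | nil => rfl
            | cons a l => obtain ⟨a1, a2⟩ := a; rw [NF.initSyms_word, NF.initSyms_word]
          rw [h5]
          refine List.Lex.append_left _ (List.Lex.rel ?_) _
          exact (digit_lt_iff x y).1 h4
        · exfalso
          nlinarith
  rcases h.lt_or_eq with h | h
  · right
    exact List.Shortlex.of_lex (by rw [hlen _ _ _ hxl, hlen _ _ _ hyl]) (key h)
  · left
    have e := digits_inj (hxl.trans hyl.symm) hx hy h
    subst e
    cases setInts xs bs with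
    | nil => rfl
    | cons a l => obtain ⟨a1, a2⟩ := a; rw [NF.initSyms_word, NF.initSyms_word]

/-- The quantity that is minimised. -/
def key (q : ℕ) (n : ℕ) (xs : List ℤ) : ℕ :=
  absSum xs * (2 * q) ^ n + digits (2 * q) xs * (2 * q) ^ (n - xs.length)

theorem norm_word_setInts_le (hp : 1 ≤ p) (hpq : p ≤ q) {xs : List ℤ} {bs : List (ℤ × Stable)}
    (hl : xs.length = bs.length) (c : ℤ) :
    (NF.word (setInts xs bs) c).norm p q ≤ absSum xs + bs.length + (lnf p q c).length := by
  rw [NF.norm_word hp hpq]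
  refine Nat.add_le_add_right ?_ _
  induction xs generalizing bs with
  | nil => simp
  | cons x xs ih =>
    cases bs with
    | nil => simp at hl
    | cons b bs =>
      have h1 := ih (bs := bs) (by simpa using hl)
      have h2 := length_lnf_le_natAbs p q x
      simp only [setInts_cons, absSum, List.map_cons, List.sum_cons, List.length_cons] at *
      omega

theorem norm_word_setInts_eq (hp : 1 ≤ p) (hpq : p ≤ q) {xs : List ℤ} {bs : List (ℤ × Stable)}
    (hl : xs.length = bs.length) (c : ℤ) (h : ∀ b ∈ setInts xs bs, Fits p q b.2 b.1) :
    (NF.word (setInts xs bs) c).norm p q = absSum xs + bs.length + (lnf p q c).length := by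
  rw [NF.norm_word hp hpq]
  refine congrArg (· + _) ?_
  induction xs generalizing bs with
  | nil =>
    have := List.length_eq_zero_iff.1 hl.symm
    simp [this, absSum]
  | cons x xs ih =>
    cases bs with
    | nil => simp at hl
    | cons b bs =>
      rw [setInts_cons, List.forall_mem_cons] at h
      have h1 := ih (bs := bs) (by simpa using hl) h.2
      have h2 := h.1.2
      rw [Int.abs_eq_natAbs] at h2
      simp only [setInts_cons, absSum, List.map_cons, List.sum_cons, List.length_cons] at *
      omega

theorem isBrittonPNF_of_min {r : ℕ} (hp : 1 ≤ p) (hpq : p ≤ q) (hq : q = p * r) {v : Word}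
    (hv : v.IsValley p q) {bs : List (ℤ × Stable)} {cur : ℤ} (hbs : v.toNF p q = (bs, cur))
    {xs : List ℤ} {z : ℤ} (hrun : ZRun p q bs xs [z]) (hx : ∀ x ∈ xs, |x| < q)
    (hmin : ∀ ys y, ZRun p q bs ys [y] → (∀ x ∈ ys, |x| < q) →
      key q bs.length xs + (lnf p q (cur - p * z)).length * (2 * q) ^ bs.length ≤
      key q bs.length ys + (lnf p q (cur - p * y)).length * (2 * q) ^ bs.length) :
    v.IsBrittonPNF p q (NF.word (setInts xs bs) (cur - p * z)) := by
  have hq1 : 1 ≤ q := hp.trans hpq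
  have hk : ValleyStack bs := by have := valleyStack_toNF hp hpq hv; rwa [hbs] at this
  have hnf : ∀ u : Word, u.val p q = v.val p q → u.toNF p q = (bs, cur) := by
    intro u h
    rw [← nf_val hp hq1, h, nf_val, hbs]
  have hth : ∀ u : Word, u.Reduced p q → u.val p q = v.val p q →
      u.tail.map Prod.fst = (bs.map Prod.snd).reverse := by
    intro u h1 h2
    have := thetas_toNF u h1
    rw [hnf u h2] at this
    rw [this, List.reverse_reverse]
  have hxl := hrun.length_eq
  set u := NF.word (setInts xs bs) (cur - p * z) with hu
  have hval : u.val p q = v.val p q := by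
    rw [hu, NF.val_word, hrun.eval_eq hq, ← toNF_eval, hbs]
    simp [total]
  have hred : u.Reduced p q := by
    rw [reduced_iff_length_toNF, hnf u hval, hu, NF.len_word, length_setInts hxl]
  have main : ∀ u' : Word, u'.Reduced p q → u'.val p q = v.val p q →
      u.norm p q ≤ u'.norm p q ∧
        (u'.norm p q ≤ u.norm p q → deltaLE (initSyms u.head u.tail)
          (initSyms u'.head u'.tail)) := by
    intro u' h1 h2
    obtain ⟨w, w1, w2, w3, w4, w5⟩ := exists_allFit hp hpq hq u' h1
      fun l' h' => rise_suffix_nonneg hk (hth u' h1 h2) h'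
    have w2' := w2.trans h2
    obtain ⟨ys, σ, c, y1, y2, y3, y4⟩ := ZRun.of_reduced hq w w1
      fun l' h' => rise_prefix_nonpos hk (hth w w1 w2') h'
    rw [hnf w w2'] at y1 y2 y3
    simp only at y1 y2 y3
    rw [rise_tail_eq_zero hk (hth w w1 w2')] at y4
    obtain ⟨y, rfl⟩ : ∃ y, σ = [y] := List.length_eq_one_iff.1 (by omega)
    have hyl := y1.length_eq
    simp only [total, mul_zero, add_zero] at y3
    have hfit : ∀ b ∈ setInts ys bs, Fits p q b.2 b.1 := by
      rw [← NF.allFit_word _ c, ← y2]; exact w4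
    have hys : ∀ x ∈ ys, |x| < q := by
      intro x hx
      have : ∀ (ys : List ℤ) (bs : List (ℤ × Stable)), ys.length = bs.length → x ∈ ys →
          ∃ θ, (x, θ) ∈ setInts ys bs := by
        intro ys
        induction ys with
        | nil => simp
        | cons y ys ih =>
          intro bs h h'
          cases bs with
          | nil => simp at h
          | cons b bs =>
            rcases List.mem_cons.1 h' with rfl | h'
            · exact ⟨b.2, by simp⟩
            · obtain ⟨θ, hθ⟩ := ih bs (by simpa using h) h'
              exact ⟨θ, by simp [hθ]⟩
      obtain ⟨θ, hθ⟩ := this ys bs hyl hx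
      have := (hfit _ hθ).1
      refine this.trans_le ?_
      cases θ <;> simp [Stable.outer]; exact_mod_cast hpq
    have hc : cur - p * y = c := by linarith
    have h3 := hmin ys y y1 hys
    rw [hc] at h3
    have e1 := norm_word_setInts_le hp hpq hxl (cur - p * z)
    have e2 := norm_word_setInts_eq hp hpq hyl c hfit
    rw [← y2] at e2
    rw [← hu] at e1
    unfold key at h3
    rw [hxl, hyl, Nat.sub_self, pow_zero, mul_one, mul_one] at h3
    have d1 := digits_lt hx
    have d2 := digits_lt hys
    rw [hxl] at d1
    rw [hyl] at d2
    set N := (2 * q) ^ bs.length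
    have h4 : absSum xs + (lnf p q (cur - p * z)).length ≤ absSum ys + (lnf p q c).length := by
      by_contra hcon
      rw [not_le] at hcon
      have := Nat.mul_le_mul_right N hcon
      rw [Nat.succ_mul, add_mul, add_mul] at this
      omega
    refine ⟨by omega, fun h5 => ?_⟩
    have h6 : absSum xs + (lnf p q (cur - p * z)).length = absSum ys + (lnf p q c).length := by
      omega
    have h7 : digits (2 * q) xs ≤ digits (2 * q) ys := by
      have := congrArg (· * N) h6
      simp only [add_mul] at this
      omega
    refine deltaLE_trans ?_ w5
    rw [hu, y2]
    exact deltaLE_of_digits_le hxl hyl hx hys h7 _ _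
  have hgeo : u.norm p q = geodesicLength p q (v.val p q) := by
    apply le_antisymm
    · obtain ⟨w, w1, w2, w3⟩ := exists_reduced_norm_le hp hpq v
      exact (main w w1 w2).1.trans w3
    · rw [← hval]; exact geodesicLength_le_norm hp hpq u
  refine ⟨⟨hred, hval, hgeo⟩, ?_, ?_⟩
  · rintro u' ⟨h1, h2, h3⟩
    rw [left_eq hk (hth u hred hval), left_eq hk (hth u' h1 h2)]
    exact (main u' h1 h2).2 (by rw [h3, hgeo])
  · rintro u' ⟨h1, h2, h3⟩ -
    rw [rightBar_eq hk (hth u hred hval), rightBar_eq hk (hth u' h1 h2)]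
    exact Or.inl rfl

/-- The peak normal form of a valley from a minimal run. -/
theorem isPNF_of_min {r : ℕ} (hp : 1 ≤ p) (hpq : p ≤ q) (hq : q = p * r) {v : Word}
    (hv : v.IsValley p q) {bs : List (ℤ × Stable)} {cur : ℤ} (hbs : v.toNF p q = (bs, cur))
    {xs : List ℤ} {z : ℤ} (hrun : ZRun p q bs xs [z]) (hx : ∀ x ∈ xs, |x| < q)
    (hmin : ∀ ys y, ZRun p q bs ys [y] → (∀ x ∈ ys, |x| < q) →
      key q bs.length xs + (lnf p q (cur - p * z)).length * (2 * q) ^ bs.length ≤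
      key q bs.length ys + (lnf p q (cur - p * y)).length * (2 * q) ^ bs.length) :
    v.IsPNF p q (((setInts xs bs).reverse.flatMap fun x => lnf p q x.1 ++ [x.2.letter]) ++
      lnf p q (cur - p * z)) :=
  ⟨_, lnf p q, isBrittonPNF_of_min hp hpq hq hv hbs hrun hx hmin, isLLNF_lnf hp hpq,
    (NF.expand_word _ _).symm⟩

end BaumslagSolitar

namespace BaumslagSolitar

/-! ### Reasoning about programs -/

instance : Add Expr := ⟨Expr.op .add⟩
instance : Sub Expr := ⟨Expr.op .sub⟩
instance : Mul Expr := ⟨Expr.op .mul⟩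
instance : Div Expr := ⟨Expr.op .div⟩
instance : Mod Expr := ⟨Expr.op .mod⟩
instance : OfNat Expr 0 := ⟨Expr.lit 0⟩
instance : OfNat Expr 1 := ⟨Expr.lit 1⟩
instance : OfNat Expr 2 := ⟨Expr.lit 2⟩
instance : OfNat Expr 3 := ⟨Expr.lit 3⟩
instance : OfNat Expr 4 := ⟨Expr.lit 4⟩

/-- The comparison `e < f`. -/
abbrev Expr.less (e f : Expr) : Expr := .op .lt e f

/-- The comparison `e = f`. -/
abbrev Expr.same (e f : Expr) : Expr := .op .eq e f

/-- The absolute value. -/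
def Expr.abs (e : Expr) : Expr := e * (1 - 2 * .less e 0)

namespace Expr

variable (s : State) (e f : Expr)

@[simp] theorem eval_lit (n : ℤ) : (Expr.lit n).eval s = n := rfl
@[simp] theorem eval_two : (2 : Expr).eval s = 2 := rfl
@[simp] theorem eval_three : (3 : Expr).eval s = 3 := rfl
@[simp] theorem eval_four : (4 : Expr).eval s = 4 := rfl
@[simp] theorem eval_zero : (0 : Expr).eval s = 0 := rfl
@[simp] theorem eval_one : (1 : Expr).eval s = 1 := rfl
@[simp] theorem eval_var (x : ℕ) : (Expr.var x).eval s = s.var x := rfl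
@[simp] theorem eval_get (A : ℕ) : (Expr.get A e).eval s = s.arr A (e.eval s) := rfl
@[simp] theorem eval_add : (e + f).eval s = e.eval s + f.eval s := rfl
@[simp] theorem eval_sub : (e - f).eval s = e.eval s - f.eval s := rfl
@[simp] theorem eval_mul : (e * f).eval s = e.eval s * f.eval s := rfl
@[simp] theorem eval_div : (e / f).eval s = e.eval s / f.eval s := rfl
@[simp] theorem eval_mod : (e % f).eval s = e.eval s % f.eval s := rfl
@[simp] theorem eval_less : (Expr.op .lt e f).eval s = if e.eval s < f.eval s then 1 else 0 := rfl
@[simp] theorem eval_same : (Expr.op .eq e f).eval s = if e.eval s = f.eval s then 1 else 0 := rfl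
@[simp] theorem eval_abs : e.abs.eval s = |e.eval s| := by
  simp only [abs, eval_mul, eval_sub, eval_one, eval_two, eval_less, eval_zero]
  rcases lt_or_ge (e.eval s) 0 with h | h
  · simp [h, abs_of_neg h]
  · simp [not_lt.2 h, abs_of_nonneg h]

/-- A bound for the growth of numbers in the evaluation. -/
def deg : Expr → ℕ
  | lit n => n.natAbs + 1
  | var _ => 1
  | get _ e => e.deg + 1
  | op _ e f => e.deg + f.deg

theorem deg_pos : ∀ e : Expr, 1 ≤ e.deg
  | lit _ => by simp [deg]
  | var _ => by simp [deg]
  | get _ _ => by simp [deg]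
  | op _ e _ => by have := deg_pos e; simp only [deg]; omega

theorem Within.mono {B B' : ℤ} (h : B ≤ B') {s : State} : ∀ {e : Expr}, e.Within B s → e.Within B' s
  | lit _, h' => le_trans h' h
  | var _, h' => le_trans h' h
  | get _ _, h' => ⟨Within.mono h h'.1, h'.2.trans h⟩
  | op _ _ _, h' => ⟨Within.mono h h'.1, Within.mono h h'.2.1, h'.2.2.trans h⟩

end Expr

/-- All cells have absolute value at most `M`. -/
def Bdd (M : ℤ) (s : State) : Prop := (∀ x, |s.var x| ≤ M) ∧ ∀ A i, |s.arr A i| ≤ M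

theorem abs_op_le {M : ℤ} (hM : 2 ≤ M) {i j : ℕ} (hi : 1 ≤ i) (hj : 1 ≤ j) {x y : ℤ}
    (hx : |x| ≤ M ^ i) (hy : |y| ≤ M ^ j) (o : Op) : |o.eval x y| ≤ M ^ (i + j) := by
  have hi' : 2 ≤ M ^ i := hM.trans (le_self_pow₀ (by omega) (by omega))
  have hj' : 2 ≤ M ^ j := hM.trans (le_self_pow₀ (by omega) (by omega))
  rw [pow_add]
  have h1 : M ^ i + M ^ j ≤ M ^ i * M ^ j := by nlinarith
  have h2 : (1 : ℤ) ≤ M ^ i * M ^ j := by nlinarith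
  have h3 : M ^ i ≤ M ^ i * M ^ j := by nlinarith
  have h4 : M ^ j ≤ M ^ i * M ^ j := by nlinarith
  cases o with
  | add => exact (abs_add_le _ _).trans (by linarith)
  | sub => exact (abs_sub _ _).trans (by linarith)
  | mul =>
    simp only [Op.eval, abs_mul]
    exact mul_le_mul hx hy (abs_nonneg _) (by linarith)
  | div =>
    refine le_trans ?_ (hx.trans h3)
    simp only [Op.eval]
    exact Int.abs_ediv_le_abs x y
  | mod =>
    simp only [Op.eval]
    rcases eq_or_ne y 0 with rfl | h
    · rw [Int.emod_zero]; exact hx.trans h3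
    · rw [abs_of_nonneg (Int.emod_nonneg _ h)]
      exact (Int.emod_lt_abs x h).le.trans (hy.trans h4)
  | lt => simp only [Op.eval]; split_ifs <;> simp <;> linarith
  | eq => simp only [Op.eval]; split_ifs <;> simp <;> linarith

theorem Bdd.within {M : ℤ} (hM : 2 ≤ M) {s : State} (h : Bdd M s) :
    ∀ e : Expr, e.Within (M ^ e.deg) s ∧ |e.eval s| ≤ M ^ e.deg
  | .lit n => by
    have h1 : |n| ≤ M ^ (n.natAbs + 1) := by
      have h2 : n.natAbs < 2 ^ n.natAbs := Nat.lt_two_pow_self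
      have h3 : (2 : ℤ) ^ n.natAbs ≤ M ^ n.natAbs := pow_le_pow_left₀ (by norm_num) hM _
      have h4 : M ^ n.natAbs ≤ M ^ (n.natAbs + 1) := pow_le_pow_right₀ (by omega) (by omega)
      rw [Int.abs_eq_natAbs]
      have h5 : (n.natAbs : ℤ) < 2 ^ n.natAbs := by exact_mod_cast h2
      linarith
    exact ⟨h1, h1⟩
  | .var x => by
    have := h.1 x
    simp only [Expr.Within, Expr.deg, pow_one, Expr.eval_var]
    exact ⟨this, this⟩
  | .get A e => by
    obtain ⟨h1, h2⟩ := Bdd.within hM h e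
    have h3 : M ^ e.deg ≤ M ^ (e.deg + 1) := pow_le_pow_right₀ (by omega) (by omega)
    have h4 : |s.arr A (e.eval s)| ≤ M ^ (e.deg + 1) :=
      (h.2 _ _).trans (le_self_pow₀ (by omega) (by omega))
    exact ⟨⟨h1.mono h3, h4⟩, h4⟩
  | .op o e f => by
    obtain ⟨h1, h2⟩ := Bdd.within hM h e
    obtain ⟨h3, h4⟩ := Bdd.within hM h f
    have h5 := abs_op_le hM e.deg_pos f.deg_pos h2 h4 o
    exact ⟨⟨h1.mono (pow_le_pow_right₀ (by omega) (by simp [Expr.deg])),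
      h3.mono (pow_le_pow_right₀ (by omega) (by simp [Expr.deg])), h5⟩, h5⟩

/-- Assignment to a variable. -/
def State.setVar (s : State) (x : ℕ) (v : ℤ) : State := { s with var := Function.update s.var x v }

/-- Assignment to a cell of an array. -/
def State.setArr (s : State) (A : ℕ) (i v : ℤ) : State :=
  { s with arr := Function.update s.arr A (Function.update (s.arr A) i v) }

@[simp] theorem State.setVar_var (s : State) (x : ℕ) (v : ℤ) (y : ℕ) :
    (s.setVar x v).var y = if y = x then v else s.var y := by
  simp [State.setVar, Function.update_apply]

@[simp] theorem State.setVar_arr (s : State) (x : ℕ) (v : ℤ) : (s.setVar x v).arr = s.arr := rfl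

@[simp] theorem State.setArr_var (s : State) (A : ℕ) (i v : ℤ) : (s.setArr A i v).var = s.var := rfl

@[simp] theorem State.setArr_arr (s : State) (A : ℕ) (i v : ℤ) (A' : ℕ) (i' : ℤ) :
    (s.setArr A i v).arr A' i' = if A' = A ∧ i' = i then v else s.arr A' i' := by
  by_cases h1 : A' = A
  · subst h1; simp [State.setArr, Function.update_apply]
  · simp [State.setArr, h1]

theorem Bdd.setVar {M : ℤ} {s : State} (h : Bdd M s) {v : ℤ} (hv : |v| ≤ M) (x : ℕ) :
    Bdd M (s.setVar x v) := by
  refine ⟨fun y => ?_, h.2⟩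
  rw [State.setVar_var]
  split_ifs
  · exact hv
  · exact h.1 y

theorem Bdd.setArr {M : ℤ} {s : State} (h : Bdd M s) {v : ℤ} (hv : |v| ≤ M) (A : ℕ) (i : ℤ) :
    Bdd M (s.setArr A i v) := by
  refine ⟨h.1, fun A' i' => ?_⟩
  rw [State.setArr_arr]
  split_ifs
  · exact hv
  · exact h.2 _ _

theorem Bdd.mono {M M' : ℤ} (h : M ≤ M') {s : State} (hs : Bdd M s) : Bdd M' s :=
  ⟨fun x => (hs.1 x).trans h, fun A i => (hs.2 A i).trans h⟩

namespace Prog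

/-- The effect of a program without loops. -/
def run : Prog → State → State
  | skip, s => s
  | assign x e, s => s.setVar x (e.eval s)
  | put A i e, s => s.setArr A (i.eval s) (e.eval s)
  | seq c d, s => d.run (c.run s)
  | ite e c d, s => if e.eval s ≠ 0 then c.run s else d.run s
  | loop _ _, s => s

/-- The program has no loops. -/
def LoopFree : Prog → Prop
  | skip => True
  | assign _ _ => True
  | put _ _ _ => True
  | seq c d => c.LoopFree ∧ d.LoopFree
  | ite _ c d => c.LoopFree ∧ d.LoopFree
  | loop _ _ => False

/-- A bound for the number of steps of a program without loops. -/
def time : Prog → ℕ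
  | skip => 1
  | assign _ e => e.cost + 1
  | put _ i e => i.cost + e.cost + 1
  | seq c d => c.time + d.time
  | ite e c d => e.cost + (c.time + d.time) + 1
  | loop _ _ => 0

/-- A bound for the growth of numbers. -/
def deg : Prog → ℕ
  | skip => 1
  | assign _ e => e.deg
  | put _ i e => i.deg * e.deg
  | seq c d => c.deg * d.deg
  | ite e c d => e.deg * (c.deg * d.deg)
  | loop e c => e.deg * c.deg

theorem deg_pos : ∀ c : Prog, 1 ≤ c.deg
  | skip => le_rfl
  | assign _ e => e.deg_pos
  | put _ i e => Nat.mul_pos i.deg_pos e.deg_pos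
  | seq c d => Nat.mul_pos c.deg_pos d.deg_pos
  | ite e c d => Nat.mul_pos e.deg_pos (Nat.mul_pos c.deg_pos d.deg_pos)
  | loop e c => Nat.mul_pos e.deg_pos c.deg_pos

/-- The program has an assignment to the variable `x`. -/
def writesVar : Prog → ℕ → Bool
  | skip, _ => false
  | assign y _, x => x == y
  | put _ _ _, _ => false
  | seq c d, x => c.writesVar x || d.writesVar x
  | ite _ c d, x => c.writesVar x || d.writesVar x
  | loop _ c, x => c.writesVar x

/-- The program has an assignment to cells of the array `A`. -/
def writesArr : Prog → ℕ → Bool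
  | skip, _ => false
  | assign _ _, _ => false
  | put B _ _, A => A == B
  | seq c d, A => c.writesArr A || d.writesArr A
  | ite _ c d, A => c.writesArr A || d.writesArr A
  | loop _ c, A => c.writesArr A

end Prog

/-- `s'` differs from `s` only in variables and arrays to which `c` assigns. -/
def Frame (c : Prog) (s s' : State) : Prop :=
  (∀ x, c.writesVar x = false → s'.var x = s.var x) ∧
    ∀ A, c.writesArr A = false → s'.arr A = s.arr A

theorem Frame.refl (c : Prog) (s : State) : Frame c s s := ⟨fun _ _ => rfl, fun _ _ => rfl⟩

theorem Frame.trans {c : Prog} {s s' s'' : State} (h : Frame c s s') (h' : Frame c s' s'') :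
    Frame c s s'' :=
  ⟨fun x hx => (h'.1 x hx).trans (h.1 x hx), fun x hx => (h'.2 x hx).trans (h.2 x hx)⟩

theorem Frame.of_imp {c d : Prog} {s s' : State} (h : Frame c s s')
    (h1 : ∀ x, d.writesVar x = false → c.writesVar x = false)
    (h2 : ∀ x, d.writesArr x = false → c.writesArr x = false) : Frame d s s' :=
  ⟨fun x hx => h.1 x (h1 x hx), fun x hx => h.2 x (h2 x hx)⟩

theorem Exec.frame {B : ℤ} {c : Prog} {s s' : State} {n : ℕ} (h : Exec B c s n s') :
    Frame c s s' := by
  induction h with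
  | skip s => exact Frame.refl _ _
  | assign s x e he =>
    refine ⟨fun y hy => ?_, fun _ _ => rfl⟩
    simp only [Prog.writesVar, beq_eq_false_iff_ne] at hy
    exact Function.update_of_ne hy _ _
  | put s A i e hi he =>
    refine ⟨fun _ _ => rfl, fun y hy => ?_⟩
    simp only [Prog.writesArr, beq_eq_false_iff_ne] at hy
    exact Function.update_of_ne hy _ _
  | seq hc hd ihc ihd =>
    exact (ihc.of_imp (by simp +contextual [Prog.writesVar])
      (by simp +contextual [Prog.writesArr])).trans
      (ihd.of_imp (by simp +contextual [Prog.writesVar]) (by simp +contextual [Prog.writesArr]))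
  | iteTrue _ _ _ ih =>
    exact ih.of_imp (by simp +contextual [Prog.writesVar]) (by simp +contextual [Prog.writesArr])
  | iteFalse _ _ _ ih =>
    exact ih.of_imp (by simp +contextual [Prog.writesVar]) (by simp +contextual [Prog.writesArr])
  | loopTrue _ _ _ _ ih ih' =>
    exact (ih.of_imp (by simp [Prog.writesVar]) (by simp [Prog.writesArr])).trans ih'
  | loopFalse _ _ => exact Frame.refl _ _

theorem Exec.mono {B B' : ℤ} (hB : B ≤ B') {c : Prog} {s s' : State} {n : ℕ}
    (h : Exec B c s n s') : Exec B' c s n s' := by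
  induction h with
  | skip s => exact .skip s
  | assign s x e he => exact .assign s x e (he.mono hB)
  | put s A i e hi he => exact .put s A i e (hi.mono hB) (he.mono hB)
  | seq _ _ ihc ihd => exact .seq ihc ihd
  | iteTrue he h _ ih => exact .iteTrue (he.mono hB) h ih
  | iteFalse he h _ ih => exact .iteFalse (he.mono hB) h ih
  | loopTrue he h _ _ ih ih' => exact .loopTrue (he.mono hB) h ih ih'
  | loopFalse he h => exact .loopFalse (he.mono hB) h

/-- `c` takes `s` to `s'` in at most `T` steps, with numbers that are polynomial in `M`. -/
def Runs (M : ℤ) (c : Prog) (s : State) (T : ℕ) (s' : State) : Prop :=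
  ∃ n ≤ T, Exec (M ^ c.deg) c s n s'

theorem Runs.frame {M : ℤ} {c : Prog} {s s' : State} {T : ℕ} (h : Runs M c s T s') :
    Frame c s s' := h.choose_spec.2.frame

theorem Runs.mono {M : ℤ} {c : Prog} {s s' : State} {T T' : ℕ} (h : Runs M c s T s')
    (hT : T ≤ T') : Runs M c s T' s' := by
  obtain ⟨n, hn, h⟩ := h
  exact ⟨n, hn.trans hT, h⟩

theorem Runs.seq {M : ℤ} (hM : 2 ≤ M) {c d : Prog} {s s' s'' : State} {T T' : ℕ}
    (h : Runs M c s T s') (h' : Runs M d s' T' s'') : Runs M (.seq c d) s (T + T') s'' := by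
  obtain ⟨n, hn, h⟩ := h
  obtain ⟨n', hn', h'⟩ := h'
  refine ⟨n + n', by omega, .seq (h.mono ?_) (h'.mono ?_)⟩
  · exact pow_le_pow_right₀ (by omega) (Nat.le_mul_of_pos_right _ d.deg_pos)
  · exact pow_le_pow_right₀ (by omega) (Nat.le_mul_of_pos_left _ c.deg_pos)

theorem exec_run {c : Prog} (hc : c.LoopFree) {M : ℤ} (hM : 2 ≤ M) {s : State} (hs : Bdd M s) :
    (∃ n ≤ c.time, Exec (M ^ c.deg) c s n (c.run s)) ∧ Bdd (M ^ c.deg) (c.run s) := by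
  induction c generalizing M s with
  | skip => exact ⟨⟨1, le_rfl, .skip s⟩, by simpa [Prog.deg, Prog.run] using hs⟩
  | assign x e =>
    obtain ⟨h1, h2⟩ := hs.within hM e
    refine ⟨⟨_, le_rfl, .assign s x e h1⟩, ?_⟩
    exact (hs.mono (le_self_pow₀ (by omega) (Nat.one_le_iff_ne_zero.1 e.deg_pos))).setVar h2 x
  | put A i e =>
    obtain ⟨h1, h2⟩ := hs.within hM e
    obtain ⟨h3, h4⟩ := hs.within hM i
    have h5 : M ^ e.deg ≤ M ^ (i.deg * e.deg) :=
      pow_le_pow_right₀ (by omega) (Nat.le_mul_of_pos_left _ i.deg_pos)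
    have h6 : M ^ i.deg ≤ M ^ (i.deg * e.deg) :=
      pow_le_pow_right₀ (by omega) (Nat.le_mul_of_pos_right _ e.deg_pos)
    refine ⟨⟨_, le_rfl, .put s A i e (h3.mono h6) (h1.mono h5)⟩, ?_⟩
    exact (hs.mono (le_self_pow₀ (by omega) (Nat.one_le_iff_ne_zero.1 (Prog.deg_pos (.put A i e))))).setArr
      (h2.trans h5) A _
  | seq c d ihc ihd =>
    obtain ⟨h1, h2⟩ := ihc hc.1 hM hs
    obtain ⟨⟨n, hn, h3⟩, h4⟩ := ihd hc.2 (hM.trans (le_self_pow₀ (by omega) (Nat.one_le_iff_ne_zero.1 c.deg_pos))) h2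
    rw [← pow_mul] at h3 h4
    obtain ⟨m, hm, h1⟩ := h1
    refine ⟨⟨m + n, by simp only [Prog.time]; omega, .seq (h1.mono ?_) h3⟩, h4⟩
    exact pow_le_pow_right₀ (by omega) (Nat.le_mul_of_pos_right _ d.deg_pos)
  | ite e c d ihc ihd =>
    obtain ⟨h1, h2⟩ := hs.within hM e
    have hcd := Nat.mul_pos c.deg_pos d.deg_pos
    have h3 : M ^ e.deg ≤ M ^ (Prog.ite e c d).deg :=
      pow_le_pow_right₀ (by omega) (Nat.le_mul_of_pos_right _ hcd)
    have h4 : M ^ c.deg ≤ M ^ (Prog.ite e c d).deg :=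
      pow_le_pow_right₀ (by omega)
        ((Nat.le_mul_of_pos_right _ d.deg_pos).trans (Nat.le_mul_of_pos_left _ e.deg_pos))
    have h5 : M ^ d.deg ≤ M ^ (Prog.ite e c d).deg :=
      pow_le_pow_right₀ (by omega)
        ((Nat.le_mul_of_pos_left _ c.deg_pos).trans (Nat.le_mul_of_pos_left _ e.deg_pos))
    simp only [Prog.run]
    split_ifs with h
    · obtain ⟨⟨n, hn, h6⟩, h7⟩ := ihc hc.1 hM hs
      exact ⟨⟨_, by simp only [Prog.time]; omega, .iteTrue (h1.mono h3) h (h6.mono h4)⟩,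
        h7.mono h4⟩
    · obtain ⟨⟨n, hn, h6⟩, h7⟩ := ihd hc.2 hM hs
      exact ⟨⟨_, by simp only [Prog.time]; omega,
        .iteFalse (h1.mono h3) (not_not.1 h) (h6.mono h5)⟩, h7.mono h5⟩
  | loop => exact hc.elim

theorem runs_run {c : Prog} (hc : c.LoopFree) {M : ℤ} (hM : 2 ≤ M) {s : State} (hs : Bdd M s) :
    Runs M c s c.time (c.run s) := (exec_run hc hM hs).1

/-- The invariant rule for loops. -/
theorem runs_loop {M : ℤ} (hM : 2 ≤ M) {e : Expr} {c : Prog} (I : ℕ → State → Prop) (N : ℕ)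
    (T : ℕ → ℕ) {s : State} (hs : Bdd M s) (h0 : I 0 s)
    (hstep : ∀ i < N, ∀ s', Bdd M s' → Frame c s s' → I i s' →
      e.eval s' ≠ 0 ∧ ∃ s'', Runs M c s' (T i) s'' ∧ Bdd M s'' ∧ I (i + 1) s'')
    (hend : ∀ s', Bdd M s' → Frame c s s' → I N s' → e.eval s' = 0) :
    ∃ s', Runs M (.loop e c) s (∑ i ∈ Finset.range N, (e.cost + T i + 1) + e.cost + 1) s' ∧
      Bdd M s' ∧ Frame c s s' ∧ I N s' := by
  have hdeg : M ^ e.deg ≤ M ^ (Prog.loop e c).deg :=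
    pow_le_pow_right₀ (by omega) (Nat.le_mul_of_pos_right _ c.deg_pos)
  have hdeg' : M ^ c.deg ≤ M ^ (Prog.loop e c).deg :=
    pow_le_pow_right₀ (by omega) (Nat.le_mul_of_pos_left _ e.deg_pos)
  have key : ∀ k ≤ N, ∀ s', Bdd M s' → Frame c s s' → I (N - k) s' →
      ∃ s'', Runs M (.loop e c) s'
        (∑ i ∈ Finset.Ico (N - k) N, (e.cost + T i + 1) + e.cost + 1) s'' ∧
        Bdd M s'' ∧ Frame c s s'' ∧ I N s'' := by
    intro k
    induction k with
    | zero =>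
      intro _ s' hb hf hi
      refine ⟨s', ⟨_, by simp, .loopFalse ((hb.within hM e).1.mono hdeg) (hend s' hb hf hi)⟩,
        hb, hf, hi⟩
    | succ k ih =>
      intro hk s' hb hf hi
      obtain ⟨h1, s1, ⟨n, hn, h2⟩, h3, h4⟩ := hstep (N - (k + 1)) (by omega) s' hb hf hi
      rw [show N - (k + 1) + 1 = N - k by omega] at h4
      obtain ⟨s2, ⟨m, hm, h5⟩, h6, h7, h8⟩ := ih (by omega) s1 h3 (hf.trans h2.frame) h4
      refine ⟨s2, ⟨_, ?_, .loopTrue ((hb.within hM e).1.mono hdeg) h1 (h2.mono hdeg') h5⟩,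
        h6, h7, h8⟩
      rw [Finset.sum_eq_sum_Ico_succ_bot (by omega),
        show N - (k + 1) + 1 = N - k by omega]
      omega
  have := key N le_rfl s hs (Frame.refl _ _) (by simpa using h0)
  simpa using this

/-- The invariant rule for loops with a constant bound for the steps of an iteration. -/
theorem runs_loop_const {M : ℤ} (hM : 2 ≤ M) {e : Expr} {c : Prog} (I : ℕ → State → Prop) (N : ℕ)
    (T : ℕ) {s : State} (hs : Bdd M s) (h0 : I 0 s)
    (hstep : ∀ i < N, ∀ s', Bdd M s' → Frame c s s' → I i s' →
      e.eval s' ≠ 0 ∧ ∃ s'', Runs M c s' T s'' ∧ Bdd M s'' ∧ I (i + 1) s'')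
    (hend : ∀ s', Bdd M s' → Frame c s s' → I N s' → e.eval s' = 0) :
    ∃ s', Runs M (.loop e c) s ((e.cost + T + 1) * (N + 1)) s' ∧
      Bdd M s' ∧ Frame c s s' ∧ I N s' := by
  obtain ⟨s', h1, h2⟩ := runs_loop hM I N (fun _ => T) hs h0 hstep hend
  refine ⟨s', h1.mono ?_, h2⟩
  rw [Finset.sum_const, Finset.card_range, smul_eq_mul, mul_add]
  nlinarith

infixr:60 " ;; " => Prog.seq
infix:62 " ≔ " => Prog.assign

/-- A variable as an expression. -/
abbrev vr (x : ℕ) : Expr := .var x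

theorem Bdd.of_frame {M : ℤ} {c : Prog} {s s' : State} (hb : Bdd M s) (hf : Frame c s s')
    (hv : ∀ x, c.writesVar x = true → |s'.var x| ≤ M)
    (ha : ∀ A, c.writesArr A = true → ∀ i, |s'.arr A i| ≤ M) : Bdd M s' := by
  constructor
  · intro x
    cases h : c.writesVar x with
    | true => exact hv x h
    | false => rw [hf.1 x h]; exact hb.1 x
  · intro A i
    cases h : c.writesArr A with
    | true => exact ha A h i
    | false => rw [hf.2 A h]; exact hb.2 A i

theorem frame_run {c : Prog} (hc : c.LoopFree) (s : State) : Frame c s (c.run s) := by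
  induction c generalizing s with
  | skip => exact Frame.refl _ _
  | assign x e =>
    refine ⟨fun y hy => ?_, fun _ _ => rfl⟩
    simp only [Prog.writesVar, beq_eq_false_iff_ne] at hy
    simp [Prog.run, hy]
  | put A i e =>
    refine ⟨fun _ _ => rfl, fun y hy => ?_⟩
    simp only [Prog.writesArr, beq_eq_false_iff_ne] at hy
    exact Function.update_of_ne hy _ _
  | seq c d ihc ihd =>
    exact ((ihc hc.1 s).of_imp (by simp +contextual [Prog.writesVar])
      (by simp +contextual [Prog.writesArr])).trans
      ((ihd hc.2 _).of_imp (by simp +contextual [Prog.writesVar])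
        (by simp +contextual [Prog.writesArr]))
  | ite e c d ihc ihd =>
    simp only [Prog.run]
    split_ifs
    · exact (ihc hc.1 s).of_imp (by simp +contextual [Prog.writesVar])
        (by simp +contextual [Prog.writesArr])
    · exact (ihd hc.2 s).of_imp (by simp +contextual [Prog.writesVar])
        (by simp +contextual [Prog.writesArr])
  | loop => exact hc.elim

/-! ### The program for normal forms of integers -/

/-- Comparison of pairs of variables in the lexicographical order. -/
def less2 (L V L' V' : ℕ) : Expr :=
  .less (vr L) (vr L') + .same (vr L) (vr L') * .less (vr V) (vr V')

/-- The number of `a^x`, where `x` and its absolute value are in the given variables. -/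
def apowExpr (a x : ℕ) : Expr := (2 + .less (vr x) 0) * ((.get 8 (vr a) - 1) / 3)

/-- Replaces the pair `(37, 38)` by the pair `(42, 43)` if the latter is smaller. -/
def takeMin : Prog := .ite (less2 42 43 37 38) (37 ≔ vr 42 ;; 38 ≔ vr 43) .skip

/-- The first candidate. -/
def candA (q : ℕ) : Prog :=
  40 ≔ vr 39 - .lit q * vr 32 ;; 41 ≔ (vr 40).abs ;; 37 ≔ vr 33 + 2 + vr 41 ;;
  38 ≔ (4 * vr 34 + 1) * .get 8 (vr 41) + apowExpr 41 40

/-- The second candidate. -/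
def candB (q : ℕ) : Prog :=
  40 ≔ vr 40 - .lit q ;; 41 ≔ (vr 40).abs ;; 42 ≔ vr 35 + 2 + vr 41 ;;
  43 ≔ (4 * vr 36 + 1) * .get 8 (vr 41) + apowExpr 41 40

/-- The third candidate. -/
def candC : Prog :=
  40 ≔ vr 39 ;; 41 ≔ (vr 40).abs ;; 42 ≔ vr 41 ;; 43 ≔ apowExpr 41 40

/-- The normal form of the integer `b` in variable `39` from the normal forms for `p m` and
`p (m + 1)`, where `m` is the quotient of `b` by `q`. -/
def selectProg (q : ℕ) : Prog :=
  candA q ;; candB q ;; takeMin ;;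
  .ite (.less (vr 39).abs (.lit (2 * q))) (candC ;; takeMin) .skip

theorem numVal_apow (x : ℤ) :
    (numVal (apow x) : ℤ) = (2 + if x < 0 then 1 else 0) * ((4 ^ x.natAbs - 1) / 3) := by
  have key : ∀ (c : Letter) (n : ℕ),
      (numVal (List.replicate n c) : ℤ) * 3 = c.code * (4 ^ n - 1) := by
    intro c n
    induction n with
    | zero => simp
    | succ n ih =>
      rw [List.replicate_succ, numVal_cons, List.length_replicate]
      push_cast
      rw [add_mul, ih]
      ring
  have h3 : (3 : ℤ) ∣ 4 ^ x.natAbs - 1 := by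
    have := sub_dvd_pow_sub_pow (4 : ℤ) 1 x.natAbs
    simpa using this
  obtain ⟨d, hd⟩ := h3
  have h := key (if x < 0 then Letter.A else Letter.a) x.natAbs
  unfold apow
  rw [hd] at h ⊢
  rw [Int.mul_ediv_cancel_left _ (by norm_num)]
  split_ifs with hx <;> simp [hx, Letter.code] at h ⊢ <;> linarith

theorem numVal_up (w : List Letter) (x : ℤ) : (numVal (.t :: w ++ .T :: apow x) : ℤ) =
    (4 * numVal w + 1) * 4 ^ x.natAbs +
      (2 + if x < 0 then 1 else 0) * ((4 ^ x.natAbs - 1) / 3) := by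
  rw [← numVal_apow, numVal_append, numVal_cons, numVal_cons]
  simp only [Letter.code, List.length_cons, length_apow]
  push_cast
  ring

/-- The variables `L` and `V` contain the length and the number of `w`. -/
def Holds (s : State) (L V : ℕ) (w : List Letter) : Prop :=
  s.var L = w.length ∧ s.var V = numVal w

theorem less2_eval {s : State} {L V L' V' : ℕ} {w w' : List Letter} (h : Holds s L V w)
    (h' : Holds s L' V' w') : (less2 L V L' V').eval s ≠ 0 ↔ rank w < rank w' := by
  rw [← not_le, rank_le_iff]
  unfold less2
  simp only [Expr.eval_add, Expr.eval_mul, Expr.eval_less, Expr.eval_same, Expr.eval_var, h.1,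
    h.2, h'.1, h'.2, Nat.cast_lt, Nat.cast_inj]
  rcases lt_trichotomy w.length w'.length with h1 | h1 | h1
  · have h2 : ¬ w'.length < w.length := by omega
    have h3 : ¬ w'.length = w.length := by omega
    simp [h1, h2, h3, h1.ne]
  · simp [h1]
  · have h2 : ¬ w.length < w'.length := by omega
    have h3 : ¬ w.length = w'.length := by omega
    simp [h1, h2, h3]

theorem takeMin_run {s : State} {w w' : List Letter} (h : Holds s 37 38 w)
    (h' : Holds s 42 43 w') : ∃ u, (u = w ∨ u = w') ∧ Holds (takeMin.run s) 37 38 u ∧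
      rank u ≤ rank w ∧ rank u ≤ rank w' := by
  have h2 := less2_eval h' h
  by_cases hlt : rank w' < rank w
  · refine ⟨w', Or.inr rfl, ?_, hlt.le, le_rfl⟩
    simp only [takeMin, Prog.run, if_pos (h2.2 hlt)]
    exact ⟨by simpa using h'.1, by simpa using h'.2⟩
  · refine ⟨w, Or.inl rfl, ?_, le_rfl, not_lt.1 hlt⟩
    simp only [takeMin, Prog.run, if_neg (fun h => hlt (h2.1 h))]
    exact h

theorem takeMin_loopFree : takeMin.LoopFree := ⟨⟨trivial, trivial⟩, trivial⟩

theorem selectProg_loopFree (q : ℕ) : (selectProg q).LoopFree := by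
  simp [selectProg, candA, candB, candC, takeMin, Prog.LoopFree]

/-- The array `8` contains the first powers of four. -/
def HasPowers (q : ℕ) (s : State) : Prop := ∀ i : ℕ, i ≤ 2 * q → s.arr 8 i = 4 ^ i

theorem candA_run {q : ℕ} {s : State} (hP : HasPowers q s) {w : List Letter}
    (hw : Holds s 33 34 w) (h0 : |s.var 39 - q * s.var 32| ≤ 2 * q) :
    Holds ((candA q).run s) 37 38 (.t :: w ++ .T :: apow (s.var 39 - q * s.var 32)) ∧
      ((candA q).run s).var 40 = s.var 39 - q * s.var 32 := by
  have h1 : s.arr 8 |s.var 39 - q * s.var 32| = 4 ^ (s.var 39 - q * s.var 32).natAbs := by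
    rw [Int.abs_eq_natAbs] at *
    exact hP _ (by omega)
  refine ⟨⟨?_, ?_⟩, ?_⟩
  · simp [candA, Prog.run, hw.1]; omega
  · rw [numVal_up]
    simp [candA, Prog.run, apowExpr, hw.2, h1]
  · simp [candA, Prog.run]

theorem candB_run {q : ℕ} {s : State} (hP : HasPowers q s) {w : List Letter}
    (hw : Holds s 35 36 w) (h0 : |s.var 40 - q| ≤ 2 * q) :
    Holds ((candB q).run s) 42 43 (.t :: w ++ .T :: apow (s.var 40 - q)) ∧
      ((candB q).run s).var 40 = s.var 40 - q ∧ ((candB q).run s).var 41 = |s.var 40 - q| := by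
  have h1 : s.arr 8 |s.var 40 - q| = 4 ^ (s.var 40 - q).natAbs := by
    rw [Int.abs_eq_natAbs] at *
    exact hP _ (by omega)
  refine ⟨⟨?_, ?_⟩, ?_, ?_⟩
  · simp [candB, Prog.run, hw.1]; omega
  · rw [numVal_up]
    simp [candB, Prog.run, apowExpr, hw.2, h1]
  · simp [candB, Prog.run]
  · simp [candB, Prog.run]

theorem candC_run {q : ℕ} {s : State} (hP : HasPowers q s) (h0 : |s.var 39| ≤ 2 * q) :
    Holds (candC.run s) 42 43 (apow (s.var 39)) ∧
      (candC.run s).var 40 = s.var 39 ∧ (candC.run s).var 41 = |s.var 39| := by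
  have h1 : s.arr 8 |s.var 39| = 4 ^ (s.var 39).natAbs := by
    rw [Int.abs_eq_natAbs] at *
    exact hP _ (by omega)
  refine ⟨⟨?_, ?_⟩, ?_, ?_⟩
  · simp [candC, Prog.run]
  · rw [numVal_apow]
    simp [candC, Prog.run, apowExpr, h1]
  · simp [candC, Prog.run]
  · simp [candC, Prog.run]

theorem Holds.of_eq {s s' : State} {L V : ℕ} {w : List Letter} (h : Holds s L V w)
    (h1 : s'.var L = s.var L) (h2 : s'.var V = s.var V) : Holds s' L V w :=
  ⟨h1.trans h.1, h2.trans h.2⟩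

theorem Holds.le {s : State} {L V : ℕ} {w : List Letter} (h : Holds s L V w) {K : ℕ}
    (hw : w.length ≤ K) {M : ℤ} (hM : 4 ^ K ≤ M) : |s.var L| ≤ M ∧ |s.var V| ≤ M := by
  rw [h.1, h.2, Nat.abs_cast, Nat.abs_cast]
  have h1 : (4 : ℤ) ^ w.length ≤ 4 ^ K := pow_le_pow_right₀ (by norm_num) hw
  have h2 : (numVal w : ℤ) < 4 ^ w.length := by exact_mod_cast numVal_lt w
  have h3 : (w.length : ℤ) < 4 ^ w.length := by exact_mod_cast Nat.lt_pow_self (by norm_num)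
  constructor <;> linarith

theorem selectProg_writesVar {q x : ℕ} (h : (selectProg q).writesVar x = true) :
    x = 37 ∨ x = 38 ∨ x = 40 ∨ x = 41 ∨ x = 42 ∨ x = 43 := by
  simp [selectProg, candA, candB, candC, takeMin, Prog.writesVar] at h
  omega

theorem selectProg_run {p q : ℕ} (hp : 1 ≤ p) (hpq : p < q) {s : State} (hP : HasPowers q s)
    (hw : Holds s 33 34 (lnf p q (p * s.var 32)))
    (hw' : Holds s 35 36 (lnf p q (p * (s.var 32 + 1))))
    (h1 : q * s.var 32 ≤ s.var 39) (h2 : s.var 39 ≤ q * s.var 32 + q)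
    {M : ℤ} {K : ℕ} (hK : (lnf p q (p * s.var 32)).length ≤ K)
    (hK' : (lnf p q (p * (s.var 32 + 1))).length ≤ K) (hM : 4 ^ (K + 2 + 2 * q) ≤ M)
    (hb : Bdd M s) :
    Holds ((selectProg q).run s) 37 38 (lnf p q (s.var 39)) ∧ Bdd M ((selectProg q).run s) := by
  set b := s.var 39 with hbdef
  set m := s.var 32 with hmdef
  set w := lnf p q (p * m) with hwdef
  set w' := lnf p q (p * (m + 1)) with hwdef'
  have hx0 : |b - q * m| ≤ q := by rw [abs_le]; constructor <;> linarith
  have hx1 : |b - q * m - q| ≤ q := by rw [abs_le]; constructor <;> linarith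
  have hq0 : (0 : ℤ) ≤ q := Int.natCast_nonneg q
  obtain ⟨a1, a2⟩ := candA_run (q := q) hP hw (hx0.trans (by linarith))
  set s1 := (candA q).run s with hs1
  have f1 : Frame (candA q) s s1 := frame_run (by simp [candA, Prog.LoopFree]) s
  have hP1 : HasPowers q s1 := by intro i hi; rw [f1.2 8 rfl]; exact hP i hi
  rw [← hbdef, ← hmdef] at a1 a2
  obtain ⟨b1, b2, b3⟩ := candB_run (q := q) hP1
    (hw'.of_eq (f1.1 35 rfl) (f1.1 36 rfl)) (by rw [a2]; linarith)
  set s2 := (candB q).run s1 with hs2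
  have f2 : Frame (candB q) s1 s2 := frame_run (by simp [candB, Prog.LoopFree]) s1
  have hP2 : HasPowers q s2 := by intro i hi; rw [f2.2 8 rfl]; exact hP1 i hi
  rw [a2] at b1 b2 b3
  obtain ⟨u, u1, u2, u3, u4⟩ := takeMin_run (a1.of_eq (f2.1 37 rfl) (f2.1 38 rfl)) b1
  set s3 := takeMin.run s2 with hs3
  have f3 : Frame takeMin s2 s3 := frame_run takeMin_loopFree s2
  have hP3 : HasPowers q s3 := by intro i hi; rw [f3.2 8 rfl]; exact hP2 i hi
  have hb3 : s3.var 39 = b := by rw [f3.1 39 rfl, f2.1 39 rfl, f1.1 39 rfl]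
  have hill0 : Hill p q b (.t :: w ++ .T :: apow (b - q * m)) := by
    have := Hill.up (p := p) (q := q) m (b - q * m) w (lnf_hill p q _)
    rwa [sub_add_cancel] at this
  have hill1 : Hill p q b (.t :: w' ++ .T :: apow (b - q * m - q)) := by
    have := Hill.up (p := p) (q := q) (m + 1) (b - q * m - q) w' (lnf_hill p q _)
    rwa [show b - q * m - q + q * (m + 1) = b by ring] at this
  have hillu : Hill p q b u := by rcases u1 with rfl | rfl <;> assumption
  have hlen0 : (Letter.t :: w ++ .T :: apow (b - q * m)).length ≤ K + 2 + 2 * q := by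
    rw [Int.abs_eq_natAbs] at hx0
    simp; omega
  have hlen1 : (Letter.t :: w' ++ .T :: apow (b - q * m - q)).length ≤ K + 2 + 2 * q := by
    rw [Int.abs_eq_natAbs] at hx1
    simp; omega
  have hMq : (2 * q : ℤ) ≤ M := by
    have h3 : 2 * q < 4 ^ (2 * q) := Nat.lt_pow_self (by norm_num)
    have h4 : (4 : ℤ) ^ (2 * q) ≤ 4 ^ (K + 2 + 2 * q) := pow_le_pow_right₀ (by norm_num) (by omega)
    have h5 : (2 * q : ℤ) < 4 ^ (2 * q) := by exact_mod_cast h3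
    linarith
  have heq : ∀ {u}, Hill p q b u → rank u ≤ rank (lnf p q b) → u.length = (lnf p q b).length ∧
      numVal u = numVal (lnf p q b) := by
    intro u hu hr
    have h3 := le_antisymm hr (rank_lnf_le hu)
    have h4 : u.length = (lnf p q b).length :=
      le_antisymm (length_le_of_rank_le hr) (length_le_of_rank_le h3.ge)
    refine ⟨h4, ?_⟩
    unfold rank at h3
    rw [h4] at h3
    omega
  have hlenb : (lnf p q b).length ≤ K + 2 + 2 * q := (length_lnf_le hill0).trans hlen0
  have hrun : (selectProg q).run s =
      if |b| < 2 * q then takeMin.run (candC.run s3) else s3 := by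
    simp only [selectProg, Prog.run]
    rw [← hs1, ← hs2, ← hs3, Expr.eval_less, Expr.eval_abs, Expr.eval_var, Expr.eval_lit, hb3]
    split_ifs <;> simp_all
  have hframe : Frame (selectProg q) s ((selectProg q).run s) :=
    frame_run (selectProg_loopFree q) s
  have hwv := fun x => selectProg_writesVar (q := q) (x := x)
  have hwa : ∀ A, (selectProg q).writesArr A = true → False := by
    intro x
    simp [selectProg, candA, candB, candC, takeMin, Prog.writesArr]
  have fin : Holds ((selectProg q).run s) 37 38 (lnf p q b) →
      |((selectProg q).run s).var 40| ≤ M → |((selectProg q).run s).var 41| ≤ M →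
      |((selectProg q).run s).var 42| ≤ M → |((selectProg q).run s).var 43| ≤ M →
      Holds ((selectProg q).run s) 37 38 (lnf p q b) ∧ Bdd M ((selectProg q).run s) := by
    intro h3 h4 h5 h6 h7
    refine ⟨h3, hb.of_frame hframe ?_ fun A hA => (hwa A hA).elim⟩
    obtain ⟨h8, h9⟩ := h3.le hlenb hM
    intro x hx
    rcases hwv x hx with rfl | rfl | rfl | rfl | rfl | rfl <;> assumption
  have hcand := lnf_candidates hp hpq h1 h2
  by_cases hbq : |b| < 2 * q
  · rw [if_pos hbq] at hrun
    obtain ⟨c1, c2, c3⟩ := candC_run (q := q) hP3 (by rw [hb3]; exact hbq.le)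
    set s4 := candC.run s3 with hs4
    have f4 : Frame candC s3 s4 := frame_run (by simp [candC, Prog.LoopFree]) s3
    rw [hb3] at c1 c2 c3
    obtain ⟨v, v1, v2, v3, v4⟩ := takeMin_run (u2.of_eq (f4.1 37 rfl) (f4.1 38 rfl)) c1
    have f5 : Frame takeMin s4 (takeMin.run s4) := frame_run takeMin_loopFree s4
    have hv : Hill p q b v := by
      rcases v1 with rfl | rfl
      · exact hillu
      · exact Hill.flat b
    have hle : rank v ≤ rank (lnf p q b) := by
      rcases hcand with h | h | h
      · rw [h]; exact v3.trans u3
      · rw [h]; exact v3.trans u4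
      · rw [h.2]; exact v4
    obtain ⟨e1, e2⟩ := heq hv hle
    rw [hrun] at fin ⊢
    have hlc : (apow b).length ≤ K + 2 + 2 * q := by
      rw [Int.abs_eq_natAbs] at hbq
      simp; omega
    obtain ⟨k1, k2⟩ := c1.le hlc hM
    refine fin ⟨by rw [← e1]; exact v2.1, by rw [← e2]; exact v2.2⟩ ?_ ?_ ?_ ?_
    · rw [f5.1 40 rfl, c2]; linarith
    · rw [f5.1 41 rfl, c3, abs_abs]; linarith
    · rw [f5.1 42 rfl]; exact k1
    · rw [f5.1 43 rfl]; exact k2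
  · rw [if_neg hbq] at hrun
    have hle : rank u ≤ rank (lnf p q b) := by
      rcases hcand with h | h | h
      · rw [h]; exact u3
      · rw [h]; exact u4
      · exact absurd h.1 hbq
    obtain ⟨e1, e2⟩ := heq hillu hle
    rw [hrun] at fin ⊢
    obtain ⟨k1, k2⟩ := b1.le hlen1 hM
    refine fin ⟨by rw [← e1]; exact u2.1, by rw [← e2]; exact u2.2⟩ ?_ ?_ ?_ ?_
    · rw [f3.1 40 rfl, b2]; linarith
    · rw [f3.1 41 rfl, b3, abs_abs]; linarith
    · rw [f3.1 42 rfl]; exact k1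
    · rw [f3.1 43 rfl]; exact k2

/-- One level of the recursion for the normal form of the integer in variable `30`. -/
def descendProg (p q r : ℕ) : Prog :=
  (31 ≔ vr 31 / .lit r ;; 46 ≔ vr 30 / vr 31 ;; 39 ≔ .lit p * vr 46) ;;
  selectProg q ;; (44 ≔ vr 37 ;; 45 ≔ vr 38 ;; 39 ≔ .lit p * (vr 46 + 1)) ;;
  selectProg q ;;
  (33 ≔ vr 44 ;; 34 ≔ vr 45 ;; 35 ≔ vr 37 ;; 36 ≔ vr 38 ;; 32 ≔ vr 46)

/-- Prepares the recursion. -/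
def startProg (p : ℕ) : Prog :=
  32 ≔ vr 30 / vr 31 ;;
  .ite (.less (vr 30) 0)
    (33 ≔ .lit p ;; 34 ≔ .lit (numVal (apow (-p))) ;; 35 ≔ 0 ;; 36 ≔ 0)
    (33 ≔ 0 ;; 34 ≔ 0 ;; 35 ≔ .lit p ;; 36 ≔ .lit (numVal (apow p)))

/-- The program for the normal form of the integer in variable `30`. -/
def llnfProg (p q r : ℕ) : Prog :=
  31 ≔ .lit q ;;
  .loop (1 - .less (vr 30).abs (vr 31)) (31 ≔ vr 31 * .lit r) ;;
  startProg p ;;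
  .loop (.less (.lit q) (vr 31)) (descendProg p q r) ;;
  39 ≔ vr 30 ;;
  selectProg q

theorem lnf_natCast_self {p q : ℕ} (hp : 1 ≤ p) (hpq : p < q) : lnf p q p = apow p := by
  have h0 := length_lnf_le_natAbs p q p
  rcases lnf_candidates (β := p) (M := 0) hp hpq (by simp) (by simp; omega) with h | h | h
  · have := congrArg List.length h
    simp [lnf_zero] at this
    simp at h0
    omega
  · have := congrArg List.length h
    simp at this
    omega
  · exact h.2

theorem lnf_neg_natCast_self {p q : ℕ} (hp : 1 ≤ p) (hpq : p < q) :
    lnf p q (-p) = apow (-p) := by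
  have h0 := length_lnf_le_natAbs p q (-p)
  rcases lnf_candidates (β := -p) (M := -1) hp hpq (by simp; omega) (by simp) with h | h | h
  · have := congrArg List.length h
    simp at this
    omega
  · have := congrArg List.length h
    simp [lnf_zero] at this
    simp at h0
    omega
  · exact h.2

theorem ediv_bounds {p q r : ℕ} (hq : q = p * r) (hr : 1 ≤ r) (X : ℤ) {P : ℤ} (hP : 0 ≤ P) :
    q * (X / (P * r)) ≤ p * (X / P) ∧ p * (X / P + 1) ≤ q * (X / (P * r)) + q := by
  rw [← Int.ediv_ediv_of_nonneg hP, hq]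
  have hr0 : (0 : ℤ) < r := by exact_mod_cast hr
  have h1 := Int.mul_ediv_self_le (x := X / P) hr0.ne'
  have h2 := Int.lt_mul_ediv_self_add (x := X / P) hr0
  have hp : (0 : ℤ) ≤ p := Int.natCast_nonneg p
  push_cast
  constructor <;> nlinarith

theorem mul_pow_le_four_pow {q r : ℕ} (hrq : r ≤ q) (h : ℕ) :
    (q * r ^ h : ℤ) ≤ 4 ^ (q * (h + 1)) := by
  have h1 : q < 4 ^ q := Nat.lt_pow_self (by norm_num)
  have h2 : (q : ℤ) ≤ 4 ^ q := by exact_mod_cast h1.le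
  have h3 : (r : ℤ) ≤ 4 ^ q := by exact_mod_cast hrq.trans h1.le
  rw [pow_mul, pow_succ, mul_comm]
  exact mul_le_mul (pow_le_pow_left₀ (by positivity) h3 h) h2 (by positivity) (by positivity)

theorem length_lnf_mul_le {p q r : ℕ} (hp : 1 ≤ p) (hr : 2 ≤ r) (hq : q = p * r) {h : ℕ} {m : ℤ}
    (hm : |m| ≤ q * r ^ h) : (lnf p q (p * m)).length ≤ (q + 2) * (h + p + 1) := by
  refine length_lnf_le_of_lt hp (by omega) hq (h + p) ?_
  have h1 : p < r ^ p := (Nat.lt_pow_self (by omega)).trans_le (Nat.pow_le_pow_left hr p)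
  have h1' : (p : ℤ) < r ^ p := by exact_mod_cast h1
  have h2 : (0 : ℤ) < q * r ^ h := by rw [hq]; positivity
  rw [abs_mul, Nat.abs_cast, pow_add]
  nlinarith [abs_nonneg m]

theorem descendProg_loopFree (p q r : ℕ) : (descendProg p q r).LoopFree := by
  simp [descendProg, selectProg_loopFree, Prog.LoopFree]

theorem descendProg_run {p q r : ℕ} (hp : 1 ≤ p) (hr : 2 ≤ r) (hq : q = p * r) {h : ℕ} {M : ℤ}
    (hM : 4 ^ ((q + 2) * (h + p + 1) + 2 + 2 * q) ≤ M) {s : State} (hb : Bdd M s)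
    (hP : HasPowers q s) {P : ℤ} (hP0 : 0 < P) (hX : |s.var 30| < q * r ^ h)
    (h31 : s.var 31 = P * r) (h32 : s.var 32 = s.var 30 / (P * r))
    (hw : Holds s 33 34 (lnf p q (p * s.var 32)))
    (hw' : Holds s 35 36 (lnf p q (p * (s.var 32 + 1)))) :
    let s' := (descendProg p q r).run s
    Bdd M s' ∧ s'.var 31 = P ∧ s'.var 32 = s.var 30 / P ∧
      Holds s' 33 34 (lnf p q (p * s'.var 32)) ∧
      Holds s' 35 36 (lnf p q (p * (s'.var 32 + 1))) := by
  have hpq : p < q := by rw [hq]; nlinarith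
  have hr0 : (0 : ℤ) < r := by exact_mod_cast (by omega : 0 < r)
  set X := s.var 30 with hXdef
  set m := X / P with hmdef
  have hm : |m| ≤ |X| := Int.abs_ediv_le_abs X P
  have hm0 : |s.var 32| ≤ |X| := by rw [h32]; exact Int.abs_ediv_le_abs X _
  have hs0 : ∀ x : ℤ, |x| ≤ |X| → |x + 1| ≤ q * r ^ h := fun x hx =>
    (abs_add_le x 1).trans (by rw [abs_one]; linarith)
  obtain ⟨e1, e2⟩ := ediv_bounds hq (by omega) X hP0.le
  rw [← h32, ← hmdef] at e1 e2
  have hpz : (0 : ℤ) < p := by exact_mod_cast hp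
  have hmul : ∀ x : ℤ, |x| ≤ q * r ^ h → |p * x| ≤ M := by
    intro x hx
    have h1 : p < r ^ p := (Nat.lt_pow_self (by omega)).trans_le (Nat.pow_le_pow_left hr p)
    have h1' : (p : ℤ) ≤ r ^ p := by exact_mod_cast h1.le
    have h2 := mul_pow_le_four_pow (q := q) (r := r) (by rw [hq]; nlinarith) (h + p)
    have h3 : (4 : ℤ) ^ (q * (h + p + 1)) ≤ 4 ^ ((q + 2) * (h + p + 1) + 2 + 2 * q) :=
      pow_le_pow_right₀ (by norm_num) (by nlinarith)
    have h4 : (p : ℤ) * |x| ≤ r ^ p * (q * r ^ h) :=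
      mul_le_mul h1' hx (abs_nonneg _) (by positivity)
    rw [abs_mul, Nat.abs_cast]
    rw [pow_add] at h2
    linarith [show (r : ℤ) ^ p * (q * r ^ h) = q * (r ^ h * r ^ p) by ring]
  have hone : ∀ x : ℤ, |x| ≤ |p * x| := by
    intro x
    rw [abs_mul, Nat.abs_cast]
    nlinarith [abs_nonneg x]
  have hPM : |P| ≤ M := by
    refine le_trans ?_ (hb.1 31)
    rw [h31, abs_mul, Nat.abs_cast]
    have : (1 : ℤ) ≤ r := by omega
    nlinarith [abs_nonneg P]
  have k0 : Prog.run (31 ≔ vr 31 / .lit r ;; 46 ≔ vr 30 / vr 31 ;; 39 ≔ .lit p * vr 46) s =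
      ((s.setVar 31 P).setVar 46 m).setVar 39 (p * m) := by
    simp [Prog.run, h31, Int.mul_ediv_cancel _ hr0.ne', ← hXdef, ← hmdef]
  set s1 := ((s.setVar 31 P).setVar 46 m).setVar 39 (p * m) with hs1
  have b1 : Bdd M s1 :=
    ((hb.setVar hPM 31).setVar ((hone m).trans (hmul m (hm.trans hX.le))) 46).setVar
      (hmul m (hm.trans hX.le)) 39
  have v1 : s1.var 39 = p * m := by simp [hs1]
  have v2 : s1.var 32 = s.var 32 := by simp [hs1]
  have P1 : HasPowers q s1 := hP
  obtain ⟨g1, b2⟩ := selectProg_run hp hpq P1 (M := M)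
    (by rw [v2]; exact hw.of_eq (by simp [hs1]) (by simp [hs1]))
    (by rw [v2]; exact hw'.of_eq (by simp [hs1]) (by simp [hs1]))
    (by rw [v1, v2]; exact e1) (by rw [v1, v2]; nlinarith)
    (by rw [v2]; exact length_lnf_mul_le hp hr hq (hm0.trans hX.le))
    (by rw [v2]; exact length_lnf_mul_le hp hr hq (hs0 _ hm0)) hM b1
  rw [v1] at g1
  set s2 := (selectProg q).run s1 with hs2
  have f2 : Frame (selectProg q) s1 s2 := frame_run (selectProg_loopFree q) s1
  have w46 : s2.var 46 = m := by rw [f2.1 46 rfl]; simp [hs1]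
  have k2 : Prog.run (44 ≔ vr 37 ;; 45 ≔ vr 38 ;; 39 ≔ .lit p * (vr 46 + 1)) s2 =
      ((s2.setVar 44 (s2.var 37)).setVar 45 (s2.var 38)).setVar 39 (p * (m + 1)) := by
    simp [Prog.run, w46]
  set s3 := ((s2.setVar 44 (s2.var 37)).setVar 45 (s2.var 38)).setVar 39 (p * (m + 1)) with hs3
  have b3 : Bdd M s3 :=
    ((b2.setVar (b2.1 37) 44).setVar (b2.1 38) 45).setVar (hmul _ (hs0 m hm)) 39
  have v3 : s3.var 39 = p * (m + 1) := by simp [hs3]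
  have v4 : s3.var 32 = s.var 32 := by
    rw [← v2, ← f2.1 32 rfl]; simp [hs3]
  have P3 : HasPowers q s3 := by
    intro i hi
    have := hP i hi
    rw [← this]
    simp only [hs3, State.setVar_arr, f2.2 8 rfl, hs1]
  obtain ⟨g3, b4⟩ := selectProg_run hp hpq P3 (M := M)
    (by rw [v4]; exact hw.of_eq (by simp [hs3, f2.1 33 rfl, hs1]) (by simp [hs3, f2.1 34 rfl, hs1]))
    (by rw [v4]; exact hw'.of_eq (by simp [hs3, f2.1 35 rfl, hs1]) (by simp [hs3, f2.1 36 rfl, hs1]))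
    (by rw [v3, v4]; nlinarith) (by rw [v3, v4]; exact e2)
    (by rw [v4]; exact length_lnf_mul_le hp hr hq (hm0.trans hX.le))
    (by rw [v4]; exact length_lnf_mul_le hp hr hq (hs0 _ hm0)) hM b3
  rw [v3] at g3
  set s4 := (selectProg q).run s3 with hs4
  have f4 : Frame (selectProg q) s3 s4 := frame_run (selectProg_loopFree q) s3
  have krun : (descendProg p q r).run s =
      ((((s4.setVar 33 (s2.var 37)).setVar 34 (s2.var 38)).setVar 35 (s4.var 37)).setVar 36
        (s4.var 38)).setVar 32 m := by
    have e44 : s4.var 44 = s2.var 37 := by rw [f4.1 44 rfl]; simp [hs3]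
    have e45 : s4.var 45 = s2.var 38 := by rw [f4.1 45 rfl]; simp [hs3]
    have e46 : s4.var 46 = m := by rw [f4.1 46 rfl]; simp [hs3, w46]
    have : (descendProg p q r).run s =
        Prog.run (33 ≔ vr 44 ;; 34 ≔ vr 45 ;; 35 ≔ vr 37 ;; 36 ≔ vr 38 ;; 32 ≔ vr 46) s4 := by
      rw [hs4, ← k2, hs2, ← k0]
      rfl
    rw [this]
    simp [Prog.run, e44, e45, e46]
  intro s'
  have hs' : s' = _ := krun
  refine ⟨?_, ?_, ?_, ?_, ?_⟩
  · rw [hs']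
    exact ((((b4.setVar (b2.1 37) 33).setVar (b2.1 38) 34).setVar (b4.1 37) 35).setVar (b4.1 38)
      36).setVar ((hone m).trans (hmul m (hm.trans hX.le))) 32
  · rw [hs']; simp [f4.1 31 rfl, hs3, f2.1 31 rfl, hs1]
  · rw [hs']; simp
  · rw [hs']
    exact ⟨by simpa using g1.1, by simpa using g1.2⟩
  · rw [hs']
    exact ⟨by simpa using g3.1, by simpa using g3.2⟩

theorem startProg_run {p q : ℕ} (hp : 1 ≤ p) (hpq : p < q) {s : State} (h : |s.var 30| < s.var 31)
    {M : ℤ} {h' : ℕ} (hM : 4 ^ ((q + 2) * (h' + p + 1) + 2 + 2 * q) ≤ M) (hb : Bdd M s) :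
    let s' := (startProg p).run s
    Bdd M s' ∧ s'.var 31 = s.var 31 ∧ s'.var 32 = s.var 30 / s.var 31 ∧
      Holds s' 33 34 (lnf p q (p * s'.var 32)) ∧
      Holds s' 35 36 (lnf p q (p * (s'.var 32 + 1))) := by
  have hpM : ∀ x : ℤ, |x| = p → |(p : ℤ)| ≤ M ∧ |(numVal (apow x) : ℤ)| ≤ M := by
    intro x hx
    have h1 : (apow x).length ≤ (q + 2) * (h' + p + 1) + 2 + 2 * q := by
      rw [Int.abs_eq_natAbs] at hx
      simp; omega
    have h2 : (apow x).length = p := by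
      rw [Int.abs_eq_natAbs] at hx
      simp; omega
    have := Holds.le (s := ⟨fun y => if y = 0 then p else numVal (apow x), fun _ _ => 0⟩)
      (L := 0) (V := 1) (w := apow x) ⟨by simp [h2], by simp⟩ h1 hM
    simpa using this
  have h1M : |(1 : ℤ)| ≤ M := by
    have : (1 : ℤ) ≤ 4 ^ ((q + 2) * (h' + p + 1) + 2 + 2 * q) := one_le_pow₀ (by norm_num)
    simpa using this.trans hM
  have h0M : |(0 : ℤ)| ≤ M := by simp at h1M ⊢; omega
  have hd : |s.var 30 / s.var 31| ≤ M := (Int.abs_ediv_le_abs _ _).trans (hb.1 30)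
  have hpp := hpM p (by simp)
  have hpn := hpM (-p) (by simp)
  rw [abs_lt] at h
  intro s'
  by_cases hX : s.var 30 < 0
  · have hm : s.var 30 / s.var 31 = -1 := by
      rw [Int.ediv_eq_iff_of_pos (by linarith)]
      constructor <;> linarith
    have hs' : s' = ((((s.setVar 32 (s.var 30 / s.var 31)).setVar 33 p).setVar 34
        (numVal (apow (-p)))).setVar 35 0).setVar 36 0 := by
      simp [s', startProg, Prog.run, hX]
    have v32 : s'.var 32 = -1 := by rw [hs', ← hm]; simp
    refine ⟨?_, ?_, ?_, ?_, ?_⟩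
    · rw [hs']
      exact ((((hb.setVar hd 32).setVar hpn.1 33).setVar hpn.2 34).setVar h0M 35).setVar h0M 36
    · rw [hs']; simp
    · rw [hs']; simp
    · rw [v32, mul_neg_one, lnf_neg_natCast_self hp hpq, hs']
      exact ⟨by simp, by simp⟩
    · rw [v32, neg_add_cancel, mul_zero, lnf_zero, hs']
      exact ⟨by simp, by simp⟩
  · have hm : s.var 30 / s.var 31 = 0 := Int.ediv_eq_zero_of_lt (by linarith) h.2
    have hs' : s' = ((((s.setVar 32 (s.var 30 / s.var 31)).setVar 33 0).setVar 34 0).setVar 35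
        p).setVar 36 (numVal (apow p)) := by
      simp [s', startProg, Prog.run, hX]
    have v32 : s'.var 32 = 0 := by rw [hs', ← hm]; simp
    refine ⟨?_, ?_, ?_, ?_, ?_⟩
    · rw [hs']
      exact ((((hb.setVar hd 32).setVar h0M 33).setVar h0M 34).setVar hpp.1 35).setVar hpp.2 36
    · rw [hs']; simp
    · rw [hs']; simp
    · rw [v32, mul_zero, lnf_zero, hs']
      exact ⟨by simp, by simp⟩
    · rw [v32, zero_add, mul_one, lnf_natCast_self hp hpq, hs']
      exact ⟨by simp, by simp⟩

/-- The number of steps of `llnfProg` for each level of the recursion. -/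
def llnfTime (p q r : ℕ) : ℕ :=
  (1 - .less (vr 30).abs (vr 31) : Expr).cost + (31 ≔ vr 31 * .lit r).time +
    (Expr.less (.lit q) (vr 31)).cost + (descendProg p q r).time + (selectProg q).time +
    (startProg p).time + 10

theorem llnfTime_aux (c1 c2 c3 c4 c5 c6 : ℕ) {N h : ℕ} (hN : N ≤ h) :
    2 + ((c1 + c2 + 1) * (N + 1) + (c6 + ((c3 + c4 + 1) * (N + 1) + (2 + c5)))) ≤
      (c1 + c2 + c3 + c4 + c5 + c6 + 10) * (h + 1) := by
  calc _ ≤ 2 + ((c1 + c2 + 1) * (h + 1) + (c6 + ((c3 + c4 + 1) * (h + 1) + (2 + c5)))) := by gcongr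
    _ ≤ _ := by nlinarith [Nat.zero_le (c5 * h), Nat.zero_le (c6 * h)]

theorem llnfProg_run {p q r : ℕ} (hp : 1 ≤ p) (hr : 2 ≤ r) (hq : q = p * r) {h : ℕ} {M : ℤ}
    (hM : 4 ^ ((q + 2) * (h + p + 1) + 2 + 2 * q) ≤ M) {s : State} (hb : Bdd M s)
    (hP : HasPowers q s) (hX : |s.var 30| < q * r ^ h) :
    ∃ s', Runs M (llnfProg p q r) s (llnfTime p q r * (h + 1)) s' ∧ Bdd M s' ∧
      Holds s' 37 38 (lnf p q (s.var 30)) := by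
  have hpq : p < q := by rw [hq]; nlinarith
  have hM2 : 2 ≤ M := by
    have : (4 : ℤ) ^ 1 ≤ 4 ^ ((q + 2) * (h + p + 1) + 2 + 2 * q) :=
      pow_le_pow_right₀ (by norm_num) (by omega)
    linarith
  set X := s.var 30 with hXdef
  have hex : ∃ N : ℕ, |X| < q * r ^ N := ⟨h, hX⟩
  classical
  set N := Nat.find hex with hN
  have hXN : |X| < q * r ^ N := Nat.find_spec hex
  have hNh : N ≤ h := Nat.find_min' hex hX
  have hmin : ∀ i < N, ¬ |X| < q * r ^ i := fun i hi => Nat.find_min hex hi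
  have hr0 : (0 : ℤ) < r := by exact_mod_cast (by omega : 0 < r)
  have hr1 : (1 : ℤ) ≤ r := hr0
  have hq0 : (0 : ℤ) < q := by exact_mod_cast (by omega : 0 < q)
  have hqM : ∀ i ≤ h, |(q * r ^ i : ℤ)| ≤ M := by
    intro i hi
    rw [abs_of_nonneg (by positivity)]
    have h1 : (q * r ^ i : ℤ) ≤ q * r ^ h :=
      mul_le_mul_of_nonneg_left (pow_le_pow_right₀ hr1 hi) hq0.le
    have h2 := mul_pow_le_four_pow (q := q) (r := r) (by rw [hq]; nlinarith) h
    have h3 : (4 : ℤ) ^ (q * (h + 1)) ≤ 4 ^ ((q + 2) * (h + p + 1) + 2 + 2 * q) :=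
      pow_le_pow_right₀ (by norm_num) (by nlinarith)
    linarith
  have hqM' : |(q : ℤ)| ≤ M := by simpa using hqM 0 (by omega)
  have r1 := runs_run (c := 31 ≔ .lit q) trivial hM2 hb
  have b1 : Bdd M (Prog.run (31 ≔ .lit q) s) := hb.setVar hqM' 31
  have l1 := runs_loop_const (e := 1 - .less (vr 30).abs (vr 31)) (c := 31 ≔ vr 31 * .lit r) hM2
    (fun i s' => s'.var 31 = q * r ^ i) N (31 ≔ vr 31 * .lit r).time b1 (by simp [Prog.run])
    (by
      intro i hi s' hb' hf hI
      have h30 : s'.var 30 = X := by rw [hf.1 30 rfl]; simp [Prog.run, hXdef]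
      refine ⟨by simp [h30, hI, hmin i hi], _, runs_run (by trivial) hM2 hb', ?_, ?_⟩
      · refine hb'.setVar ?_ 31
        have := hqM (i + 1) (by omega)
        rwa [pow_succ, ← mul_assoc, ← hI] at this
      · simp [Prog.run, hI, pow_succ, mul_assoc])
    (by
      intro s' hb' hf hI
      have h30 : s'.var 30 = X := by rw [hf.1 30 rfl]; simp [Prog.run, hXdef]
      simp [h30, hI, hXN])
  obtain ⟨s2, r2, b2, f2, i2⟩ := l1
  have h302 : s2.var 30 = X := by rw [f2.1 30 rfl]; simp [Prog.run, hXdef]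
  have hP2 : HasPowers q s2 := by
    intro i hi; rw [f2.2 8 rfl]; exact hP i hi
  have hsl : (startProg p).LoopFree := by simp [startProg, Prog.LoopFree]
  have r3 := runs_run hsl hM2 b2
  obtain ⟨b3, i31, i32, i33, i35⟩ := startProg_run hp hpq (h' := h) (by rw [h302, i2]; exact hXN) hM b2
  have f3 := frame_run hsl s2
  set s3 := (startProg p).run s2 with hs3
  have h303 : s3.var 30 = X := by rw [f3.1 30 rfl, h302]
  have l2 := runs_loop_const (e := .less (.lit q) (vr 31)) (c := descendProg p q r) hM2
    (fun i s' => s'.var 31 = q * r ^ (N - i) ∧ s'.var 32 = X / s'.var 31 ∧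
      Holds s' 33 34 (lnf p q (p * s'.var 32)) ∧ Holds s' 35 36 (lnf p q (p * (s'.var 32 + 1))))
    N (descendProg p q r).time b3 ⟨by rw [i31, i2]; rfl, by rw [i32, i31, h302], i33, i35⟩
    (by
      rintro i hi s' hb' hf ⟨j31, j32, j33, j35⟩
      have h30 : s'.var 30 = X := by rw [hf.1 30 rfl, h303]
      have hP' : HasPowers q s' := by
        intro i hi; rw [hf.2 8 rfl, f3.2 8 rfl]; exact hP2 i hi
      have hNi : N - i = (N - (i + 1)) + 1 := by omega
      have hPr : (q * r ^ (N - i) : ℤ) = q * r ^ (N - (i + 1)) * r := by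
        rw [hNi, pow_succ, mul_assoc]
      have hcond : (q : ℤ) < q * r ^ (N - i) := by
        have : (1 : ℤ) < r ^ (N - i) := one_lt_pow₀ (by exact_mod_cast hr) (by omega)
        nlinarith
      obtain ⟨c1, c2, c3, c4, c5⟩ := descendProg_run hp hr hq hM hb' hP'
        (P := q * r ^ (N - (i + 1))) (by positivity) (h30 ▸ hX) (by rw [j31, hPr])
        (by rw [j32, j31, hPr, h30]) j33 j35
      refine ⟨by simp [j31, hcond], _, runs_run (descendProg_loopFree p q r) hM2 hb', c1, c2, ?_,
        c4, c5⟩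
      rw [c3, c2, h30])
    (by
      rintro s' hb' hf ⟨j31, -⟩
      simp [j31])
  obtain ⟨s4, r4, b4, f4, j31, j32, j33, j35⟩ := l2
  have h304 : s4.var 30 = X := by rw [f4.1 30 rfl, h303]
  rw [Nat.sub_self, pow_zero, mul_one] at j31
  rw [j31] at j32
  have r5 := runs_run (c := 39 ≔ vr 30) trivial hM2 b4
  have b5 : Bdd M (Prog.run (39 ≔ vr 30) s4) := b4.setVar (b4.1 30) 39
  set s5 := Prog.run (39 ≔ vr 30) s4 with hs5
  have v39 : s5.var 39 = X := by simp [hs5, Prog.run, h304]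
  have v32 : s5.var 32 = X / q := by rw [← j32]; simp [hs5, Prog.run]
  have hP5 : HasPowers q s5 := by
    intro i hi; simp only [hs5, Prog.run, State.setVar_arr]
    rw [f4.2 8 rfl, f3.2 8 rfl]; exact hP2 i hi
  have hm : |X / q| ≤ |X| := Int.abs_ediv_le_abs X q
  have hm1 : |X / q + 1| ≤ q * r ^ h :=
    (abs_add_le _ 1).trans (by rw [abs_one]; linarith)
  have hd := Int.mul_ediv_add_emod X q
  have hd1 := Int.emod_nonneg X hq0.ne'
  have hd2 := Int.emod_lt_of_pos X hq0
  have h32 : s4.var 32 = s5.var 32 := by simp [hs5, Prog.run]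
  rw [h32] at j33 j35
  obtain ⟨g1, b6⟩ := selectProg_run hp hpq hP5 (M := M)
    (j33.of_eq (by simp [hs5, Prog.run]) (by simp [hs5, Prog.run]))
    (j35.of_eq (by simp [hs5, Prog.run]) (by simp [hs5, Prog.run]))
    (by rw [v39, v32]; linarith) (by rw [v39, v32]; linarith)
    (by rw [v32]; exact length_lnf_mul_le hp hr hq (hm.trans hX.le))
    (by rw [v32]; exact length_lnf_mul_le hp hr hq hm1) hM b5
  have r6 := runs_run (selectProg_loopFree q) hM2 b5
  refine ⟨_, Runs.mono (r1.seq hM2 (r2.seq hM2 (r3.seq hM2 (r4.seq hM2 (r5.seq hM2 r6))))) ?_,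
    b6, ?_⟩
  · have h4 : (Prog.assign 31 (.lit q)).time = 2 := rfl
    have h5 : (Prog.assign 39 (vr 30)).time = 2 := rfl
    rw [h4, h5]
    unfold llnfTime
    generalize (1 - .less (vr 30).abs (vr 31) : Expr).cost = c1
    generalize (31 ≔ vr 31 * .lit r).time = c2
    generalize (Expr.less (.lit q) (vr 31)).cost = c3
    generalize (descendProg p q r).time = c4
    generalize (selectProg q).time = c5
    generalize (startProg p).time = c6
    exact llnfTime_aux c1 c2 c3 c4 c5 c6 hNh
  · rwa [v39] at g1

/-! ### Sizes of temporary values -/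

/-- All variables in the expression belong to `L`. -/
def Expr.usesOnly (L : List ℕ) : Expr → Bool
  | lit _ => true
  | var x => L.contains x
  | get _ e => e.usesOnly L
  | op _ e f => e.usesOnly L && f.usesOnly L

/-- If the program reads only variables that are in `L` or have been assigned to before, the
list of `L` and the variables that are certainly assigned to. -/
def Prog.scope : List ℕ → Prog → Option (List ℕ)
  | L, skip => some L
  | L, assign x e => if e.usesOnly L then some (x :: L) else none
  | L, put _ i e => if i.usesOnly L && e.usesOnly L then some L else none
  | L, seq c d => (c.scope L).bind fun L' => d.scope L'
  | L, ite e c d => if e.usesOnly L then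
      (c.scope L).bind fun L1 => (d.scope L).map fun L2 => L1.filter L2.contains else none
  | _, loop _ _ => none

/-- The variables in `L` and all cells of arrays are bounded by `M`. -/
def Tame (L : List ℕ) (M : ℤ) (s : State) : Prop :=
  (∀ x ∈ L, |s.var x| ≤ M) ∧ ∀ A i, |s.arr A i| ≤ M

theorem Tame.eval {L : List ℕ} {M : ℤ} (hM : 2 ≤ M) {s : State} (h : Tame L M s) {e : Expr}
    (he : e.usesOnly L) : |e.eval s| ≤ M ^ e.deg := by
  classical
  set s0 : State := ⟨fun y => if y ∈ L then s.var y else 0, s.arr⟩ with hs0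
  have hb : Bdd M s0 := by
    refine ⟨fun x => ?_, h.2⟩
    simp only [hs0]
    split_ifs with hx
    · exact h.1 x hx
    · simp; omega
  have heq : ∀ e : Expr, e.usesOnly L → e.eval s0 = e.eval s := by
    intro e he
    induction e with
    | lit n => rfl
    | var x =>
      have hx : x ∈ L := by simpa [Expr.usesOnly] using he
      simp [hs0, hx]
    | get A e ih => rw [Expr.eval_get, Expr.eval_get, ih he]
    | op o e f ihe ihf =>
      simp only [Expr.usesOnly, Bool.and_eq_true] at he
      simp only [Expr.eval, ihe he.1, ihf he.2]
  rw [← heq e he]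
  exact (hb.within hM e).2

theorem Tame.mono {L L' : List ℕ} {M M' : ℤ} (h : M ≤ M') {s : State} (hs : Tame L M s)
    (hL : L' ⊆ L := by simp) : Tame L' M' s :=
  ⟨fun x hx => (hs.1 x (hL hx)).trans h, fun A i => (hs.2 A i).trans h⟩

theorem tame_run {c : Prog} {L L' : List ℕ} (hc : c.scope L = some L') {M₀ M : ℤ} (hM₀ : 2 ≤ M₀)
    {s : State} (ht : Tame L M₀ s) (hM : M₀ ^ c.deg ≤ M) (hb : Bdd M s) :
    Tame L' (M₀ ^ c.deg) (c.run s) ∧ Bdd M (c.run s) := by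
  have h1 : (1 : ℤ) ≤ M₀ := by linarith
  induction c generalizing L L' M₀ s with
  | skip => cases hc; exact ⟨by simpa [Prog.deg, Prog.run] using ht, hb⟩
  | assign x e =>
    simp only [Prog.scope, Option.ite_none_right_eq_some, Option.some.injEq] at hc
    obtain ⟨he, rfl⟩ := hc
    have hv := ht.eval hM₀ he
    have h2 : M₀ ≤ M₀ ^ e.deg := le_self_pow₀ h1 (Nat.one_le_iff_ne_zero.1 e.deg_pos)
    refine ⟨⟨fun y hy => ?_, fun A i => (ht.2 A i).trans h2⟩, hb.setVar (hv.trans hM) x⟩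
    simp only [Prog.run, State.setVar_var]
    split_ifs with hxy
    · exact hv
    · exact (ht.1 y ((List.mem_cons.1 hy).resolve_left hxy)).trans h2
  | put A i e =>
    simp only [Prog.scope, Option.ite_none_right_eq_some, Option.some.injEq, Bool.and_eq_true] at hc
    obtain ⟨⟨hi, he⟩, rfl⟩ := hc
    have h2 : M₀ ^ e.deg ≤ M₀ ^ (i.deg * e.deg) :=
      pow_le_pow_right₀ h1 (Nat.le_mul_of_pos_left _ i.deg_pos)
    have hv := (ht.eval hM₀ he).trans h2
    have h3 : M₀ ≤ M₀ ^ (i.deg * e.deg) :=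
      le_self_pow₀ h1 (Nat.one_le_iff_ne_zero.1 (Nat.mul_pos i.deg_pos e.deg_pos))
    refine ⟨⟨fun y hy => (ht.1 y hy).trans h3, fun B j => ?_⟩, hb.setArr (hv.trans hM) A _⟩
    simp only [Prog.run, State.setArr_arr]
    split_ifs
    · exact hv
    · exact (ht.2 B j).trans h3
  | seq c d ihc ihd =>
    simp only [Prog.scope, Option.bind_eq_some_iff] at hc
    obtain ⟨L1, hc, hd⟩ := hc
    have h2 : M₀ ^ c.deg ≤ M₀ ^ (c.deg * d.deg) :=
      pow_le_pow_right₀ h1 (Nat.le_mul_of_pos_right _ d.deg_pos)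
    obtain ⟨t1, b1⟩ := ihc hc hM₀ ht (h2.trans hM) hb h1
    have h3 : M₀ ≤ M₀ ^ c.deg := le_self_pow₀ h1 (Nat.one_le_iff_ne_zero.1 c.deg_pos)
    have := ihd hd (hM₀.trans h3) t1 (by rw [← pow_mul]; exact hM) b1 (h1.trans h3)
    rwa [← pow_mul] at this
  | ite e c d ihc ihd =>
    simp only [Prog.scope, Option.ite_none_right_eq_some, Option.bind_eq_some_iff,
      Option.map_eq_some_iff] at hc
    obtain ⟨-, L1, hc, L2, hd, rfl⟩ := hc
    have h4 : M₀ ^ c.deg ≤ M₀ ^ (Prog.ite e c d).deg :=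
      pow_le_pow_right₀ h1
        ((Nat.le_mul_of_pos_right _ d.deg_pos).trans (Nat.le_mul_of_pos_left _ e.deg_pos))
    have h5 : M₀ ^ d.deg ≤ M₀ ^ (Prog.ite e c d).deg :=
      pow_le_pow_right₀ h1
        ((Nat.le_mul_of_pos_left _ c.deg_pos).trans (Nat.le_mul_of_pos_left _ e.deg_pos))
    simp only [Prog.run]
    split_ifs
    · obtain ⟨t1, b1⟩ := ihc hc hM₀ ht (h4.trans hM) hb h1
      exact ⟨t1.mono h4 (List.filter_subset_self _), b1⟩
    · obtain ⟨t1, b1⟩ := ihd hd hM₀ ht (h5.trans hM) hb h1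
      refine ⟨t1.mono h5 fun x hx => ?_, b1⟩
      simpa using (List.mem_filter.1 hx).2
  | loop => simp [Prog.scope] at hc

theorem Prog.loopFree_of_scope {c : Prog} {L L' : List ℕ} (h : c.scope L = some L') :
    c.LoopFree := by
  induction c generalizing L L' with
  | seq c d ihc ihd =>
    simp only [Prog.scope, Option.bind_eq_some_iff] at h
    obtain ⟨L1, hc, hd⟩ := h
    exact ⟨ihc hc, ihd hd⟩
  | ite e c d ihc ihd =>
    simp only [Prog.scope, Option.ite_none_right_eq_some, Option.bind_eq_some_iff,
      Option.map_eq_some_iff] at h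
    obtain ⟨-, L1, hc, L2, hd, rfl⟩ := h
    exact ⟨ihc hc, ihd hd⟩
  | loop => simp [Prog.scope] at h
  | _ => trivial

/-! ### The powers of four -/

/-- Writes the powers of four to the array `8`. -/
def powersProg (q : ℕ) : Prog :=
  (.put 8 0 1 ;; 1 ≔ 0) ;;
  .loop (.less (vr 1) (.lit (2 * q))) (.put 8 (vr 1 + 1) (4 * .get 8 (vr 1)) ;; 1 ≔ vr 1 + 1)

/-- The number of steps of `powersProg`. -/
def powersTime (q : ℕ) : ℕ :=
  (.put 8 0 1 ;; 1 ≔ 0 : Prog).time + ((Expr.less (vr 1) (.lit (2 * q))).cost +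
    (.put 8 (vr 1 + 1) (4 * .get 8 (vr 1)) ;; 1 ≔ vr 1 + 1 : Prog).time + 1) * (2 * q + 1)

theorem powersProg_run {q : ℕ} {M : ℤ} {s : State} (hM : 4 ^ (2 * q + 1) ≤ M) (hb : Bdd M s) :
    ∃ s', Runs M (powersProg q) s (powersTime q) s' ∧ Bdd M s' ∧ HasPowers q s' ∧
      ∀ i, |s'.arr 8 i| ≤ max (4 ^ (2 * q)) |s.arr 8 i| := by
  have hM2 : 2 ≤ M := by
    have : (4 : ℤ) ^ 1 ≤ 4 ^ (2 * q + 1) := pow_le_pow_right₀ (by norm_num) (by omega)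
    linarith
  have hpM : ∀ i ≤ 2 * q, |(4 ^ i : ℤ)| ≤ M := by
    intro i hi
    rw [abs_of_nonneg (by positivity)]
    exact (pow_le_pow_right₀ (by norm_num) (by omega)).trans hM
  have hiM : ∀ i ≤ 2 * q, |(i : ℤ)| ≤ M := by
    intro i hi
    have h1 : i < 4 ^ i := Nat.lt_pow_self (by norm_num)
    have h2 : (i : ℤ) < 4 ^ i := by exact_mod_cast h1
    have := hpM i hi
    rw [abs_of_nonneg (by positivity)] at this ⊢
    linarith
  have h1 : |(1 : ℤ)| ≤ M := by simp; omega
  have h0 : |(0 : ℤ)| ≤ M := by simp; omega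
  have b1 : Bdd M (Prog.run (.put 8 0 1 ;; 1 ≔ 0) s) := (hb.setArr h1 8 0).setVar h0 1
  have r1 := runs_run (c := .put 8 0 1 ;; 1 ≔ 0) ⟨trivial, trivial⟩ hM2 hb
  have l := runs_loop_const (e := .less (vr 1) (.lit (2 * q)))
    (c := .put 8 (vr 1 + 1) (4 * .get 8 (vr 1)) ;; 1 ≔ vr 1 + 1) hM2
    (fun i s' => s'.var 1 = i ∧ (∀ j : ℕ, j ≤ i → s'.arr 8 j = 4 ^ j) ∧
      ∀ j, |s'.arr 8 j| ≤ max (4 ^ (2 * q)) |s.arr 8 j|) (2 * q)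
    (.put 8 (vr 1 + 1) (4 * .get 8 (vr 1)) ;; 1 ≔ vr 1 + 1 : Prog).time b1
    (by
      refine ⟨by simp [Prog.run], ?_, ?_⟩
      · intro j hj
        have : j = 0 := by omega
        simp [Prog.run, this]
      · intro j
        simp only [Prog.run, State.setVar_arr, State.setArr_arr]
        split_ifs
        · refine le_max_of_le_left ?_
          simpa using one_le_pow₀ (by norm_num : (1 : ℤ) ≤ 4)
        · exact le_max_right _ _)
    (by
      rintro i hi s' hb' hf ⟨h1, h2, h3⟩
      have h4 : s'.arr 8 i = 4 ^ i := h2 i le_rfl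
      refine ⟨by simp [h1]; exact_mod_cast hi, _, runs_run (by exact ⟨trivial, trivial⟩) hM2 hb', ?_, ?_, ?_,
        ?_⟩
      · have h5 := hpM (i + 1) (by omega)
        have h6 := hiM (i + 1) (by omega)
        refine (hb'.setArr ?_ _ _).setVar ?_ _
        · simpa [h1, h4, pow_succ, mul_comm] using h5
        · simpa [Prog.run, h1] using h6
      · simp [Prog.run, h1]
      · intro j hj
        simp only [Prog.run, State.setVar_arr, State.setArr_arr, Expr.eval_add, Expr.eval_var, h1,
          Expr.eval_one, true_and, Expr.eval_mul, Expr.eval_four, Expr.eval_get, h4]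
        split_ifs with hji
        · have : j = i + 1 := by exact_mod_cast hji
          rw [this, pow_succ, mul_comm]
        · exact h2 j (by
            have : j ≠ i + 1 := fun h => hji (by exact_mod_cast h)
            omega)
      · intro j
        simp only [Prog.run, State.setVar_arr, State.setArr_arr, Expr.eval_add, Expr.eval_var, h1,
          Expr.eval_one, true_and, Expr.eval_mul, Expr.eval_four, Expr.eval_get, h4]
        split_ifs with hji
        · refine le_max_of_le_left ?_
          rw [abs_of_nonneg (by positivity), mul_comm, ← pow_succ]
          exact pow_le_pow_right₀ (by norm_num) (by omega)
        · exact h3 j)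
    (by
      rintro s' hb' hf ⟨h1, -⟩
      simp [h1])
  obtain ⟨s', r2, b2, -, -, h3, h4⟩ := l
  exact ⟨s', r1.seq hM2 r2, b2, h3, h4⟩

/-! ### The program for the stack of a word -/

/-- The stack `l` is stored in the arrays `3` and `4`. -/
def StackIn (s : State) : List (ℤ × Stable) → Prop
  | [] => True
  | (b, θ) :: l => s.arr 3 l.length = b ∧ s.arr 4 (l.length + 1) = θ.sign ∧ StackIn s l

theorem StackIn.congr {s s' : State} {l : List (ℤ × Stable)} (h : StackIn s l)
    (h' : ∀ j : ℕ, j < l.length → s'.arr 3 j = s.arr 3 j ∧ s'.arr 4 (j + 1) = s.arr 4 (j + 1)) :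
    StackIn s' l := by
  induction l with
  | nil => trivial
  | cons y l ih =>
    obtain ⟨h1, h2, h3⟩ := h
    obtain ⟨h4, h5⟩ := h' l.length (by simp)
    exact ⟨h4.trans h1, h5.trans h2, ih h3 fun j hj => h' j (by simp; omega)⟩

theorem StackIn.suffix {s : State} {l k : List (ℤ × Stable)} (h : StackIn s l) (hk : k <:+ l) :
    StackIn s k := by
  induction l with
  | nil => rw [List.suffix_nil.1 hk]; trivial
  | cons y l ih =>
    rcases List.suffix_cons_iff.1 hk with rfl | hk
    · exact h
    · exact ih h.2.2 hk

/-- Processes one stable letter and the integer behind it. -/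
def parseBody (p q : ℕ) : Prog :=
  .ite (.less 0 (.get 1 (vr 1))) (4 ≔ .lit q ;; 5 ≔ .lit p) (4 ≔ .lit p ;; 5 ≔ .lit q) ;;
  6 ≔ vr 2 / vr 4 ;;
  .ite (.same (.get 4 (vr 3) + .get 1 (vr 1)) 0 * .same (vr 2 % vr 4) 0)
    (3 ≔ vr 3 - 1 ;; 2 ≔ .get 3 (vr 3) + vr 5 * vr 6 + .get 0 (vr 1))
    (.put 3 (vr 3) (vr 2 % vr 4) ;; 3 ≔ vr 3 + 1 ;; .put 4 (vr 3) (.get 1 (vr 1)) ;;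
      2 ≔ vr 5 * vr 6 + .get 0 (vr 1)) ;;
  1 ≔ vr 1 + 1

/-- Computes the stack of the input. -/
def parseProg (p q : ℕ) : Prog :=
  (2 ≔ .get 0 0 ;; 1 ≔ 1 ;; 3 ≔ 0) ;; .loop (1 - .less (vr 0) (vr 1)) (parseBody p q)

theorem parseBody_scope (p q : ℕ) : ∃ L, (parseBody p q).scope [0, 1, 2, 3] = some L := ⟨_, rfl⟩

theorem parseBody_run {p q : ℕ} {s : State} {l : List (ℤ × Stable)} {c α : ℤ} {θ : Stable}
    (h1 : s.arr 1 (s.var 1) = θ.sign) (h0 : s.arr 0 (s.var 1) = α) (h2 : s.var 2 = c)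
    (h3 : s.var 3 = l.length) (hl : StackIn s l) (h4 : s.arr 4 0 = 0) :
    let s' := (parseBody p q).run s
    let S := NF.step p q θ (l, c)
    s'.var 1 = s.var 1 + 1 ∧ s'.var 2 = S.2 + α ∧ s'.var 3 = S.1.length ∧ StackIn s' S.1 ∧
      s'.arr 4 0 = 0 ∧ (∀ i, s'.arr 3 i = s.arr 3 i ∨ s'.arr 3 i = c % θ.outer p q) ∧
      ∀ i, s'.arr 4 i = s.arr 4 i ∨ s'.arr 4 i = θ.sign := by
  have hpush : ∀ s', s' = (((((((s.setVar 4 (θ.outer p q)).setVar 5 (θ.inner p q)).setVar 6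
      (c / θ.outer p q)).setArr 3 l.length (c % θ.outer p q)).setVar 3 (l.length + 1)).setArr 4
      (l.length + 1) θ.sign).setVar 2 (θ.inner p q * (c / θ.outer p q) + α)).setVar 1
      (s.var 1 + 1) → s'.var 1 = s.var 1 + 1 ∧ s'.var 2 = (NF.push p q θ (l, c)).2 + α ∧
      s'.var 3 = (NF.push p q θ (l, c)).1.length ∧ StackIn s' (NF.push p q θ (l, c)).1 ∧
      s'.arr 4 0 = 0 ∧ (∀ i, s'.arr 3 i = s.arr 3 i ∨ s'.arr 3 i = c % θ.outer p q) ∧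
      ∀ i, s'.arr 4 i = s.arr 4 i ∨ s'.arr 4 i = θ.sign := by
    rintro s' rfl
    refine ⟨by simp, by simp [NF.push], by simp [NF.push], ⟨by simp, by simp, ?_⟩, ?_, ?_, ?_⟩
    · refine hl.congr fun j hj => ?_
      simp [hj.ne]
    · have : (0 : ℤ) ≠ l.length + 1 := by omega
      simp [this, h4]
    · intro i
      by_cases hi : i = l.length <;> simp [hi]
    · intro i
      by_cases hi : i = l.length + 1 <;> simp [hi]
  intro s' S
  cases l with
  | nil =>
    refine hpush s' ?_
    cases θ <;> simp [s', parseBody, Prog.run, h1, h0, h2, h3, h4, Stable.sign, Stable.outer,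
      Stable.inner]
  | cons y l =>
    obtain ⟨b, θ'⟩ := y
    obtain ⟨g1, g2, g3⟩ := hl
    by_cases hcond : θ' ≠ θ ∧ θ.outer p q ∣ c
    · have hS : S = (l, b + θ.inner p q * (c / θ.outer p q)) := if_pos hcond
      have hs' : s' = (((((s.setVar 4 (θ.outer p q)).setVar 5 (θ.inner p q)).setVar 6
          (c / θ.outer p q)).setVar 3 l.length).setVar 2
          (b + θ.inner p q * (c / θ.outer p q) + α)).setVar 1 (s.var 1 + 1) := by
        have hm := Int.emod_eq_zero_of_dvd hcond.2
        have hne := hcond.1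
        cases θ <;> cases θ' <;> simp [Stable.outer] at hm hne <;>
          simp [s', parseBody, Prog.run, h1, h0, h2, h3, g1, g2, Stable.sign, Stable.outer,
            Stable.inner, hm]
      rw [hS, hs']
      refine ⟨by simp, by simp, by simp, g3.congr fun j hj => by simp, by simp [h4], ?_, ?_⟩
      · intro i; left; simp
      · intro i; left; simp
    · have hS : S = NF.push p q θ ((b, θ') :: l, c) := if_neg hcond
      rw [hS]
      refine hpush s' ?_
      have hm : θ' = θ ∨ ¬ c % θ.outer p q = 0 := by
        rw [← Int.dvd_iff_emod_eq_zero]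
        tauto
      cases θ <;> cases θ' <;> simp [Stable.outer] at hm <;>
        simp [s', parseBody, Prog.run, h1, h0, h2, h3, g2, Stable.sign, Stable.outer,
          Stable.inner, hm]

theorem norm_concat {p q : ℕ} (hp : 1 ≤ p) (hpq : p ≤ q) (h : ℤ) (l : List (Stable × ℤ))
    (θ : Stable) (x : ℤ) : (Word.mk h (l ++ [(θ, x)])).norm p q =
      (Word.mk h l).norm p q + 1 + (lnf p q x).length := by
  simp [Word.norm, Word.len, Word.coeffs, intNorm_eq hp hpq]
  omega

theorem norm_take_le {p q : ℕ} (h : ℤ) (l : List (Stable × ℤ)) (i : ℕ) :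
    (Word.mk h (l.take i)).norm p q ≤ (Word.mk h l).norm p q := by
  conv_rhs => rw [← List.take_append_drop i l]
  simp only [Word.norm, Word.len, Word.coeffs, List.length_append, List.map_append,
    List.map_cons, List.sum_cons, List.sum_append]
  omega

theorem abs_step_le {p q : ℕ} (hp : 1 ≤ p) (hpq : p ≤ q) {S : NF} (hv : NF.Valid p q S.1)
    (θ : Stable) : |(NF.step p q θ S).2| ≤ q + q * |S.2| := by
  have h2 : |θ.inner p q * (S.2 / θ.outer p q)| ≤ q * |S.2| := by
    rw [abs_mul]
    refine mul_le_mul ?_ (Int.abs_ediv_le_abs _ _) (abs_nonneg _) (by positivity)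
    cases θ <;> simp [Stable.inner, hpq]
  have hpush : ∀ l, |(NF.push p q θ (l, S.2)).2| ≤ q + q * |S.2| := fun l => by
    simp only [NF.push]
    linarith [show (0 : ℤ) ≤ q by positivity]
  match S, hv with
  | ([], c), _ => exact hpush []
  | ((b, θ') :: l, c), hv =>
    rw [NF.step]
    split_ifs
    · have h3 : b < q := by
        refine hv.2.1.trans_le ?_
        cases θ' <;> simp [Stable.outer, hpq]
      have h4 : |b| ≤ q := by rw [abs_of_nonneg hv.1]; exact h3.le
      exact (abs_add_le _ _).trans (add_le_add h4 h2)
    · exact hpush _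

theorem abs_toNF_le {p q : ℕ} (hp : 1 ≤ p) (hpq : p ≤ q) (h : ℤ) (l : List (Stable × ℤ)) :
    |((Word.mk h l).toNF p q).2| ≤ (4 * q) ^ ((Word.mk h l).norm p q + 1) := by
  have hq : (1 : ℤ) ≤ q := by exact_mod_cast hp.trans hpq
  have key : ∀ x : ℤ, |x| ≤ (4 * q) ^ (lnf p q x).length := fun x =>
    (abs_lt_pow_lnf hpq hp x).le.trans (pow_le_pow_left₀ (by linarith) (by linarith) _)
  induction l using List.reverseRecOn with
  | nil =>
    refine (key h).trans (pow_le_pow_right₀ (by linarith) ?_)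
    simp [Word.norm, Word.len, Word.coeffs, intNorm_eq hp hpq]
  | append_singleton l x ih =>
    obtain ⟨θ, x⟩ := x
    rw [toNF_concat, norm_concat hp hpq]
    set S := (Word.mk h l).toNF p q
    set N := (Word.mk h l).norm p q
    have hv : NF.Valid p q S.1 := by
      have := nf_valid hp (hp.trans hpq) ((Word.mk h l).val p q)
      rwa [nf_val] at this
    have h1 := abs_step_le hp hpq hv θ
    have h2 := abs_lt_pow_lnf hpq hp x
    have h3 : (2 * q : ℤ) ^ (lnf p q x).length ≤ (4 * q) ^ (lnf p q x).length :=
      pow_le_pow_left₀ (by linarith) (by linarith) _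
    have h4 : (1 : ℤ) ≤ (4 * q) ^ (N + 1) := one_le_pow₀ (by linarith)
    have h5 : (1 : ℤ) ≤ (4 * q) ^ (lnf p q x).length := one_le_pow₀ (by linarith)
    rw [show N + 1 + (lnf p q x).length + 1 = (N + 1) + (lnf p q x).length + 1 by omega, pow_succ,
      pow_add]
    set A := (4 * q : ℤ) ^ (N + 1)
    set B := (4 * q : ℤ) ^ (lnf p q x).length
    have h6 := abs_add_le (NF.step p q θ S).2 x
    have h7 : A ≤ A * B := le_mul_of_one_le_right (by linarith) h5
    have h8 : B ≤ A * B := le_mul_of_one_le_left (by linarith) h4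
    have h9 : q * |S.2| ≤ q * (A * B) := mul_le_mul_of_nonneg_left (ih.trans h7) (by linarith)
    have h10 : (1 : ℤ) ≤ A * B := by linarith
    have h11 : A * B ≤ q * (A * B) := le_mul_of_one_le_left (by linarith) hq
    have h12 : (q : ℤ) ≤ q * (A * B) := le_mul_of_one_le_right (by linarith) h10
    linarith

theorem Word.inputState_coeff (v : Word) {i : ℕ} (hi : i < v.tail.length) :
    v.inputState.arr 0 (i + 1 : ℤ) = v.tail[i].2 ∧
      v.inputState.arr 1 (i + 1 : ℤ) = v.tail[i].1.sign := by
  have h : (0 : ℤ) ≤ i + 1 := by omega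
  have h' : ((i : ℤ) + 1).toNat = i + 1 := by omega
  constructor
  · simp [Word.inputState, h, h', Word.coeffs, hi]
  · simp [Word.inputState, h, h', Word.theta, hi]

/-- The number of steps of `parseProg` for each letter. -/
def parseTime (p q : ℕ) : ℕ :=
  (2 ≔ .get 0 0 ;; 1 ≔ 1 ;; 3 ≔ 0 : Prog).time +
    ((1 - .less (vr 0) (vr 1) : Expr).cost + (parseBody p q).time + 1)

theorem parseProg_run {p q : ℕ} (hp : 1 ≤ p) (hpq : p ≤ q) {v : Word} {M₀ M : ℤ} {s : State}
    (hM₀ : (4 * q) ^ (v.norm p q + 1) ≤ M₀) (hM : M₀ ^ (parseBody p q).deg ≤ M) (hb : Bdd M s)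
    (ht : ∀ A i, |s.arr A i| ≤ M₀) (hk : s.var 0 = v.len) (ha0 : s.arr 0 = v.inputState.arr 0)
    (ha1 : s.arr 1 = v.inputState.arr 1) (h40 : s.arr 4 0 = 0) :
    ∃ s', Runs M (parseProg p q) s (parseTime p q * (v.len + 1)) s' ∧ Bdd M s' ∧
      (∀ A i, |s'.arr A i| ≤ M₀) ∧ s'.var 2 = (v.toNF p q).2 ∧
      s'.var 3 = (v.toNF p q).1.length ∧ StackIn s' (v.toNF p q).1 := by
  have hq : (1 : ℤ) ≤ q := by exact_mod_cast hp.trans hpq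
  have hle : (4 * q : ℤ) ≤ M₀ :=
    (le_self_pow₀ (by linarith) (by omega)).trans hM₀
  have hM₀2 : 2 ≤ M₀ := by linarith
  have hM₀M : M₀ ≤ M :=
    (le_self_pow₀ (by linarith) (Nat.one_le_iff_ne_zero.1 (Prog.deg_pos _))).trans hM
  have hM2 : 2 ≤ M := by linarith
  have hlen : (v.len : ℤ) + 1 ≤ M₀ := by
    have h1 : v.norm p q + 1 < 2 ^ (v.norm p q + 1) := Nat.lt_two_pow_self
    have h2 : v.len ≤ v.norm p q := by simp [Word.norm]
    have h3 : (2 : ℤ) ^ (v.norm p q + 1) ≤ (4 * q) ^ (v.norm p q + 1) :=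
      pow_le_pow_left₀ (by norm_num) (by linarith) _
    have h4 : (v.norm p q : ℤ) + 1 < 2 ^ (v.norm p q + 1) := by exact_mod_cast h1
    have h5 : (v.len : ℤ) ≤ v.norm p q := by exact_mod_cast h2
    linarith
  have hcur : ∀ i, |((Word.mk v.head (v.tail.take i)).toNF p q).2| ≤ M₀ := fun i =>
    (abs_toNF_le hp hpq _ _).trans
      ((pow_le_pow_right₀ (by linarith)
        (Nat.succ_le_succ (norm_take_le (p := p) (q := q) v.head v.tail i))).trans hM₀)
  have hstart : Prog.run (2 ≔ .get 0 0 ;; 1 ≔ 1 ;; 3 ≔ 0) s =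
      ((s.setVar 2 v.head).setVar 1 1).setVar 3 0 := by
    simp [Prog.run, ha0, Word.inputState, Word.coeffs]
  have hlf : Prog.LoopFree (2 ≔ .get 0 0 ;; 1 ≔ 1 ;; 3 ≔ 0) := ⟨trivial, trivial, trivial⟩
  have r1 := runs_run hlf hM2 hb
  have b1 : Bdd M (Prog.run (2 ≔ .get 0 0 ;; 1 ≔ 1 ;; 3 ≔ 0) s) := by
    rw [hstart]
    refine ((hb.setVar ?_ 2).setVar ?_ 1).setVar ?_ 3
    · have := hb.2 0 0
      simpa [ha0, Word.inputState, Word.coeffs] using this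
    · simp; linarith
    · simp; linarith
  set s1 := Prog.run (2 ≔ .get 0 0 ;; 1 ≔ 1 ;; 3 ≔ 0) s with hs1
  have harr : s1.arr = s.arr := by rw [hstart]; simp
  obtain ⟨L, hscope⟩ := parseBody_scope p q
  have l := runs_loop_const (e := 1 - .less (vr 0) (vr 1)) (c := parseBody p q) hM2
    (fun i s' => s'.var 1 = i + 1 ∧ (∀ A i, |s'.arr A i| ≤ M₀) ∧ s'.arr 4 0 = 0 ∧
      s'.var 2 = ((Word.mk v.head (v.tail.take i)).toNF p q).2 ∧
      s'.var 3 = ((Word.mk v.head (v.tail.take i)).toNF p q).1.length ∧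
      StackIn s' ((Word.mk v.head (v.tail.take i)).toNF p q).1) v.len (parseBody p q).time b1
    (by
      refine ⟨?_, ?_, ?_, ?_, ?_, trivial⟩
      · rw [hstart]; simp
      · intro A i; rw [harr]; exact ht A i
      · rw [harr, h40]
      · rw [hstart]; simp [Word.toNF]
      · rw [hstart]; simp [Word.toNF])
    (by
      rintro i hi s' hb' hf ⟨i1, i2, i3, i4, i5, i6⟩
      have h0 : s'.var 0 = v.len := by
        rw [hf.1 0 rfl, ← hk, hstart]; simp
      have hi' : i < v.tail.length := hi
      obtain ⟨c0, c1⟩ := v.inputState_coeff hi'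
      rw [← ha0, ← harr, ← hf.2 0 rfl, ← i1] at c0
      rw [← ha1, ← harr, ← hf.2 1 rfl, ← i1] at c1
      have htake : v.tail.take (i + 1) = v.tail.take i ++ [(v.tail[i].1, v.tail[i].2)] := by
        rw [List.take_add_one]; simp [hi']
      obtain ⟨e1, e2, e3, e4, e5, e6, e7⟩ := parseBody_run c1 c0 i4 i5 i6 i3
      have hbd : Bdd M ((parseBody p q).run s') := by
        refine (tame_run hscope hM₀2 ⟨?_, i2⟩ hM hb').2
        have hilen : (i : ℤ) < v.len := by exact_mod_cast hi
        intro x hx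
        simp only [List.mem_cons, List.not_mem_nil, or_false] at hx
        rcases hx with rfl | rfl | rfl | rfl
        · rw [h0, Nat.abs_cast]; linarith
        · rw [i1, abs_of_nonneg (by positivity)]; linarith
        · rw [i4]; exact hcur i
        · rw [i5, Nat.abs_cast]
          have h1 := length_toNF_le (p := p) (q := q) (Word.mk v.head (v.tail.take i))
          have h2 : (Word.mk v.head (v.tail.take i)).len ≤ v.len := by
            simp [Word.len]
          have h3 : (((Word.mk v.head (v.tail.take i)).toNF p q).1.length : ℤ) ≤ v.len := by
            exact_mod_cast h1.trans h2
          linarith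
      have hfb := frame_run (Prog.loopFree_of_scope hscope) s'
      refine ⟨?_, _, runs_run (Prog.loopFree_of_scope hscope) hM2 hb', hbd, ?_, ?_, e5, ?_, ?_, ?_⟩
      · have : ¬ (v.len : ℤ) < i + 1 := by
          have : (i : ℤ) < v.len := by exact_mod_cast hi
          omega
        simp [h0, i1, this]
      · rw [e1, i1]; push_cast; ring
      · intro A j
        by_cases hA3 : A = 3
        · subst hA3
          rcases e6 j with h | h
          · rw [h]; exact i2 3 j
          · have h1 := Stable.outer_pos hp (hp.trans hpq) v.tail[i].1
            have h2 : (v.tail[i].1).outer p q ≤ q := by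
              cases v.tail[i].1 <;> simp [Stable.outer, hpq]
            rw [h, abs_of_nonneg (Int.emod_nonneg _ h1.ne')]
            linarith [Int.emod_lt_of_pos
              ((Word.mk v.head (v.tail.take i)).toNF p q).2 h1]
        · by_cases hA4 : A = 4
          · subst hA4
            rcases e7 j with h | h
            · rw [h]; exact i2 4 j
            · rw [h]
              cases v.tail[i].1 <;> simp [Stable.sign] <;> linarith
          · have : (parseBody p q).writesArr A = false := by
              simp [parseBody, Prog.writesArr, hA3, hA4]
            rw [hfb.2 A this]
            exact i2 A j
      · rw [e2, htake, toNF_concat]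
      · rw [e3, htake, toNF_concat]
      · rw [htake, toNF_concat]; exact e4)
    (by
      rintro s' hb' hf ⟨i1, -⟩
      have h0 : s'.var 0 = v.len := by
        rw [hf.1 0 rfl, ← hk, hstart]; simp
      simp [h0, i1])
  obtain ⟨s', r2, b2, -, -, j2, -, j4, j5, j6⟩ := l
  rw [List.take_of_length_le (by exact le_rfl)] at j4 j5 j6
  refine ⟨s', (r1.seq hM2 r2).mono ?_, b2, j2, j4, j5, j6⟩
  unfold parseTime
  generalize Prog.time _ = c1
  generalize (_ + (parseBody p q).time + 1) = c2
  nlinarith [Nat.zero_le (c1 * v.len)]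

/-! ### Dynamic programming for the runs over a stack -/

/-- The regions of the table for the carries of a run, from the top to the bottom: the number of
the region, and its width. -/
def regions (r : ℕ) : List (ℤ × Stable) → List (ℕ × ℕ)
  | [] => [(0, 0)]
  | (_, .T) :: bs => match regions r bs with
    | (_, w) :: R => (0, 0) :: (bs.length + 1, w + 2 * r) :: R
    | [] => []
  | (_, .t) :: bs => match regions r bs with
    | (_, w) :: (_, u) :: R => (bs.length + 1, u + 2 + w / r) :: R
    | _ => []

/-- The table `a` has entries for the list of carries; the number is the sum of the entries, each
decreased by one. -/
inductive Config (a : ℤ → ℤ) (S : ℤ) : List (ℕ × ℕ) → List ℤ → ℤ → Prop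
  | nil : Config a S [] [] 0
  | cons {R : List (ℕ × ℕ)} {σ : List ℤ} {κ z : ℤ} {e w : ℕ} (hz : |z| ≤ w)
      (ha : 0 < a (e * S + z)) (h : Config a S R σ κ) :
      Config a S ((e, w) :: R) (z :: σ) (κ + (a (e * S + z) - 1))

theorem Config.congr {a a' : ℤ → ℤ} {S : ℤ} {R : List (ℕ × ℕ)} {σ : List ℤ} {κ : ℤ}
    (h : Config a S R σ κ)
    (h' : ∀ y ∈ R, ∀ z : ℤ, |z| ≤ y.2 → a' (y.1 * S + z) = a (y.1 * S + z)) :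
    Config a' S R σ κ := by
  induction h with
  | nil => exact .nil
  | @cons R σ κ z e w hz ha h ih =>
    have h1 := h' (e, w) (by simp) z hz
    simp only at h1
    rw [← h1] at ha ⊢
    exact .cons hz ha (ih fun y hy => h' y (by simp [hy]))

/-- An entry `v` for the cell `c` of the new region at `nb`. The entry is obtained from the
entries for the carries `z` and `y` in the regions at `eb` and `pb` by choosing the integer `x`. -/
structure Cand (p q : ℕ) (P b Dn pw : ℤ) (w u : ℕ) (eb pb nb : ℤ) (a : ℤ → ℤ)
    (x y z c v : ℤ) : Prop where
  hx : |x| < q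
  hy : |y| ≤ u
  hz : |z| ≤ w
  posz : 0 < a (eb + z)
  posy : 0 < a (pb + y)
  dvd : P ∣ x - b + p * z
  hc : c = nb + y + (x - b + p * z) / P
  hv : v = a (eb + z) + a (pb + y) - 1 + |x| * Dn + digit x * pw

/-- `a'` is obtained from `a` by filling the region at `nb`. -/
structure Relaxed (p q : ℕ) (P b Dn pw : ℤ) (w u : ℕ) (eb pb nb : ℤ) (W : ℤ) (a a' : ℤ → ℤ) :
    Prop where
  far : ∀ c, W < |c - nb| → a' c = a c
  sound : ∀ c, |c - nb| ≤ W → a' c ≠ 0 → ∃ x y z, Cand p q P b Dn pw w u eb pb nb a x y z c (a' c)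
  complete : ∀ x y z c v, Cand p q P b Dn pw w u eb pb nb a x y z c v → 0 < a' c ∧ a' c ≤ v

/-- A bound for the entries of the table. -/
def cap (q n j : ℕ) : ℤ := 2 ^ j * (1 + 3 * q * (2 * q) ^ n) - 3 * q * (2 * q) ^ n

/-- The table `a` describes the runs over `bs`. -/
structure TableFor (p q r n : ℕ) (S : ℤ) (bs : List (ℤ × Stable)) (a : ℤ → ℤ) : Prop where
  zero : a 0 = 1
  nonneg : ∀ c, 0 ≤ a c
  le_cap : ∀ c, a c ≤ cap q n bs.length
  fresh : ∀ c, a c ≠ 0 → 2 * c < (2 * bs.length + 1) * S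
  sound : ∀ σ κ, Config a S (regions r bs) σ κ →
    ∃ xs, ZRun p q bs xs σ ∧ (∀ x ∈ xs, |x| < q) ∧ κ = key q n xs
  complete : ∀ xs σ, ZRun p q bs xs σ → (∀ x ∈ xs, |x| < q) →
    ∃ κ, Config a S (regions r bs) σ κ ∧ κ ≤ key q n xs

/-- A stride that separates the regions. -/
def stride (r n : ℕ) : ℤ := (4 * r + 5) * (n + 1)

theorem regions_le (r : ℕ) (bs : List (ℤ × Stable)) :
    (∀ y ∈ regions r bs, y.1 ≤ bs.length) ∧
      ((regions r bs).map Prod.snd).sum ≤ (2 * r + 2) * bs.length := by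
  induction bs with
  | nil => simp [regions]
  | cons y bs ih =>
    obtain ⟨b, θ⟩ := y
    obtain ⟨h1, h2⟩ := ih
    rw [List.length_cons, mul_add_one]
    rcases hR : regions r bs with _ | ⟨⟨e, w⟩, _ | ⟨⟨f, u⟩, R⟩⟩ <;> rw [hR] at h1 h2 <;>
      cases θ <;> simp only [regions, hR, List.map_cons, List.map_nil, List.sum_cons, List.sum_nil,
        List.forall_mem_cons, List.not_mem_nil, false_imp_iff, implies_true,
        and_true, zero_le, true_and, le_refl] at h1 h2 ⊢
    · omega
    · have := Nat.div_le_self w r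
      exact ⟨fun y hy => (h1.2.2 y hy).trans (by omega), by omega⟩
    · exact ⟨⟨by omega, fun y hy => (h1.2.2 y hy).trans (by omega)⟩, by omega⟩

theorem width_le {r : ℕ} {bs : List (ℤ × Stable)} {y : ℕ × ℕ} (h : y ∈ regions r bs) :
    y.2 ≤ (2 * r + 2) * bs.length :=
  (List.single_le_sum (by simp) _ (List.mem_map_of_mem h)).trans (regions_le r bs).2

theorem stride_pos (r n : ℕ) : 0 < stride r n := by unfold stride; positivity

theorem stride_gt {r n : ℕ} {W : ℤ} {j : ℕ} (hj : j ≤ n) (hW : W ≤ (2 * r + 2) * j) :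
    2 * W < stride r n := by
  unfold stride
  have : (j : ℤ) ≤ n := by exact_mod_cast hj
  nlinarith

theorem far_of_mem {r n : ℕ} {bs : List (ℤ × Stable)} (hn : bs.length < n) {y : ℕ × ℕ}
    (hy : y ∈ regions r bs) {z : ℤ} (hz : |z| ≤ y.2) {W : ℤ}
    (hW : W ≤ (2 * r + 2) * (bs.length + 1)) :
    W < |y.1 * stride r n + z - (bs.length + 1) * stride r n| := by
  have h1 := (regions_le r bs).1 y hy
  have h2 := width_le hy
  have h3 : (y.1 : ℤ) ≤ bs.length := by exact_mod_cast h1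
  have h4 : (y.2 : ℤ) ≤ (2 * r + 2) * bs.length := by exact_mod_cast h2
  have h5 := stride_gt (r := r) (n := n) (W := (2 * r + 2) * (bs.length + 1)) (j := bs.length + 1) hn
    (by push_cast; exact le_rfl)
  have h6 := stride_pos r n
  have h7 : |z| ≤ (2 * r + 2) * bs.length := hz.trans h4
  have h8 := (abs_le.1 h7).2
  rw [abs_sub_comm]
  refine lt_of_lt_of_le ?_ (le_abs_self _)
  nlinarith

theorem key_cons {q n : ℕ} (x : ℤ) {xs : List ℤ} (h : xs.length < n) :
    (key q n (x :: xs) : ℤ) =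
      key q n xs + (|x| * (2 * q) ^ n + digit x * (2 * q) ^ (n - (xs.length + 1))) := by
  have h1 : n - xs.length = n - (xs.length + 1) + 1 := by omega
  simp only [key, absSum, digits, List.map_cons, List.sum_cons, List.length_cons, h1, pow_succ]
  push_cast
  ring

theorem abs_quotient_down {p q r : ℕ} (hp : 1 ≤ p) (hq : q = p * r) {x b z m : ℤ} {w : ℕ}
    (hx : |x| < q) (hb0 : 0 ≤ b) (hb : b < p) (hz : |z| ≤ w) (h : x - b + p * z = p * m) :
    |m| ≤ w + 2 * r := by
  have hpz : (0 : ℤ) < p := by exact_mod_cast hp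
  have hqz : (q : ℤ) = p * r := by exact_mod_cast hq
  rw [abs_lt] at hx
  rw [abs_le] at hz ⊢
  have hr : (1 : ℤ) ≤ r := by
    by_contra hr
    have : (r : ℤ) = 0 := by omega
    rw [this, mul_zero] at hqz
    omega
  constructor
  · by_contra hc
    have h1 : m - z + 2 * r ≤ -1 := by linarith
    nlinarith
  · by_contra hc
    have h1 : 1 ≤ m - z - 2 * r := by linarith
    nlinarith

theorem abs_quotient_up {p q r : ℕ} (hp : 1 ≤ p) (hr : 1 ≤ r) (hq : q = p * r) {x b z m : ℤ}
    {w : ℕ} (hx : |x| < q) (hb0 : 0 ≤ b) (hb : b < q) (hz : |z| ≤ w)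
    (h : x - b + p * z = q * m) : |m| ≤ 2 + (w / r : ℕ) := by
  have hpz : (0 : ℤ) < p := by exact_mod_cast hp
  have hqz : (q : ℤ) = p * r := by exact_mod_cast hq
  have h1 : (q : ℤ) * |m| < 2 * q + p * w := by
    have h2 : |(q : ℤ) * m| = q * |m| := by rw [abs_mul, Nat.abs_cast]
    rw [← h2, ← h]
    have h3 := abs_add_le (x - b) (p * z)
    have h4 := abs_sub x b
    have h5 : |(p : ℤ) * z| ≤ p * w := by
      rw [abs_mul, Nat.abs_cast]
      exact mul_le_mul_of_nonneg_left hz hpz.le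
    have h6 : |b| < q := by rw [abs_of_nonneg hb0]; exact hb
    linarith
  rw [hqz] at h1
  have h2 : (r : ℤ) * |m| < 2 * r + w := by nlinarith
  obtain ⟨k, hk⟩ : ∃ k : ℕ, |m| = k := ⟨m.natAbs, Int.abs_eq_natAbs m⟩
  rw [hk] at h2 ⊢
  have h3 : r * k < 2 * r + w := by exact_mod_cast h2
  have h4 : k ≤ 2 + w / r := by
    by_contra hc
    have h5 : w / r < k - 2 := by omega
    rw [Nat.div_lt_iff_lt_mul (by omega), Nat.sub_mul] at h5
    have h6 : k * r = r * k := mul_comm _ _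
    omega
  exact_mod_cast h4

theorem cand_value_le {p q : ℕ} {P b : ℤ} {w u n j : ℕ} {eb pb nb : ℤ} {a : ℤ → ℤ} {x y z c v : ℤ}
    (hj : j < n) (ha : ∀ c, a c ≤ cap q n j)
    (h : Cand p q P b ((2 * q) ^ n) ((2 * q) ^ (n - (j + 1))) w u eb pb nb a x y z c v) :
    0 < v ∧ v ≤ cap q n (j + 1) := by
  obtain ⟨hx, -, -, h1, h2, -, -, hv⟩ := h
  have hq1 : (1 : ℤ) ≤ q := by have := abs_nonneg x; omega
  have hd : (digit x : ℤ) ≤ 2 * q := by exact_mod_cast (digit_lt hx).le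
  have hpw : (1 : ℤ) ≤ (2 * q : ℤ) ^ (n - (j + 1)) := one_le_pow₀ (by linarith)
  have hpw' : (2 * q : ℤ) ^ (n - (j + 1)) ≤ (2 * q) ^ n := pow_le_pow_right₀ (by linarith) (by omega)
  have h3 : |x| * (2 * q : ℤ) ^ n ≤ q * (2 * q) ^ n :=
    mul_le_mul_of_nonneg_right hx.le (by linarith)
  have h4 : digit x * (2 * q : ℤ) ^ (n - (j + 1)) ≤ 2 * q * (2 * q) ^ n :=
    mul_le_mul hd hpw' (by linarith) (by linarith)
  have h5 : 0 ≤ |x| * (2 * q : ℤ) ^ n := mul_nonneg (abs_nonneg x) (by linarith)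
  have h6 : 0 ≤ digit x * (2 * q : ℤ) ^ (n - (j + 1)) :=
    mul_nonneg (by positivity) (by linarith)
  refine ⟨by linarith, ?_⟩
  have h7 := ha (eb + z)
  have h8 := ha (pb + y)
  have h9 : (1 : ℤ) ≤ 2 ^ j := one_le_pow₀ (by norm_num)
  have h10 : (0 : ℤ) ≤ 3 * q * (2 * q) ^ n := by positivity
  unfold cap at *
  rw [pow_succ]
  linarith

/-- The properties of a table that do not depend on the kind of the new region. -/
theorem TableFor.basic {p q r n : ℕ} {bs : List (ℤ × Stable)} {a a' : ℤ → ℤ}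
    (h : TableFor p q r n (stride r n) bs a) (hn : bs.length < n) {P b : ℤ} {w u : ℕ} {eb pb W : ℤ}
    (hW : W ≤ (2 * r + 2) * (bs.length + 1))
    (hr : Relaxed p q P b ((2 * q) ^ n) ((2 * q) ^ (n - (bs.length + 1))) w u eb pb
      ((bs.length + 1) * stride r n) W a a') :
    a' 0 = 1 ∧ (∀ c, 0 ≤ a' c) ∧ (∀ c, a' c ≤ cap q n (bs.length + 1)) ∧
      ∀ c, a' c ≠ 0 → 2 * c < (2 * ((bs.length + 1 : ℕ) : ℤ) + 1) * stride r n := by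
  have hS := stride_pos r n
  have hWS := stride_gt (r := r) (n := n) (W := W) (j := bs.length + 1) hn (by push_cast; exact hW)
  have hcap : cap q n bs.length ≤ cap q n (bs.length + 1) := by
    unfold cap
    rw [pow_succ]
    have : (0 : ℤ) ≤ 2 ^ bs.length * (1 + 3 * q * (2 * q) ^ n) := by positivity
    linarith
  have hcap0 : 0 ≤ cap q n (bs.length + 1) := by
    have := h.le_cap 0
    rw [h.zero] at this
    linarith
  refine ⟨?_, fun c => ?_, fun c => ?_, fun c hc => ?_⟩
  · rw [hr.far 0, h.zero]
    rw [zero_sub, abs_neg]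
    refine lt_of_lt_of_le ?_ (le_abs_self _)
    nlinarith
  · by_cases hc : |c - (bs.length + 1) * stride r n| ≤ W
    · by_cases h0 : a' c = 0
      · exact h0.ge
      · obtain ⟨x, y, z, hcand⟩ := hr.sound c hc h0
        exact (cand_value_le hn h.le_cap hcand).1.le
    · rw [hr.far c (not_le.1 hc)]; exact h.nonneg c
  · by_cases hc : |c - (bs.length + 1) * stride r n| ≤ W
    · by_cases h0 : a' c = 0
      · rw [h0]; exact hcap0
      · obtain ⟨x, y, z, hcand⟩ := hr.sound c hc h0
        exact (cand_value_le hn h.le_cap hcand).2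
    · rw [hr.far c (not_le.1 hc)]; exact (h.le_cap c).trans hcap
  · push_cast
    by_cases hc' : |c - (bs.length + 1) * stride r n| ≤ W
    · have := (abs_le.1 hc').2
      nlinarith
    · rw [hr.far c (not_le.1 hc')] at hc
      have := h.fresh c hc
      nlinarith

theorem TableFor.nil {p q r n : ℕ} {a : ℤ → ℤ} (h : ∀ c, a c = if c = 0 then 1 else 0) :
    TableFor p q r n (stride r n) [] a := by
  refine ⟨by simp [h], fun c => ?_, fun c => ?_, fun c hc => ?_, ?_, ?_⟩
  · rw [h]; split_ifs <;> simp
  · rw [h]; unfold cap; split_ifs <;> simp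
  · have : c = 0 := by
      by_contra h0
      exact hc (by simp [h, h0])
    simpa [this] using stride_pos r n
  · intro σ κ hc
    rcases hc with _ | @⟨_, _, κ, z, _, _, hz, ha, hc⟩
    rcases hc with _ | _
    have : z = 0 := by simpa using hz
    subst this
    exact ⟨[], .nil, by simp, by simp [h, key, absSum, digits]⟩
  · intro xs σ hrun hx
    cases hrun
    refine ⟨_, .cons (by simp) (by simp [h]) .nil, by simp [h]⟩

theorem TableFor.down {p q r n : ℕ} (hp : 1 ≤ p) (hq : q = p * r) {bs : List (ℤ × Stable)}
    {a a' : ℤ → ℤ} (h : TableFor p q r n (stride r n) bs a) (hn : bs.length < n) {b : ℤ}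
    (hb0 : 0 ≤ b) (hb : b < p) {e w : ℕ} {R : List (ℕ × ℕ)} (hR : regions r bs = (e, w) :: R)
    (hr : Relaxed p q p b ((2 * q) ^ n) ((2 * q) ^ (n - (bs.length + 1))) w 0 (e * stride r n) 0
      ((bs.length + 1) * stride r n) (w + 2 * r) a a') :
    TableFor p q r n (stride r n) ((b, .T) :: bs) a' := by
  have hpz : (p : ℤ) ≠ 0 := by exact_mod_cast (by omega : p ≠ 0)
  have hw : w ≤ (2 * r + 2) * bs.length := width_le (y := (e, w)) (by rw [hR]; simp)
  have hwz : (w : ℤ) ≤ (2 * r + 2) * bs.length := by exact_mod_cast hw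
  have hW : (w + 2 * r : ℤ) ≤ (2 * r + 2) * (bs.length + 1) := by linarith
  obtain ⟨h1, h2, h3, h4⟩ := h.basic hn hW hr
  have hfar : ∀ y ∈ R, ∀ z : ℤ, |z| ≤ y.2 →
      a' (y.1 * stride r n + z) = a (y.1 * stride r n + z) := fun y hy z hz =>
    hr.far _ (far_of_mem hn (by rw [hR]; exact List.mem_cons_of_mem _ hy) hz hW)
  have hreg : regions r ((b, .T) :: bs) = (0, 0) :: (bs.length + 1, w + 2 * r) :: R := by
    simp [regions, hR]
  refine ⟨h1, h2, h3, h4, ?_, ?_⟩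
  · intro σ κ hc
    rw [hreg] at hc
    rcases hc with _ | @⟨_, _, _, z0, _, _, hz0, ha0, hc⟩
    rcases hc with _ | @⟨_, τ, κ, z', _, _, hz', ha', hc⟩
    have : z0 = 0 := by simpa using hz0
    subst this
    push_cast at ha' hz' ⊢
    obtain ⟨x, y, z, hcand⟩ := hr.sound _ (by rw [add_sub_cancel_left]; exact hz') ha'.ne'
    have hy : y = 0 := by simpa using hcand.hy
    subst hy
    have hc' : Config a (stride r n) R τ κ := hc.congr fun y hy z hz => (hfar y hy z hz).symm
    have hcfg := Config.cons hcand.hz hcand.posz hc'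
    rw [← hR] at hcfg
    obtain ⟨xs, hrun, hxs, hkey⟩ := h.sound _ _ hcfg
    refine ⟨x :: xs, .down hrun b x z' ?_, ?_, ?_⟩
    · have h5 := Int.mul_ediv_cancel' hcand.dvd
      have h6 := hcand.hc
      rw [add_zero, add_left_cancel_iff] at h6
      rw [h6, h5]
    · exact List.forall_mem_cons.2 ⟨hcand.hx, hxs⟩
    · have hlen := hrun.length_eq
      rw [key_cons x (by omega), ← hkey, hcand.hv, hlen]
      simp only [add_zero, zero_mul, h.zero, h1]
      ring
  · intro xs σ hrun hxs
    rcases hrun with _ | @⟨_, xs, τ, z, hrun, _, x, z', heq⟩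
    rw [List.forall_mem_cons] at hxs
    obtain ⟨κ, hc, hκ⟩ := h.complete xs (z :: τ) hrun hxs.2
    rw [hR] at hc
    rcases hc with _ | @⟨_, _, κ, _, _, _, hz, ha, hc⟩
    have hcand : Cand p q p b ((2 * q) ^ n) ((2 * q) ^ (n - (bs.length + 1))) w 0 (e * stride r n) 0
        ((bs.length + 1) * stride r n) a x 0 z ((bs.length + 1) * stride r n + z') _ :=
      ⟨hxs.1, by simp, hz, ha, by simp [h.zero], ⟨z', heq⟩, by
        rw [heq, Int.mul_ediv_cancel_left _ hpz, add_zero], rfl⟩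
    obtain ⟨h5, h6⟩ := hr.complete _ _ _ _ _ hcand
    have hz' := abs_quotient_down hp hq hxs.1 hb0 hb hz heq
    have hc' : Config a' (stride r n) R τ κ := hc.congr hfar
    have hcfg := Config.cons (a := a') (S := stride r n) (e := 0) (w := 0) (z := 0) (by simp)
      (by simp [h1]) (Config.cons (e := bs.length + 1) (w := w + 2 * r) (z := z')
        (by push_cast; exact hz') (by push_cast; exact h5) hc')
    rw [← hreg] at hcfg
    refine ⟨_, hcfg, ?_⟩
    have hlen := hrun.length_eq
    rw [key_cons x (by omega), hlen]
    push_cast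
    rw [zero_mul, zero_add, h1]
    rw [zero_add, h.zero] at h6
    linarith

theorem TableFor.up {p q r n : ℕ} (hp : 1 ≤ p) (hr1 : 1 ≤ r) (hq : q = p * r)
    {bs : List (ℤ × Stable)}
    {a a' : ℤ → ℤ} (h : TableFor p q r n (stride r n) bs a) (hn : bs.length < n) {b : ℤ}
    (hb0 : 0 ≤ b) (hb : b < q) {e w f u : ℕ} {R : List (ℕ × ℕ)}
    (hR : regions r bs = (e, w) :: (f, u) :: R)
    (hr : Relaxed p q q b ((2 * q) ^ n) ((2 * q) ^ (n - (bs.length + 1))) w u (e * stride r n)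
      (f * stride r n) ((bs.length + 1) * stride r n) (u + 2 + (w / r : ℕ)) a a') :
    TableFor p q r n (stride r n) ((b, .t) :: bs) a' := by
  have hqz : (q : ℤ) ≠ 0 := by
    rw [hq]
    exact_mod_cast (Nat.mul_pos hp hr1).ne'
  have hw : u + 2 + w / r ≤ (2 * r + 2) * (bs.length + 1) := by
    have h1 := (regions_le r bs).2
    rw [hR] at h1
    simp only [List.map_cons, List.sum_cons] at h1
    have h2 := Nat.div_le_self w r
    rw [mul_add_one]
    omega
  have hW : (u + 2 + (w / r : ℕ) : ℤ) ≤ (2 * r + 2) * (bs.length + 1) := by exact_mod_cast hw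
  obtain ⟨h1, h2, h3, h4⟩ := h.basic hn hW hr
  have hfar : ∀ y ∈ R, ∀ z : ℤ, |z| ≤ y.2 →
      a' (y.1 * stride r n + z) = a (y.1 * stride r n + z) := fun y hy z hz =>
    hr.far _ (far_of_mem hn (by rw [hR]; simp [hy]) hz hW)
  have hreg : regions r ((b, .t) :: bs) = (bs.length + 1, u + 2 + w / r) :: R := by
    simp [regions, hR]
  refine ⟨h1, h2, h3, h4, ?_, ?_⟩
  · intro σ κ hc
    rw [hreg] at hc
    rcases hc with _ | @⟨_, τ, κ, z', _, _, hz', ha', hc⟩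
    push_cast at ha' hz' ⊢
    obtain ⟨x, y, z, hcand⟩ := hr.sound _ (by rw [add_sub_cancel_left]; push_cast; exact hz') ha'.ne'
    have hc' : Config a (stride r n) R τ κ := hc.congr fun y hy z hz => (hfar y hy z hz).symm
    have hcfg := Config.cons hcand.hz hcand.posz (Config.cons hcand.hy hcand.posy hc')
    rw [← hR] at hcfg
    obtain ⟨xs, hrun, hxs, hkey⟩ := h.sound _ _ hcfg
    have h5 := Int.mul_ediv_cancel' hcand.dvd
    have h6 := hcand.hc
    rw [add_assoc, add_left_cancel_iff] at h6
    refine ⟨x :: xs, ?_, ?_, ?_⟩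
    · rw [h6]
      exact .up hrun b x _ h5.symm
    · exact List.forall_mem_cons.2 ⟨hcand.hx, hxs⟩
    · have hlen := hrun.length_eq
      rw [key_cons x (by omega), ← hkey, hcand.hv, hlen]
      ring
  · intro xs σ hrun hxs
    rcases hrun with _ | _ | @⟨_, xs, τ, z, y, hrun, _, x, c, heq⟩
    rw [List.forall_mem_cons] at hxs
    obtain ⟨κ, hc, hκ⟩ := h.complete xs (z :: y :: τ) hrun hxs.2
    rw [hR] at hc
    rcases hc with _ | @⟨_, _, _, _, _, _, hz, ha, hc⟩
    rcases hc with _ | @⟨_, _, κ, _, _, _, hy, hay, hc⟩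
    have hcand : Cand p q q b ((2 * q) ^ n) ((2 * q) ^ (n - (bs.length + 1))) w u (e * stride r n)
        (f * stride r n) ((bs.length + 1) * stride r n) a x y z
        ((bs.length + 1) * stride r n + (y + c)) _ :=
      ⟨hxs.1, hy, hz, ha, hay, ⟨c, heq⟩, by
        rw [heq, Int.mul_ediv_cancel_left _ hqz, add_assoc], rfl⟩
    obtain ⟨h5, h6⟩ := hr.complete _ _ _ _ _ hcand
    have hc2 := abs_quotient_up hp hr1 hq hxs.1 hb0 hb hz heq
    have hz' : |y + c| ≤ ((u + 2 + w / r : ℕ) : ℤ) := by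
      have := abs_add_le y c
      push_cast at hc2 ⊢
      linarith
    have hc' : Config a' (stride r n) R τ κ := hc.congr hfar
    have hcfg := Config.cons (a := a') (S := stride r n) (e := bs.length + 1) hz'
      (by push_cast; exact h5) hc'
    rw [← hreg] at hcfg
    refine ⟨_, hcfg, ?_⟩
    have hlen := hrun.length_eq
    rw [key_cons x (by omega), hlen]
    push_cast
    linarith

/-! ### The program for one region of the table -/

/-- The value of a candidate. -/
def candExpr : Expr :=
  .get 5 (vr 13 + vr 22) + .get 5 (vr 15 + vr 21) - 1 + (vr 20).abs * vr 9 +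
    (2 * (vr 20).abs - .less 0 (vr 20)) * vr 8

/-- The integer and the carries with the number in variable `18`. -/
def decodeProg (p q : ℕ) : Prog :=
  20 ≔ vr 18 % .lit (2 * q - 1) - .lit (q - 1) ;;
  21 ≔ vr 18 / .lit (2 * q - 1) % (2 * vr 16 + 1) - vr 16 ;;
  22 ≔ vr 18 / .lit (2 * q - 1) / (2 * vr 16 + 1) - vr 14 ;;
  23 ≔ vr 20 - vr 12 + .lit p * vr 22

/-- Processes one candidate. -/
def relaxBody (p q : ℕ) : Prog :=
  decodeProg p q ;;
  .ite (.less 0 (.get 5 (vr 13 + vr 22)) * .less 0 (.get 5 (vr 15 + vr 21)) *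
      .same (vr 23 % vr 4) 0)
    (24 ≔ vr 17 + vr 21 + vr 23 / vr 4 ;; 25 ≔ candExpr ;;
      .ite (.less 0 (.get 5 (vr 24)) * .less (.get 5 (vr 24)) (vr 25)) .skip
        (.put 5 (vr 24) (vr 25)))
    .skip ;;
  18 ≔ vr 18 + 1

/-- Processes all candidates. -/
def relaxProg (p q : ℕ) : Prog := .loop (.less (vr 18) (vr 19)) (relaxBody p q)

theorem relaxBody_scope (p q : ℕ) :
    ∃ L, (relaxBody p q).scope [4, 8, 9, 12, 13, 14, 15, 16, 17, 18] = some L := ⟨_, rfl⟩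

theorem digit_eq (x : ℤ) : (digit x : ℤ) = 2 * |x| - if 0 < x then 1 else 0 := by
  unfold digit
  rw [Int.abs_eq_natAbs]
  split_ifs <;> omega

theorem relaxBody_run {p q w u : ℕ} {P b Dn pw eb pb nb : ℤ} {s : State} (h4 : s.var 4 = P)
    (h8 : s.var 8 = pw) (h9 : s.var 9 = Dn) (h12 : s.var 12 = b) (h13 : s.var 13 = eb)
    (h14 : s.var 14 = w) (h15 : s.var 15 = pb) (h16 : s.var 16 = u) (h17 : s.var 17 = nb)
    {i x y z : ℤ} (h18 : s.var 18 = i) (hx : x = i % (2 * q - 1) - (q - 1))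
    (hy : y = i / (2 * q - 1) % (2 * u + 1) - u) (hz : z = i / (2 * q - 1) / (2 * u + 1) - w) :
    let s' := (relaxBody p q).run s
    let c := nb + y + (x - b + p * z) / P
    let v := s.arr 5 (eb + z) + s.arr 5 (pb + y) - 1 + |x| * Dn + digit x * pw
    let valid := 0 < s.arr 5 (eb + z) ∧ 0 < s.arr 5 (pb + y) ∧ P ∣ x - b + p * z
    s'.var 18 = i + 1 ∧ (¬ valid → s'.arr 5 = s.arr 5) ∧
      (valid → ∀ c', s'.arr 5 c' =
        if c' = c ∧ ¬ (0 < s.arr 5 c ∧ s.arr 5 c < v) then v else s.arr 5 c') := by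
  subst h4 h8 h9 h12 h13 h15 h17
  have e1 : (decodeProg p q).run s =
      (((s.setVar 20 x).setVar 21 y).setVar 22 z).setVar 23 (x - s.var 12 + p * z) := by
    simp [decodeProg, Prog.run, h18, h16, h14, ← hx, ← hy, ← hz]
  intro s' c v valid
  have e2 : s' = Prog.run (18 ≔ vr 18 + 1) (Prog.run (.ite (.less 0 (.get 5 (vr 13 + vr 22)) *
        .less 0 (.get 5 (vr 15 + vr 21)) * .same (vr 23 % vr 4) 0)
      (24 ≔ vr 17 + vr 21 + vr 23 / vr 4 ;; 25 ≔ candExpr ;;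
        .ite (.less 0 (.get 5 (vr 24)) * .less (.get 5 (vr 24)) (vr 25)) .skip
          (.put 5 (vr 24) (vr 25))) .skip) ((decodeProg p q).run s)) := rfl
  rw [e1] at e2
  set s1 := (((s.setVar 20 x).setVar 21 y).setVar 22 z).setVar 23 (x - s.var 12 + p * z) with hs1
  have hcond : (Expr.less 0 (.get 5 (vr 13 + vr 22)) * .less 0 (.get 5 (vr 15 + vr 21)) *
      .same (vr 23 % vr 4) 0).eval s1 ≠ 0 ↔ valid := by
    simp only [valid, Int.dvd_iff_emod_eq_zero]
    simp [hs1]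
    tauto
  by_cases hv : valid
  · have e3 : Prog.run (24 ≔ vr 17 + vr 21 + vr 23 / vr 4 ;; 25 ≔ candExpr) s1 =
        (s1.setVar 24 c).setVar 25 v := by
      simp [Prog.run, hs1, candExpr, c, v, digit_eq]
    set s2 := (s1.setVar 24 c).setVar 25 v with hs2
    have hcond' : (Expr.less 0 (.get 5 (vr 24)) * .less (.get 5 (vr 24)) (vr 25)).eval s2 ≠ 0 ↔
        0 < s.arr 5 c ∧ s.arr 5 c < v := by
      simp [hs2, hs1]
      exact and_comm
    have e4 : s' = Prog.run (18 ≔ vr 18 + 1) (Prog.run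
        (.ite (.less 0 (.get 5 (vr 24)) * .less (.get 5 (vr 24)) (vr 25)) .skip
          (.put 5 (vr 24) (vr 25))) s2) := by
      rw [e2, ← e3]
      exact congrArg _ (if_pos (hcond.2 hv))
    refine ⟨?_, fun h => absurd hv h, fun _ c' => ?_⟩
    · rw [e4]
      by_cases hc : 0 < s.arr 5 c ∧ s.arr 5 c < v
      · simp only [Prog.run, if_pos (hcond'.2 hc)]; simp [hs2, hs1, h18]
      · simp only [Prog.run, if_neg (fun h => hc (hcond'.1 h))]; simp [hs2, hs1, h18]
    · rw [e4]
      by_cases hc : 0 < s.arr 5 c ∧ s.arr 5 c < v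
      · simp only [Prog.run, if_pos (hcond'.2 hc), hc]; simp [hs2, hs1]
      · simp only [Prog.run, if_neg (fun h => hc (hcond'.1 h)), hc, not_false_eq_true, and_true]
        simp [hs2, hs1]
  · have e3 : s' = Prog.run (18 ≔ vr 18 + 1) s1 := by
      rw [e2]
      simp only [Prog.run, if_neg (fun h => hv (hcond.1 h))]
    refine ⟨?_, fun _ => ?_, fun h => absurd h hv⟩
    · rw [e3]; simp [Prog.run, hs1, h18]
    · rw [e3]; simp [Prog.run, hs1]

theorem decode_range {q w u i : ℕ} (hq : 1 ≤ q)
    (hi : i < (2 * w + 1) * (2 * u + 1) * (2 * q - 1)) :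
    |(i : ℤ) % (2 * q - 1) - (q - 1)| < q ∧ |(i : ℤ) / (2 * q - 1) % (2 * u + 1) - u| ≤ u ∧
      |(i : ℤ) / (2 * q - 1) / (2 * u + 1) - w| ≤ w := by
  have hD : (0 : ℤ) < 2 * q - 1 := by omega
  have hU : (0 : ℤ) < 2 * u + 1 := by omega
  have h1 := Int.emod_nonneg (i : ℤ) hD.ne'
  have h2 := Int.emod_lt_of_pos (i : ℤ) hD
  have h3 := Int.emod_nonneg ((i : ℤ) / (2 * q - 1)) hU.ne'
  have h4 := Int.emod_lt_of_pos ((i : ℤ) / (2 * q - 1)) hU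
  have h5 : 0 ≤ (i : ℤ) / (2 * q - 1) / (2 * u + 1) :=
    Int.ediv_nonneg (Int.ediv_nonneg (by omega) hD.le) hU.le
  have h6 : (i : ℤ) / (2 * q - 1) / (2 * u + 1) < 2 * w + 1 := by
    rw [Int.ediv_lt_iff_lt_mul hU, Int.ediv_lt_iff_lt_mul hD]
    have : (i : ℤ) < (((2 * w + 1) * (2 * u + 1) * (2 * q - 1) : ℕ) : ℤ) := by exact_mod_cast hi
    rw [Nat.cast_mul, Nat.cast_sub (by omega)] at this
    push_cast at this
    linarith
  refine ⟨?_, ?_, ?_⟩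
  · rw [abs_lt]; omega
  · rw [abs_le]; omega
  · rw [abs_le]; omega

theorem decode_surj {q w u : ℕ} {x y z : ℤ} (hx : |x| < q) (hy : |y| ≤ u) (hz : |z| ≤ w) :
    ∃ i : ℕ, i < (2 * w + 1) * (2 * u + 1) * (2 * q - 1) ∧
      x = (i : ℤ) % (2 * q - 1) - (q - 1) ∧ y = (i : ℤ) / (2 * q - 1) % (2 * u + 1) - u ∧
      z = (i : ℤ) / (2 * q - 1) / (2 * u + 1) - w := by
  rw [abs_lt] at hx
  rw [abs_le] at hy hz
  have hD : (0 : ℤ) < 2 * q - 1 := by omega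
  have hU : (0 : ℤ) < 2 * u + 1 := by omega
  obtain ⟨X, hX⟩ := Int.eq_ofNat_of_zero_le (by omega : 0 ≤ x + (q - 1))
  obtain ⟨Y, hY⟩ := Int.eq_ofNat_of_zero_le (by omega : 0 ≤ y + u)
  obtain ⟨Z, hZ⟩ := Int.eq_ofNat_of_zero_le (by omega : 0 ≤ z + w)
  have e1 : ((((Z * (2 * u + 1) + Y) * (2 * q - 1) + X : ℕ)) : ℤ) =
      ((z + w) * (2 * u + 1) + (y + u)) * (2 * q - 1) + (x + (q - 1)) := by
    rw [hX, hY, hZ]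
    rw [Nat.cast_add, Nat.cast_mul, Nat.cast_sub (by omega)]
    push_cast
    ring
  have d1 : (((z + w) * (2 * u + 1) + (y + u)) * (2 * q - 1) + (x + (q - 1))) / (2 * q - 1) =
      (z + w) * (2 * u + 1) + (y + u) := by
    rw [Int.add_comm, Int.add_mul_ediv_right _ _ hD.ne', Int.ediv_eq_zero_of_lt (by omega) (by omega),
      zero_add]
  refine ⟨(Z * (2 * u + 1) + Y) * (2 * q - 1) + X, ?_, ?_, ?_, ?_⟩
  · have h1 : Z < 2 * w + 1 := by omega
    have h2 : Y < 2 * u + 1 := by omega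
    have h3 : X < 2 * q - 1 := by omega
    have h4 : Z * (2 * u + 1) + Y < (2 * w + 1) * (2 * u + 1) := by nlinarith
    calc _ < (Z * (2 * u + 1) + Y + 1) * (2 * q - 1) := by rw [add_one_mul]; omega
      _ ≤ _ := Nat.mul_le_mul_right _ h4
  · rw [e1, Int.add_comm, Int.add_mul_emod_self_right, Int.emod_eq_of_lt (by omega) (by omega)]
    ring
  · rw [e1, d1, Int.add_comm, Int.add_mul_emod_self_right, Int.emod_eq_of_lt (by omega) (by omega)]
    ring
  · rw [e1, d1, Int.add_comm, Int.add_mul_ediv_right _ _ hU.ne',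
      Int.ediv_eq_zero_of_lt (by omega) (by omega)]
    ring

/-- The number of steps of `relaxProg` for each candidate. -/
def relaxTime (p q : ℕ) : ℕ := (Expr.less (vr 18) (vr 19)).cost + (relaxBody p q).time + 1

theorem relaxProg_run {p q w u : ℕ} (hq : 1 ≤ q) {P b Dn pw eb pb nb W : ℤ} {a : ℤ → ℤ}
    {M₀ M : ℤ} (hM₀ : 2 ≤ M₀) (hM : M₀ ^ (relaxBody p q).deg ≤ M) {s : State} (hb : Bdd M s)
    (ht : Tame [4, 8, 9, 12, 13, 14, 15, 16, 17, 19] M₀ s) (h4 : s.var 4 = P)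
    (h8 : s.var 8 = pw) (h9 : s.var 9 = Dn) (h12 : s.var 12 = b) (h13 : s.var 13 = eb)
    (h14 : s.var 14 = w) (h15 : s.var 15 = pb) (h16 : s.var 16 = u) (h17 : s.var 17 = nb)
    (h18 : s.var 18 = 0)
    (h19 : s.var 19 = ((2 * w + 1) * (2 * u + 1) * (2 * q - 1) : ℕ)) (ha : s.arr 5 = a)
    (hfz : ∀ z : ℤ, |z| ≤ w → W < |eb + z - nb|) (hfy : ∀ y : ℤ, |y| ≤ u → W < |pb + y - nb|)
    (hin : ∀ x y z : ℤ, |x| < q → |y| ≤ u → |z| ≤ w → P ∣ x - b + p * z →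
      |y + (x - b + p * z) / P| ≤ W)
    (hzero : ∀ c, |c - nb| ≤ W → a c = 0)
    (hval : ∀ x y z c v, Cand p q P b Dn pw w u eb pb nb a x y z c v → 0 < v ∧ v ≤ M₀) :
    ∃ s', Runs M (relaxProg p q) s
        (relaxTime p q * ((2 * w + 1) * (2 * u + 1) * (2 * q - 1) + 1)) s' ∧ Bdd M s' ∧
      (∀ A i, |s'.arr A i| ≤ M₀) ∧ Relaxed p q P b Dn pw w u eb pb nb W a (s'.arr 5) := by
  have hM2 : 2 ≤ M :=
    (hM₀.trans (le_self_pow₀ (by linarith) (Nat.one_le_iff_ne_zero.1 (Prog.deg_pos _)))).trans hM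
  obtain ⟨L, hscope⟩ := relaxBody_scope p q
  have hlf := Prog.loopFree_of_scope hscope
  set N := (2 * w + 1) * (2 * u + 1) * (2 * q - 1) with hN
  have hNM : (N : ℤ) ≤ M₀ := by
    have := ht.1 19 (by simp)
    rwa [h19, Nat.abs_cast] at this
  obtain ⟨s', r, b', -, -, i2, i3, i4, i5⟩ := runs_loop_const (e := .less (vr 18) (vr 19))
    (c := relaxBody p q) hM2
    (fun i s' => s'.var 18 = i ∧ (∀ A j, |s'.arr A j| ≤ M₀) ∧
      (∀ c, W < |c - nb| → s'.arr 5 c = a c) ∧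
      (∀ c, |c - nb| ≤ W → s'.arr 5 c ≠ 0 →
        ∃ x y z, Cand p q P b Dn pw w u eb pb nb a x y z c (s'.arr 5 c)) ∧
      ∀ i' < i, ∀ c v, Cand p q P b Dn pw w u eb pb nb a ((i' : ℤ) % (2 * q - 1) - (q - 1))
        ((i' : ℤ) / (2 * q - 1) % (2 * u + 1) - u) ((i' : ℤ) / (2 * q - 1) / (2 * u + 1) - w) c v →
        0 < s'.arr 5 c ∧ s'.arr 5 c ≤ v) N (relaxBody p q).time hb
    ⟨by simp [h18], ht.2, fun c _ => by rw [ha], fun c hc h0 => absurd (by rw [ha, hzero c hc]) h0,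
      by simp⟩
    (by
      rintro i hi s' hb' hf ⟨i1, i2, i3, i4, i5⟩
      have g19 : s'.var 19 = N := by rw [hf.1 19 rfl, h19]
      obtain ⟨d1, d2, d3⟩ := decode_range hq hi
      obtain ⟨e1, e2, e3⟩ := relaxBody_run (p := p) (q := q) (s := s')
        ((hf.1 4 rfl).trans h4) ((hf.1 8 rfl).trans h8) ((hf.1 9 rfl).trans h9)
        ((hf.1 12 rfl).trans h12) ((hf.1 13 rfl).trans h13) ((hf.1 14 rfl).trans h14)
        ((hf.1 15 rfl).trans h15) ((hf.1 16 rfl).trans h16) ((hf.1 17 rfl).trans h17) i1 rfl rfl rfl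
      set x := (i : ℤ) % (2 * q - 1) - (q - 1) with hx
      set y := (i : ℤ) / (2 * q - 1) % (2 * u + 1) - u with hy
      set z := (i : ℤ) / (2 * q - 1) / (2 * u + 1) - w with hz
      rw [i3 _ (hfz z d3), i3 _ (hfy y d2)] at e2 e3
      set c₀ := nb + y + (x - b + p * z) / P with hc₀
      set v₀ := a (eb + z) + a (pb + y) - 1 + |x| * Dn + digit x * pw with hv₀
      set s2 := (relaxBody p q).run s' with hs2
      have htame : Tame [4, 8, 9, 12, 13, 14, 15, 16, 17, 18] M₀ s' := by
        refine ⟨?_, i2⟩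
        intro k hk
        by_cases hk8 : k = 18
        · rw [hk8, i1, Nat.abs_cast]
          exact (by exact_mod_cast hi.le : (i : ℤ) ≤ N).trans hNM
        · have : (relaxBody p q).writesVar k = false := by
            simp only [List.mem_cons, List.not_mem_nil, or_false] at hk
            rcases hk with rfl | rfl | rfl | rfl | rfl | rfl | rfl | rfl | rfl | rfl <;>
              first | rfl | exact absurd rfl hk8
          rw [hf.1 k this]
          refine ht.1 k ?_
          simp only [List.mem_cons, List.not_mem_nil, or_false] at hk ⊢
          omega
      have hb2 : Bdd M s2 := (tame_run hscope hM₀ htame hM hb').2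
      have hf2 : Frame (relaxBody p q) s' s2 := frame_run hlf s'
      have hcond : (Expr.less (vr 18) (vr 19)).eval s' ≠ 0 := by
        have : (i : ℤ) < N := by exact_mod_cast hi
        simp [i1, g19, this]
      refine ⟨hcond, s2, runs_run hlf hM2 hb', hb2, by rw [e1]; push_cast; rfl, ?_⟩
      have hcand : 0 < a (eb + z) ∧ 0 < a (pb + y) ∧ P ∣ x - b + p * z →
          Cand p q P b Dn pw w u eb pb nb a x y z c₀ v₀ :=
        fun h => ⟨d1, d2, d3, h.1, h.2.1, h.2.2, rfl, rfl⟩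
      have harr : (∀ j, |s2.arr 5 j| ≤ M₀) → ∀ A j, |s2.arr A j| ≤ M₀ := by
        intro h A j
        by_cases hA : A = 5
        · rw [hA]; exact h j
        · have : (relaxBody p q).writesArr A = false := by
            simp [relaxBody, decodeProg, Prog.writesArr, hA]
          rw [hf2.2 A this]; exact i2 A j
      by_cases hv : 0 < a (eb + z) ∧ 0 < a (pb + y) ∧ P ∣ x - b + p * z
      · have hca := hcand hv
        obtain ⟨v1, v2⟩ := hval _ _ _ _ _ hca
        have hcW : |c₀ - nb| ≤ W := by
          have := hin x y z d1 d2 d3 hv.2.2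
          rwa [hc₀, show nb + y + (x - b + p * z) / P - nb = y + (x - b + p * z) / P by ring]
        have e4 := e3 hv
        refine ⟨harr fun j => ?_, fun c hc => ?_, fun c hc h0 => ?_, fun i' hi' c v hcc => ?_⟩
        · rw [e4]
          split_ifs
          · rw [abs_of_pos v1]; exact v2
          · exact i2 5 j
        · rw [e4, if_neg, i3 c hc]
          rintro ⟨rfl, -⟩
          exact absurd hcW (not_le.2 hc)
        · rw [e4] at h0 ⊢
          split_ifs at h0 ⊢ with h
          · rw [h.1]; exact ⟨x, y, z, hca⟩
          · exact i4 c hc h0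
        · have hpos : 0 ≤ s'.arr 5 c₀ := by
            by_cases h0 : s'.arr 5 c₀ = 0
            · exact h0.ge
            · obtain ⟨x', y', z', h⟩ := i4 c₀ hcW h0
              exact (hval _ _ _ _ _ h).1.le
          rcases Nat.lt_succ_iff_lt_or_eq.1 hi' with h | rfl
          · obtain ⟨j1, j2⟩ := i5 i' h c v hcc
            rw [e4]
            split_ifs with h
            · rw [h.1] at j1 j2
              have := h.2
              constructor <;> omega
            · exact ⟨j1, j2⟩
          · have hc' : c = c₀ := hcc.hc
            have hv' : v = v₀ := hcc.hv
            rw [e4, hc', hv']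
            split_ifs with h
            · exact ⟨v1, le_rfl⟩
            · simp only [true_and, not_not] at h
              exact ⟨h.1, h.2.le⟩
      · have e4 := e2 hv
        refine ⟨harr fun j => by rw [e4]; exact i2 5 j, fun c hc => by rw [e4, i3 c hc],
          fun c hc h0 => by rw [e4] at h0 ⊢; exact i4 c hc h0, fun i' hi' c v hcc => ?_⟩
        rw [e4]
        rcases Nat.lt_succ_iff_lt_or_eq.1 hi' with h | rfl
        · exact i5 i' h c v hcc
        · exact absurd ⟨hcc.posz, hcc.posy, hcc.dvd⟩ hv)
    (by
      rintro s' hb' hf ⟨i1, -⟩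
      have g19 : s'.var 19 = N := by rw [hf.1 19 rfl, h19]
      simp [i1, g19])
  refine ⟨s', r, b', i2, i3, i4, fun x y z c v hc => ?_⟩
  obtain ⟨i, hi, rfl, rfl, rfl⟩ := decode_surj hc.hx hc.hy hc.hz
  exact i5 i hi c v hc

/-! ### The program for the table -/

/-- The numbers and widths of the regions are stored in the arrays `6` and `7`. -/
def RegionsIn (s : State) : List (ℕ × ℕ) → Prop
  | [] => True
  | (e, w) :: R => s.arr 6 R.length = e ∧ s.arr 7 R.length = w ∧ RegionsIn s R

theorem RegionsIn.congr {s s' : State} {R : List (ℕ × ℕ)} (h : RegionsIn s R)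
    (h' : ∀ j : ℕ, j < R.length → s'.arr 6 j = s.arr 6 j ∧ s'.arr 7 j = s.arr 7 j) :
    RegionsIn s' R := by
  induction R with
  | nil => trivial
  | cons y R ih =>
    obtain ⟨h1, h2, h3⟩ := h
    obtain ⟨h4, h5⟩ := h' R.length (by simp)
    exact ⟨h4.trans h1, h5.trans h2, ih h3 fun j hj => h' j (by simp; omega)⟩

/-- Loads the parameters of the next region. -/
def fillPrep (p q : ℕ) : Prog :=
  8 ≔ vr 8 / .lit (2 * q) ;; 12 ≔ .get 3 (vr 7) ;; 13 ≔ .get 6 (vr 11) * vr 10 ;;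
  14 ≔ .get 7 (vr 11) ;;
  .ite (.less 0 (.get 4 (vr 7 + 1)))
    (4 ≔ .lit q ;; 11 ≔ vr 11 - 1 ;; 15 ≔ .get 6 (vr 11) * vr 10 ;; 16 ≔ .get 7 (vr 11))
    (4 ≔ .lit p ;; 15 ≔ 0 ;; 16 ≔ 0) ;;
  17 ≔ (vr 7 + 1) * vr 10 ;; 18 ≔ 0 ;;
  19 ≔ (2 * vr 14 + 1) * (2 * vr 16 + 1) * .lit (2 * q - 1)

/-- Registers the new region. -/
def fillPost (r : ℕ) : Prog :=
  .put 6 (vr 11) (vr 7 + 1) ;;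
  .ite (.less 0 (.get 4 (vr 7 + 1)))
    (.put 7 (vr 11) (vr 16 + 2 + vr 14 / .lit r))
    (.put 7 (vr 11) (vr 14 + .lit (2 * r)) ;; 11 ≔ vr 11 + 1 ;; .put 6 (vr 11) 0 ;;
      .put 7 (vr 11) 0) ;;
  7 ≔ vr 7 + 1

/-- Computes the region for one letter of the stack. -/
def fillBody (p q r : ℕ) : Prog := fillPrep p q ;; relaxProg p q ;; fillPost r

theorem fillPrep_scope (p q : ℕ) : ∃ L, (fillPrep p q).scope [3, 7, 8, 9, 10, 11] = some L ∧
    [4, 7, 8, 9, 11, 12, 13, 14, 15, 16, 17, 19] ⊆ L := ⟨_, rfl, by decide⟩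

theorem fillPost_scope (r : ℕ) : ∃ L, (fillPost r).scope [7, 11, 14, 16] = some L := ⟨_, rfl⟩

theorem fillPrep_run_down {p q : ℕ} (hq : 1 ≤ q) {s : State} {j m e w d : ℕ} {b S : ℤ}
    (h7 : s.var 7 = j)
    (h8 : s.var 8 = (2 * q) ^ (m + 1)) (h10 : s.var 10 = S) (h11 : s.var 11 = d)
    (h3 : s.arr 3 j = b) (h4 : s.arr 4 (j + 1) = -1) (h6 : s.arr 6 d = e) (h7' : s.arr 7 d = w) :
    let s' := (fillPrep p q).run s
    s'.var 4 = p ∧ s'.var 8 = (2 * q) ^ m ∧ s'.var 12 = b ∧ s'.var 13 = e * S ∧ s'.var 14 = w ∧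
      s'.var 15 = 0 ∧ s'.var 16 = (0 : ℕ) ∧ s'.var 17 = (j + 1) * S ∧ s'.var 18 = 0 ∧
      s'.var 19 = ((2 * w + 1) * (2 * 0 + 1) * (2 * q - 1) : ℕ) ∧ s'.var 11 = d := by
  have hq0 : (2 * q : ℤ) ≠ 0 := by omega
  have hdiv : (2 * q : ℤ) ^ (m + 1) / (2 * q) = (2 * q) ^ m := by
    rw [pow_succ, Int.mul_ediv_cancel _ hq0]
  have hsub : ((2 * q - 1 : ℕ) : ℤ) = 2 * q - 1 := by rw [Nat.cast_sub (by omega)]; simp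
  simp [fillPrep, Prog.run, h7, h8, h10, h11, h3, h4, h6, h7', hdiv, hsub]

theorem fillPrep_run_up {p q : ℕ} (hq : 1 ≤ q) {s : State} {j m e w f u d : ℕ} {b S : ℤ}
    (h7 : s.var 7 = j)
    (h8 : s.var 8 = (2 * q) ^ (m + 1)) (h10 : s.var 10 = S) (h11 : s.var 11 = d + 1)
    (h3 : s.arr 3 j = b) (h4 : s.arr 4 (j + 1) = 1) (h6 : s.arr 6 (d + 1) = e)
    (h7' : s.arr 7 (d + 1) = w) (h6d : s.arr 6 d = f) (h7d : s.arr 7 d = u) :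
    let s' := (fillPrep p q).run s
    s'.var 4 = q ∧ s'.var 8 = (2 * q) ^ m ∧ s'.var 12 = b ∧ s'.var 13 = e * S ∧ s'.var 14 = w ∧
      s'.var 15 = f * S ∧ s'.var 16 = u ∧ s'.var 17 = (j + 1) * S ∧ s'.var 18 = 0 ∧
      s'.var 19 = ((2 * w + 1) * (2 * u + 1) * (2 * q - 1) : ℕ) ∧ s'.var 11 = d := by
  have hq0 : (2 * q : ℤ) ≠ 0 := by omega
  have hdiv : (2 * q : ℤ) ^ (m + 1) / (2 * q) = (2 * q) ^ m := by
    rw [pow_succ, Int.mul_ediv_cancel _ hq0]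
  have hsub : ((2 * q - 1 : ℕ) : ℤ) = 2 * q - 1 := by rw [Nat.cast_sub (by omega)]; simp
  simp [fillPrep, Prog.run, h7, h8, h10, h11, h3, h4, h6, h7', h6d, h7d, hdiv, hsub]

theorem fillPost_run_down {r : ℕ} {s : State} {j w d : ℕ} {R : List (ℕ × ℕ)} (hd : d = R.length)
    (h7 : s.var 7 = j) (h11 : s.var 11 = d) (h14 : s.var 14 = w)
    (h4 : s.arr 4 (j + 1) = -1) (hR : RegionsIn s R) :
    let s' := (fillPost r).run s
    s'.var 7 = j + 1 ∧ s'.var 11 = d + 1 ∧ RegionsIn s' ((0, 0) :: (j + 1, w + 2 * r) :: R) ∧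
      (∀ i, s'.arr 6 i = s.arr 6 i ∨ s'.arr 6 i = j + 1 ∨ s'.arr 6 i = 0) ∧
      (∀ i, s'.arr 7 i = s.arr 7 i ∨ s'.arr 7 i = (w + 2 * r : ℕ) ∨ s'.arr 7 i = 0) := by
  subst hd
  intro s'
  have hs' : s' = (((((((s.setArr 6 R.length (j + 1)).setArr 7 R.length (w + 2 * r))).setVar 11
      (R.length + 1)).setArr 6 (R.length + 1) 0).setArr 7 (R.length + 1) 0)).setVar 7 (j + 1) := by
    simp [s', fillPost, Prog.run, h7, h11, h14, h4]
  rw [hs']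
  refine ⟨by simp, by simp, ⟨by simp, by simp, by simp, by simp, hR.congr fun i hi => ?_⟩, ?_, ?_⟩
  · have : (i : ℤ) ≠ R.length + 1 := by omega
    simp [hi.ne, this]
  · intro i
    by_cases h1 : i = R.length + 1 <;> by_cases h2 : i = R.length <;> simp [h1, h2]
  · intro i
    by_cases h1 : i = R.length + 1 <;> by_cases h2 : i = R.length <;> simp [h1, h2]

theorem fillPost_run_up {r : ℕ} {s : State} {j w u d : ℕ} {R : List (ℕ × ℕ)} (hd : d = R.length)
    (h7 : s.var 7 = j) (h11 : s.var 11 = d) (h14 : s.var 14 = w) (h16 : s.var 16 = u)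
    (h4 : s.arr 4 (j + 1) = 1) (hR : RegionsIn s R) :
    let s' := (fillPost r).run s
    s'.var 7 = j + 1 ∧ s'.var 11 = d ∧ RegionsIn s' ((j + 1, u + 2 + w / r) :: R) ∧
      (∀ i, s'.arr 6 i = s.arr 6 i ∨ s'.arr 6 i = j + 1) ∧
      (∀ i, s'.arr 7 i = s.arr 7 i ∨ s'.arr 7 i = (u + 2 + w / r : ℕ)) := by
  subst hd
  intro s'
  have hs' : s' = ((s.setArr 6 R.length (j + 1)).setArr 7 R.length (u + 2 + w / r)).setVar 7
      (j + 1) := by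
    simp [s', fillPost, Prog.run, h7, h11, h14, h16, h4]
  rw [hs']
  refine ⟨by simp, by simp [h11], ⟨by simp, by simp, hR.congr fun i hi => ?_⟩, ?_, ?_⟩
  · simp [hi.ne]
  · intro i
    by_cases h2 : i = R.length <;> simp [h2]
  · intro i
    by_cases h2 : i = R.length <;> simp [h2]

theorem length_regions {r : ℕ} {l : List (ℤ × Stable)} (h : ∀ k, k <:+ l → stackRise k ≤ 0) :
    ((regions r l).length : ℤ) = 1 - stackRise l := by
  induction l with
  | nil => simp [regions, stackRise]
  | cons y l ih =>
    have ih := ih fun k hk => h k (hk.trans (List.suffix_cons _ _))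
    have h1 := h l (List.suffix_cons _ _)
    have h2 := h (y :: l) (List.suffix_refl _)
    obtain ⟨b, θ⟩ := y
    rcases hR : regions r l with _ | ⟨⟨e, w⟩, _ | ⟨⟨f, u⟩, R⟩⟩ <;> rw [hR] at ih <;>
      cases θ <;> simp [regions, hR, stackRise, Stable.sign] at * <;> omega

/-- The number of pairs of carries for the top region. -/
def window (r : ℕ) : List (ℤ × Stable) → ℕ
  | [] => 0
  | (_, .T) :: bs => match regions r bs with
    | (_, w) :: _ => 2 * w + 1
    | [] => 0
  | (_, .t) :: bs => match regions r bs with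
    | (_, w) :: (_, u) :: _ => (2 * w + 1) * (2 * u + 1)
    | _ => 0

theorem cap_mono (q n : ℕ) {i j : ℕ} (h : i ≤ j) : cap q n i ≤ cap q n j := by
  unfold cap
  have h1 : (2 : ℤ) ^ i ≤ 2 ^ j := pow_le_pow_right₀ (by norm_num) h
  have h2 : (0 : ℤ) ≤ 1 + 3 * q * (2 * q) ^ n := by positivity
  have := mul_le_mul_of_nonneg_right h1 h2
  linarith

theorem fillPrep_writesArr (p q A : ℕ) : (fillPrep p q).writesArr A = false := by
  simp [fillPrep, Prog.writesArr]

theorem relaxProg_writesArr {p q A : ℕ} (h : A ≠ 5) : (relaxProg p q).writesArr A = false := by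
  simp [relaxProg, relaxBody, decodeProg, Prog.writesArr, h]

theorem fillPost_writesArr {r A : ℕ} (h : A ≠ 6) (h' : A ≠ 7) :
    (fillPost r).writesArr A = false := by
  simp [fillPost, Prog.writesArr, h, h']

theorem fillRelax_run {p q r n : ℕ} (hq : 1 ≤ q) {M₀ M : ℤ} (hM₀ : 2 ≤ M₀)
    (hM : M₀ ^ ((fillPrep p q).deg * (relaxBody p q).deg) ≤ M) (hcap : cap q n n ≤ M₀) {s : State}
    (hb : Bdd M s) (ht : Tame [3, 7, 8, 9, 10, 11] M₀ s) {k : List (ℤ × Stable)}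
    (hk : k.length < n) (htab : TableFor p q r n (stride r n) k (s.arr 5))
    {P b pb W : ℤ} {e w u : ℕ} (hew : (e, w) ∈ regions r k)
    (hpb : (u = 0 ∧ pb = 0) ∨ ∃ f : ℕ, (f, u) ∈ regions r k ∧ pb = f * stride r n)
    (hW : W ≤ (2 * r + 2) * (k.length + 1))
    (hin : ∀ x y z : ℤ, |x| < q → |y| ≤ u → |z| ≤ w → P ∣ x - b + p * z →
      |y + (x - b + p * z) / P| ≤ W)
    {s1 : State} (hs1 : s1 = (fillPrep p q).run s)
    (v4 : s1.var 4 = P) (v8 : s1.var 8 = (2 * q) ^ (n - (k.length + 1))) (v9 : s1.var 9 = (2 * q) ^ n)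
    (v12 : s1.var 12 = b) (v13 : s1.var 13 = e * stride r n) (v14 : s1.var 14 = w)
    (v15 : s1.var 15 = pb) (v16 : s1.var 16 = u) (v17 : s1.var 17 = (k.length + 1) * stride r n)
    (v18 : s1.var 18 = 0)
    (v19 : s1.var 19 = ((2 * w + 1) * (2 * u + 1) * (2 * q - 1) : ℕ)) :
    ∃ s2, Runs M (.seq (fillPrep p q) (relaxProg p q)) s ((fillPrep p q).time + relaxTime p q *
        ((2 * w + 1) * (2 * u + 1) * (2 * q - 1) + 1)) s2 ∧ Bdd M s2 ∧
      (∀ A i, |s2.arr A i| ≤ M₀ ^ (fillPrep p q).deg) ∧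
      Relaxed p q P b ((2 * q) ^ n) ((2 * q) ^ (n - (k.length + 1))) w u (e * stride r n) pb
        ((k.length + 1) * stride r n) W (s.arr 5) (s2.arr 5) ∧
      (∀ x ∈ [3, 7, 8, 9, 10, 11, 14, 16], s2.var x = s1.var x) ∧
      (∀ A ≠ 5, s2.arr A = s.arr A) ∧ Tame [7, 11, 14, 16] (M₀ ^ (fillPrep p q).deg) s2 := by
  obtain ⟨L, hL, hLs⟩ := fillPrep_scope p q
  have hlf := Prog.loopFree_of_scope hL
  have h1 : (1 : ℤ) ≤ M₀ := by linarith
  have hM1 : M₀ ≤ M₀ ^ (fillPrep p q).deg := le_self_pow₀ h1 (Nat.one_le_iff_ne_zero.1 (Prog.deg_pos _))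
  have hM' : M₀ ^ (fillPrep p q).deg ≤ M :=
    (pow_le_pow_right₀ h1 (Nat.le_mul_of_pos_right _ (Prog.deg_pos _))).trans hM
  have hM2 : 2 ≤ M := by linarith
  obtain ⟨t1, b1⟩ := tame_run hL hM₀ ht hM' hb
  have r1 := runs_run hlf hM2 hb
  have f1 := frame_run hlf s
  rw [← hs1] at t1 b1 r1 f1
  have a1 : s1.arr = s.arr := by
    funext A; exact f1.2 A (fillPrep_writesArr p q A)
  set S := stride r n with hS
  have hfz : ∀ z : ℤ, |z| ≤ w → W < |e * S + z - (k.length + 1) * S| := fun z hz =>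
    far_of_mem hk hew hz hW
  have hS0 := stride_pos r n
  have hWS := stride_gt (r := r) (n := n) (W := W) (j := k.length + 1) hk (by push_cast; exact hW)
  have hfy : ∀ y : ℤ, |y| ≤ u → W < |pb + y - (k.length + 1) * S| := by
    intro y hy
    rcases hpb with ⟨rfl, rfl⟩ | ⟨f, hf, rfl⟩
    · have : y = 0 := by simpa using hy
      rw [this, add_zero, zero_sub, abs_neg]
      refine lt_of_lt_of_le ?_ (le_abs_self _)
      nlinarith
    · exact far_of_mem hk hf hy hW
  have hzero : ∀ c, |c - (k.length + 1) * S| ≤ W → s.arr 5 c = 0 := by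
    intro c hc
    by_contra h0
    have h2 := htab.fresh c h0
    have h3 := (abs_le.1 hc).1
    nlinarith
  obtain ⟨s2, r2, b2, a2, hrel⟩ := relaxProg_run (p := p) hq (hM₀.trans hM1)
    (by rw [← pow_mul]; exact hM) b1 (t1.mono le_rfl (L' := [4, 8, 9, 12, 13, 14, 15, 16, 17, 19])
      (fun x hx => hLs (by
        simp only [List.mem_cons, List.not_mem_nil, or_false] at hx ⊢; omega)))
    v4 v8 v9 v12 v13 v14 v15 v16 v17 v18 v19 (by rw [a1]) hfz hfy hin hzero
    (fun x y z c v hc => by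
      obtain ⟨h2, h3⟩ := cand_value_le hk htab.le_cap hc
      exact ⟨h2, h3.trans ((cap_mono q n hk).trans (hcap.trans hM1))⟩)
  have f2 := r2.frame
  have hvar : ∀ x ∈ [3, 7, 8, 9, 10, 11, 14, 16], s2.var x = s1.var x := by
    intro x hx
    simp only [List.mem_cons, List.not_mem_nil, or_false] at hx
    rcases hx with rfl | rfl | rfl | rfl | rfl | rfl | rfl | rfl <;> exact f2.1 _ rfl
  refine ⟨s2, r1.seq hM2 r2, b2, a2, hrel, hvar, fun A hA => ?_, ?_, a2⟩
  · rw [f2.2 A (relaxProg_writesArr hA), a1]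
  · intro x hx
    rw [hvar x (by simp only [List.mem_cons, List.not_mem_nil, or_false] at hx ⊢; omega)]
    exact t1.1 x (hLs (by
      simp only [List.mem_cons, List.not_mem_nil, or_false] at hx ⊢; omega))

/-- The state of the machine after the regions for `k` have been filled. -/
structure FillInv (p q r n : ℕ) (M₀ : ℤ) (k : List (ℤ × Stable)) (s : State) : Prop where
  v7 : s.var 7 = k.length
  v8 : s.var 8 = (2 * q) ^ (n - k.length)
  v11 : s.var 11 + 1 = (regions r k).length
  reg : RegionsIn s (regions r k)
  table : TableFor p q r n (stride r n) k (s.arr 5)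
  arr : ∀ A i, |s.arr A i| ≤ M₀

/-- The number of steps of `fillBody` for each pair of carries. -/
def fillTime (p q r : ℕ) : ℕ :=
  (fillPrep p q).time + relaxTime p q * (2 * q) + (fillPost r).time

theorem fillTime_aux (c₁ c₂ c₃ N : ℕ) {q : ℕ} (hq : 1 ≤ q) :
    c₁ + c₂ * (N * (2 * q - 1) + 1) + c₃ ≤ (c₁ + c₂ * (2 * q) + c₃) * (N + 1) := by
  have h1 : N * (2 * q - 1) + 1 ≤ 2 * q * (N + 1) := by
    have : N * (2 * q - 1) ≤ N * (2 * q) := Nat.mul_le_mul_left _ (by omega)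
    nlinarith
  have h2 := Nat.mul_le_mul_left c₂ h1
  nlinarith [Nat.zero_le (c₁ * N), Nat.zero_le (c₃ * N)]

theorem fillBody_run {p q r n : ℕ} (hp : 1 ≤ p) (hr : 1 ≤ r) (hq : q = p * r) {M₀ M : ℤ}
    (hM₀ : 2 ≤ M₀)
    (hM : M₀ ^ ((fillPrep p q).deg * ((relaxBody p q).deg * (fillPost r).deg)) ≤ M)
    (hcap : cap q n n ≤ M₀) (hS : stride r n ≤ M₀) (hD : (2 * q) ^ n ≤ M₀) {s : State}
    (hb : Bdd M s) {k : List (ℤ × Stable)} {b : ℤ} {θ : Stable} (hk : k.length < n)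
    (hb0 : 0 ≤ b) (hb1 : b < θ.outer p q)
    (hlen : ∀ k', k' <:+ (b, θ) :: k → stackRise k' ≤ 0) (h : FillInv p q r n M₀ k s)
    (v3 : s.var 3 = n) (v9 : s.var 9 = (2 * q) ^ n) (v10 : s.var 10 = stride r n)
    (h3 : s.arr 3 k.length = b) (h4 : s.arr 4 (k.length + 1) = θ.sign) :
    ∃ s', Runs M (fillBody p q r) s (fillTime p q r * (window r ((b, θ) :: k) + 1)) s' ∧
      Bdd M s' ∧ FillInv p q r n M₀ ((b, θ) :: k) s' := by
  have hq1 : 1 ≤ q := by rw [hq]; exact Nat.mul_pos hp hr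
  have hqz : (1 : ℤ) ≤ q := by exact_mod_cast hq1
  have h1 : (1 : ℤ) ≤ M₀ := by linarith
  have hnS : (n : ℤ) + 1 ≤ stride r n := by
    unfold stride
    nlinarith [show (0 : ℤ) ≤ 4 * r by positivity]
  have hkn : (k.length : ℤ) < n := by exact_mod_cast hk
  have hlen1 : ((regions r k).length : ℤ) ≤ k.length + 1 := by
    rw [length_regions (r := r) fun k' hk' => hlen k' (hk'.trans (List.suffix_cons _ _))]
    have h2 : ∀ m : List (ℤ × Stable), -(m.length : ℤ) ≤ stackRise m := by
      intro m
      induction m with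
      | nil => simp [stackRise]
      | cons y m ih =>
        have h5 : stackRise (y :: m) = y.2.sign + stackRise m := by simp [stackRise]
        have h6 : -1 ≤ y.2.sign := by cases y.2 <;> simp [Stable.sign]
        rw [h5, List.length_cons]
        push_cast
        linarith
    linarith [h2 k]
  have hRl := length_regions (r := r) fun k' hk' => hlen k' (hk'.trans (List.suffix_cons _ _))
  have hk0 := hlen k (List.suffix_cons _ _)
  have hk1 := hlen ((b, θ) :: k) (List.suffix_refl _)
  have hpow : (2 * q : ℤ) ^ (n - k.length) ≤ (2 * q) ^ n :=
    pow_le_pow_right₀ (by linarith) (by omega)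
  have ht : Tame [3, 7, 8, 9, 10, 11] M₀ s := by
    refine ⟨fun x hx => ?_, h.arr⟩
    simp only [List.mem_cons, List.not_mem_nil, or_false] at hx
    rcases hx with rfl | rfl | rfl | rfl | rfl | rfl
    · rw [v3, Nat.abs_cast]; linarith
    · rw [h.v7, Nat.abs_cast]; linarith
    · rw [h.v8, abs_of_nonneg (by positivity)]; linarith
    · rw [v9, abs_of_nonneg (by positivity)]; exact hD
    · rw [v10, abs_of_pos (stride_pos r n)]; exact hS
    · have := h.v11
      rw [abs_of_nonneg (by omega)]; linarith
  have hdp := Prog.deg_pos (fillPrep p q)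
  have hdr := Prog.deg_pos (relaxBody p q)
  have hdo := Prog.deg_pos (fillPost r)
  have hMa : M₀ ^ ((fillPrep p q).deg * (relaxBody p q).deg) ≤ M :=
    (pow_le_pow_right₀ h1 (Nat.mul_le_mul_left _ (Nat.le_mul_of_pos_right _ hdo))).trans hM
  have hMb : (M₀ ^ (fillPrep p q).deg) ^ (fillPost r).deg ≤ M := by
    rw [← pow_mul]
    exact (pow_le_pow_right₀ h1 (Nat.mul_le_mul_left _ (Nat.le_mul_of_pos_left _ hdr))).trans hM
  have hM1 : M₀ ≤ M₀ ^ (fillPrep p q).deg := le_self_pow₀ h1 (Nat.one_le_iff_ne_zero.1 hdp)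
  have hM2 : 2 ≤ M :=
    hM₀.trans ((le_self_pow₀ h1 (Nat.one_le_iff_ne_zero.1 (Nat.mul_pos hdp hdr))).trans hMa)
  obtain ⟨Lp, hLp⟩ := fillPost_scope r
  have hlfp := Prog.loopFree_of_scope hLp
  have hfill : ∀ {s2 s3 : State} {N : ℕ}, s3 = (fillPost r).run s2 →
      Runs M (.seq (fillPrep p q) (relaxProg p q)) s ((fillPrep p q).time + relaxTime p q *
        (N * (2 * q - 1) + 1)) s2 → Bdd M s2 → Runs M (fillBody p q r) s
        (fillTime p q r * (N + 1)) s3 := by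
    rintro s2 s3 N rfl hr1 hb2
    obtain ⟨n1, hn1, e1⟩ := hr1.seq hM2 (runs_run hlfp hM2 hb2)
    have hdeg : (((fillPrep p q).seq (relaxProg p q)).seq (fillPost r)).deg =
        (fillBody p q r).deg := by
      simp only [fillBody, Prog.deg, mul_assoc]
    rw [hdeg] at e1
    refine ⟨n1, hn1.trans (fillTime_aux _ _ _ _ hq1), ?_⟩
    rcases e1 with _ | _ | _ | @⟨_, _, _, s4, _, m1, m2, e2, e3⟩
    rcases e2 with _ | _ | _ | @⟨_, _, _, s5, _, m3, m4, e4, e5⟩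
    rw [add_assoc]
    exact .seq e4 (.seq e5 e3)
  have harr3 : ∀ {s2 s3 : State}, s3 = (fillPost r).run s2 → (∀ A ≠ 5, s2.arr A = s.arr A) →
      (∀ i, |s3.arr 6 i| ≤ M₀) → (∀ i, |s3.arr 7 i| ≤ M₀) →
      TableFor p q r n (stride r n) ((b, θ) :: k) (s2.arr 5) → ∀ A i, |s3.arr A i| ≤ M₀ := by
    rintro s2 s3 rfl hA5 hA6 hA7 htab A i
    have hf := frame_run hlfp s2
    by_cases h6 : A = 6
    · rw [h6]; exact hA6 i
    · by_cases h7 : A = 7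
      · rw [h7]; exact hA7 i
      · rw [hf.2 A (fillPost_writesArr h6 h7)]
        by_cases h5 : A = 5
        · rw [h5, abs_of_nonneg (htab.nonneg i)]
          exact (htab.le_cap i).trans ((cap_mono q n (by simpa using hk)).trans hcap)
        · rw [hA5 A h5]; exact h.arr A i
  have hwid : ∀ {W : ℕ}, W ≤ (2 * r + 2) * (k.length + 1) → (W : ℤ) ≤ M₀ := by
    intro W hW
    have h5 : (W : ℤ) ≤ (2 * r + 2) * (k.length + 1) := by exact_mod_cast hW
    have h6 := stride_gt (r := r) (n := n) (W := W) (j := k.length + 1) hk (by push_cast; exact h5)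
    have h7 : (0 : ℤ) ≤ W := by positivity
    linarith
  have hsum := (regions_le r k).2
  have hv8 : s.var 8 = (2 * q) ^ (n - (k.length + 1) + 1) := by
    rw [h.v8]; congr 1; omega
  set s1 := (fillPrep p q).run s with hs1
  have w9 : s1.var 9 = (2 * q) ^ n := by
    obtain ⟨L, hL, -⟩ := fillPrep_scope p q
    rw [hs1, (frame_run (Prog.loopFree_of_scope hL) s).1 9 rfl, v9]
  have w7 : s1.var 7 = k.length := by
    obtain ⟨L, hL, -⟩ := fillPrep_scope p q
    rw [hs1, (frame_run (Prog.loopFree_of_scope hL) s).1 7 rfl, h.v7]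
  cases θ with
  | T =>
    rcases hR : regions r k with _ | ⟨⟨e, w⟩, R⟩
    · rw [hR] at hRl; simp at hRl; omega
    have hreg := h.reg
    rw [hR] at hreg hsum
    obtain ⟨g6, g7, gR⟩ := hreg
    have hv11 : s.var 11 = R.length := by
      have := h.v11
      rw [hR] at this; simp at this; exact this
    obtain ⟨u4, u8, u12, u13, u14, u15, u16, u17, u18, u19, u11⟩ :=
      fillPrep_run_down (p := p) hq1 h.v7 hv8 v10 hv11 h3 h4 g6 g7
    simp only [List.map_cons, List.sum_cons] at hsum
    have hWle : w + 2 * r ≤ (2 * r + 2) * (k.length + 1) := by rw [mul_add_one]; omega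
    obtain ⟨s2, r2, b2, a2, hrel, hvar, harr, ht2⟩ := fillRelax_run hq1 hM₀ hMa hcap hb ht hk
      h.table (e := e) (w := w) (u := 0) (W := w + 2 * r) (by rw [hR]; simp) (Or.inl ⟨rfl, rfl⟩)
      (by exact_mod_cast hWle)
      (by
        intro x y z hx hy hz hd
        have hy0 : y = 0 := by simpa using hy
        rw [hy0, zero_add]
        exact abs_quotient_down hp hq hx hb0 hb1 hz (Int.mul_ediv_cancel' hd).symm)
      hs1 u4 u8 w9 u12 u13 u14 u15 u16 u17 u18 u19
    have htab := h.table.down hp hq hk hb0 hb1 hR hrel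
    obtain ⟨p7, p11, pR, p6, p7'⟩ := fillPost_run_down (r := r) (s := s2) (j := k.length) rfl
      ((hvar 7 (by simp)).trans w7) ((hvar 11 (by simp)).trans u11)
      ((hvar 14 (by simp)).trans u14) (by rw [harr 4 (by simp)]; exact h4)
      (gR.congr fun j _ => by rw [harr 6 (by simp), harr 7 (by simp)]; exact ⟨rfl, rfl⟩)
    have hb3 := (tame_run hLp (hM₀.trans hM1) ht2 hMb b2).2
    set s3 := (fillPost r).run s2 with hs3
    have hf3 := frame_run hlfp s2
    have ha5 : s3.arr 5 = s2.arr 5 := hf3.2 5 (fillPost_writesArr (by simp) (by simp))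
    have hregs : regions r ((b, .T) :: k) = (0, 0) :: (k.length + 1, w + 2 * r) :: R := by
      simp [regions, hR]
    refine ⟨s3, ?_, hb3, ⟨by simpa using p7, ?_, ?_, by rw [hregs]; exact pR, by rw [ha5]; exact htab,
      harr3 hs3 harr ?_ ?_ htab⟩⟩
    · have hwin : window r ((b, .T) :: k) = (2 * w + 1) * (2 * 0 + 1) := by simp [window, hR]
      rw [hwin]
      exact hfill hs3 r2 b2
    · rw [hs3, hf3.1 8 rfl, hvar 8 (by simp)]
      exact u8
    · rw [p11, hregs]; simp
    · intro i
      rcases p6 i with h5 | h5 | h5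
      · rw [h5, harr 6 (by simp)]; exact h.arr 6 i
      · rw [h5, abs_of_nonneg (by positivity)]; linarith
      · rw [h5]; simp; linarith
    · intro i
      rcases p7' i with h5 | h5 | h5
      · rw [h5, harr 7 (by simp)]; exact h.arr 7 i
      · rw [h5, Nat.abs_cast]; exact hwid hWle
      · rw [h5]; simp; linarith
  | t =>
    have hrise : stackRise ((b, Stable.t) :: k) = 1 + stackRise k := by
      simp [stackRise, Stable.sign]
    rcases hR : regions r k with _ | ⟨⟨e, w⟩, _ | ⟨⟨f, u⟩, R⟩⟩
    · rw [hR] at hRl; simp at hRl; omega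
    · rw [hR] at hRl; simp at hRl; omega
    have hreg := h.reg
    rw [hR] at hreg hsum
    obtain ⟨g6, g7, g6d, g7d, gR⟩ := hreg
    have hv11 : s.var 11 = (R.length : ℤ) + 1 := by
      have := h.v11
      rw [hR] at this; simp at this; linarith
    obtain ⟨u4, u8, u12, u13, u14, u15, u16, u17, u18, u19, u11⟩ :=
      fillPrep_run_up (p := p) hq1 h.v7 hv8 v10 hv11 h3 h4
        (by rw [← g6]; simp) (by rw [← g7]; simp) g6d g7d
    simp only [List.map_cons, List.sum_cons] at hsum
    have hWle : u + 2 + w / r ≤ (2 * r + 2) * (k.length + 1) := by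
      have := Nat.div_le_self w r
      rw [mul_add_one]; omega
    obtain ⟨s2, r2, b2, a2, hrel, hvar, harr, ht2⟩ := fillRelax_run hq1 hM₀ hMa hcap hb ht hk
      h.table (e := e) (w := w) (u := u) (W := u + 2 + (w / r : ℕ)) (by rw [hR]; simp)
      (Or.inr ⟨f, by rw [hR]; simp, rfl⟩) (by exact_mod_cast hWle)
      (by
        intro x y z hx hy hz hd
        have h5 := abs_quotient_up hp hr hq hx hb0 hb1 hz (Int.mul_ediv_cancel' hd).symm
        have h6 := abs_add_le y ((x - b + p * z) / q)
        linarith)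
      hs1 u4 u8 w9 u12 u13 u14 u15 u16 u17 u18 u19
    have htab := h.table.up hp hr hq hk hb0 hb1 hR hrel
    obtain ⟨p7, p11, pR, p6, p7'⟩ := fillPost_run_up (r := r) (s := s2) (j := k.length) rfl
      ((hvar 7 (by simp)).trans w7) ((hvar 11 (by simp)).trans u11)
      ((hvar 14 (by simp)).trans u14) ((hvar 16 (by simp)).trans u16)
      (by rw [harr 4 (by simp)]; exact h4)
      (gR.congr fun j _ => by rw [harr 6 (by simp), harr 7 (by simp)]; exact ⟨rfl, rfl⟩)
    have hb3 := (tame_run hLp (hM₀.trans hM1) ht2 hMb b2).2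
    set s3 := (fillPost r).run s2 with hs3
    have hf3 := frame_run hlfp s2
    have ha5 : s3.arr 5 = s2.arr 5 := hf3.2 5 (fillPost_writesArr (by simp) (by simp))
    have hregs : regions r ((b, .t) :: k) = (k.length + 1, u + 2 + w / r) :: R := by
      simp [regions, hR]
    refine ⟨s3, ?_, hb3, ⟨by simpa using p7, ?_, ?_, by rw [hregs]; exact pR, by rw [ha5]; exact htab,
      harr3 hs3 harr ?_ ?_ htab⟩⟩
    · have hwin : window r ((b, .t) :: k) = (2 * w + 1) * (2 * u + 1) := by simp [window, hR]
      rw [hwin]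
      exact hfill hs3 r2 b2
    · rw [hs3, hf3.1 8 rfl, hvar 8 (by simp)]
      exact u8
    · rw [p11, hregs]; simp
    · intro i
      rcases p6 i with h5 | h5
      · rw [h5, harr 6 (by simp)]; exact h.arr 6 i
      · rw [h5, abs_of_nonneg (by positivity)]; linarith
    · intro i
      rcases p7' i with h5 | h5
      · rw [h5, harr 7 (by simp)]; exact h.arr 7 i
      · rw [h5, Nat.abs_cast]; exact hwid hWle

/-- Computes the powers `(2q)^i`. -/
def powerProg (q : ℕ) : Prog :=
  (9 ≔ 1 ;; 7 ≔ 0) ;; .loop (.less (vr 7) (vr 3)) (9 ≔ vr 9 * .lit (2 * q) ;; 7 ≔ vr 7 + 1)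

/-- Prepares the table. -/
def fillInit (r : ℕ) : Prog :=
  8 ≔ vr 9 ;; 10 ≔ .lit (4 * r + 5) * (vr 3 + 1) ;; .put 5 0 1 ;; 11 ≔ 0 ;; .put 6 0 0 ;;
  .put 7 0 0 ;; 7 ≔ 0

/-- Computes the table for the runs over the stack. -/
def fillProg (p q r : ℕ) : Prog :=
  powerProg q ;; fillInit r ;; .loop (.less (vr 7) (vr 3)) (fillBody p q r)

theorem powerProg_run {q n : ℕ} (hq : 1 ≤ q) {M : ℤ} (hM : 2 ≤ M) (hD : (2 * q) ^ n ≤ M) {s : State}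
    (hb : Bdd M s) (h3 : s.var 3 = n) :
    ∃ s', Runs M (powerProg q) s (20 * (n + 1)) s' ∧ Bdd M s' ∧ s'.var 9 = (2 * q) ^ n := by
  have hqz : (1 : ℤ) ≤ q := by exact_mod_cast hq
  have h1 : |(1 : ℤ)| ≤ M := by simp; omega
  have h0 : |(0 : ℤ)| ≤ M := by simp; omega
  have hnM : (n : ℤ) ≤ M := by
    have := hb.1 3
    rwa [h3, Nat.abs_cast] at this
  have b1 : Bdd M (Prog.run (9 ≔ 1 ;; 7 ≔ 0) s) := (hb.setVar h1 9).setVar h0 7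
  have r1 := runs_run (c := 9 ≔ 1 ;; 7 ≔ 0) ⟨trivial, trivial⟩ hM hb
  obtain ⟨s', r2, b2, -, -, i2⟩ := runs_loop_const (e := .less (vr 7) (vr 3))
    (c := 9 ≔ vr 9 * .lit (2 * q) ;; 7 ≔ vr 7 + 1) hM
    (fun i s' => s'.var 7 = i ∧ s'.var 9 = (2 * q) ^ i) n
    (9 ≔ vr 9 * .lit (2 * q) ;; 7 ≔ vr 7 + 1 : Prog).time b1 (by simp [Prog.run])
    (by
      rintro i hi s' hb' hf ⟨i1, i2⟩
      have g3 : s'.var 3 = n := by rw [hf.1 3 rfl]; simpa [Prog.run] using h3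
      have hin : (i : ℤ) < n := by exact_mod_cast hi
      have hs : Prog.run (9 ≔ vr 9 * .lit (2 * q) ;; 7 ≔ vr 7 + 1) s' =
          (s'.setVar 9 ((2 * q) ^ (i + 1))).setVar 7 (i + 1) := by
        simp [Prog.run, i1, i2, pow_succ]
      refine ⟨by simp [i1, g3, hi], _, runs_run (by exact ⟨trivial, trivial⟩) hM hb', ?_, ?_, ?_⟩
      · rw [hs]
        refine (hb'.setVar ?_ 9).setVar ?_ 7
        · rw [abs_of_nonneg (by positivity)]
          exact (pow_le_pow_right₀ (by linarith) (by omega)).trans hD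
        · rw [abs_of_nonneg (by positivity)]; omega
      · rw [hs]; simp
      · rw [hs]; simp)
    (by
      rintro s' hb' hf ⟨i1, -⟩
      have g3 : s'.var 3 = n := by rw [hf.1 3 rfl]; simpa [Prog.run] using h3
      simp [i1, g3])
  refine ⟨s', (r1.seq hM r2).mono ?_, b2, i2⟩
  have e1 : (9 ≔ 1 ;; 7 ≔ 0 : Prog).time = 4 := rfl
  have e2 : (9 ≔ vr 9 * .lit (2 * q) ;; 7 ≔ vr 7 + 1 : Prog).time = 8 := rfl
  have e3 : (Expr.less (vr 7) (vr 3)).cost = 3 := rfl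
  rw [e1, e2, e3]
  omega

/-- The sum of the windows. -/
def windowSum (r : ℕ) : List (ℤ × Stable) → ℕ
  | [] => 0
  | y :: l => window r (y :: l) + windowSum r l

theorem sum_window (r : ℕ) (l : List (ℤ × Stable)) :
    ∑ i ∈ Finset.range l.length, window r (l.drop (l.length - (i + 1))) = windowSum r l := by
  induction l with
  | nil => rfl
  | cons y l ih =>
    rw [List.length_cons, Finset.sum_range_succ, windowSum, ← ih, Nat.sub_self, List.drop_zero,
      add_comm]
    congr 1
    refine Finset.sum_congr rfl fun i hi => ?_
    have h : l.length + 1 - (i + 1) = (l.length - (i + 1)) + 1 := by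
      have := Finset.mem_range.1 hi
      omega
    rw [h, List.drop_succ_cons]

/-- The number of steps of `fillProg` for each pair of carries. -/
def fillProgTime (p q r : ℕ) : ℕ := (fillInit r).time + 30 + fillTime p q r

theorem NF.Valid.suffix {p q : ℕ} {l k : List (ℤ × Stable)} (h : NF.Valid p q l) (hk : k <:+ l) :
    NF.Valid p q k := by
  induction l with
  | nil => rw [List.suffix_nil.1 hk]; trivial
  | cons y l ih =>
    rcases List.suffix_cons_iff.1 hk with rfl | hk
    · exact h
    · exact ih h.2.2.2 hk

theorem fillProg_run {p q r : ℕ} (hp : 1 ≤ p) (hr : 1 ≤ r) (hq : q = p * r) {M₀ M : ℤ}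
    (hM₀ : 2 ≤ M₀)
    (hM : M₀ ^ ((fillPrep p q).deg * ((relaxBody p q).deg * (fillPost r).deg)) ≤ M)
    {l : List (ℤ × Stable)}
    (hcap : cap q l.length l.length ≤ M₀) (hS : stride r l.length ≤ M₀)
    (hD : (2 * q) ^ l.length ≤ M₀) {s : State} (hb : Bdd M s)
    (ht : ∀ A i, |s.arr A i| ≤ M₀) (hv : NF.Valid p q l) (hl : ValleyStack l)
    (hin : StackIn s l) (v3 : s.var 3 = l.length) (ha : ∀ i, s.arr 5 i = 0) :
    ∃ s', Runs M (fillProg p q r) s (fillProgTime p q r * (windowSum r l + l.length + 1)) s' ∧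
      Bdd M s' ∧ FillInv p q r l.length M₀ l s' ∧ s'.var 9 = (2 * q) ^ l.length ∧
      s'.var 10 = stride r l.length := by
  have h1 : (1 : ℤ) ≤ M₀ := by linarith
  have hq1 : 1 ≤ q := by rw [hq]; exact Nat.mul_pos hp hr
  have hM0M : M₀ ≤ M :=
    (le_self_pow₀ h1 (Nat.one_le_iff_ne_zero.1 (Nat.mul_pos (Prog.deg_pos _)
      (Nat.mul_pos (Prog.deg_pos _) (Prog.deg_pos _))))).trans hM
  have hM2 : 2 ≤ M := by linarith
  set n := l.length with hn
  obtain ⟨s1, r1, b1, w9⟩ := powerProg_run hq1 hM2 (hD.trans hM0M) hb v3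
  have f1 := r1.frame
  have w3 : s1.var 3 = n := (f1.1 3 rfl).trans v3
  have harr1 : s1.arr = s.arr := by funext A; exact f1.2 A (by simp [powerProg, Prog.writesArr])
  have hlf : (fillInit r).LoopFree := by simp [fillInit, Prog.LoopFree]
  have r2 := runs_run hlf hM2 b1
  have hs2 : (fillInit r).run s1 = (((((((s1.setVar 8 ((2 * q) ^ n)).setVar 10 (stride r n)).setArr 5 0
      1).setVar 11 0).setArr 6 0 0).setArr 7 0 0)).setVar 7 0 := by
    simp [fillInit, Prog.run, w9, w3, stride]
  have ha1 : |(1 : ℤ)| ≤ M := by simp; omega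
  have ha0 : |(0 : ℤ)| ≤ M := by simp; omega
  have b2 : Bdd M ((fillInit r).run s1) := by
    rw [hs2]
    refine ((((((b1.setVar ?_ 8).setVar ?_ 10).setArr ha1 5 0).setVar ha0 11).setArr ha0 6 0).setArr
      ha0 7 0).setVar ha0 7
    · rw [abs_of_nonneg (by positivity)]; exact hD.trans hM0M
    · rw [abs_of_pos (stride_pos r n)]; exact hS.trans hM0M
  set s2 := (fillInit r).run s1 with hs2'
  have f2 : Frame (fillInit r) s1 s2 := frame_run hlf s1
  have hsuf : ∀ i, l.drop i <:+ l := fun i => List.drop_suffix i l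
  have hinv0 : FillInv p q r n M₀ (l.drop (n - 0)) s2 := by
    rw [Nat.sub_zero, hn, List.drop_length]
    refine ⟨by simp [hs2], by simp [hs2, hn], by simp [hs2, regions], ?_, TableFor.nil fun c => ?_, ?_⟩
    · simp [hs2, regions, RegionsIn]
    · by_cases hc : c = 0 <;> simp [hs2, hc, harr1, ha]
    · intro A i
      have := ht A i
      rw [← harr1] at this
      simp only [hs2, State.setVar_arr, State.setArr_arr]
      split_ifs <;> first | exact this | (simp; try linarith)
  obtain ⟨s3, r3, b3, f3, hinv⟩ := runs_loop (e := .less (vr 7) (vr 3)) (c := fillBody p q r) hM2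
    (fun i s' => FillInv p q r n M₀ (l.drop (n - i)) s') n
    (fun i => fillTime p q r * (window r (l.drop (n - (i + 1))) + 1)) b2 hinv0
    (by
      intro i hi s' hb' hf hI
      have hlt : n - (i + 1) < l.length := by omega
      have hcons : l.drop (n - (i + 1)) = l[n - (i + 1)] :: l.drop (n - i) := by
        rw [List.drop_eq_getElem_cons hlt]
        congr 2; omega
      have hklen : (l.drop (n - i)).length = i := by rw [List.length_drop]; omega
      have g3 : s'.var 3 = n := by rw [hf.1 3 rfl, f2.1 3 rfl, w3]
      have g9 : s'.var 9 = (2 * q) ^ n := by rw [hf.1 9 rfl, f2.1 9 rfl, w9]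
      have g10 : s'.var 10 = stride r n := by rw [hf.1 10 rfl, hs2]; simp
      have hst : StackIn s' (l.drop (n - (i + 1))) := by
        refine (hin.suffix (hsuf _)).congr fun j _ => ?_
        rw [hf.2 3 rfl, hf.2 4 rfl, f2.2 3 rfl, f2.2 4 rfl, harr1]
        exact ⟨rfl, rfl⟩
      have hvd := hv.suffix (hsuf (n - (i + 1)))
      have hvs : ∀ k', k' <:+ l.drop (n - (i + 1)) → stackRise k' ≤ 0 := fun k' hk' =>
        hl.2 k' (hk'.trans (hsuf _))
      rw [hcons] at hst hvd hvs
      rcases hbt : l[n - (i + 1)] with ⟨b, θ⟩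
      rw [hbt] at hst hvd hvs hcons
      obtain ⟨s'', r4, b4, hI4⟩ := fillBody_run hp hr hq hM₀ hM hcap hS hD hb' (by omega) hvd.1 hvd.2.1
        hvs hI g3 g9 g10 hst.1 hst.2.1
      refine ⟨?_, s'', by rw [hcons]; exact r4, b4, by rw [hcons]; exact hI4⟩
      have : (i : ℤ) < n := by exact_mod_cast hi
      simp [hI.v7, hklen, g3, hi])
    (by
      intro s' hb' hf hI
      have g3 : s'.var 3 = n := by rw [hf.1 3 rfl, f2.1 3 rfl, w3]
      have := hI.v7
      rw [Nat.sub_self, List.drop_zero] at this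
      simp [this, g3, hn])
  rw [Nat.sub_self, List.drop_zero] at hinv
  refine ⟨s3, (r1.seq hM2 (r2.seq hM2 r3)).mono ?_, b3, hinv, ?_, ?_⟩
  · have e3 : (Expr.less (vr 7) (vr 3)).cost = 3 := rfl
    have e4 : ∑ i ∈ Finset.range n, ((Expr.less (vr 7) (vr 3)).cost +
        fillTime p q r * (window r (l.drop (n - (i + 1))) + 1) + 1) =
        fillTime p q r * (windowSum r l + n) + 4 * n := by
      rw [e3, ← sum_window r l, ← hn]
      simp only [mul_add, mul_one, Finset.sum_add_distrib, Finset.sum_const, Finset.card_range,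
        smul_eq_mul, Finset.mul_sum]
      ring
    rw [e4, e3]
    unfold fillProgTime
    generalize (fillInit r).time = c1
    generalize fillTime p q r = c2
    generalize windowSum r l = X
    nlinarith [Nat.zero_le (c1 * X), Nat.zero_le (c1 * n)]
  · rw [f3.1 9 rfl, f2.1 9 rfl, w9]
  · rw [f3.1 10 rfl, hs2]; simp

/-! ### The program for the integer at the peak -/

/-- Processes one carry at the bottom. -/
def bestBody (p q r : ℕ) : Prog :=
  (22 ≔ vr 18 - vr 14 ;; 30 ≔ vr 2 - .lit p * vr 22) ;; llnfProg p q r ;;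
  (25 ≔ .get 5 (vr 13 + vr 22) + vr 37 * vr 9 ;;
    .ite (.less 0 (.get 5 (vr 13 + vr 22)) * (.same (vr 26) 0 + .less (vr 25) (vr 26)))
      (26 ≔ vr 25 ;; 27 ≔ vr 30) .skip ;;
    18 ≔ vr 18 + 1)

/-- Prepares the search. -/
def bestInit : Prog :=
  13 ≔ .get 6 0 * vr 10 ;; 14 ≔ .get 7 0 ;; 26 ≔ 0 ;; 27 ≔ 0 ;; 18 ≔ 0

/-- Finds the best integer at the peak. -/
def bestProg (p q r : ℕ) : Prog :=
  bestInit ;; .loop (.less (vr 18) (2 * vr 14 + 1)) (bestBody p q r)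

/-- The number of steps of `bestProg` for each carry and each level of the normal forms. -/
def bestTime (p q r : ℕ) : ℕ := llnfTime p q r + 100

theorem llnfProg_writesVar {p q r x : ℕ} (hx : x < 31 ∨ 46 < x) :
    (llnfProg p q r).writesVar x = false := by
  simp only [llnfProg, startProg, descendProg, selectProg, candA, candB, candC, takeMin,
    Prog.writesVar, Bool.or_false, Bool.or_eq_false_iff, beq_eq_false_iff_ne]
  omega

theorem llnfProg_writesArr (p q r A : ℕ) : (llnfProg p q r).writesArr A = false := by
  simp [llnfProg, startProg, descendProg, selectProg, candA, candB, candC, takeMin,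
    Prog.writesArr]

theorem exists_run {p q : ℕ} (hp : 1 ≤ p) (hpq : p < q) {l : List (ℤ × Stable)}
    (hv : NF.Valid p q l) (hl : ∀ k, k <:+ l → stackRise k ≤ 0) :
    ∃ xs σ, ZRun p q l xs σ ∧ (∀ x ∈ xs, |x| < q) ∧ (σ.length : ℤ) = 1 - stackRise l := by
  induction l with
  | nil => exact ⟨[], [0], .nil, by simp, by simp [stackRise]⟩
  | cons y l ih =>
    obtain ⟨xs, σ, h1, h2, h3⟩ := ih hv.2.2.2 fun k hk => hl k (hk.trans (List.suffix_cons _ _))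
    have h4 := hl l (List.suffix_cons _ _)
    have h5 := hl (y :: l) (List.suffix_refl _)
    obtain ⟨b, θ⟩ := y
    have hqz : (0 : ℤ) < q := by exact_mod_cast (by omega : 0 < q)
    cases θ with
    | T =>
      rcases σ with _ | ⟨z, ρ⟩
      · exact absurd rfl h1.ne_nil
      have hb1 : b < p := hv.2.1
      have hb0 : 0 ≤ b := hv.1
      refine ⟨b :: xs, 0 :: z :: ρ, .down h1 b b z (by ring), ?_, ?_⟩
      · refine List.forall_mem_cons.2 ⟨?_, h2⟩
        rw [abs_of_nonneg hb0]
        have : (p : ℤ) < q := by exact_mod_cast hpq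
        linarith
      · simp [stackRise, Stable.sign] at h3 ⊢
        linarith
    | t =>
      have hrise : stackRise ((b, Stable.t) :: l) = 1 + stackRise l := by
        simp [stackRise, Stable.sign]
      rcases σ with _ | ⟨z, _ | ⟨y, ρ⟩⟩
      · exact absurd rfl h1.ne_nil
      · simp at h3; omega
      refine ⟨(b - p * z) % q :: xs, _, .up h1 b _ (-((b - p * z) / q)) ?_, ?_, ?_⟩
      · have := Int.mul_ediv_add_emod (b - p * z) q
        linarith
      · refine List.forall_mem_cons.2 ⟨?_, h2⟩
        rw [abs_of_nonneg (Int.emod_nonneg _ hqz.ne')]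
        exact Int.emod_lt_of_pos _ hqz
      · rw [hrise]
        simp at h3 ⊢
        linarith

theorem better_iff {a b c : ℤ} : (if 0 < a then (1 : ℤ) else 0) *
    ((if b = 0 then 1 else 0) + if c < b then 1 else 0) ≠ 0 ↔ 0 < a ∧ (b = 0 ∨ c < b) := by
  by_cases h1 : 0 < a <;> by_cases h2 : b = 0 <;> by_cases h3 : c < b <;>
    simp [h1, h2, h3] <;> split_ifs <;> norm_num

set_option maxHeartbeats 800000 in
theorem bestProg_loop {p q r n w : ℕ} (hp : 1 ≤ p) (hr : 2 ≤ r) (hq : q = p * r) {h : ℕ} {M : ℤ}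
    (hM : 4 ^ ((q + 2) * (h + p + 1) + 2 + 2 * q) ≤ M) {s : State} (hb : Bdd M s)
    (hP : HasPowers q s) {cur eb : ℤ} {a : ℤ → ℤ} {A : ℤ} (ha0 : ∀ c, 0 ≤ a c) (haA : ∀ c, a c ≤ A)
    (hAM : A + (q + 2) * (h + 1) * (2 * q) ^ n ≤ M) (hwM : 2 * w + 1 ≤ M)
    (hX : ∀ z : ℤ, |z| ≤ w → |cur - p * z| < q * r ^ h)
    (v2 : s.var 2 = cur) (v9 : s.var 9 = (2 * q) ^ n) (v13 : s.var 13 = eb) (v14 : s.var 14 = w)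
    (v26 : s.var 26 = 0) (v18 : s.var 18 = 0) (ha : s.arr 5 = a) :
    ∃ s', Runs M (.loop (.less (vr 18) (2 * vr 14 + 1)) (bestBody p q r)) s
        (bestTime p q r * ((h + 1) * (2 * w + 2))) s' ∧ Bdd M s' ∧
      (∀ z : ℤ, |z| ≤ w → 0 < a (eb + z) → 0 < s'.var 26 ∧
        s'.var 26 ≤ a (eb + z) + (lnf p q (cur - p * z)).length * (2 * q) ^ n) ∧
      ((s'.var 26 = 0) ∨ ∃ z : ℤ, |z| ≤ w ∧ 0 < a (eb + z) ∧
        s'.var 26 = a (eb + z) + (lnf p q (cur - p * z)).length * (2 * q) ^ n ∧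
        s'.var 27 = cur - p * z) := by
  have hM2 : 2 ≤ M := by
    have : (4 : ℤ) ^ 1 ≤ 4 ^ ((q + 2) * (h + p + 1) + 2 + 2 * q) :=
      pow_le_pow_right₀ (by norm_num) (by omega)
    linarith
  have hXM : ∀ z : ℤ, |z| ≤ w → |cur - p * z| ≤ M := by
    intro z hz
    have h2 := mul_pow_le_four_pow (q := q) (r := r) (by rw [hq]; nlinarith) h
    have h3 : (4 : ℤ) ^ (q * (h + 1)) ≤ 4 ^ ((q + 2) * (h + p + 1) + 2 + 2 * q) :=
      pow_le_pow_right₀ (by norm_num) (by nlinarith)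
    linarith [hX z hz]
  have hlenD : ∀ z : ℤ, |z| ≤ w →
      ((lnf p q (cur - p * z)).length : ℤ) * (2 * q) ^ n ≤ (q + 2) * (h + 1) * (2 * q) ^ n := by
    intro z hz
    have h1 := length_lnf_le_of_lt hp (by omega) hq h (hX z hz)
    have h2 : ((lnf p q (cur - p * z)).length : ℤ) ≤ (q + 2) * (h + 1) := by exact_mod_cast h1
    exact mul_le_mul_of_nonneg_right h2 (by positivity)
  set val : ℤ → ℤ := fun z => a (eb + z) + (lnf p q (cur - p * z)).length * (2 * q) ^ n with hval
  have hval0 : ∀ z, 0 ≤ (lnf p q (cur - p * z)).length * (2 * q : ℤ) ^ n := fun z => by positivity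
  have hvalM : ∀ z : ℤ, |z| ≤ w → |val z| ≤ M := by
    intro z hz
    have h1 := ha0 (eb + z)
    have h2 := haA (eb + z)
    rw [abs_of_nonneg (add_nonneg h1 (hval0 z))]
    linarith [hlenD z hz]
  have hz' : ∀ i : ℕ, i < 2 * w + 1 → |(i : ℤ) - w| ≤ w := by
    intro i hi
    rw [abs_le]; omega
  obtain ⟨s', r', b', -, -, -, i3, i4⟩ := runs_loop_const (e := .less (vr 18) (2 * vr 14 + 1))
    (c := bestBody p q r) hM2
    (fun i s' => s'.var 18 = i ∧ s'.arr = s.arr ∧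
      (∀ i' < i, 0 < a (eb + ((i' : ℤ) - w)) → 0 < s'.var 26 ∧ s'.var 26 ≤ val ((i' : ℤ) - w)) ∧
      ((s'.var 26 = 0) ∨ ∃ z : ℤ, |z| ≤ w ∧ 0 < a (eb + z) ∧ s'.var 26 = val z ∧
        s'.var 27 = cur - p * z)) (2 * w + 1) (llnfTime p q r * (h + 1) + 50) hb
    ⟨by simp [v18], rfl, by simp, Or.inl v26⟩
    (by
      rintro i hi s' hb' hf ⟨i1, i2, i3, i4⟩
      have g2 : s'.var 2 = cur := by rw [hf.1 2 (by simp [bestBody, Prog.writesVar, llnfProg_writesVar]), v2]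
      have g9 : s'.var 9 = (2 * q) ^ n := by rw [hf.1 9 (by simp [bestBody, Prog.writesVar, llnfProg_writesVar]), v9]
      have g13 : s'.var 13 = eb := by rw [hf.1 13 (by simp [bestBody, Prog.writesVar, llnfProg_writesVar]), v13]
      have g14 : s'.var 14 = w := by rw [hf.1 14 (by simp [bestBody, Prog.writesVar, llnfProg_writesVar]), v14]
      have g5 : s'.arr 5 = a := by rw [i2, ha]
      have hzi := hz' i hi
      set z := (i : ℤ) - w with hz
      have e1 : Prog.run (22 ≔ vr 18 - vr 14 ;; 30 ≔ vr 2 - .lit p * vr 22) s' =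
          (s'.setVar 22 z).setVar 30 (cur - p * z) := by
        simp [Prog.run, i1, g14, g2, hz]
      have hzM : |z| ≤ M := by linarith [hzi, show (0 : ℤ) ≤ w by positivity]
      have b1 : Bdd M ((s'.setVar 22 z).setVar 30 (cur - p * z)) :=
        (hb'.setVar hzM 22).setVar (hXM z hzi) 30
      have r1 := runs_run (c := 22 ≔ vr 18 - vr 14 ;; 30 ≔ vr 2 - .lit p * vr 22)
        ⟨trivial, trivial⟩ hM2 hb'
      rw [e1] at r1
      set s1 := (s'.setVar 22 z).setVar 30 (cur - p * z) with hs1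
      obtain ⟨s2, r2, b2, hh⟩ := llnfProg_run hp hr hq hM b1
        (by intro j hj; simp only [hs1, State.setVar_arr, i2]; exact hP j hj)
        (by simpa [hs1] using hX z hzi)
      have h37 : s2.var 37 = (lnf p q (cur - p * z)).length := by
        have := hh.1
        simpa [hs1] using this
      have f2 := r2.frame
      have k9 : s2.var 9 = (2 * q) ^ n := by rw [f2.1 9 (llnfProg_writesVar (by omega))]; simp [hs1, g9]
      have k13 : s2.var 13 = eb := by rw [f2.1 13 (llnfProg_writesVar (by omega))]; simp [hs1, g13]
      have k22 : s2.var 22 = z := by rw [f2.1 22 (llnfProg_writesVar (by omega))]; simp [hs1]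
      have k18 : s2.var 18 = i := by rw [f2.1 18 (llnfProg_writesVar (by omega))]; simp [hs1, i1]
      have k30 : s2.var 30 = cur - p * z := by
        rw [f2.1 30 (llnfProg_writesVar (by omega))]; simp [hs1]
      have k26 : s2.var 26 = s'.var 26 := by
        rw [f2.1 26 (llnfProg_writesVar (by omega))]; simp [hs1]
      have k27 : s2.var 27 = s'.var 27 := by
        rw [f2.1 27 (llnfProg_writesVar (by omega))]; simp [hs1]
      have karr : s2.arr = s.arr := by
        funext B; rw [f2.2 B (llnfProg_writesArr p q r B)]; simp [hs1, i2]
      have k5 : s2.arr 5 = a := by rw [karr, ha]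
      have r3 := runs_run (c := 25 ≔ .get 5 (vr 13 + vr 22) + vr 37 * vr 9 ;;
        .ite (.less 0 (.get 5 (vr 13 + vr 22)) * (.same (vr 26) 0 + .less (vr 25) (vr 26)))
          (26 ≔ vr 25 ;; 27 ≔ vr 30) .skip ;; 18 ≔ vr 18 + 1)
        (by simp [Prog.LoopFree]) hM2 b2
      have hcond : (Expr.less 0 (.get 5 (vr 13 + vr 22)) * (.same (vr 26) 0 +
          .less (vr 25) (vr 26))).eval (s2.setVar 25 (val z)) ≠ 0 ↔
          0 < a (eb + z) ∧ (s'.var 26 = 0 ∨ val z < s'.var 26) := by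
        rw [← better_iff]
        simp [k13, k22, k5, k26]
      have e3 : Prog.run (25 ≔ .get 5 (vr 13 + vr 22) + vr 37 * vr 9) s2 = s2.setVar 25 (val z) := by
        simp [Prog.run, k13, k22, k5, h37, k9, hval]
      have hi1 : |((i : ℤ) + 1)| ≤ M := by
        rw [abs_of_nonneg (by positivity)]
        have : (i : ℤ) < 2 * w + 1 := by exact_mod_cast hi
        linarith
      have hguard : (Expr.less (vr 18) (2 * vr 14 + 1)).eval s' ≠ 0 := by
        have : (i : ℤ) < 2 * w + 1 := by exact_mod_cast hi
        simp [i1, g14, this]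
      refine ⟨hguard, _, (r1.seq hM2 (r2.seq hM2 r3)).mono (by
        have t1 : (22 ≔ vr 18 - vr 14 ;; 30 ≔ vr 2 - .lit p * vr 22 : Prog).time = 10 := rfl
        have t2 : (25 ≔ .get 5 (vr 13 + vr 22) + vr 37 * vr 9 ;;
          .ite (.less 0 (.get 5 (vr 13 + vr 22)) * (.same (vr 26) 0 + .less (vr 25) (vr 26)))
          (26 ≔ vr 25 ;; 27 ≔ vr 30) .skip ;; 18 ≔ vr 18 + 1 : Prog).time ≤ 40 := by decide
        rw [t1]; omega), ?_⟩
      rw [show ∀ c : Expr, ∀ d e f : Prog, ∀ x : Prog, Prog.run (x ;; .ite c d e ;; f) s2 =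
        f.run (Prog.run (.ite c d e) (x.run s2)) from fun _ _ _ _ _ => rfl, e3]
      by_cases hc : 0 < a (eb + z) ∧ (s'.var 26 = 0 ∨ val z < s'.var 26)
      · have e4 : Prog.run (.ite (.less 0 (.get 5 (vr 13 + vr 22)) * (.same (vr 26) 0 +
            .less (vr 25) (vr 26))) (26 ≔ vr 25 ;; 27 ≔ vr 30) .skip) (s2.setVar 25 (val z)) =
            ((s2.setVar 25 (val z)).setVar 26 (val z)).setVar 27 (cur - p * z) := by
          rw [Prog.run, if_pos (hcond.2 hc)]
          simp [Prog.run, k30]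
        have e5 : Prog.run (18 ≔ vr 18 + 1) (((s2.setVar 25 (val z)).setVar 26 (val z)).setVar 27
            (cur - p * z)) = (((s2.setVar 25 (val z)).setVar 26 (val z)).setVar 27
            (cur - p * z)).setVar 18 (i + 1) := by
          simp [Prog.run, k18]
        rw [e4, e5]
        have hvpos : 0 < val z := by
          have := hval0 z
          simp only [hval]; linarith [hc.1]
        refine ⟨(((b2.setVar (hvalM z hzi) 25).setVar (hvalM z hzi) 26).setVar (hXM z hzi) 27).setVar
          hi1 18, by simp, by simp [karr], fun i' hi' hpos => ?_, Or.inr ⟨z, hzi, hc.1, by simp,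
          by simp⟩⟩
        simp only [State.setVar_var]
        norm_num
        rcases Nat.lt_succ_iff_lt_or_eq.1 hi' with h1 | rfl
        · obtain ⟨j1, j2⟩ := i3 i' h1 hpos
          refine ⟨hvpos, ?_⟩
          rcases hc.2 with h2 | h2
          · omega
          · linarith
        · exact ⟨hvpos, le_rfl⟩
      · have e4 : Prog.run (.ite (.less 0 (.get 5 (vr 13 + vr 22)) * (.same (vr 26) 0 +
            .less (vr 25) (vr 26))) (26 ≔ vr 25 ;; 27 ≔ vr 30) .skip) (s2.setVar 25 (val z)) =
            s2.setVar 25 (val z) := by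
          rw [Prog.run, if_neg (fun h => hc (hcond.1 h))]
          rfl
        have e5 : Prog.run (18 ≔ vr 18 + 1) (s2.setVar 25 (val z)) =
            (s2.setVar 25 (val z)).setVar 18 (i + 1) := by
          simp [Prog.run, k18]
        rw [e4, e5]
        refine ⟨(b2.setVar (hvalM z hzi) 25).setVar hi1 18, by simp, by simp [karr],
          fun i' hi' hpos => ?_, ?_⟩
        · simp only [State.setVar_var]
          norm_num
          rw [k26]
          rcases Nat.lt_succ_iff_lt_or_eq.1 hi' with h1 | rfl
          · exact i3 i' h1 hpos
          · have h2 : ¬ (s'.var 26 = 0 ∨ val z < s'.var 26) := fun h => hc ⟨hpos, h⟩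
            push Not at h2
            have h3 : 0 ≤ s'.var 26 := by
              rcases i4 with h4 | ⟨z', h4, h5, h6, -⟩
              · exact h4.ge
              · rw [h6]; exact add_nonneg (ha0 _) (hval0 _)
            exact ⟨lt_of_le_of_ne h3 (Ne.symm h2.1), h2.2⟩
        · simp only [State.setVar_var]
          norm_num
          rw [k26, k27]
          exact i4)
    (by
      rintro s' hb' hf ⟨i1, -⟩
      have g14 : s'.var 14 = w := by
        rw [hf.1 14 (by simp [bestBody, Prog.writesVar, llnfProg_writesVar]), v14]
      simp [i1, g14])
  refine ⟨s', r'.mono ?_, b', fun z hz hpos => ?_, i4⟩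
  · have t1 : (Expr.less (vr 18) (2 * vr 14 + 1)).cost = 7 := rfl
    rw [t1]
    unfold bestTime
    generalize llnfTime p q r = c
    calc (7 + (c * (h + 1) + 50) + 1) * (2 * w + 1 + 1) ≤ ((c + 100) * (h + 1)) * (2 * w + 2) := by
          refine Nat.mul_le_mul ?_ (by omega)
          nlinarith
      _ = _ := by ring
  · have h1 : (((z + w).toNat : ℕ) : ℤ) = z + w := Int.toNat_of_nonneg (by rw [abs_le] at hz; omega)
    have h2 : (z + w).toNat < 2 * w + 1 := by rw [abs_le] at hz; omega
    have := i3 (z + w).toNat h2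
    rw [h1, add_sub_cancel_right] at this
    exact this hpos

theorem Config.singleton {a : ℤ → ℤ} {S : ℤ} {e w : ℕ} {σ : List ℤ} {κ : ℤ}
    (h : Config a S [(e, w)] σ κ) :
    ∃ z, σ = [z] ∧ |z| ≤ w ∧ 0 < a (e * S + z) ∧ κ = a (e * S + z) - 1 := by
  cases h with
  | cons hz ha h' =>
    cases h' with
    | nil => exact ⟨_, rfl, hz, ha, by ring⟩

theorem bestProg_run {p q r w e : ℕ} (hp : 1 ≤ p) (hpq : p < q) (hr : 2 ≤ r) (hq : q = p * r)
    {l : List (ℤ × Stable)} (hv : NF.Valid p q l) (hl : ValleyStack l)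
    (hR : regions r l = [(e, w)]) {h : ℕ} {M M₀ : ℤ}
    (hM : 4 ^ ((q + 2) * (h + p + 1) + 2 + 2 * q) ≤ M) {s : State} (hb : Bdd M s)
    (hP : HasPowers q s) (hinv : FillInv p q r l.length M₀ l s) {cur : ℤ}
    (hAM : cap q l.length l.length + (q + 2) * (h + 1) * (2 * q) ^ l.length ≤ M)
    (hwM : 2 * w + 1 ≤ M) (heM : e * stride r l.length ≤ M)
    (hX : ∀ z : ℤ, |z| ≤ w → |cur - p * z| < q * r ^ h)
    (v2 : s.var 2 = cur) (v9 : s.var 9 = (2 * q) ^ l.length) (v10 : s.var 10 = stride r l.length) :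
    ∃ s' xs z, Runs M (bestProg p q r) s (bestTime p q r * ((h + 1) * (2 * w + 2)) + 20) s' ∧
      Bdd M s' ∧ ZRun p q l xs [z] ∧ (∀ x ∈ xs, |x| < q) ∧ |z| ≤ w ∧
      s'.var 26 = (key q l.length xs + (lnf p q (cur - p * z)).length * (2 * q) ^ l.length : ℕ) + 1 ∧
      s'.var 27 = cur - p * z ∧
      ∀ ys y, ZRun p q l ys [y] → (∀ x ∈ ys, |x| < q) →
        key q l.length xs + (lnf p q (cur - p * z)).length * (2 * q) ^ l.length ≤
          key q l.length ys + (lnf p q (cur - p * y)).length * (2 * q) ^ l.length := by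
  have hM2 : 2 ≤ M := by
    have : (4 : ℤ) ^ 1 ≤ 4 ^ ((q + 2) * (h + p + 1) + 2 + 2 * q) :=
      pow_le_pow_right₀ (by norm_num) (by omega)
    linarith
  have hreg := hinv.reg
  rw [hR] at hreg
  obtain ⟨g6, g7, -⟩ := hreg
  simp only [List.length_nil, Nat.cast_zero] at g6 g7
  have htab := hinv.table
  have hS := stride_pos r l.length
  set S := stride r l.length with hSdef
  have e1 : bestInit.run s = ((((s.setVar 13 (e * S)).setVar 14 w).setVar 26 0).setVar 27 0).setVar
      18 0 := by
    simp [bestInit, Prog.run, g6, g7, v10]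
  have r1 := runs_run (c := bestInit) (by simp [bestInit, Prog.LoopFree]) hM2 hb
  have h0 : |(0 : ℤ)| ≤ M := by simp; omega
  have b1 : Bdd M (bestInit.run s) := by
    rw [e1]
    refine ((((hb.setVar ?_ 13).setVar ?_ 14).setVar h0 26).setVar h0 27).setVar h0 18
    · rw [abs_of_nonneg (by positivity)]; exact heM
    · rw [abs_of_nonneg (by positivity)]; omega
  obtain ⟨s', r2, b2, hmin, hres⟩ := bestProg_loop (n := l.length) (a := s.arr 5) hp hr hq hM b1
    (by rw [e1]; exact hP) htab.nonneg htab.le_cap hAM hwM hX (by simp [e1, v2]) (by simp [e1, v9])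
    (eb := e * S) (by simp [e1]) (by simp [e1]) (by simp [e1]) (by simp [e1]) (by simp [e1])
  have hcomp : ∀ ys y, ZRun p q l ys [y] → (∀ x ∈ ys, |x| < q) →
      |y| ≤ w ∧ 0 < s.arr 5 (e * S + y) ∧ s.arr 5 (e * S + y) - 1 ≤ key q l.length ys := by
    intro ys y h1 h2
    obtain ⟨κ, h3, h4⟩ := htab.complete ys [y] h1 h2
    rw [hR] at h3
    obtain ⟨z, h5, h6, h7, h8⟩ := h3.singleton
    obtain rfl : y = z := by simpa using h5
    exact ⟨h6, h7, h8 ▸ h4⟩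
  have hval : ∀ ys y, ZRun p q l ys [y] → (∀ x ∈ ys, |x| < q) → 0 < s'.var 26 ∧
      s'.var 26 ≤ (key q l.length ys +
        (lnf p q (cur - p * y)).length * (2 * q) ^ l.length : ℕ) + 1 := by
    intro ys y h1 h2
    obtain ⟨h3, h4, h5⟩ := hcomp ys y h1 h2
    obtain ⟨h6, h7⟩ := hmin y h3 h4
    refine ⟨h6, ?_⟩
    push_cast
    linarith
  obtain ⟨xs₀, σ₀, h1, h2, h3⟩ := exists_run hp hpq hv hl.2
  obtain ⟨z₀, rfl⟩ : ∃ z, σ₀ = [z] := by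
    rw [hl.1, sub_zero] at h3
    exact List.length_eq_one_iff.1 (by exact_mod_cast h3)
  rcases hres with h4 | ⟨z, hz, hpos, h26, h27⟩
  · have := (hval xs₀ z₀ h1 h2).1
    omega
  obtain ⟨xs, h5, h6, h7⟩ := htab.sound [z] _ (by rw [hR]; exact .cons hz hpos .nil)
  have h26' : s'.var 26 = (key q l.length xs +
      (lnf p q (cur - p * z)).length * (2 * q) ^ l.length : ℕ) + 1 := by
    push_cast
    rw [h26]
    linarith
  refine ⟨s', xs, z, (r1.seq hM2 r2).mono ?_, b2, h5, h6, hz, h26', h27, fun ys y h8 h9 => ?_⟩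
  · have : bestInit.time ≤ 20 := by decide
    omega
  · have := (hval ys y h8 h9).2
    rw [h26'] at this
    exact_mod_cast (add_le_add_iff_right _).1 this

/-! ### The program for the output -/

/-- Appends a word to the output. -/
def emitProg : Prog :=
  28 ≔ vr 37 ;;
  .loop (.less 0 (vr 28)) (28 ≔ vr 28 - 1 ;; .put 2 (vr 0 + vr 28) (vr 38 % 4) ;; 38 ≔ vr 38 / 4) ;;
  0 ≔ vr 0 + vr 37

/-- Appends the normal form of the integer in variable `30` to the output. -/
def emitInt (p q r : ℕ) : Prog := llnfProg p q r ;; emitProg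

/-- Appends the part of the output for one stable letter. -/
def decodeBody (p q r : ℕ) : Prog :=
  (8 ≔ vr 8 / .lit (2 * q) ;; 22 ≔ vr 26 / vr 8 % .lit (2 * q) ;;
    30 ≔ (vr 22 + 1) / 2 * (2 * (vr 22 % 2) - 1)) ;;
  emitInt p q r ;;
  (.put 2 (vr 0) (.less (.get 4 (vr 7 + 1)) 0) ;; 0 ≔ vr 0 + 1 ;; 7 ≔ vr 7 + 1)

/-- Prepares the output. -/
def decodeInit : Prog := 26 ≔ vr 26 - 1 ;; 8 ≔ vr 9 ;; 0 ≔ 0 ;; 7 ≔ 0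

/-- Computes the output. -/
def outputProg (p q r : ℕ) : Prog :=
  decodeInit ;; .loop (.less (vr 7) (vr 3)) (decodeBody p q r) ;; 30 ≔ vr 27 ;; emitInt p q r

theorem numVal_take_succ {w : List Letter} {i : ℕ} (hi : i < w.length) :
    numVal (w.take (i + 1)) = numVal (w.take i) * 4 + (w[i]).code := by
  rw [List.take_succ_eq_append_getElem hi, numVal_append]
  simp [numVal]

theorem State.Outputs.append {s s' : State} {u w : List Letter} (h : s.Outputs u)
    (h0 : s'.var 0 = s.var 0 + w.length)
    (h1 : ∀ i : ℤ, i < u.length → s'.arr 2 i = s.arr 2 i)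
    (h2 : ∀ (i : ℕ) (hi : i < w.length), s'.arr 2 (u.length + i) = (w[i]).code) :
    s'.Outputs (u ++ w) := by
  refine ⟨by rw [h0, h.1, List.length_append]; push_cast; rfl, fun i hi => ?_⟩
  rcases lt_or_ge i u.length with h3 | h3
  · rw [List.getElem_append_left h3, h1 _ (by exact_mod_cast h3), h.2 i h3]
  · obtain ⟨j, rfl⟩ := Nat.exists_eq_add_of_le h3
    rw [List.getElem_append_right h3]
    have := h2 j (by simp at hi; omega)
    push_cast
    rw [this]
    simp

theorem emitProg_run {M : ℤ} (hM : 4 ≤ M) {s : State} (hb : Bdd M s) {u w : List Letter}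
    (hu : s.Outputs u) (hw : Holds s 37 38 w) (hlen : (u.length : ℤ) + w.length ≤ M) :
    ∃ s', Runs M emitProg s (30 * (w.length + 1)) s' ∧ Bdd M s' ∧ s'.Outputs (u ++ w) := by
  have hM2 : 2 ≤ M := by linarith
  have hnM : |(w.length : ℤ)| ≤ M := by rw [abs_of_nonneg (by positivity)]; linarith
  have b1 : Bdd M (s.setVar 28 w.length) := hb.setVar hnM 28
  have r1 := runs_run (c := 28 ≔ vr 37) trivial hM2 hb
  rw [show Prog.run (28 ≔ vr 37) s = s.setVar 28 w.length by simp [Prog.run, hw.1]] at r1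
  obtain ⟨s2, r2, b2, f2, i1, i2, i3, i4⟩ := runs_loop_const (e := .less 0 (vr 28))
    (c := 28 ≔ vr 28 - 1 ;; .put 2 (vr 0 + vr 28) (vr 38 % 4) ;; 38 ≔ vr 38 / 4) hM2
    (fun i s' => s'.var 28 = w.length - i ∧ s'.var 38 = numVal (w.take (w.length - i)) ∧
      (∀ k : ℤ, k < u.length → s'.arr 2 k = s.arr 2 k) ∧
      (∀ (k : ℕ) (hk : k < w.length), w.length - i ≤ k → s'.arr 2 (u.length + k) = (w[k]).code))
    w.length 15 b1
    ⟨by simp, by simp [hw.2], by simp, fun k hk hk' => absurd hk (by omega)⟩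
    (by
      rintro i hi s' hb' hf ⟨i1, i2, i3, i4⟩
      have g0 : s'.var 0 = u.length := by rw [hf.1 0 rfl]; simpa using hu.1
      obtain ⟨m, hm⟩ : ∃ m, w.length - i = m + 1 := ⟨w.length - i - 1, by omega⟩
      have hmw : m < w.length := by omega
      have hm' : w.length - (i + 1) = m := by omega
      have hmz : (w.length : ℤ) - i = m + 1 := by omega
      rw [hm, numVal_take_succ hmw] at i2
      rw [hmz] at i1
      have hc := (w[m]).code_lt
      have d1 : ((numVal (w.take m) * 4 + (w[m]).code : ℕ) : ℤ) % 4 = (w[m]).code := by omega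
      have d2 : ((numVal (w.take m) * 4 + (w[m]).code : ℕ) : ℤ) / 4 = numVal (w.take m) := by omega
      have hs : Prog.run (28 ≔ vr 28 - 1 ;; .put 2 (vr 0 + vr 28) (vr 38 % 4) ;; 38 ≔ vr 38 / 4) s' =
          ((s'.setVar 28 m).setArr 2 (u.length + m) (w[m]).code).setVar 38 (numVal (w.take m)) := by
        rw [← d1, ← d2, ← i2]
        simp [Prog.run, i1, g0]
      refine ⟨by rw [Expr.eval_less, Expr.eval_var, i1, Expr.eval_zero, if_pos (by positivity)]; simp,
        _, (runs_run (by exact ⟨trivial, trivial, trivial⟩) hM2 hb').mono (by decide), ?_⟩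
      rw [hs]
      refine ⟨((hb'.setVar ?_ 28).setArr ?_ 2 _).setVar ?_ 38, ?_, ?_, ?_, ?_⟩
      · rw [abs_of_nonneg (by positivity)]; omega
      · rw [abs_of_nonneg (by positivity)]; omega
      · have := hb'.1 38
        rw [i2, abs_of_nonneg (by positivity)] at this
        rw [abs_of_nonneg (by positivity)]
        push_cast at this
        have : (0 : ℤ) ≤ numVal (w.take m) := by positivity
        have : (0 : ℤ) ≤ (w[m]).code := by positivity
        linarith
      · simp; omega
      · simp [hm']
      · intro k hk
        rw [State.setVar_arr, State.setArr_arr, if_neg (by omega), State.setVar_arr, i3 k hk]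
      · intro k hk hk'
        rw [State.setVar_arr, State.setArr_arr, State.setVar_arr]
        rcases Nat.lt_or_ge m k with h | h
        · rw [if_neg (by omega), i4 k hk (by omega)]
        · obtain rfl : k = m := by omega
          rw [if_pos ⟨rfl, rfl⟩])
    (by
      rintro s' hb' hf ⟨i1, -⟩
      simp [i1])
  have r3 := runs_run (c := 0 ≔ vr 0 + vr 37) trivial hM2 b2
  have g0 : s2.var 0 = u.length := by rw [f2.1 0 rfl]; simpa using hu.1
  have g37 : s2.var 37 = w.length := by rw [f2.1 37 rfl]; simpa using hw.1
  have e3 : Prog.run (0 ≔ vr 0 + vr 37) s2 = s2.setVar 0 (u.length + w.length) := by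
    simp [Prog.run, g0, g37]
  rw [e3] at r3
  refine ⟨_, (r1.seq hM2 (r2.seq hM2 r3)).mono ?_, b2.setVar ?_ 0, hu.append ?_ i3 ?_⟩
  · have t1 : (28 ≔ vr 37 : Prog).time = 2 := rfl
    have t2 : (0 ≔ vr 0 + vr 37 : Prog).time = 4 := rfl
    have t3 : (Expr.less 0 (vr 28)).cost = 3 := rfl
    rw [t1, t2, t3]; omega
  · rw [abs_of_nonneg (by positivity)]; exact hlen
  · simp [hu.1]
  · exact fun i hi => i4 i hi (by rw [Nat.sub_self]; exact Nat.zero_le i)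

/-- The number of steps of `emitInt` for each level of the normal form. -/
def emitTime (p q r : ℕ) : ℕ := llnfTime p q r + 30 * (q + 3)

theorem emitInt_run {p q r : ℕ} (hp : 1 ≤ p) (hr : 2 ≤ r) (hq : q = p * r) {h : ℕ} {M : ℤ}
    (hM : 4 ^ ((q + 2) * (h + p + 1) + 2 + 2 * q) ≤ M) {s : State} (hb : Bdd M s)
    (hP : HasPowers q s) {X : ℤ} (h30 : s.var 30 = X) (hX : |X| < q * r ^ h) {u : List Letter}
    (hu : s.Outputs u) (hlen : (u.length : ℤ) + (lnf p q X).length ≤ M) :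
    ∃ s', Runs M (emitInt p q r) s (emitTime p q r * (h + 1)) s' ∧ Bdd M s' ∧
      s'.Outputs (u ++ lnf p q X) := by
  subst h30
  have hM4 : 4 ≤ M := by
    have : (4 : ℤ) ^ 1 ≤ 4 ^ ((q + 2) * (h + p + 1) + 2 + 2 * q) :=
      pow_le_pow_right₀ (by norm_num) (by omega)
    linarith
  obtain ⟨s1, r1, b1, h1⟩ := llnfProg_run hp hr hq hM hb hP hX
  have f1 := r1.frame
  obtain ⟨s2, r2, b2, h2⟩ := emitProg_run (u := u) hM4 b1 ⟨by
    rw [f1.1 0 (llnfProg_writesVar (by omega)), hu.1], fun i hi => by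
    rw [f1.2 2 (llnfProg_writesArr p q r 2), hu.2 i hi]⟩ h1 hlen
  refine ⟨s2, (r1.seq (by linarith) r2).mono ?_, b2, h2⟩
  have h3 := length_lnf_le_of_lt hp (by omega) hq h hX
  unfold emitTime
  nlinarith

theorem digits_div {D : ℕ} {xs : List ℤ} (h : ∀ x ∈ xs, digit x < D) (Y : ℕ) {i : ℕ}
    (hi : i < xs.length) :
    (Y * D ^ xs.length + digits D xs) / D ^ i % D = digit xs[i] := by
  have hD : 0 < D := by
    have := h _ (List.getElem_mem hi)
    omega
  induction i generalizing xs with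
  | zero =>
    obtain ⟨x, xs, rfl⟩ : ∃ x l, xs = x :: l := List.exists_cons_of_length_pos hi
    rw [pow_zero, Nat.div_one, List.length_cons, pow_succ, digits,
      show Y * (D ^ xs.length * D) + (digits D xs * D + digit x) =
        digit x + D * (Y * D ^ xs.length + digits D xs) by ring, Nat.add_mul_mod_self_left]
    exact Nat.mod_eq_of_lt (h x (by simp))
  | succ i ih =>
    obtain ⟨x, xs, rfl⟩ : ∃ x l, xs = x :: l := List.exists_cons_of_length_pos (by omega)
    have := ih (xs := xs) (fun y hy => h y (by simp [hy])) (by simpa using hi)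
    rw [List.getElem_cons_succ, ← this, pow_succ', ← Nat.div_div_eq_div_mul, List.length_cons,
      pow_succ, digits, show Y * (D ^ xs.length * D) + (digits D xs * D + digit x) =
        digit x + D * (Y * D ^ xs.length + digits D xs) by ring, Nat.add_mul_div_left _ _ hD,
      Nat.div_eq_of_lt (h x (by simp)), zero_add]

theorem eq_of_digit (x : ℤ) : ((digit x : ℤ) + 1) / 2 * (2 * (digit x % 2) - 1) = x := by
  unfold digit
  split_ifs with h
  · have e1 : (((2 * x.natAbs - 1 : ℕ) : ℤ) + 1) / 2 = x := by omega
    have e2 : 2 * (((2 * x.natAbs - 1 : ℕ) : ℤ) % 2) - 1 = 1 := by omega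
    rw [e1, e2, mul_one]
  · have e1 : (((2 * x.natAbs : ℕ) : ℤ) + 1) / 2 = -x := by omega
    have e2 : 2 * (((2 * x.natAbs : ℕ) : ℤ) % 2) - 1 = -1 := by omega
    rw [e1, e2]; ring

/-- The part of the normal form given by the integers `xs` on the stack `l`. -/
noncomputable def stackWord (p q : ℕ) (xs : List ℤ) (l : List (ℤ × Stable)) : List Letter :=
  (setInts xs l).reverse.flatMap fun x => lnf p q x.1 ++ [x.2.letter]

theorem stackWord_cons (p q : ℕ) (x b : ℤ) (θ : Stable) (xs : List ℤ) (l : List (ℤ × Stable)) :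
    stackWord p q (x :: xs) ((b, θ) :: l) = stackWord p q xs l ++ lnf p q x ++ [θ.letter] := by
  simp [stackWord]

theorem length_stackWord_le {p q : ℕ} {xs : List ℤ} {l : List (ℤ × Stable)}
    (h : ∀ x ∈ xs, |x| < q) : (stackWord p q xs l).length ≤ q * l.length := by
  induction l generalizing xs with
  | nil => simp [stackWord, setInts]
  | cons y l ih =>
    obtain ⟨b, θ⟩ := y
    cases xs with
    | nil => simp [stackWord, setInts]
    | cons x xs =>
      rw [List.forall_mem_cons] at h
      have h1 := ih h.2
      have h2 := length_lnf_le_natAbs p q x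
      have h3 := h.1
      rw [Int.abs_eq_natAbs] at h3
      rw [stackWord_cons]
      simp only [List.length_append, List.length_cons, List.length_nil, mul_add, mul_one]
      omega

theorem decodeBody_run {p q r n : ℕ} (hp : 1 ≤ p) (hr : 2 ≤ r) (hq : q = p * r) {M : ℤ}
    (hM : 4 ^ ((q + 2) * (p + 1) + 2 + 2 * q) ≤ M) {s : State} (hb : Bdd M s)
    (hP : HasPowers q s) {Y j : ℕ} {x b : ℤ} {θ : Stable} {xs : List ℤ} {l : List (ℤ × Stable)}
    (hx : |x| < q) (hxs : ∀ x ∈ xs, |x| < q) (hj : l.length = j)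
    (v7 : s.var 7 = j) (v8 : s.var 8 = (2 * q) ^ (n + 1)) (v26 : s.var 26 = Y)
    (hY : Y / (2 * q) ^ n % (2 * q) = digit x) (hin : StackIn s ((b, θ) :: l))
    (hout : s.Outputs (stackWord p q xs l)) (hlen : (q * (j + 1) : ℤ) ≤ M) :
    ∃ s', Runs M (decodeBody p q r) s (emitTime p q r + 100) s' ∧ Bdd M s' ∧
      s'.var 7 = j + 1 ∧ s'.var 8 = (2 * q) ^ n ∧
      s'.Outputs (stackWord p q (x :: xs) ((b, θ) :: l)) := by
  have hM4 : 4 ≤ M := by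
    have : (4 : ℤ) ^ 1 ≤ 4 ^ ((q + 2) * (p + 1) + 2 + 2 * q) :=
      pow_le_pow_right₀ (by norm_num) (by omega)
    linarith
  have hM2 : 2 ≤ M := by linarith
  have hq1 : 1 ≤ q := by rw [hq]; exact Nat.mul_pos hp (by omega)
  have hqz : (1 : ℤ) ≤ q := by exact_mod_cast hq1
  have hqM : (q : ℤ) ≤ M := by nlinarith
  have hdl := digit_lt hx
  set P : ℤ := (2 * q) ^ n with hPdef
  have e1 : Prog.run (8 ≔ vr 8 / .lit (2 * q) ;; 22 ≔ vr 26 / vr 8 % .lit (2 * q) ;;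
      30 ≔ (vr 22 + 1) / 2 * (2 * (vr 22 % 2) - 1)) s =
      ((s.setVar 8 P).setVar 22 (digit x)).setVar 30 x := by
    have d1 : (2 * q : ℤ) ^ (n + 1) / (2 * q) = P := by
      rw [pow_succ, Int.mul_ediv_cancel _ (by positivity)]
    have d2 : (Y : ℤ) / P % (2 * q) = digit x := by rw [← hY, hPdef]; push_cast; rfl
    have d3 := eq_of_digit x
    simp only [Prog.run, Expr.eval_div, Expr.eval_var, Expr.eval_lit, v8, d1, Expr.eval_mod,
      Expr.eval_mul, Expr.eval_add, Expr.eval_sub, Expr.eval_one, Expr.eval_two]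
    simp [State.setVar, v26, d2, d3]
  have r1 := runs_run (c := 8 ≔ vr 8 / .lit (2 * q) ;; 22 ≔ vr 26 / vr 8 % .lit (2 * q) ;;
      30 ≔ (vr 22 + 1) / 2 * (2 * (vr 22 % 2) - 1)) (by exact ⟨trivial, trivial, trivial⟩) hM2 hb
  rw [e1] at r1
  set s1 := ((s.setVar 8 P).setVar 22 (digit x)).setVar 30 x with hs1
  have h8 := hb.1 8
  have hP0 : 0 < P := by positivity
  have b1 : Bdd M s1 := by
    refine ((hb.setVar ?_ 8).setVar ?_ 22).setVar (hx.le.trans hqM) 30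
    · rw [abs_of_nonneg hP0.le]
      rw [v8, abs_of_nonneg (by positivity), pow_succ] at h8
      nlinarith
    · rw [abs_of_nonneg (by positivity)]
      have : (digit x : ℤ) < 2 * q := by exact_mod_cast hdl
      have h4q : 2 * (q : ℤ) ≤ 4 ^ ((q + 2) * (p + 1) + 2 + 2 * q) := by
        have h1 : 2 * q < 4 ^ (2 * q) := Nat.lt_pow_self (by norm_num)
        have h2 : (4 : ℕ) ^ (2 * q) ≤ 4 ^ ((q + 2) * (p + 1) + 2 + 2 * q) :=
          Nat.pow_le_pow_right (by norm_num) (by omega)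
        exact_mod_cast h1.le.trans h2
      linarith
  have hlx := length_lnf_le_natAbs p q x
  have hl1 := length_stackWord_le (p := p) (l := l) hxs
  have hlx' : ((lnf p q x).length : ℤ) + 1 ≤ q := by
    rw [Int.abs_eq_natAbs] at hx; omega
  have hl1' : ((stackWord p q xs l).length : ℤ) ≤ q * j := by rw [← hj]; exact_mod_cast hl1
  obtain ⟨s2, r2, b2, o2⟩ := emitInt_run (h := 0) (X := x) (u := stackWord p q xs l) hp hr hq
    (by simpa using hM) b1 hP (by simp [hs1]) (by simpa using hx) hout (by linarith)
  have f2 := r2.frame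
  have wv : ∀ y, y < 31 → y ≠ 0 → y ≠ 28 → (emitInt p q r).writesVar y = false := by
    intro y h1 h2 h3
    simp only [emitInt, Prog.writesVar, llnfProg_writesVar (Or.inl h1), emitProg, Bool.false_or,
      Bool.or_eq_false_iff, beq_eq_false_iff_ne]
    omega
  have wa : ∀ A, A ≠ 2 → (emitInt p q r).writesArr A = false := by
    intro A hA
    simp only [emitInt, Prog.writesArr, llnfProg_writesArr, emitProg, Bool.false_or,
      Bool.or_false, beq_eq_false_iff_ne]
    omega
  have k7 : s2.var 7 = j := by rw [f2.1 7 (wv 7 (by omega) (by omega) (by omega))]; simp [hs1, v7]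
  have k8 : s2.var 8 = P := by rw [f2.1 8 (wv 8 (by omega) (by omega) (by omega))]; simp [hs1]
  have k0 := o2.1
  have k4 : s2.arr 4 (j + 1) = θ.sign := by
    rw [f2.2 4 (wa 4 (by omega)), ← hj]; exact hin.2.1
  set L := (stackWord p q xs l ++ lnf p q x).length with hL
  have hcode : (if θ.sign < 0 then (1 : ℤ) else 0) = θ.letter.code := by
    cases θ <;> simp [Stable.sign, Stable.letter, Letter.code]
  have r3 := runs_run (c := .put 2 (vr 0) (.less (.get 4 (vr 7 + 1)) 0) ;; 0 ≔ vr 0 + 1 ;;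
    7 ≔ vr 7 + 1) (by exact ⟨trivial, trivial, trivial⟩) hM2 b2
  have e3 : Prog.run (.put 2 (vr 0) (.less (.get 4 (vr 7 + 1)) 0) ;; 0 ≔ vr 0 + 1 ;;
      7 ≔ vr 7 + 1) s2 = ((s2.setArr 2 L θ.letter.code).setVar 0 (L + 1)).setVar 7 (j + 1) := by
    simp [Prog.run, k7, k4, k0, hcode]
  rw [e3] at r3
  have hLz : (L : ℤ) + 1 ≤ q * (j + 1) := by
    rw [hL, List.length_append]; push_cast; linarith
  refine ⟨_, (r1.seq hM2 (r2.seq hM2 r3)).mono ?_, ((b2.setArr ?_ 2 _).setVar ?_ 0).setVar ?_ 7,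
    by simp, by simp [k8], ?_⟩
  · have t1 : (8 ≔ vr 8 / .lit (2 * q) ;; 22 ≔ vr 26 / vr 8 % .lit (2 * q) ;;
      30 ≔ (vr 22 + 1) / 2 * (2 * (vr 22 % 2) - 1) : Prog).time ≤ 40 := Nat.le_of_ble_eq_true rfl
    have t2 : (.put 2 (vr 0) (.less (.get 4 (vr 7 + 1)) 0) ;; 0 ≔ vr 0 + 1 ;;
      7 ≔ vr 7 + 1 : Prog).time ≤ 50 := by decide
    omega
  · have := θ.letter.code_lt
    rw [abs_of_nonneg (by positivity)]; omega
  · rw [abs_of_nonneg (by positivity)]; linarith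
  · rw [abs_of_nonneg (by positivity)]; nlinarith
  · rw [stackWord_cons]
    refine o2.append (by simp [k0]) ?_ ?_
    · intro i hi
      rw [State.setVar_arr, State.setVar_arr, State.setArr_arr, if_neg (by omega)]
    · intro i hi
      obtain rfl : i = 0 := by simpa using hi
      rw [State.setVar_arr, State.setVar_arr, State.setArr_arr, if_pos ⟨rfl, by simp [hL]⟩]
      rfl

theorem outputProg_run {p q r : ℕ} (hp : 1 ≤ p) (hr : 2 ≤ r) (hq : q = p * r) {h : ℕ} {M : ℤ}
    (hM : 4 ^ ((q + 2) * (h + p + 1) + 2 + 2 * q) ≤ M) {s : State} (hb : Bdd M s)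
    (hP : HasPowers q s) {Y : ℕ} {X : ℤ} {xs : List ℤ} {l : List (ℤ × Stable)}
    (hxs : ∀ x ∈ xs, |x| < q) (hxl : xs.length = l.length) (hin : StackIn s l)
    (v3 : s.var 3 = l.length) (v9 : s.var 9 = (2 * q) ^ l.length)
    (v26 : s.var 26 = (Y * (2 * q) ^ l.length + digits (2 * q) xs : ℕ) + 1) (v27 : s.var 27 = X)
    (hX : |X| < q * r ^ h) (hlen : (q * l.length + (q + 2) * (h + 1) : ℤ) ≤ M) :
    ∃ s', Runs M (outputProg p q r) s
      ((emitTime p q r + 120) * (l.length + 1) + emitTime p q r * (h + 1)) s' ∧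
      s'.Outputs (stackWord p q xs l ++ lnf p q X) := by
  have hM4 : 4 ≤ M := by
    have : (4 : ℤ) ^ 1 ≤ 4 ^ ((q + 2) * (h + p + 1) + 2 + 2 * q) :=
      pow_le_pow_right₀ (by norm_num) (by omega)
    linarith
  have hM2 : 2 ≤ M := by linarith
  have hM0 : 4 ^ ((q + 2) * (p + 1) + 2 + 2 * q) ≤ M := by
    have : (4 : ℤ) ^ ((q + 2) * (p + 1) + 2 + 2 * q) ≤ 4 ^ ((q + 2) * (h + p + 1) + 2 + 2 * q) :=
      pow_le_pow_right₀ (by norm_num) (by nlinarith)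
    linarith
  set n := l.length with hn
  set D := 2 * q with hD
  have h26 := hb.1 26
  have h9 := hb.1 9
  set K := Y * D ^ n + digits D xs with hK
  have e1 : decodeInit.run s = (((s.setVar 26 K).setVar 8 (D ^ n : ℕ)).setVar 0 0).setVar 7 0 := by
    simp [decodeInit, Prog.run, v26, v9, hD]
  have r1 := runs_run (c := decodeInit) (by simp [decodeInit, Prog.LoopFree]) hM2 hb
  rw [e1] at r1
  set s1 := (((s.setVar 26 K).setVar 8 (D ^ n : ℕ)).setVar 0 0).setVar 7 0 with hs1
  have h0 : |(0 : ℤ)| ≤ M := by simp; omega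
  have b1 : Bdd M s1 := by
    refine (((hb.setVar ?_ 26).setVar ?_ 8).setVar h0 0).setVar h0 7
    · rw [v26, abs_of_nonneg (by positivity)] at h26
      rw [abs_of_nonneg (by positivity)]; linarith
    · rw [v9] at h9
      rw [hD]; push_cast; exact h9
  have hdig : ∀ x ∈ xs, digit x < D := fun x hx => digit_lt (hxs x hx)
  have wv : ∀ y, y < 31 → y ≠ 0 → y ≠ 28 → (emitInt p q r).writesVar y = false := by
    intro y h1 h2 h3
    simp only [emitInt, Prog.writesVar, llnfProg_writesVar (Or.inl h1), emitProg, Bool.false_or,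
      Bool.or_eq_false_iff, beq_eq_false_iff_ne]
    omega
  have wa : ∀ A, A ≠ 2 → (emitInt p q r).writesArr A = false := by
    intro A hA
    simp only [emitInt, Prog.writesArr, llnfProg_writesArr, emitProg, Bool.false_or,
      Bool.or_false, beq_eq_false_iff_ne]
    omega
  have wdv : ∀ y, (y = 3 ∨ y = 26 ∨ y = 27) → (decodeBody p q r).writesVar y = false := by
    rintro y (rfl | rfl | rfl) <;>
      simp [decodeBody, Prog.writesVar, wv]
  have wda : ∀ A, A ≠ 2 → (decodeBody p q r).writesArr A = false := by
    intro A hA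
    simp [decodeBody, Prog.writesArr, wa A hA, hA]
  obtain ⟨s2, r2, b2, f2, -, -, o2⟩ := runs_loop_const (e := .less (vr 7) (vr 3))
    (c := decodeBody p q r) hM2
    (fun j s' => s'.var 7 = j ∧ s'.var 8 = (D ^ (n - j) : ℕ) ∧
      s'.Outputs (stackWord p q (xs.drop (n - j)) (l.drop (n - j)))) n (emitTime p q r + 100) b1
    ⟨by simp [hs1], by simp [hs1], by
      rw [Nat.sub_zero, hn, List.drop_length]
      exact ⟨by simp [hs1, stackWord, setInts], fun i hi => absurd hi (by simp [stackWord, setInts])⟩⟩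
    (by
      rintro j hj s' hb' hf ⟨i1, i2, i3⟩
      obtain ⟨m, hm⟩ : ∃ m, n - j = m + 1 := ⟨n - j - 1, by omega⟩
      have hm' : n - (j + 1) = m := by omega
      have hml : m < l.length := by omega
      have hmx : m < xs.length := by omega
      have g3 : s'.var 3 = n := by rw [hf.1 3 (wdv 3 (by simp))]; simpa [hs1] using v3
      have g26 : s'.var 26 = K := by rw [hf.1 26 (wdv 26 (by simp))]; simp [hs1]
      have gP : HasPowers q s' := by
        intro i hi
        rw [hf.2 8 (wda 8 (by omega))]; exact hP i hi
      have gin : StackIn s' (l.drop m) :=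
        (hin.suffix (List.drop_suffix m l)).congr fun i _ => by
          rw [hf.2 3 (wda 3 (by omega)), hf.2 4 (wda 4 (by omega))]; exact ⟨rfl, rfl⟩
      rw [hm] at i2 i3
      rw [hm', List.drop_eq_getElem_cons hml, List.drop_eq_getElem_cons hmx]
      rw [List.drop_eq_getElem_cons hml] at gin
      obtain ⟨s3, r3, b3, j1, j2, j3⟩ := decodeBody_run (n := m) (Y := K) (j := j) (x := xs[m])
        (b := l[m].1) (θ := l[m].2) (xs := xs.drop (m + 1)) (l := l.drop (m + 1)) hp hr hq hM0 hb'
        gP (hxs _ (List.getElem_mem hmx)) (fun x hx => hxs x (List.mem_of_mem_drop hx))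
        (by rw [List.length_drop]; omega) i1 (by rw [i2, hD]; push_cast; rfl) g26
        (by rw [hK, ← hxl]; exact digits_div hdig Y hmx) gin i3
        (by
          have : ((j : ℤ) + 1) ≤ n := by exact_mod_cast hj
          nlinarith [Nat.zero_le q, Nat.zero_le h])
      exact ⟨by simp [i1, g3, hj], s3, r3, b3, by simp [j1], by rw [j2, hD]; push_cast; rfl, j3⟩)
    (by
      rintro s' hb' hf ⟨i1, -⟩
      have g3 : s'.var 3 = n := by rw [hf.1 3 (wdv 3 (by simp))]; simpa [hs1] using v3
      simp [i1, g3])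
  rw [Nat.sub_self, List.drop_zero, List.drop_zero] at o2
  have g27 : s2.var 27 = X := by rw [f2.1 27 (wdv 27 (by simp))]; simpa [hs1] using v27
  have r3 := runs_run (c := 30 ≔ vr 27) trivial hM2 b2
  rw [show Prog.run (30 ≔ vr 27) s2 = s2.setVar 30 X by simp [Prog.run, g27]] at r3
  have hXM := b2.1 27
  rw [g27] at hXM
  have h1 := length_stackWord_le (p := p) (l := l) hxs
  have h2 := length_lnf_le_of_lt hp (by omega) hq h hX
  have h3 : ((stackWord p q xs l).length : ℤ) + (lnf p q X).length ≤ M := by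
    have h4 : ((stackWord p q xs l).length : ℤ) ≤ q * n := by exact_mod_cast h1
    have h5 : ((lnf p q X).length : ℤ) ≤ (q + 2) * (h + 1) := by exact_mod_cast h2
    linarith
  obtain ⟨s4, r4, -, o4⟩ := emitInt_run (X := X) (u := stackWord p q xs l) hp hr hq hM
    (b2.setVar hXM 30) (by
      intro i hi
      rw [State.setVar_arr, f2.2 8 (wda 8 (by omega))]; exact hP i hi) (by simp) hX
    ⟨by simpa using o2.1, by simpa using o2.2⟩ h3
  refine ⟨s4, (r1.seq hM2 (r2.seq hM2 (r3.seq hM2 r4))).mono ?_, o4⟩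
  have t1 : decodeInit.time = 10 := rfl
  have t2 : (30 ≔ vr 27 : Prog).time = 2 := rfl
  have t3 : (Expr.less (vr 7) (vr 3)).cost = 3 := rfl
  rw [t1, t2, t3]
  nlinarith

/-! ### The total size of the windows -/

/-- The number of leaves of the trees of carries that are still present. -/
def leaves : List (ℤ × Stable) → List ℕ
  | [] => [0]
  | (_, .T) :: bs => 0 :: leaves bs
  | (_, .t) :: bs => match leaves bs with
    | l :: y :: ρ => (y + max l 1) :: ρ
    | ρ => ρ

/-- The widths of regions are bounded in terms of numbers of leaves. -/
def WidthLE (r : ℕ) : List (ℕ × ℕ) → List ℕ → Prop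
  | [], _ => True
  | (_, w) :: R, l :: ρ =>
    w ≤ (4 * r + 4) * l ∧ List.Forall₂ (fun y l => y.2 ≤ (4 * r + 4) * l + 2 * r) R ρ
  | _, _ => False

theorem widthLE_leaves {r : ℕ} (hr : 2 ≤ r) (bs : List (ℤ × Stable)) :
    WidthLE r (regions r bs) (leaves bs) := by
  induction bs with
  | nil => simp [regions, leaves, WidthLE]
  | cons y bs ih =>
    obtain ⟨b, θ⟩ := y
    rcases hR : regions r bs with _ | ⟨⟨e, w⟩, R⟩
    · cases θ <;> simp [regions, hR, WidthLE]
    rcases hL : leaves bs with _ | ⟨l, ρ⟩ <;> rw [hR, hL] at ih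
    · exact ih.elim
    · obtain ⟨h1, h2⟩ := ih
      cases θ with
      | T =>
        simp only [regions, leaves, hR, hL, WidthLE]
        exact ⟨Nat.zero_le _, .cons (by simp; omega) h2⟩
      | t =>
        cases h2 with
        | nil => simp [regions, hR, WidthLE]
        | @cons y z R ρ h3 h4 =>
          obtain ⟨f, u⟩ := y
          simp only [regions, leaves, hR, hL, WidthLE]
          refine ⟨?_, h4⟩
          have h5 : w / r ≤ w / 2 := Nat.div_le_div_left hr (by norm_num)
          have h6 : 2 * (w / 2) ≤ w := Nat.mul_div_le w 2
          rcases Nat.eq_zero_or_pos l with rfl | hl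
          · simp at h1 h3 ⊢
            subst h1
            simp at h5 ⊢
            nlinarith
          · rw [max_eq_left hl]
            simp at h3
            nlinarith

/-- The number of changes from `T` to `t`, the last letter standing first. -/
def turns : List Stable → ℕ
  | [] => 0
  | θ :: l => turns l + if θ = .t ∧ l.head? = some .T then 1 else 0

theorem sum_leaves_le (bs : List (ℤ × Stable)) : (leaves bs).sum ≤ turns (bs.map Prod.snd) ∧
    ((leaves bs).head? = some 0 → (leaves bs).length = 1 ∨ (bs.map Prod.snd).head? = some .T) := by
  induction bs with
  | nil => simp [leaves, turns]
  | cons y bs ih =>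
    obtain ⟨b, θ⟩ := y
    obtain ⟨h1, h2⟩ := ih
    cases θ with
    | T => exact ⟨by simpa [leaves, turns] using h1, by simp⟩
    | t =>
      rcases hL : leaves bs with _ | ⟨l, _ | ⟨y, ρ⟩⟩
      · simp [leaves, hL]
      · rw [hL] at h1
        simp only [leaves, hL, List.map_cons, turns] at h1 ⊢
        exact ⟨by omega, fun _ => Or.inl rfl⟩
      · rw [hL] at h1 h2
        simp only [leaves, hL, List.map_cons, turns, List.sum_cons, List.head?_cons] at h1 h2 ⊢
        refine ⟨?_, fun h => absurd (Option.some.inj h) (by omega)⟩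
        rcases Nat.eq_zero_or_pos l with rfl | hl
        · rcases h2 rfl with h3 | h3
          · simp at h3
          · rw [if_pos ⟨trivial, h3⟩]; simp at h1 ⊢; omega
        · rw [max_eq_left hl]; omega

theorem windowSum_le {r : ℕ} (hr : 2 ≤ r) (bs : List (ℤ × Stable)) :
    windowSum r bs ≤ 2 * (4 * r + 4) ^ 2 * ((leaves bs).map (· ^ 2)).sum +
      (40 * r + 40) * (4 * r + 1) * ((turns (bs.map Prod.snd) + 1) * bs.length) := by
  induction bs with
  | nil => simp [windowSum]
  | cons y bs ih =>
    obtain ⟨b, θ⟩ := y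
    have hw := widthLE_leaves hr bs
    have hs := (sum_leaves_le bs).1
    set τ := turns (bs.map Prod.snd) with hτ
    have hturn : τ ≤ turns (((b, θ) :: bs).map Prod.snd) := by
      rw [List.map_cons, turns]; omega
    have hstep : (τ + 1) * bs.length + (τ + 1) ≤
        (turns (((b, θ) :: bs).map Prod.snd) + 1) * ((b, θ) :: bs).length := by
      rw [List.length_cons, ← mul_add_one]
      exact Nat.mul_le_mul_right _ (by omega)
    set N := (turns (((b, θ) :: bs).map Prod.snd) + 1) * ((b, θ) :: bs).length
    suffices h : window r ((b, θ) :: bs) + 2 * (4 * r + 4) ^ 2 * ((leaves bs).map (· ^ 2)).sum ≤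
        2 * (4 * r + 4) ^ 2 * ((leaves ((b, θ) :: bs)).map (· ^ 2)).sum +
        (40 * r + 40) * (4 * r + 1) * (τ + 1) by
      rw [windowSum]
      have h2 := Nat.mul_le_mul_left ((40 * r + 40) * (4 * r + 1)) hstep
      rw [mul_add] at h2
      omega
    set K := 4 * r + 4 with hK
    have hsq : ∀ l z : ℕ, 2 * (l * z) + l ^ 2 + z ^ 2 ≤ (z + max l 1) ^ 2 := fun l z => by
      have : l ≤ max l 1 := le_max_left _ _
      nlinarith
    rcases hR : regions r bs with _ | ⟨⟨e, w⟩, R⟩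
    · cases θ with
      | T => simp [window, hR, leaves]
      | t =>
        rcases hL : leaves bs with _ | ⟨l, _ | ⟨z, ρ⟩⟩
        · simp [window, hR, leaves, hL]
        · simp [window, hR, leaves, hL]
        · simp only [window, hR, leaves, hL, List.map_cons, List.sum_cons]
          have h8 := Nat.mul_le_mul_left (2 * K ^ 2) (hsq l z)
          nlinarith [Nat.zero_le (2 * K ^ 2 * (2 * (l * z))),
            Nat.zero_le ((40 * r + 40) * (4 * r + 1) * (τ + 1))]
    rcases hL : leaves bs with _ | ⟨l, ρ⟩ <;> rw [hR, hL] at hw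
    · exact hw.elim
    obtain ⟨h1, h2⟩ := hw
    rw [hL, List.sum_cons] at hs
    have hKl : K * l ≤ K * τ := Nat.mul_le_mul_left _ (by omega)
    rw [show 40 * r + 40 = 10 * K by omega]
    cases θ with
    | T =>
      simp only [window, hR, leaves, hL, List.map_cons, List.sum_cons]
      have h3 : 10 * K * (τ + 1) ≤ 10 * K * (4 * r + 1) * (τ + 1) :=
        Nat.mul_le_mul_right _ (Nat.le_mul_of_pos_right _ (by omega))
      have h4 : 10 * K * (τ + 1) = 10 * (K * τ) + 10 * K := by ring
      have h5 : 2 * K ^ 2 * (0 ^ 2 + (l ^ 2 + (ρ.map (· ^ 2)).sum)) =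
        2 * K ^ 2 * (l ^ 2 + (ρ.map (· ^ 2)).sum) := by ring
      rw [h5]
      change w ≤ K * l at h1
      omega
    | t =>
      cases h2 with
      | nil => simp [window, hR, leaves, hL]
      | @cons y z R ρ h3 h4 =>
        obtain ⟨f, u⟩ := y
        simp only [window, hR, leaves, hL, List.map_cons, List.sum_cons] at hs h3 ⊢
        change w ≤ K * l at h1
        change u ≤ K * z + 2 * r at h3
        have h5 : (2 * w + 1) * (2 * u + 1) ≤
            (2 * (K * l) + 1) * (2 * (K * z + 2 * r) + 1) :=
          Nat.mul_le_mul (by omega) (by omega)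
        have hKz : K * z ≤ K * τ := Nat.mul_le_mul_left _ (by omega)
        have h8 := Nat.mul_le_mul_left (2 * K ^ 2) (hsq l z)
        have h9 : (2 * (K * l) + 1) * (2 * (K * z + 2 * r) + 1) =
          2 * K ^ 2 * (2 * (l * z)) + 2 * (K * l) * (4 * r + 1) + 2 * (K * z) + (4 * r + 1) := by ring
        have h10 : K * l * (4 * r + 1) ≤ K * τ * (4 * r + 1) := Nat.mul_le_mul_right _ hKl
        have h11 : K * τ ≤ K * τ * (4 * r + 1) := Nat.le_mul_of_pos_right _ (by omega)
        have h12 : 4 * r + 1 ≤ K * (4 * r + 1) := Nat.le_mul_of_pos_left _ (by omega)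
        have h13 : 10 * K * (4 * r + 1) * (τ + 1) =
          10 * (K * τ * (4 * r + 1)) + 10 * (K * (4 * r + 1)) := by ring
        have h14 : 2 * K ^ 2 * ((z + max l 1) ^ 2 + (ρ.map (· ^ 2)).sum) =
          2 * K ^ 2 * (z + max l 1) ^ 2 + 2 * K ^ 2 * (ρ.map (· ^ 2)).sum := by ring
        have h15 : 2 * K ^ 2 * (l ^ 2 + (z ^ 2 + (ρ.map (· ^ 2)).sum)) + 2 * K ^ 2 * (2 * (l * z)) =
          2 * K ^ 2 * (2 * (l * z) + l ^ 2 + z ^ 2) + 2 * K ^ 2 * (ρ.map (· ^ 2)).sum := by ring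
        rw [h13, h14]
        have h16 : 2 * (K * l) * (4 * r + 1) = 2 * (K * l * (4 * r + 1)) := by ring
        omega

theorem turns_toNF_le (p q : ℕ) (h : ℤ) (l : List (Stable × ℤ)) :
    turns (((Word.mk h l).toNF p q).1.map Prod.snd) +
      (if (l.map Prod.fst).reverse.head? = some .t ∧
        (((Word.mk h l).toNF p q).1.map Prod.snd).head? = some .T then 1 else 0) ≤
      turns (l.map Prod.fst).reverse := by
  induction l using List.reverseRecOn with
  | nil => simp [Word.toNF, turns]
  | append_singleton l x ih =>
    obtain ⟨θ, x⟩ := x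
    rw [toNF_concat]
    have hl : ((Word.mk h l).toNF p q).1.length ≤ l.length := length_toNF_le ⟨h, l⟩
    generalize (Word.mk h l).toNF p q = N at *
    obtain ⟨S, c⟩ := N
    simp only [List.map_append, List.map_cons, List.map_nil, List.reverse_append,
      List.reverse_cons, List.reverse_nil, List.nil_append, List.singleton_append, List.head?_cons,
      Option.some.injEq, turns] at ih hl ⊢
    have hlast : (l.map Prod.fst).reverse = [] → S = [] := by
      intro h1
      have : l = [] := by simpa using h1
      subst this
      simpa using hl
    generalize (l.map Prod.fst).reverse = L at *
    rcases S with _ | ⟨⟨b, θ'⟩, S⟩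
    · simp [NF.step, NF.push, turns]
      cases θ <;> simp
    · rcases L with _ | ⟨φ, L⟩
      · simp at hlast
      · simp only [NF.step]
        split_ifs <;> cases θ <;> cases θ' <;> cases φ <;> simp_all [turns, NF.push] <;>
          omega

theorem sinks_pos (v : Word) : 1 ≤ v.sinks := by
  have hex : ∃ i, v.theta (i + 1) ≠ some .T := ⟨v.tail.length, by simp [Word.theta]⟩
  classical
  have h1 := Nat.find_spec hex
  have h2 : Nat.find hex ≤ v.tail.length := Nat.find_min' hex (by simp [Word.theta])
  refine Finset.card_pos.2 ⟨Nat.find hex, ?_⟩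
  rw [Finset.mem_filter, Finset.mem_range]
  refine ⟨by rw [Word.len]; omega, ?_, h1⟩
  rcases h3 : Nat.find hex with _ | i
  · simp [Word.theta]
  · have h4 := Nat.find_min hex (m := i) (by omega)
    rw [not_not] at h4
    rw [h4]; simp

theorem turns_le_sinks (v : Word) : turns (v.tail.map Prod.fst).reverse ≤ v.sinks := by
  obtain ⟨h, l⟩ := v
  have key : turns (l.map Prod.fst).reverse ≤ ((Finset.range (l.length + 1)).filter fun i =>
      (Word.mk h l).theta i = some .T ∧ (Word.mk h l).theta (i + 1) = some .t).card := by
    induction l using List.reverseRecOn with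
    | nil => simp [turns]
    | append_singleton l x ih =>
      obtain ⟨θ, x⟩ := x
      have hth : ∀ i ≤ l.length, (Word.mk h (l ++ [(θ, x)])).theta i = (Word.mk h l).theta i := by
        rintro (_ | i) hi
        · rfl
        · simp [Word.theta, List.getElem?_append_left (show i < l.length by omega)]
      have hlast : (Word.mk h (l ++ [(θ, x)])).theta (l.length + 1) = some θ := by
        simp [Word.theta]
      have hhead : (l.map Prod.fst).reverse.head? = (Word.mk h l).theta l.length := by
        rw [List.head?_reverse, List.getLast?_eq_getElem?, List.length_map]
        rcases hn : l.length with _ | n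
        · rw [List.length_eq_zero_iff.1 hn]; rfl
        · simp [Word.theta]
      have hnone : (Word.mk h l).theta (l.length + 1) = none := by simp [Word.theta]
      set F := (Finset.range (l.length + 1)).filter fun i =>
        (Word.mk h l).theta i = some .T ∧ (Word.mk h l).theta (i + 1) = some .t with hF
      have hsub : F ⊆ (Finset.range ((l ++ [(θ, x)]).length + 1)).filter fun i =>
          (Word.mk h (l ++ [(θ, x)])).theta i = some .T ∧
            (Word.mk h (l ++ [(θ, x)])).theta (i + 1) = some .t := by
        intro i hi
        rw [hF, Finset.mem_filter, Finset.mem_range] at hi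
        obtain ⟨h1, h2, h3⟩ := hi
        have h4 : i + 1 ≤ l.length := by
          rcases Nat.lt_or_ge i l.length with h4 | h4
          · exact h4
          · rw [show i = l.length by omega, hnone] at h3
            simp at h3
        rw [Finset.mem_filter, Finset.mem_range, hth _ (by omega), hth _ h4]
        exact ⟨by simp; omega, h2, h3⟩
      have hnotin : l.length ∉ F := by
        rw [hF, Finset.mem_filter, hnone]; simp
      simp only [List.map_append, List.map_cons, List.map_nil, List.reverse_append,
        List.reverse_cons, List.reverse_nil, List.nil_append, List.singleton_append, turns, hhead]
      split_ifs with hc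
      · refine le_trans ?_ (Finset.card_le_card (Finset.insert_subset
          (a := l.length) ?_ hsub))
        · rw [Finset.card_insert_of_notMem hnotin]; omega
        · rw [Finset.mem_filter, Finset.mem_range, hth _ le_rfl, hlast, hc.1]
          exact ⟨by simp, hc.2, rfl⟩
      · exact (Nat.add_le_add_right ih 0).trans (Finset.card_le_card hsub)
  refine key.trans (Finset.card_le_card fun i hi => ?_)
  simp only [Finset.mem_filter] at hi ⊢
  refine ⟨hi.1, ?_, ?_⟩
  · rw [hi.2.1]; simp
  · rw [hi.2.2]; simp

/-! ### The program for peak normal forms -/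

/-- Computes the peak normal form of a valley. -/
def pnfProg (p q r : ℕ) : Prog :=
  powersProg q ;; parseProg p q ;; fillProg p q r ;; bestProg p q r ;; outputProg p q r

theorem abs_inputState_le {p q : ℕ} (hp : 1 ≤ p) (hpq : p ≤ q) (v : Word) (A : ℕ) (i : ℤ) :
    |v.inputState.arr A i| ≤ (4 * q) ^ (v.norm p q + 1) := by
  have hq : (1 : ℤ) ≤ q := by exact_mod_cast hp.trans hpq
  have h1 : (1 : ℤ) ≤ (4 * q) ^ (v.norm p q + 1) := one_le_pow₀ (by linarith)
  simp only [Word.inputState]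
  split_ifs
  · by_cases h2 : i.toNat < v.coeffs.length
    · rw [List.getD_eq_getElem _ _ h2]
      have h3 : v.coeffs[i.toNat] ∈ v.coeffs := List.getElem_mem h2
      generalize v.coeffs[i.toNat] = x at *
      have h4 : intNorm p q x ≤ (v.coeffs.map (intNorm p q)).sum :=
        List.single_le_sum (by simp) _ (List.mem_map_of_mem h3)
      have h5 := abs_lt_pow_lnf hpq hp x
      rw [intNorm_eq hp hpq] at h4
      calc |x| ≤ (2 * q : ℤ) ^ (lnf p q x).length := h5.le
        _ ≤ (4 * q) ^ (lnf p q x).length := pow_le_pow_left₀ (by linarith) (by linarith) _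
        _ ≤ _ := pow_le_pow_right₀ (by linarith) (by rw [Word.norm]; omega)
    · rw [List.getD_eq_default _ _ (by omega)]
      simp
  · rcases v.theta i.toNat with _ | θ
    · simp
    · cases θ <;> simp [Stable.sign] <;> linarith
  · simp
  · simp

theorem bestProg_frame {p q r : ℕ} {s s' : State} (h : Frame (bestProg p q r) s s') :
    s'.var 3 = s.var 3 ∧ s'.var 9 = s.var 9 ∧ s'.arr = s.arr := by
  refine ⟨h.1 3 ?_, h.1 9 ?_, funext fun A => h.2 A ?_⟩ <;>
    simp [bestProg, bestInit, bestBody, Prog.writesVar, Prog.writesArr, llnfProg_writesVar,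
      llnfProg_writesArr]

/-- The number of steps of `pnfProg`, except for the search at the peak. -/
def pnfTime (p q r : ℕ) : ℕ :=
  powersTime q + parseTime p q + fillProgTime p q r + emitTime p q r + 140

set_option maxHeartbeats 2000000 in
theorem pnfProg_run {p q r : ℕ} (hp : 1 ≤ p) (hr : 2 ≤ r) (hq : q = p * r) {v : Word}
    (hv : v.IsValley p q) {h : ℕ} {M₀ M : ℤ} (h1 : (4 * q) ^ (v.norm p q + 1) ≤ M₀)
    (h2 : 4 ^ (2 * q) ≤ M₀) (h3 : ∀ n ≤ v.norm p q, cap q n n ≤ M₀)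
    (h4 : ∀ n ≤ v.norm p q, stride r n ≤ M₀)
    (h5 : M₀ ^ (parseBody p q).deg ≤ M)
    (h6 : M₀ ^ ((fillPrep p q).deg * ((relaxBody p q).deg * (fillPost r).deg)) ≤ M)
    (h7 : 4 ^ ((q + 2) * (h + p + 1) + 2 + 2 * q) ≤ M)
    (h8 : M₀ + (q + 2) * (h + 1) * M₀ ≤ M)
    (h9 : 2 * ((2 * r + 2) * v.norm p q) + 1 ≤ M)
    (h10 : v.norm p q * M₀ ≤ M)
    (h11 : (4 * q) ^ (v.norm p q + 1) + p * ((2 * r + 2) * v.norm p q) < (q : ℤ) * r ^ h)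
    (h12 : (q * v.norm p q + (q + 2) * (h + 1) : ℤ) ≤ M) :
    ∃ s' x, Runs M (pnfProg p q r) v.inputState
      (pnfTime p q r * (windowSum r (v.toNF p q).1 + v.norm p q + h + 2) +
        bestTime p q r * ((h + 1) * (2 * ((4 * r + 4) * v.sinks) + 2))) s' ∧
      s'.Outputs x ∧ v.IsPNF p q x := by
  have hpq : p < q := by rw [hq]; nlinarith
  have hq1 : 1 ≤ q := by omega
  have hqz : (1 : ℤ) ≤ q := by exact_mod_cast hq1
  have h4q : (4 * q : ℤ) ≤ (4 * q) ^ (v.norm p q + 1) := le_self_pow₀ (by linarith) (by omega)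
  have hM₀ : 2 ≤ M₀ := by linarith
  have hM₀M : M₀ ≤ M :=
    (le_self_pow₀ (by linarith) (Nat.one_le_iff_ne_zero.1 (Prog.deg_pos _))).trans h5
  have hM2 : 2 ≤ M := by linarith
  have hlen : v.len ≤ v.norm p q := Nat.le_add_right _ _
  have hn0 : (v.toNF p q).1.length ≤ v.norm p q := (length_toNF_le v).trans hlen
  have hnorm : (v.norm p q : ℤ) ≤ M := by nlinarith [Nat.zero_le (v.norm p q)]
  have harr0 : ∀ A i, |v.inputState.arr A i| ≤ M₀ := fun A i =>
    (abs_inputState_le hp hpq.le v A i).trans h1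
  have b0 : Bdd M v.inputState := by
    refine ⟨fun x => ?_, fun A i => (harr0 A i).trans hM₀M⟩
    simp only [Word.inputState]
    split_ifs
    · rw [Nat.abs_cast]
      have : (v.len : ℤ) ≤ v.norm p q := by exact_mod_cast hlen
      linarith
    · simp; linarith
  have hpowM : (4 : ℤ) ^ (2 * q + 1) ≤ M :=
    (pow_le_pow_right₀ (by norm_num) (by nlinarith)).trans h7
  obtain ⟨s1, r1, b1, P1, a1⟩ := powersProg_run hpowM b0
  have f1 := r1.frame
  have harr1 : ∀ A i, |s1.arr A i| ≤ M₀ := by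
    intro A i
    by_cases hA : A = 8
    · subst hA
      exact (a1 i).trans (max_le h2 (harr0 8 i))
    · rw [f1.2 A (by simp [powersProg, Prog.writesArr]; omega)]
      exact harr0 A i
  have hz : ∀ A i, 2 ≤ A → v.inputState.arr A i = 0 := by
    intro A i hA
    simp only [Word.inputState]
    rw [if_neg (by omega : ¬ A = 0), if_neg (by omega : ¬ A = 1), ite_self]
  obtain ⟨s2, r2, b2, harr2, k2, k3, hin⟩ := parseProg_run hp hpq.le h1 h5 b1 harr1
    (by rw [f1.1 0 rfl]; rfl) (f1.2 0 rfl) (f1.2 1 rfl) (by rw [f1.2 4 rfl]; exact hz 4 0 (by omega))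
  have f2 := r2.frame
  have hvs := valleyStack_toNF hp hpq.le hv
  have hvalid : NF.Valid p q (v.toNF p q).1 := by
    rw [← nf_val hp hq1]; exact nf_valid hp hq1 _
  have hcur : |(v.toNF p q).2| ≤ (4 * q) ^ (v.norm p q + 1) := abs_toNF_le hp hpq.le v.head v.tail
  have hτ : turns ((v.toNF p q).1.map Prod.snd) ≤ v.sinks :=
    (Nat.le_add_right _ _).trans ((turns_toNF_le p q v.head v.tail).trans (turns_le_sinks v))
  rcases hbs : v.toNF p q with ⟨l, cur⟩
  rw [hbs] at hn0 k2 k3 hin hvs hvalid hcur hτ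
  simp only at hn0 k2 k3 hin hvs hvalid hcur hτ
  have hD : (2 * q : ℤ) ^ l.length ≤ M₀ :=
    ((pow_le_pow_left₀ (by linarith) (by linarith) _).trans
      (pow_le_pow_right₀ (by linarith) (by omega))).trans h1
  obtain ⟨s3, r3, b3, hinv, k9, k10⟩ := fillProg_run hp (by omega) hq hM₀ h6 (h3 _ hn0) (h4 _ hn0)
    hD b2 harr2 hvalid hvs hin k3 (fun i => by
      rw [f2.2 5 rfl, f1.2 5 rfl]; exact hz 5 i (by omega))
  have f3 := r3.frame
  obtain ⟨⟨e, w⟩, hR⟩ := List.length_eq_one_iff.1 (by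
    have := length_regions (r := r) hvs.2
    rw [hvs.1, sub_zero] at this
    exact_mod_cast this : (regions r l).length = 1)
  have hw : w ≤ (2 * r + 2) * l.length := width_le (y := (e, w)) (by simp [hR])
  have hw' : w ≤ (2 * r + 2) * v.norm p q := hw.trans (Nat.mul_le_mul_left _ hn0)
  have hwz : (w : ℤ) ≤ (2 * r + 2) * v.norm p q := by exact_mod_cast hw'
  have he : e ≤ v.norm p q := ((regions_le r l).1 (e, w) (by simp [hR])).trans hn0
  have hez : (e : ℤ) ≤ v.norm p q := by exact_mod_cast he
  have hws : w ≤ (4 * r + 4) * v.sinks := by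
    have hwl := widthLE_leaves hr l
    have hsum := (sum_leaves_le l).1
    rw [hR] at hwl
    rcases hL : leaves l with _ | ⟨m, ρ⟩ <;> rw [hL] at hwl hsum
    · exact hwl.elim
    · rw [List.sum_cons] at hsum
      exact hwl.1.trans (Nat.mul_le_mul_left _ (by omega))
  have hX : ∀ z : ℤ, |z| ≤ w → |cur - p * z| < q * r ^ h := by
    intro z hz
    have hpz : (p : ℤ) * |z| ≤ p * ((2 * r + 2) * v.norm p q) :=
      mul_le_mul_of_nonneg_left (hz.trans hwz) (by positivity)
    calc |cur - p * z| ≤ |cur| + |p * z| := abs_sub _ _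
      _ = |cur| + p * |z| := by rw [abs_mul, Nat.abs_cast]
      _ < _ := by linarith
  have P3 : HasPowers q s3 := fun i hi => by
    rw [f3.2 8 rfl, f2.2 8 rfl]; exact P1 i hi
  obtain ⟨s4, xs, z, r4, b4, hrun, hxs, hzw, k26, k27, hmin⟩ := bestProg_run hp hpq hr hq hvalid hvs
    hR h7 b3 P3 hinv (cur := cur) (by
      have := mul_le_mul_of_nonneg_left hD (show (0 : ℤ) ≤ (q + 2) * (h + 1) by positivity)
      linarith [h3 _ hn0]) (by linarith) (by
      calc (e : ℤ) * stride r l.length ≤ v.norm p q * M₀ :=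
            mul_le_mul hez (h4 _ hn0) (stride_pos _ _).le (by positivity)
        _ ≤ M := h10) hX (by rw [f3.1 2 rfl, k2]) k9 k10
  obtain ⟨g3, g9, garr⟩ := bestProg_frame r4.frame
  have hxl := hrun.length_eq
  obtain ⟨s5, r5, hout⟩ := outputProg_run (l := l)
    (Y := absSum xs + (lnf p q (cur - p * z)).length) hp hr hq h7 b4
    (fun i hi => by rw [garr]; exact P3 i hi) hxs hxl
    (hin.congr fun j _ => by
      rw [garr, f3.2 3 rfl, f3.2 4 rfl]; exact ⟨rfl, rfl⟩)
    (by rw [g3, f3.1 3 rfl, k3]) (by rw [g9, k9])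
    (by
      rw [k26, key, hxl, Nat.sub_self, pow_zero, mul_one]
      push_cast
      ring) k27 (hX z hzw) (by
      have : (l.length : ℤ) ≤ v.norm p q := by exact_mod_cast hn0
      nlinarith)
  refine ⟨s5, _, (r1.seq hM2 (r2.seq hM2 (r3.seq hM2 (r4.seq hM2 r5)))).mono ?_, hout,
    isPNF_of_min hp hpq.le hq hv hbs hrun hxs hmin⟩
  have hb : bestTime p q r * ((h + 1) * (2 * w + 2)) ≤
      bestTime p q r * ((h + 1) * (2 * ((4 * r + 4) * v.sinks) + 2)) :=
    Nat.mul_le_mul_left _ (Nat.mul_le_mul_left _ (by omega))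
  unfold pnfTime
  simp only
  generalize windowSum r l = W at *
  generalize l.length = n at *
  generalize v.len = k at *
  generalize v.norm p q = N at *
  generalize powersTime q = c1
  generalize parseTime p q = c2
  generalize fillProgTime p q r = c3
  generalize emitTime p q r = c4
  have t1 : c1 ≤ c1 * (W + N + h + 2) := Nat.le_mul_of_pos_right _ (by omega)
  have t2 : c2 * (k + 1) ≤ c2 * (W + N + h + 2) := Nat.mul_le_mul_left _ (by omega)
  have t3 : c3 * (W + n + 1) ≤ c3 * (W + N + h + 2) := Nat.mul_le_mul_left _ (by omega)
  have t4 : c4 * (n + 1) + c4 * (h + 1) ≤ c4 * (W + N + h + 2) := by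
    rw [← mul_add]; exact Nat.mul_le_mul_left _ (by omega)
  have t5 : (c4 + 120) * (n + 1) = c4 * (n + 1) + 120 * (n + 1) := by ring
  have t6 : (c1 + c2 + c3 + c4 + 140) * (W + N + h + 2) = c1 * (W + N + h + 2) +
    c2 * (W + N + h + 2) + c3 * (W + N + h + 2) + c4 * (W + N + h + 2) +
    140 * (W + N + h + 2) := by ring
  rw [t5, t6]
  omega

/-! ### The bounds on the time and the size of the integers -/

theorem sum_sq_le (l : List ℕ) : (l.map (· ^ 2)).sum ≤ l.sum ^ 2 := by
  induction l with
  | nil => simp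
  | cons x l ih =>
    rw [List.map_cons, List.sum_cons, List.sum_cons]
    nlinarith [Nat.zero_le (x * l.sum)]

theorem windowSum_toNF_le {p q r : ℕ} (hr : 2 ≤ r) (v : Word) :
    windowSum r (v.toNF p q).1 ≤ (2 * (4 * r + 4) ^ 2 + 2 * ((40 * r + 40) * (4 * r + 1))) *
      (v.sinks * (v.norm p q + v.sinks)) := by
  have hs := sinks_pos v
  have hτ : turns ((v.toNF p q).1.map Prod.snd) ≤ v.sinks :=
    (Nat.le_add_right _ _).trans ((turns_toNF_le p q v.head v.tail).trans (turns_le_sinks v))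
  have hn : (v.toNF p q).1.length ≤ v.norm p q := (length_toNF_le v).trans (Nat.le_add_right _ _)
  have h1 := windowSum_le hr (v.toNF p q).1
  have h2 : ((leaves (v.toNF p q).1).map (· ^ 2)).sum ≤ v.sinks * (v.norm p q + v.sinks) :=
    calc _ ≤ (leaves (v.toNF p q).1).sum ^ 2 := sum_sq_le _
      _ ≤ v.sinks ^ 2 := Nat.pow_le_pow_left ((sum_leaves_le _).1.trans hτ) 2
      _ ≤ _ := by nlinarith
  have h3 : (turns ((v.toNF p q).1.map Prod.snd) + 1) * (v.toNF p q).1.length ≤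
      2 * (v.sinks * (v.norm p q + v.sinks)) :=
    calc _ ≤ (2 * v.sinks) * (v.norm p q + v.sinks) := Nat.mul_le_mul (by omega) (by omega)
      _ = _ := by ring
  exact (h1.trans (Nat.add_le_add (Nat.mul_le_mul_left _ h2) (Nat.mul_le_mul_left _ h3))).trans_eq
    (by ring)

theorem lt_two_pow_of_le {x k : ℕ} (h : x ≤ k) : (x : ℤ) + 1 ≤ 2 ^ k :=
  calc (x : ℤ) + 1 ≤ 2 ^ x := by exact_mod_cast Nat.lt_two_pow_self (n := x)
    _ ≤ 2 ^ k := pow_le_pow_right₀ (by norm_num) h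

/-- The number of levels of the normal forms, for each unit of the size of the input. -/
def levels (p q r : ℕ) : ℕ := 4 * q + p * (2 * r + 2) + 2

/-- The number of bits of the entries of the arrays, for each unit of the size of the input. -/
def entryBits (q r : ℕ) : ℕ := 7 * q + 4 * r + 6

/-- The number of bits of the values of the variables, for each unit of the size of the input. -/
def cellBits (p q r : ℕ) : ℕ :=
  entryBits q r * (parseBody p q).deg +
    entryBits q r * ((fillPrep p q).deg * ((relaxBody p q).deg * (fillPost r).deg)) +
    2 * ((q + 2) * (levels p q r + p + 1) + 2 + 2 * q) +
    (entryBits q r + (q + 2) * (levels p q r + 1)) + 2 * (2 * r + 2) + q + 1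

theorem four_mul_pow_le {q x k : ℕ} (h : 4 * q * x ≤ k) : (4 * q : ℤ) ^ x ≤ 2 ^ k :=
  calc (4 * q : ℤ) ^ x ≤ (2 ^ (4 * q)) ^ x := by
        refine pow_le_pow_left₀ (by positivity) ?_ x
        exact_mod_cast (Nat.lt_two_pow_self (n := 4 * q)).le
    _ = 2 ^ (4 * q * x) := by rw [← pow_mul]
    _ ≤ 2 ^ k := pow_le_pow_right₀ (by norm_num) h

theorem cap_le {q n N : ℕ} (hq : 1 ≤ q) (hn : n < N) : cap q n n ≤ 2 ^ ((7 * q) * N) := by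
  have hqz : (1 : ℤ) ≤ q := by exact_mod_cast hq
  have h1 : (1 : ℤ) ≤ (2 * q) ^ n := one_le_pow₀ (by linarith)
  have h2 : (4 * q : ℤ) * (2 * q) ^ n ≤ (4 * q) ^ N :=
    calc (4 * q : ℤ) * (2 * q) ^ n ≤ (4 * q) * (4 * q) ^ n := by gcongr; norm_num
      _ = (4 * q) ^ (n + 1) := by rw [pow_succ']
      _ ≤ _ := pow_le_pow_right₀ (by linarith) hn
  calc cap q n n ≤ 2 ^ n * (1 + 3 * q * (2 * q) ^ n) := by
        unfold cap
        have : (0 : ℤ) ≤ 3 * q * (2 * q) ^ n := by positivity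
        linarith
    _ ≤ 2 ^ N * 2 ^ (4 * q * N) := by
        refine mul_le_mul (pow_le_pow_right₀ (by norm_num) hn.le) ?_ (by positivity) (by positivity)
        refine le_trans ?_ (four_mul_pow_le le_rfl)
        refine le_trans ?_ h2
        nlinarith
    _ = 2 ^ (N + 4 * q * N) := by rw [pow_add]
    _ ≤ _ := pow_le_pow_right₀ (by norm_num) (by nlinarith)

theorem stride_le {r n N : ℕ} (hn : n < N) : stride r n ≤ 2 ^ ((4 * r + 6) * N) :=
  calc stride r n ≤ 2 ^ ((4 * r + 5) * N) * 2 ^ N := by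
        unfold stride
        have h1 := lt_two_pow_of_le (x := 4 * r + 5) (k := (4 * r + 5) * N)
          (Nat.le_mul_of_pos_right _ (by omega))
        have h2 := lt_two_pow_of_le (x := n) hn.le
        push_cast at h1
        exact mul_le_mul (by linarith) h2 (by positivity) (by positivity)
    _ = 2 ^ ((4 * r + 6) * N) := by rw [← pow_add]; congr 1; ring

theorem exists_pnf_run {p q r : ℕ} (hp : 1 ≤ p) (hr : 2 ≤ r) (hq : q = p * r) {v : Word}
    (hv : v.IsValley p q) :
    ∃ s' x, Runs (2 ^ (cellBits p q r * (v.norm p q + 1))) (pnfProg p q r) v.inputState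
      (pnfTime p q r * (windowSum r (v.toNF p q).1 + v.norm p q +
          levels p q r * (v.norm p q + 1) + 2) +
        bestTime p q r * ((levels p q r * (v.norm p q + 1) + 1) *
          (2 * ((4 * r + 4) * v.sinks) + 2))) s' ∧
      s'.Outputs x ∧ v.IsPNF p q x := by
  have hq1 : 1 ≤ q := by rw [hq]; exact Nat.mul_pos hp (by omega)
  have hqz : (1 : ℤ) ≤ q := by exact_mod_cast hq1
  set m := v.norm p q with hm
  set a := levels p q r with ha
  set N := m + 1 with hN
  have hmN : m < N := Nat.lt_succ_self m
  have hN1 : 1 ≤ N := by omega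
  have hz2 : (1 : ℤ) ≤ 2 := by norm_num
  set e := entryBits q r with he
  set c := cellBits p q r with hc
  have hcv : c = e * (parseBody p q).deg +
    e * ((fillPrep p q).deg * ((relaxBody p q).deg * (fillPost r).deg)) +
    2 * ((q + 2) * (a + p + 1) + 2 + 2 * q) + (e + (q + 2) * (a + 1)) + 2 * (2 * r + 2) + q + 1 := rfl
  have heN : ∀ k ≤ e, k * N ≤ e * N := fun k hk => Nat.mul_le_mul_right _ hk
  have hcN : ∀ k ≤ c, k * N ≤ c * N := fun k hk => Nat.mul_le_mul_right _ hk
  have hlin : (q + 2) * (a * N + 1) ≤ (q + 2) * (a + 1) * N := by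
    rw [mul_assoc]
    exact Nat.mul_le_mul_left _ (by nlinarith)
  refine pnfProg_run (h := a * N) (M₀ := 2 ^ (e * N)) hp hr hq hv ?_ ?_ ?_ ?_ ?_ ?_ ?_ ?_ ?_ ?_ ?_ ?_
  · exact four_mul_pow_le (heN _ (by rw [he, entryBits]; omega))
  · rw [show (4 : ℤ) = 2 ^ 2 by norm_num, ← pow_mul]
    refine pow_le_pow_right₀ hz2 (le_trans ?_ (heN (4 * q) (by rw [he, entryBits]; omega)))
    nlinarith
  · exact fun n hn => (cap_le hq1 (by omega)).trans
      (pow_le_pow_right₀ hz2 (heN _ (by rw [he, entryBits]; omega)))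
  · exact fun n hn => (stride_le (by omega)).trans
      (pow_le_pow_right₀ hz2 (heN _ (by rw [he, entryBits]; omega)))
  · rw [← pow_mul]
    refine pow_le_pow_right₀ hz2 ?_
    rw [mul_right_comm]
    exact hcN _ (by rw [hcv]; omega)
  · rw [← pow_mul]
    refine pow_le_pow_right₀ hz2 ?_
    rw [mul_right_comm]
    exact hcN _ (by rw [hcv]; omega)
  · rw [show (4 : ℤ) = 2 ^ 2 by norm_num, ← pow_mul]
    refine pow_le_pow_right₀ hz2 (le_trans ?_
      (hcN (2 * ((q + 2) * (a + p + 1) + 2 + 2 * q)) (by rw [hcv]; omega)))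
    rw [mul_assoc]
    refine Nat.mul_le_mul_left _ ?_
    have h1 : a * N + p + 1 ≤ (a + p + 1) * N := by nlinarith
    have h2 := Nat.mul_le_mul_left (q + 2) h1
    nlinarith
  · have h1 := lt_two_pow_of_le hlin
    push_cast at h1
    calc (2 : ℤ) ^ (e * N) + (q + 2) * ((a * N : ℕ) + 1) * 2 ^ (e * N)
        = 2 ^ (e * N) * ((q + 2) * (a * N + 1) + 1) := by push_cast; ring
      _ ≤ 2 ^ (e * N) * 2 ^ ((q + 2) * (a + 1) * N) :=
          mul_le_mul_of_nonneg_left h1 (by positivity)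
      _ = 2 ^ ((e + (q + 2) * (a + 1)) * N) := by rw [← pow_add]; congr 1; ring
      _ ≤ _ := pow_le_pow_right₀ hz2 (hcN _ (by rw [hcv]; omega))
  · have h1 : 2 * ((2 * r + 2) * m) ≤ c * N :=
      le_trans (by rw [← mul_assoc]; exact Nat.mul_le_mul_left _ hmN.le)
        (hcN (2 * (2 * r + 2)) (by rw [hcv]; omega))
    exact_mod_cast lt_two_pow_of_le h1
  · have h1 := lt_two_pow_of_le hmN.le
    calc (m : ℤ) * 2 ^ (e * N) ≤ 2 ^ N * 2 ^ (e * N) :=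
          mul_le_mul_of_nonneg_right (by linarith) (by positivity)
      _ = 2 ^ ((e + 1) * N) := by rw [← pow_add]; congr 1; ring
      _ ≤ _ := pow_le_pow_right₀ hz2 (hcN _ (by rw [hcv]; omega))
  · have h1 : (4 * q : ℤ) ^ N ≤ 2 ^ (4 * q * N) := four_mul_pow_le le_rfl
    have h2 : p * ((2 * r + 2) * m) ≤ p * (2 * r + 2) * N := by
      rw [← mul_assoc]; exact Nat.mul_le_mul_left _ hmN.le
    have h3 := lt_two_pow_of_le h2
    have h4 : (1 : ℤ) ≤ 2 ^ (4 * q * N) := one_le_pow₀ hz2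
    have h5 : (2 : ℤ) ^ (4 * q * N) * 2 ^ (p * (2 * r + 2) * N) * 2 ^ 2 ≤ 2 ^ (a * N) := by
      rw [← pow_add, ← pow_add]
      refine pow_le_pow_right₀ hz2 ?_
      rw [ha, levels]
      nlinarith
    have h6 : (2 : ℤ) ^ (a * N) ≤ r ^ (a * N) :=
      pow_le_pow_left₀ (by norm_num) (by exact_mod_cast hr) _
    have h7 : (r : ℤ) ^ (a * N) ≤ q * r ^ (a * N) := le_mul_of_one_le_left (by positivity) hqz
    have h8 : (1 : ℤ) ≤ 2 ^ (p * (2 * r + 2) * N) := one_le_pow₀ hz2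
    push_cast at h3
    nlinarith
  · have h1 : q * m + (q + 2) * (a * N + 1) ≤ c * N := by
      refine le_trans ?_ (hcN (q + (q + 2) * (a + 1)) (by rw [hcv]; omega))
      exact (Nat.add_le_add (Nat.mul_le_mul_left q hmN.le) hlin).trans_eq (add_mul _ _ _).symm
    have := lt_two_pow_of_le h1
    push_cast at this ⊢
    linarith

theorem exists_program {p q r : ℕ} (hp : 1 ≤ p) (hr : 2 ≤ r) (hq : q = p * r) :
    ∃ C : ℕ, ∀ v : Word, v.IsValley p q → ∃ (n : ℕ) (s : State) (x : List Letter),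
      Exec (2 ^ (C * (v.norm p q + v.sinks))) (pnfProg p q r) v.inputState n s ∧
      s.Outputs x ∧ v.IsPNF p q x ∧ n ≤ C * (v.sinks * (v.norm p q + v.sinks)) := by
  set a := levels p q r with ha
  set W := 2 * (4 * r + 4) ^ 2 + 2 * ((40 * r + 40) * (4 * r + 1)) with hW
  refine ⟨cellBits p q r * (pnfProg p q r).deg + (pnfTime p q r * (W + a + 2) +
    bestTime p q r * ((a + 1) * (2 * (4 * r + 4) + 2))), fun v hv => ?_⟩
  obtain ⟨s, x, ⟨n, hn, hrun⟩, hout, hx⟩ := exists_pnf_run hp hr hq hv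
  refine ⟨n, s, x, hrun.mono ?_, hout, hx, hn.trans ?_⟩
  · rw [← pow_mul]
    refine pow_le_pow_right₀ (by norm_num) ?_
    rw [mul_right_comm]
    exact Nat.mul_le_mul (Nat.le_add_right _ _) (Nat.add_le_add_left (sinks_pos v) _)
  · have hs := sinks_pos v
    have hw := windowSum_toNF_le (p := p) (q := q) hr v
    rw [← hW] at hw
    rw [← ha]
    generalize v.norm p q = m at *
    generalize v.sinks = σ at *
    have h1 : σ * (m + 1) ≤ σ * (m + σ) := Nat.mul_le_mul_left _ (by omega)
    have h2 : m + 1 ≤ σ * (m + σ) := (Nat.le_mul_of_pos_left _ hs).trans h1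
    set G := σ * (m + σ)
    have h3 : windowSum r (v.toNF p q).1 + m + a * (m + 1) + 2 ≤ (W + a + 2) * G := by
      have := Nat.mul_le_mul_left a h2
      nlinarith
    have h4 : (a * (m + 1) + 1) * (2 * ((4 * r + 4) * σ) + 2) ≤
        (a + 1) * (2 * (4 * r + 4) + 2) * G :=
      calc _ ≤ ((a + 1) * (m + 1)) * ((2 * (4 * r + 4) + 2) * σ) :=
            Nat.mul_le_mul (by nlinarith) (by nlinarith)
        _ = (a + 1) * (2 * (4 * r + 4) + 2) * (σ * (m + 1)) := by ring
        _ ≤ _ := Nat.mul_le_mul_left _ h1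
    have h5 := Nat.mul_le_mul_left (pnfTime p q r) h3
    have h6 := Nat.mul_le_mul_left (bestTime p q r) h4
    refine (Nat.add_le_add h5 h6).trans ?_
    rw [← mul_assoc, ← mul_assoc (bestTime p q r), ← add_mul]
    exact Nat.mul_le_mul_right _ (Nat.le_add_left _ _)

end BaumslagSolitar

theorem corollary7p6 (p q : ℕ) (hp : 1 ≤ p) (hpq : p < q) (hdvd : p ∣ q) :
    ∃ (prog : BaumslagSolitar.Prog) (C : ℕ),
      ∀ v : BaumslagSolitar.Word, v.IsValley p q →
        ∃ (n : ℕ) (s : BaumslagSolitar.State) (x : List BaumslagSolitar.Letter),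
          BaumslagSolitar.Exec (2 ^ (C * (v.norm p q + v.sinks))) prog v.inputState n s ∧
          s.Outputs x ∧
          v.IsPNF p q x ∧
          n ≤ C * (v.sinks * (v.norm p q + v.sinks)) := by
  obtain ⟨r, hr⟩ := hdvd
  have h2 : 2 ≤ r := by
    by_contra h
    have : r ≤ 1 := by omega
    have := Nat.mul_le_mul_left p this
    omega
  exact ⟨_, BaumslagSolitar.exists_program hp h2 hr⟩
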